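/- Let $\mathbb H=\{x\in\mathbb R^2: x_2>0\}$, $\alpha>0$, and let $q$ be a bounded (finite signed) Radon measure on $\mathbb H$. **Notation.** $\operatorname{curl}u=\partial_1u_2-\partial_2u_1$. $G_\alpha=\mathcal F^{-1}\big(\tfrac1{1+\alpha|\xi|^2}\big)$ is the Green function of $\mathbb I-\alpha\Delta$ in $\mathbb R^2$, i.e. $G_\alpha(x)=\int_0^\infty e^{-t}\frac{e^{-|x|^2/(4\alpha t)}}{4\pi\alpha t}\,dt$; $H_\alpha(x)=\alpha G_\alpha(x)+\frac1{2\pi}\ln|x|$; $K(x)=\frac{(-x_2,x_1)}{2\pi|x|^2}$ and $K_\alpha=K*G_\alpha$; $\eta_1(x)=\frac{x_2^2-x_1^2}{|x|^4}$, $\eta_2(x)=\frac{x_1x_2}{|x|^4}$. The odd extension $\tilde q$ of $q$ is the measure on $\mathbb R^2$ with $\int\varphi\,d\tilde q=\int_{\mathbb H}(\varphi(y_1,y_2)-\varphi(y_1,-y_2))\,dq(y)$. The convolution in the first variable is $(g*_1\varphi)(x)=\int_{\mathbb R}g(y_1)\varphi(x_1-y_1,x_2)\,dy_1$, and the half-plane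 convolution is the iterated integral $$(\varphi\star\psi)(x)=\int_0^{x_2}\Big(\int_{\mathbb R}\varphi(y_1,y_2)\,\psi(x_1-y_1,x_2-y_2)\,dy_1\Big)dy_2 ,\qquad x\in\mathbb H.$$ For a function $g$ on $\mathbb R$ define the vector field $B_\alpha[g]$ on $\mathbb H$ by $$B_\alpha[g]^1=-2\alpha\, g*_1\partial_2G_\alpha+\frac{2\alpha}{\pi}\,(g*_1\partial_2G_\alpha)\star\eta_1,\qquad B_\alpha[g]^2=-\frac{4\alpha}{\pi}\,(g*_1\partial_2G_\alpha)\star\eta_2 .$$ Below, equations in $\mathbb H$ hold in the sense of distributions, boundary values are traces, and solutions are sought among vector fields $v$ such that $v$ and $\nabla v$ belong to the Lorentz space $L^{2,\infty}(\mathbb H)$ (this class contains $H^1(\mathbb H)$). Vector fields are identified when they agree almost everywhere. **(1) Formula for the velocity.** The system $$\operatorname{div}u=0,\qquad \operatorname{curl}(u-\alpha\Delta u)=q\quad\text{in }\mathbb H,\qquad u=0\quad\text{on }\partial\mathbb H$$ has exactly one solution, and it is $$u=K_\alpha*\tilde q+u_{\rm bdry},\qquad u_{\rm bdry}=B_\alpha[g],\qquad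 g(x_1)=-2\int_{\mathbb H}\partial_2H_\alpha(x_1-y_1,y_2)\,dq(y).$$ The integrals defining $K_\alpha*\tilde q$ and $g$ converge absolutely at every point, and $g\in L^1(\mathbb R)\cap H^{1/2}(\mathbb R)$. **(2) Formula for the boundary problem.** For every $g\in L^1(\mathbb R)\cap H^{1/2}(\mathbb R)$, the Stokes problem $$w-\alpha\Delta w+\nabla p=0,\qquad \operatorname{div}w=0\quad\text{in }\mathbb H,\qquad w_1=g,\quad w_2=0\quad\text{on }\partial\mathbb H,$$ where $p$ is some scalar function, has exactly one solution $w$, namely $w=B_\alpha[g]$. At every $x\in\mathbb H$ the integral defining $g*_1\partial_2G_\alpha$ and the iterated integrals defining $(g*_1\partial_2G_\alpha)\star\eta_1$ and $(g*_1\partial_2G_\alpha)\star\eta_2$ converge absolutely (the inner integral for each $y_2\in(0,x_2)$, the outer one after the inner has been evaluated). -/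

import Mathlib

open MeasureTheory Set Real
open scoped ContDiff FourierTransform

noncomputable section

namespace AlphaEuler

/-- The open upper half-plane `{x ∈ ℝ² : x₂ > 0}`. -/
def halfPlane : Set (ℝ × ℝ) := {x | 0 < x.2}

/-- `|x|² = x₁² + x₂²`. -/
def normSq (x : ℝ × ℝ) : ℝ := x.1 ^ 2 + x.2 ^ 2

/-- Classical partial derivative in the first variable. -/
def d1 (f : ℝ × ℝ → ℝ) (x : ℝ × ℝ) : ℝ := deriv (fun s => f (s, x.2)) x.1

/-- Classical partial derivative in the second variable. -/
def d2 (f : ℝ × ℝ → ℝ) (x : ℝ × ℝ) : ℝ := deriv (fun s => f (x.1, s)) x.2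

/-- Classical Laplacian. -/
def lap (f : ℝ × ℝ → ℝ) (x : ℝ × ℝ) : ℝ := d1 (d1 f) x + d2 (d2 f) x

/-! ### Kernels -/

/-- The Green function `G_α` of `I - αΔ` in the plane, that is, the inverse Fourier transform of
`1 / (1 + α|ξ|²)` (see `integrable_helmholtzGreen` and `fourier_helmholtzGreen`), as a superposition
of heat kernels: `G_α(x) = ∫₀^∞ e^{-t} e^{-|x|²/(4αt)} / (4παt) dt`. -/
def helmholtzGreen (α : ℝ) (x : ℝ × ℝ) : ℝ :=
  ∫ t in Ioi (0 : ℝ), exp (-t) * (exp (-(1 / (4 * α * t)) * normSq x) / (4 * π * α * t))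

/-- The Green function `G(x) = (1/2π) ln |x|` of the Laplacian in the plane. -/
def laplaceGreen (x : ℝ × ℝ) : ℝ := 1 / (2 * π) * log (√(normSq x))

/-- `H_α = α G_α + G`. -/
def kernelH (α : ℝ) (x : ℝ × ℝ) : ℝ := α * helmholtzGreen α x + laplaceGreen x

/-- The Biot-Savart kernel `K(x) = x^⊥ / (2π|x|²)`, with `(a, b)^⊥ = (-b, a)`. -/
def biotSavart (x : ℝ × ℝ) : ℝ × ℝ := (-x.2 / (2 * π * normSq x), x.1 / (2 * π * normSq x))

/-- The smoothed kernel `K_α = K ∗ G_α`. -/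
def smoothedBiotSavart (α : ℝ) (x : ℝ × ℝ) : ℝ × ℝ :=
  (∫ y, (biotSavart y).1 * helmholtzGreen α (x - y),
   ∫ y, (biotSavart y).2 * helmholtzGreen α (x - y))

/-- `η₁(x) = (x₂² - x₁²) / |x|⁴`. -/
def eta1 (x : ℝ × ℝ) : ℝ := (x.2 ^ 2 - x.1 ^ 2) / normSq x ^ 2

/-- `η₂(x) = x₁ x₂ / |x|⁴`. -/
def eta2 (x : ℝ × ℝ) : ℝ := x.1 * x.2 / normSq x ^ 2

/-! ### Convolutions -/

/-- The convolution `g ∗₁ φ` in the first variable of a function `g` on `ℝ` with a function `φ` of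
two variables. -/
def conv1 (g : ℝ → ℝ) (φ : ℝ × ℝ → ℝ) (x : ℝ × ℝ) : ℝ := ∫ y, g y * φ (x.1 - y, x.2)

/-- The half-plane convolution
`(φ ⋆ ψ)(x) = ∫₀^{x₂} ( ∫_ℝ φ(y₁, y₂) ψ(x₁ - y₁, x₂ - y₂) dy₁ ) dy₂`: a convolution in the first
variable for each `y₂`, followed by an integration in `y₂`. -/
def convH (φ ψ : ℝ × ℝ → ℝ) (x : ℝ × ℝ) : ℝ :=
  ∫ s in (0 : ℝ)..x.2, ∫ y, φ (y, s) * ψ (x.1 - y, x.2 - s)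

/-- Both integrals in `(φ ⋆ ψ)(x)` converge absolutely. -/
def ConvHConverges (φ ψ : ℝ × ℝ → ℝ) (x : ℝ × ℝ) : Prop :=
  (∀ s ∈ Ioo 0 x.2, Integrable fun y : ℝ => φ (y, s) * ψ (x.1 - y, x.2 - s)) ∧
  IntervalIntegrable (fun s : ℝ => ∫ y, φ (y, s) * ψ (x.1 - y, x.2 - s)) volume 0 x.2

/-! ### The interior part, the boundary datum and the boundary corrector -/

/-- The odd extension `q̃` of a bounded measure `q` on the half-plane: `q` itself in the upper
half-plane, minus the reflection of `q` in the lower one, so that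
`∫ φ dq̃ = ∫ (φ(y₁, y₂) - φ(y₁, -y₂)) dq(y)`. -/
def oddExtension (q : SignedMeasure halfPlane) : SignedMeasure (ℝ × ℝ) :=
  q.map (fun y : halfPlane => (y : ℝ × ℝ)) - q.map (fun y : halfPlane => (y.1.1, -y.1.2))

/-- The interior part `u_int = K_α ∗ q̃`. -/
def interiorPart (α : ℝ) (q : SignedMeasure halfPlane) (x : ℝ × ℝ) : ℝ × ℝ :=
  ((oddExtension q).integral (fun y => (smoothedBiotSavart α (x - y)).1)
      (ContinuousLinearMap.lsmul ℝ ℝ),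
   (oddExtension q).integral (fun y => (smoothedBiotSavart α (x - y)).2)
      (ContinuousLinearMap.lsmul ℝ ℝ))

/-- The boundary datum `g(x₁) = -2 ∫ ∂₂H_α(x₁ - y₁, y₂) dq(y)`. -/
def boundaryDatum (α : ℝ) (q : SignedMeasure halfPlane) (x₁ : ℝ) : ℝ :=
  -2 * q.integral (fun y : halfPlane => d2 (kernelH α) (x₁ - y.1.1, y.1.2))
    (ContinuousLinearMap.lsmul ℝ ℝ)

/-- The boundary corrector with boundary datum `g`:
`( -2α g ∗₁ ∂₂G_α + (2α/π) (g ∗₁ ∂₂G_α) ⋆ η₁ , -(4α/π) (g ∗₁ ∂₂G_α) ⋆ η₂ )`. -/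
def boundaryPart (α : ℝ) (g : ℝ → ℝ) (x : ℝ × ℝ) : ℝ × ℝ :=
  (-2 * α * conv1 g (d2 (helmholtzGreen α)) x
      + 2 * α / π * convH (conv1 g (d2 (helmholtzGreen α))) eta1 x,
   -(4 * α / π) * convH (conv1 g (d2 (helmholtzGreen α))) eta2 x)

/-! ### Function spaces and weak solutions -/

/-- Smooth compactly supported functions on the plane. -/
def IsTest (φ : ℝ × ℝ → ℝ) : Prop := ContDiff ℝ ∞ φ ∧ HasCompactSupport φ

/-- Smooth functions with compact support inside the open half-plane. -/
def IsTestInHalfPlane (φ : ℝ × ℝ → ℝ) : Prop := IsTest φ ∧ tsupport φ ⊆ halfPlane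

/-- The Lorentz space `L^{2,∞}` (weak `L²`) on the half-plane. -/
def WeakL2 (f : ℝ × ℝ → ℝ) : Prop :=
  AEStronglyMeasurable f (volume.restrict halfPlane) ∧
  ∃ C : ℝ, ∀ r : ℝ, 0 < r →
    volume.restrict halfPlane {x | r < |f x|} ≤ ENNReal.ofReal (C / r ^ 2)

/-- `f ∈ L^{2,∞}` has a weak gradient in `L^{2,∞}` and trace `g` on the boundary `x₂ = 0`.
The gradient `(v₁, v₂)` and the trace are expressed together by the Gauss-Green formula, tested
against functions which need not vanish on the boundary. -/
def HasGradAndTrace (f : ℝ × ℝ → ℝ) (g : ℝ → ℝ) : Prop :=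
  WeakL2 f ∧ LocallyIntegrable g ∧ ∃ v₁ v₂ : ℝ × ℝ → ℝ, WeakL2 v₁ ∧ WeakL2 v₂ ∧
    ∀ φ, IsTest φ →
      (∫ x in halfPlane, f x * d1 φ x) = -(∫ x in halfPlane, v₁ x * φ x) ∧
      (∫ x in halfPlane, f x * d2 φ x)
        = -(∫ x in halfPlane, v₂ x * φ x) - ∫ x₁ : ℝ, g x₁ * φ (x₁, 0)

/-- `div u = 0` in the half-plane, in the sense of distributions. -/
def DivFree (u : ℝ × ℝ → ℝ × ℝ) : Prop :=
  ∀ φ, IsTestInHalfPlane φ → ∫ x in halfPlane, ((u x).1 * d1 φ x + (u x).2 * d2 φ x) = 0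

/-- `u` is the solution of `curl (u - αΔu) = q`, `div u = 0` in the half-plane, `u = 0` on its
boundary: `u` and `∇u` are in `L^{2,∞}`, `u` has zero trace, and both equations hold in the sense
of distributions, with `curl u = ∂₁u₂ - ∂₂u₁`. -/
def IsFilteredVelocity (α : ℝ) (q : SignedMeasure halfPlane) (u : ℝ × ℝ → ℝ × ℝ) : Prop :=
  HasGradAndTrace (fun x => (u x).1) 0 ∧ HasGradAndTrace (fun x => (u x).2) 0 ∧
  DivFree u ∧
  ∀ φ, IsTestInHalfPlane φ →
    ∫ x in halfPlane, ((u x).1 * d2 (fun z => φ z - α * lap φ z) x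
        - (u x).2 * d1 (fun z => φ z - α * lap φ z) x)
      = q.integral (fun y : halfPlane => φ y) (ContinuousLinearMap.lsmul ℝ ℝ)

/-- `w` solves the Stokes problem `w - αΔw + ∇p = 0`, `div w = 0` in the half-plane, with
`w = (g, 0)` on its boundary, for some scalar function `p`: `w` and `∇w` are in `L^{2,∞}`, the
boundary values are traces, and the equations hold in the sense of distributions. -/
def IsStokesSolution (α : ℝ) (g : ℝ → ℝ) (w : ℝ × ℝ → ℝ × ℝ) : Prop :=
  HasGradAndTrace (fun x => (w x).1) g ∧ HasGradAndTrace (fun x => (w x).2) 0 ∧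
  DivFree w ∧
  ∃ p : ℝ × ℝ → ℝ, LocallyIntegrableOn p halfPlane ∧ ∀ φ, IsTestInHalfPlane φ →
    (∫ x in halfPlane, (w x).1 * (φ x - α * lap φ x)) - (∫ x in halfPlane, p x * d1 φ x) = 0 ∧
    (∫ x in halfPlane, (w x).2 * (φ x - α * lap φ x)) - (∫ x in halfPlane, p x * d2 φ x) = 0

/-- `g ∈ L¹(ℝ) ∩ H^{1/2}(ℝ)`. -/
def MemL1Hhalf (g : ℝ → ℝ) : Prop :=
  Integrable g ∧ Integrable fun ξ : ℝ => (1 + |ξ|) * ‖𝓕 (fun t : ℝ => (g t : ℂ)) ξ‖ ^ 2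

/-! ### `G_α` is the inverse Fourier transform of `1 / (1 + α|ξ|²)` -/

lemma gaussian_fourier_plane {b : ℝ} (hb : 0 < b) (ξ : ℝ × ℝ) :
    Integrable (fun x : ℝ × ℝ => Complex.exp (-Complex.I * (x.1 * ξ.1 + x.2 * ξ.2 : ℝ)) *
      (exp (-b * normSq x) : ℝ)) ∧
    ∫ x : ℝ × ℝ, Complex.exp (-Complex.I * (x.1 * ξ.1 + x.2 * ξ.2 : ℝ)) *
      (exp (-b * normSq x) : ℝ) = ((π / b * exp (-normSq ξ / (4 * b)) : ℝ) : ℂ) := by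
  have hb' : 0 < (b : ℂ).re := by simpa using hb
  have key : (fun x : ℝ × ℝ => Complex.exp (-Complex.I * (x.1 * ξ.1 + x.2 * ξ.2 : ℝ)) *
      (exp (-b * normSq x) : ℝ)) = fun x : ℝ × ℝ =>
      (Complex.exp (Complex.I * (-ξ.1 : ℂ) * x.1) * Complex.exp (-b * x.1 ^ 2)) *
      (Complex.exp (Complex.I * (-ξ.2 : ℂ) * x.2) * Complex.exp (-b * x.2 ^ 2)) := by
    funext x
    simp only [normSq]
    push_cast
    rw [← Complex.exp_add, ← Complex.exp_add, ← Complex.exp_add, ← Complex.exp_add]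
    congr 1
    ring
  have hint : ∀ c : ℝ, Integrable (fun x : ℝ =>
      Complex.exp (Complex.I * (-c : ℂ) * x) * Complex.exp (-b * x ^ 2)) := by
    intro c
    refine (integrable_cexp_quadratic hb' (Complex.I * (-c : ℂ)) 0).congr ?_
    refine Filter.Eventually.of_forall fun x => ?_
    simp only [add_zero]
    rw [← Complex.exp_add, add_comm]
  rw [key]
  refine ⟨(hint ξ.1).mul_prod (hint ξ.2), ?_⟩
  rw [Measure.volume_eq_prod]
  have h := integral_prod_mul (μ := (volume : Measure ℝ)) (ν := (volume : Measure ℝ))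
    (fun x : ℝ => Complex.exp (Complex.I * (-ξ.1 : ℂ) * x) * Complex.exp (-b * x ^ 2))
    (fun x : ℝ => Complex.exp (Complex.I * (-ξ.2 : ℂ) * x) * Complex.exp (-b * x ^ 2))
  rw [h, fourierIntegral_gaussian hb', fourierIntegral_gaussian hb']
  have hpi : ((π : ℂ) / b) ≠ 0 := by
    have : π / b ≠ 0 := by positivity
    exact_mod_cast this
  have hs : ((π : ℂ) / b) ^ (1 / 2 : ℂ) * ((π : ℂ) / b) ^ (1 / 2 : ℂ) = (π : ℂ) / b := by
    rw [← Complex.cpow_add _ _ hpi]; norm_num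
  rw [mul_mul_mul_comm, hs, ← Complex.exp_add]
  push_cast [normSq]
  congr 2
  ring

lemma helmholtz_fourier_aux {α : ℝ} (hα : 0 < α) (ξ : ℝ × ℝ) :
    Integrable (Function.uncurry fun (x : ℝ × ℝ) (t : ℝ) =>
      Complex.exp (-Complex.I * (x.1 * ξ.1 + x.2 * ξ.2 : ℝ)) *
      ((exp (-t) * (exp (-(1 / (4 * α * t)) * normSq x) / (4 * π * α * t)) : ℝ) : ℂ))
      ((volume : Measure (ℝ × ℝ)).prod (volume.restrict (Ioi (0 : ℝ)))) := by
  have hmeas : Measurable (Function.uncurry fun (x : ℝ × ℝ) (t : ℝ) =>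
      Complex.exp (-Complex.I * (x.1 * ξ.1 + x.2 * ξ.2 : ℝ)) *
      ((exp (-t) * (exp (-(1 / (4 * α * t)) * normSq x) / (4 * π * α * t)) : ℝ) : ℂ)) := by
    unfold Function.uncurry normSq
    fun_prop
  rw [integrable_prod_iff' hmeas.aestronglyMeasurable]
  have hx : ∀ t ∈ Ioi (0 : ℝ), ∀ x : ℝ × ℝ,
      Complex.exp (-Complex.I * (x.1 * ξ.1 + x.2 * ξ.2 : ℝ)) *
      ((exp (-t) * (exp (-(1 / (4 * α * t)) * normSq x) / (4 * π * α * t)) : ℝ) : ℂ) =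
      ((exp (-t) / (4 * π * α * t) : ℝ) : ℂ) *
      (Complex.exp (-Complex.I * (x.1 * ξ.1 + x.2 * ξ.2 : ℝ)) *
        (exp (-(1 / (4 * α * t)) * normSq x) : ℝ)) := by
    intro t ht x
    push_cast
    ring
  constructor
  · refine (ae_restrict_iff' measurableSet_Ioi).2 (Filter.Eventually.of_forall fun t ht => ?_)
    have hb : 0 < 1 / (4 * α * t) := by have : 0 < t := ht; positivity
    refine ((gaussian_fourier_plane hb ξ).1.const_mul
      ((exp (-t) / (4 * π * α * t) : ℝ) : ℂ)).congr ?_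
    exact Filter.Eventually.of_forall fun x => (hx t ht x).symm
  · have hexp : IntegrableOn (fun t : ℝ => exp (-t)) (Ioi 0) := integrableOn_exp_neg_Ioi 0
    refine hexp.congr_fun ?_ measurableSet_Ioi
    intro t ht
    have ht0 : 0 < t := ht
    have hb : 0 < 1 / (4 * α * t) := by positivity
    have hn : ∀ x : ℝ × ℝ, ‖Function.uncurry (fun (x : ℝ × ℝ) (t : ℝ) =>
      Complex.exp (-Complex.I * (x.1 * ξ.1 + x.2 * ξ.2 : ℝ)) *
      ((exp (-t) * (exp (-(1 / (4 * α * t)) * normSq x) / (4 * π * α * t)) : ℝ) : ℂ)) (x, t)‖ =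
        exp (-t) / (4 * π * α * t) * exp (-(1 / (4 * α * t)) * normSq x) := by
      intro x
      have h1 : -Complex.I * ((x.1 * ξ.1 + x.2 * ξ.2 : ℝ) : ℂ)
          = ((-(x.1 * ξ.1 + x.2 * ξ.2) : ℝ) : ℂ) * Complex.I := by push_cast; ring
      simp only [Function.uncurry_apply_pair]
      rw [norm_mul, h1, Complex.norm_exp_ofReal_mul_I, one_mul, Complex.norm_real,
        Real.norm_of_nonneg (by positivity)]
      ring
    have hg : ∫ x : ℝ × ℝ, exp (-(1 / (4 * α * t)) * normSq x) = 4 * π * α * t := by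
      have h2 := (gaussian_fourier_plane hb 0).2
      have h3 : ∀ x : ℝ × ℝ, Complex.exp (-Complex.I * ((x.1 * (0 : ℝ × ℝ).1
          + x.2 * (0 : ℝ × ℝ).2 : ℝ) : ℂ)) * (exp (-(1 / (4 * α * t)) * normSq x) : ℝ)
          = ((exp (-(1 / (4 * α * t)) * normSq x) : ℝ) : ℂ) := by
        intro x; simp
      simp_rw [h3] at h2
      rw [integral_complex_ofReal] at h2
      have h4 := Complex.ofReal_injective h2
      rw [h4]
      have h5 : normSq (0 : ℝ × ℝ) = 0 := by simp [normSq]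
      rw [h5, neg_zero, zero_div, exp_zero]
      field_simp
    simp_rw [hn]
    rw [integral_const_mul, hg]
    field_simp

/-- `G_α` is integrable on the plane. -/
theorem integrable_helmholtzGreen {α : ℝ} (hα : 0 < α) : Integrable (helmholtzGreen α) := by
  have h := (helmholtz_fourier_aux hα 0).integral_prod_left
  have h2 := h.re
  refine h2.congr (Filter.Eventually.of_forall fun x => ?_)
  simp only [Function.uncurry_apply_pair, helmholtzGreen]
  have h3 : ∀ t : ℝ, Complex.exp (-Complex.I * ((x.1 * (0 : ℝ × ℝ).1
      + x.2 * (0 : ℝ × ℝ).2 : ℝ) : ℂ)) *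
      ((exp (-t) * (exp (-(1 / (4 * α * t)) * normSq x) / (4 * π * α * t)) : ℝ) : ℂ) =
      ((exp (-t) * (exp (-(1 / (4 * α * t)) * normSq x) / (4 * π * α * t)) : ℝ) : ℂ) := by
    intro t; simp
  simp_rw [h3]
  rw [integral_complex_ofReal]
  simp

/-- The Fourier transform of `G_α` is `1 / (1 + α|ξ|²)`. -/
theorem fourier_helmholtzGreen {α : ℝ} (hα : 0 < α) (ξ : ℝ × ℝ) :
    ∫ x : ℝ × ℝ, Complex.exp (-Complex.I * (x.1 * ξ.1 + x.2 * ξ.2 : ℝ)) *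
      (helmholtzGreen α x : ℂ) = ((1 / (1 + α * normSq ξ) : ℝ) : ℂ) := by
  have h1 : ∀ x : ℝ × ℝ, Complex.exp (-Complex.I * (x.1 * ξ.1 + x.2 * ξ.2 : ℝ)) *
      (helmholtzGreen α x : ℂ) = ∫ t in Ioi (0 : ℝ),
      Complex.exp (-Complex.I * (x.1 * ξ.1 + x.2 * ξ.2 : ℝ)) *
      ((exp (-t) * (exp (-(1 / (4 * α * t)) * normSq x) / (4 * π * α * t)) : ℝ) : ℂ) := by
    intro x
    rw [integral_const_mul, integral_complex_ofReal]
    rfl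
  simp_rw [h1]
  rw [integral_integral_swap (helmholtz_fourier_aux hα ξ)]
  have hpos : 0 < 1 + α * normSq ξ := by unfold normSq; positivity
  have h2 : ∀ t ∈ Ioi (0 : ℝ), (∫ x : ℝ × ℝ,
      Complex.exp (-Complex.I * (x.1 * ξ.1 + x.2 * ξ.2 : ℝ)) *
      ((exp (-t) * (exp (-(1 / (4 * α * t)) * normSq x) / (4 * π * α * t)) : ℝ) : ℂ)) =
      ((exp (-(1 + α * normSq ξ) * t) : ℝ) : ℂ) := by
    intro t ht
    have ht0 : 0 < t := ht
    have hb : 0 < 1 / (4 * α * t) := by positivity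
    have hx : ∀ x : ℝ × ℝ,
        Complex.exp (-Complex.I * (x.1 * ξ.1 + x.2 * ξ.2 : ℝ)) *
        ((exp (-t) * (exp (-(1 / (4 * α * t)) * normSq x) / (4 * π * α * t)) : ℝ) : ℂ) =
        ((exp (-t) / (4 * π * α * t) : ℝ) : ℂ) *
        (Complex.exp (-Complex.I * (x.1 * ξ.1 + x.2 * ξ.2 : ℝ)) *
          (exp (-(1 / (4 * α * t)) * normSq x) : ℝ)) := by
      intro x
      push_cast
      ring
    simp_rw [hx]
    rw [integral_const_mul, (gaussian_fourier_plane hb ξ).2, ← Complex.ofReal_mul]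
    congr 1
    have e1 : exp (-(1 + α * normSq ξ) * t) = exp (-t) * exp (-normSq ξ / (4 * (1 / (4 * α * t)))) := by
      rw [← exp_add]
      congr 1
      field_simp
      ring
    rw [e1]
    field_simp
  rw [setIntegral_congr_fun measurableSet_Ioi h2, integral_complex_ofReal]
  congr 1
  have h5 := integral_exp_mul_Ioi (a := -(1 + α * normSq ξ)) (by linarith) 0
  rw [h5, mul_zero, exp_zero, neg_div_neg_eq]

end AlphaEuler

end

open AlphaEuler

open scoped Topology

noncomputable section

namespace AlphaEuler

open Filter
open Complex (I norm_real ofRealCLM I_sq re_ofReal_mul norm_I norm_exp reCLM abs_re_le_norm)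
open ENNReal (ofReal ofReal_mul ofReal_le_ofReal ofReal_lt_top ofReal_add ofReal_ne_top ofReal_toReal toReal_ofReal)
open Function (uncurry)
open ContinuousLinearMap (lsmul)
open Complex renaming exp → cexp

section

lemma integral_ext {X E : Type*} [MeasurableSpace X] {μ : Measure X} [NormedAddCommGroup E] [NormedSpace ℝ E] {f g : X → E}
    (h : ∀ x, f x = g x) : ∫ x, f x ∂μ = ∫ x, g x ∂μ := by rw [funext h]

/-! ### The radial profiles of the Helmholtz kernels -/

/-- The Bessel-type integrals `∫₀^∞ e^{-t} t^{-n} e^{-ρ/(4αt)} dt`. -/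
def besselInt (α : ℝ) (n : ℕ) (ρ : ℝ) : ℝ :=
  ∫ t in Ioi (0 : ℝ), exp (-t) * (t⁻¹ ^ n * exp (-(ρ / (4 * α) * t⁻¹)))

lemma pow_mul_exp_neg_le {u : ℝ} (hu : 0 ≤ u) (n : ℕ) : u ^ n * exp (-u) ≤ n.factorial := by
  have h := pow_div_factorial_le_exp u hu n
  rw [div_le_iff₀ (by positivity)] at h
  rw [exp_neg, ← div_eq_mul_inv, div_le_iff₀ (exp_pos _)]
  linarith

lemma inv_pow_mul_exp_le {c t : ℝ} (hc : 0 < c) (ht : 0 < t) (n : ℕ) :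
    t⁻¹ ^ n * exp (-(c * t⁻¹)) ≤ n.factorial / c ^ n := by
  have h := pow_mul_exp_neg_le (u := c * t⁻¹) (by positivity) n
  rw [le_div_iff₀ (by positivity)]
  rw [mul_pow] at h
  linarith

lemma integrableOn_exp_neg : IntegrableOn (fun t : ℝ => exp (-t)) (Ioi 0) :=
  integrableOn_exp_neg_Ioi 0

lemma integral_exp_neg_Ioi' : ∫ t in Ioi (0 : ℝ), exp (-t) = 1 := by
  simpa using integral_exp_neg_Ioi 0

lemma measurable_besselIntegrand (α : ℝ) (n : ℕ) (ρ : ℝ) :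
    Measurable fun t : ℝ => exp (-t) * (t⁻¹ ^ n * exp (-(ρ / (4 * α) * t⁻¹))) := by fun_prop

variable {α : ℝ}

lemma integrableOn_besselIntegrand (hα : 0 < α) (n : ℕ) {ρ : ℝ} (hρ : 0 < ρ) :
    IntegrableOn (fun t : ℝ => exp (-t) * (t⁻¹ ^ n * exp (-(ρ / (4 * α) * t⁻¹)))) (Ioi 0) := by
  refine Integrable.mono' (integrableOn_exp_neg.mul_const (n.factorial / (ρ / (4 * α)) ^ n))
    (measurable_besselIntegrand α n ρ).aestronglyMeasurable ?_
  refine ae_restrict_of_forall_mem measurableSet_Ioi fun t ht => ?_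
  have ht : 0 < t := ht
  rw [norm_of_nonneg (by positivity)]
  exact mul_le_mul_of_nonneg_left (inv_pow_mul_exp_le (by positivity) ht n) (exp_pos _).le

lemma integrableOn_besselIntegrand_zero (hα : 0 < α) {ρ : ℝ} (hρ : 0 ≤ ρ) :
    IntegrableOn (fun t : ℝ => exp (-t) * (t⁻¹ ^ 0 * exp (-(ρ / (4 * α) * t⁻¹)))) (Ioi 0) := by
  refine Integrable.mono' integrableOn_exp_neg
    (measurable_besselIntegrand α 0 ρ).aestronglyMeasurable ?_
  refine ae_restrict_of_forall_mem measurableSet_Ioi fun t ht => ?_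
  have ht : 0 < t := ht
  rw [norm_of_nonneg (by positivity), pow_zero, one_mul]
  have : exp (-(ρ / (4 * α) * t⁻¹)) ≤ 1 := exp_le_one_iff.2 (by
    have : 0 ≤ ρ / (4 * α) * t⁻¹ := by positivity
    linarith)
  nlinarith [exp_pos (-t)]

lemma besselInt_nonneg (α : ℝ) (n : ℕ) (ρ : ℝ) : 0 ≤ besselInt α n ρ :=
  setIntegral_nonneg measurableSet_Ioi fun t ht => by
    have : 0 < t := ht
    positivity

lemma hasDerivAt_besselInt (hα : 0 < α) (n : ℕ) {ρ : ℝ} (hρ : 0 < ρ) :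
    HasDerivAt (besselInt α n) (-(1 / (4 * α)) * besselInt α (n + 1) ρ) ρ := by
  have hs : Ioi (ρ / 2) ∈ nhds ρ := Ioi_mem_nhds (by linarith)
  have key := hasDerivAt_integral_of_dominated_loc_of_deriv_le (μ := volume.restrict (Ioi (0 : ℝ)))
    (F := fun ρ t => exp (-t) * (t⁻¹ ^ n * exp (-(ρ / (4 * α) * t⁻¹))))
    (F' := fun ρ t => -(1 / (4 * α)) * (exp (-t) * (t⁻¹ ^ (n + 1) * exp (-(ρ / (4 * α) * t⁻¹)))))
    (bound := fun t => 1 / (4 * α) * (exp (-t) * ((n + 1).factorial / (ρ / 2 / (4 * α)) ^ (n + 1))))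
    (x₀ := ρ) hs
    (.of_forall fun r => (measurable_besselIntegrand α n r).aestronglyMeasurable)
    (integrableOn_besselIntegrand hα n hρ)
    ((measurable_besselIntegrand α (n + 1) ρ).const_mul _).aestronglyMeasurable
    ?_ ((integrableOn_exp_neg.mul_const _).const_mul _) ?_
  · have := key.2
    rw [integral_const_mul] at this
    exact this
  · refine ae_restrict_of_forall_mem measurableSet_Ioi fun t ht r hr => ?_
    have ht : 0 < t := ht
    have hr : ρ / 2 < r := hr
    have hr0 : 0 < r := by linarith
    rw [norm_mul, norm_neg, norm_of_nonneg (by positivity : 0 ≤ 1 / (4 * α)),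
      norm_of_nonneg (by positivity)]
    gcongr
    refine (inv_pow_mul_exp_le (by positivity) ht (n + 1)).trans ?_
    gcongr
  · refine .of_forall fun t r _ => ?_
    have h1 : HasDerivAt (fun r : ℝ => -(r / (4 * α) * t⁻¹)) (-(1 / (4 * α) * t⁻¹)) r :=
      (((hasDerivAt_id r).div_const _).mul_const _).neg
    convert! ((h1.exp.const_mul (t⁻¹ ^ n)).const_mul (exp (-t))) using 1
    ring

lemma besselInt_zero_eq (hα : 0 < α) {ρ : ℝ} (hρ : 0 < ρ) :
    besselInt α 0 ρ = ρ / (4 * α) * besselInt α 2 ρ := by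
  have hc : 0 < ρ / (4 * α) := by positivity
  set c := ρ / (4 * α) with hcdef
  have h0 := integrableOn_besselIntegrand hα 0 hρ
  have h2 := (integrableOn_besselIntegrand hα 2 hρ).const_mul c
  rw [← hcdef] at h0 h2
  have hd : ∀ t ∈ Ioi (0 : ℝ), HasDerivAt (fun t : ℝ => exp (-t) * exp (-(c * t⁻¹)))
      (c * (exp (-t) * (t⁻¹ ^ 2 * exp (-(c * t⁻¹))))
        - exp (-t) * (t⁻¹ ^ 0 * exp (-(c * t⁻¹)))) t := by
    intro t ht
    have ht : 0 < t := ht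
    have h1 : HasDerivAt (fun t : ℝ => -(c * t⁻¹)) (-(c * (-(t ^ 2)⁻¹))) t :=
      ((hasDerivAt_inv ht.ne').const_mul c).neg
    convert! (((hasDerivAt_id t).neg).exp.mul h1.exp) using 1
    field_simp
    simp
    ring
  have hlim0 : Tendsto (fun t : ℝ => exp (-t) * exp (-(c * t⁻¹))) (nhdsWithin 0 (Ioi 0))
      (nhds 0) := by
    have h1 : Tendsto (fun t : ℝ => exp (-(c * t⁻¹))) (nhdsWithin 0 (Ioi 0)) (nhds 0) :=
      tendsto_exp_neg_atTop_nhds_zero.comp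
        ((tendsto_const_mul_atTop_of_pos hc).2 tendsto_inv_nhdsGT_zero)
    have h3 : Tendsto (fun t : ℝ => exp (-t)) (nhdsWithin 0 (Ioi 0)) (nhds (exp (-0))) :=
      ((by fun_prop : Continuous fun t : ℝ => exp (-t)).tendsto 0).mono_left nhdsWithin_le_nhds
    simpa using h3.mul h1
  have hlim1 : Tendsto (fun t : ℝ => exp (-t) * exp (-(c * t⁻¹))) atTop
      (nhds 0) := by
    have h1 : Tendsto (fun t : ℝ => exp (-(c * t⁻¹))) atTop (nhds (exp (-(c * 0)))) :=
      (Real.continuous_exp.tendsto _).comp ((tendsto_inv_atTop_zero.const_mul c).neg)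
    simpa using tendsto_exp_neg_atTop_nhds_zero.mul h1
  have h' := integral_Ioi_of_hasDerivAt_of_tendsto (a := 0)
    (f := Function.update (fun t : ℝ => exp (-t) * exp (-(c * t⁻¹))) 0 0)
    (f' := fun t => c * (exp (-t) * (t⁻¹ ^ 2 * exp (-(c * t⁻¹))))
        - exp (-t) * (t⁻¹ ^ 0 * exp (-(c * t⁻¹)))) (m := 0) ?_ ?_ (Integrable.sub' h2 h0) ?_
  · rw [integral_sub h2 h0, integral_const_mul] at h'
    simp only [Function.update_self, sub_zero] at h'
    change c * besselInt α 2 ρ - besselInt α 0 ρ = 0 at h'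
    linarith
  · rw [continuousWithinAt_update_same]
    refine hlim0.mono_left (nhdsWithin_mono _ ?_)
    intro t ht
    exact lt_of_le_of_ne ht.1 (Ne.symm ht.2)
  · intro t ht
    refine (hd t ht).congr_of_eventuallyEq ?_
    filter_upwards [isOpen_ne.mem_nhds (ne_of_gt ht : t ≠ 0)] with s hs
    rw [Function.update_of_ne hs]
  · refine hlim1.congr' ?_
    filter_upwards [eventually_ne_atTop 0] with s hs
    rw [Function.update_of_ne hs]

lemma integrableOn_exp_neg_rpow : IntegrableOn (fun t : ℝ => exp (-t) * t ^ (-(1 / 2) : ℝ)) (Ioi 0) := by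
  have := GammaIntegral_convergent (s := 1 / 2) (by norm_num)
  convert this using 3
  norm_num

lemma sqrt_mul_exp_neg_le_one {u : ℝ} (hu : 0 ≤ u) : √u * exp (-u) ≤ 1 := by
  have h1 : √u ≤ exp u := by
    have h2 := add_one_le_exp u
    have h3 : √u ≤ u + 1 := by nlinarith [sq_sqrt hu, sqrt_nonneg u, sq_nonneg (√u - 1)]
    linarith
  rw [exp_neg, ← div_eq_mul_inv, div_le_one (exp_pos _)]
  exact h1

lemma one_sub_exp_neg_le_sqrt {u : ℝ} (hu : 0 ≤ u) : 1 - exp (-u) ≤ √u := by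
  by_cases h : u ≤ 1
  · have := add_one_le_exp (-u)
    have : u ≤ √u := by
      rw [Real.le_sqrt hu hu]; nlinarith
    linarith
  · have : 1 ≤ √u := Real.one_le_sqrt.2 (by linarith)
    linarith [exp_pos (-u)]

lemma sqrt_mul_inv {c t : ℝ} (hc : 0 ≤ c) (ht : 0 < t) : √(c * t⁻¹) = √c * t ^ (-(1 / 2) : ℝ) := by
  rw [sqrt_mul hc, Real.sqrt_inv, Real.rpow_neg ht.le, sqrt_eq_rpow t]

lemma exists_besselInt_one_le (hα : 0 < α) : ∃ C, 0 < C ∧ ∀ ρ, 0 < ρ →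
    besselInt α 1 ρ ≤ C / √ρ := by
  refine ⟨√(4 * α) * (∫ t in Ioi (0 : ℝ), exp (-t) * t ^ (-(1 / 2) : ℝ)) + 1, ?_, fun ρ hρ => ?_⟩
  · have : 0 ≤ ∫ t in Ioi (0 : ℝ), exp (-t) * t ^ (-(1 / 2) : ℝ) :=
      setIntegral_nonneg measurableSet_Ioi fun t ht => by
        have : 0 < t := ht
        positivity
    positivity
  have hc : 0 < ρ / (4 * α) := by positivity
  have h1 : besselInt α 1 ρ ≤ ∫ t in Ioi (0 : ℝ), (√(ρ / (4 * α)))⁻¹ * (exp (-t) * t ^ (-(1 / 2) : ℝ)) := by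
    refine setIntegral_mono_on (integrableOn_besselIntegrand hα 1 hρ)
      (integrableOn_exp_neg_rpow.const_mul _) measurableSet_Ioi fun t ht => ?_
    have ht : 0 < t := ht
    have h2 := sqrt_mul_exp_neg_le_one (u := ρ / (4 * α) * t⁻¹) (by positivity)
    have h3 := sqrt_mul_inv hc.le ht
    have h4 : t⁻¹ = t ^ (-(1 / 2) : ℝ) * t ^ (-(1 / 2) : ℝ) := by
      rw [← Real.rpow_add ht]; norm_num [Real.rpow_neg_one]
    rw [h3] at h2
    have hp : 0 < t ^ (-(1 / 2) : ℝ) := by positivity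
    have hs : 0 < √(ρ / (4 * α)) := by positivity
    rw [pow_one]
    calc exp (-t) * (t⁻¹ * exp (-(ρ / (4 * α) * t⁻¹)))
        = (√(ρ / (4 * α)))⁻¹ * (exp (-t) * t ^ (-(1 / 2) : ℝ)) *
          (√(ρ / (4 * α)) * t ^ (-(1 / 2) : ℝ) * exp (-(ρ / (4 * α) * t⁻¹))) := by
          have h5 : t⁻¹ * exp (-(ρ / (4 * α) * t⁻¹)) = t ^ (-(1 / 2) : ℝ) * t ^ (-(1 / 2) : ℝ)
            * exp (-(ρ / (4 * α) * t⁻¹)) := by rw [← h4]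
          rw [h5]
          field_simp
      _ ≤ (√(ρ / (4 * α)))⁻¹ * (exp (-t) * t ^ (-(1 / 2) : ℝ)) * 1 := by
          gcongr
      _ = _ := mul_one _
  refine h1.trans ?_
  rw [integral_const_mul, sqrt_div hρ.le, inv_div, div_mul_eq_mul_div]
  gcongr
  linarith

lemma exists_one_sub_besselInt_le (hα : 0 < α) : ∃ C, 0 < C ∧ ∀ ρ, 0 ≤ ρ →
    1 - besselInt α 0 ρ ≤ C * √ρ := by
  have hI : 0 ≤ ∫ t in Ioi (0 : ℝ), exp (-t) * t ^ (-(1 / 2) : ℝ) :=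
      setIntegral_nonneg measurableSet_Ioi fun t ht => by
        have : 0 < t := ht
        positivity
  refine ⟨(∫ t in Ioi (0 : ℝ), exp (-t) * t ^ (-(1 / 2) : ℝ)) / √(4 * α) + 1, by positivity,
    fun ρ hρ => ?_⟩
  have hc : 0 ≤ ρ / (4 * α) := by positivity
  have h1 : 1 - besselInt α 0 ρ
      ≤ ∫ t in Ioi (0 : ℝ), √(ρ / (4 * α)) * (exp (-t) * t ^ (-(1 / 2) : ℝ)) := by
    have h0 : 1 - besselInt α 0 ρ = ∫ t in Ioi (0 : ℝ), (exp (-t)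
        - exp (-t) * (t⁻¹ ^ 0 * exp (-(ρ / (4 * α) * t⁻¹)))) := by
      rw [integral_sub integrableOn_exp_neg (integrableOn_besselIntegrand_zero hα hρ),
        integral_exp_neg_Ioi', besselInt]
    rw [h0]
    refine setIntegral_mono_on (integrableOn_exp_neg.sub (integrableOn_besselIntegrand_zero hα hρ))
      (integrableOn_exp_neg_rpow.const_mul _) measurableSet_Ioi fun t ht => ?_
    have ht : 0 < t := ht
    have h2 := one_sub_exp_neg_le_sqrt (u := ρ / (4 * α) * t⁻¹) (by positivity)
    rw [sqrt_mul_inv hc ht] at h2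
    have := mul_le_mul_of_nonneg_left h2 (exp_pos (-t)).le
    rw [pow_zero]
    linarith
  refine h1.trans ?_
  rw [integral_const_mul, sqrt_div hρ]
  have : 0 ≤ √ρ := sqrt_nonneg _
  have h : √ρ / √(4 * α) * (∫ t in Ioi (0 : ℝ), exp (-t) * t ^ (-(1 / 2) : ℝ))
    = (∫ t in Ioi (0 : ℝ), exp (-t) * t ^ (-(1 / 2) : ℝ)) / √(4 * α) * √ρ := by ring
  rw [h]
  gcongr
  linarith

lemma besselInt_zero_le_one (hα : 0 < α) {ρ : ℝ} (hρ : 0 ≤ ρ) : besselInt α 0 ρ ≤ 1 := by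
  rw [← integral_exp_neg_Ioi', besselInt]
  refine setIntegral_mono_on (integrableOn_besselIntegrand_zero hα hρ) integrableOn_exp_neg
    measurableSet_Ioi fun t ht => ?_
  have ht : 0 < t := ht
  have : exp (-(ρ / (4 * α) * t⁻¹)) ≤ 1 := exp_le_one_iff.2 (by
    have : 0 ≤ ρ / (4 * α) * t⁻¹ := by positivity
    linarith)
  rw [pow_zero, one_mul]
  nlinarith [exp_pos (-t)]

lemma measurable_besselInt (α : ℝ) (n : ℕ) : Measurable (besselInt α n) := by
  have : StronglyMeasurable fun ρ => ∫ t in Ioi (0 : ℝ), 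
      (uncurry fun (ρ t : ℝ) => exp (-t) * (t⁻¹ ^ n * exp (-(ρ / (4 * α) * t⁻¹)))) (ρ, t) := by
    refine StronglyMeasurable.integral_prod_right (Measurable.stronglyMeasurable ?_)
    unfold uncurry
    fun_prop
  exact this.measurable

lemma tendsto_besselInt_zero (hα : 0 < α) :
    Tendsto (besselInt α 0) (nhdsWithin 0 (Ici 0)) (nhds 1) := by
  obtain ⟨C, hC, h⟩ := exists_one_sub_besselInt_le hα
  have h1 : Tendsto (fun ρ : ℝ => 1 - C * √ρ) (nhdsWithin 0 (Ici 0)) (nhds (1 - C * √0)) :=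
    ((by fun_prop : Continuous fun ρ : ℝ => 1 - C * √ρ).tendsto 0).mono_left nhdsWithin_le_nhds
  rw [sqrt_zero, mul_zero, sub_zero] at h1
  refine tendsto_of_tendsto_of_tendsto_of_le_of_le' h1 tendsto_const_nhds ?_ ?_
  · filter_upwards [self_mem_nhdsWithin] with ρ hρ
    linarith [h ρ hρ]
  · filter_upwards [self_mem_nhdsWithin] with ρ hρ
    exact besselInt_zero_le_one hα hρ

lemma helmholtzGreen_eq (α : ℝ) (x : ℝ × ℝ) :
    helmholtzGreen α x = 1 / (4 * π * α) * besselInt α 1 (normSq x) := by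
  rw [helmholtzGreen, besselInt, ← integral_const_mul]
  refine setIntegral_congr_fun measurableSet_Ioi fun t ht => ?_
  have ht : 0 < t := ht
  have : -(1 / (4 * α * t)) * normSq x = -(normSq x / (4 * α) * t⁻¹) := by
    rw [one_div, mul_inv, div_eq_mul_inv]; ring
  simp only [this]
  rw [pow_one, div_eq_mul_inv, mul_inv]
  ring

end

section

/-! ### The Euclidean norm and polar coordinates -/

/-- The Euclidean norm on `ℝ × ℝ`. -/
def rad (x : ℝ × ℝ) : ℝ := √(normSq x)

lemma normSq_nonneg (x : ℝ × ℝ) : 0 ≤ normSq x := by unfold normSq; positivity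

lemma normSq_pos {x : ℝ × ℝ} (hx : x ≠ 0) : 0 < normSq x := by
  have : x.1 ≠ 0 ∨ x.2 ≠ 0 := by
    by_contra! h
    exact hx (Prod.ext h.1 h.2)
  unfold normSq
  rcases this with h | h <;> positivity

lemma rad_nonneg (x : ℝ × ℝ) : 0 ≤ rad x := sqrt_nonneg _

lemma rad_pos {x : ℝ × ℝ} (hx : x ≠ 0) : 0 < rad x := sqrt_pos.2 (normSq_pos hx)

lemma rad_sq (x : ℝ × ℝ) : rad x ^ 2 = normSq x := sq_sqrt (normSq_nonneg x)

lemma rad_zero : rad 0 = 0 := by simp [rad, normSq]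

lemma abs_fst_le_rad (x : ℝ × ℝ) : |x.1| ≤ rad x := abs_le_sqrt (by unfold normSq; nlinarith)

lemma abs_snd_le_rad (x : ℝ × ℝ) : |x.2| ≤ rad x := abs_le_sqrt (by unfold normSq; nlinarith)

lemma normSq_neg (x : ℝ × ℝ) : normSq (-x) = normSq x := by simp [normSq]

lemma continuous_normSq : Continuous normSq := by unfold normSq; fun_prop

lemma continuous_rad : Continuous rad := by unfold rad; exact continuous_normSq.sqrt

lemma measurable_normSq : Measurable normSq := continuous_normSq.measurable

lemma measurable_rad : Measurable rad := continuous_rad.measurable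

lemma rad_eq_norm (x : ℝ × ℝ) : rad x = ‖(⟨x.1, x.2⟩ : ℂ)‖ := by
  rw [rad, Complex.norm_def, Complex.normSq_mk, normSq]; ring_nf

lemma rad_add_le (x y : ℝ × ℝ) : rad (x + y) ≤ rad x + rad y := by
  rw [rad_eq_norm, rad_eq_norm, rad_eq_norm]
  exact norm_add_le (⟨x.1, x.2⟩ : ℂ) ⟨y.1, y.2⟩

lemma rad_neg (x : ℝ × ℝ) : rad (-x) = rad x := by rw [rad, normSq_neg, rad]

lemma norm_le_rad (x : ℝ × ℝ) : ‖x‖ ≤ rad x := by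
  rw [Prod.norm_def]
  exact max_le (abs_fst_le_rad x) (abs_snd_le_rad x)

lemma normSq_polar (p : ℝ × ℝ) : normSq (polarCoord.symm p) = p.1 ^ 2 := by
  rw [polarCoord_symm_apply, normSq]
  have := Real.cos_sq_add_sin_sq p.2
  nlinarith

lemma rad_polar {p : ℝ × ℝ} (hp : 0 < p.1) : rad (polarCoord.symm p) = p.1 := by
  rw [rad, normSq_polar, sqrt_sq hp.le]

lemma integrableOn_polarCoord {E : Type*} [NormedAddCommGroup E] [NormedSpace ℝ E]
    {f : ℝ × ℝ → E} (hf : Integrable f) :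
    IntegrableOn (fun p : ℝ × ℝ => p.1 • f (polarCoord.symm p)) polarCoord.target := by
  have h := (integrableOn_image_iff_integrableOn_abs_det_fderiv_smul volume
    polarCoord.open_target.measurableSet
    (fun p _ => (hasFDerivAt_polarCoord_symm p).hasFDerivWithinAt)
    polarCoord.symm.injOn f).1 hf.integrableOn
  refine h.congr_fun (fun p hp => ?_) polarCoord.open_target.measurableSet
  simp only [det_fderivPolarCoordSymm]
  rw [abs_of_pos hp.1]

lemma restrict_polarCoord_target : (volume : Measure (ℝ × ℝ)).restrict polarCoord.target
    = (volume.restrict (Ioi (0 : ℝ))).prod (volume.restrict (Ioo (-π) π)) := by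
  rw [polarCoord_target, Measure.volume_eq_prod, Measure.prod_restrict]

lemma integral_polar {E : Type*} [NormedAddCommGroup E] [NormedSpace ℝ E]
    {f : ℝ × ℝ → E} (hf : Integrable f) :
    ∫ x, f x = ∫ r in Ioi (0 : ℝ), ∫ θ in Ioo (-π) π, r • f (r * cos θ, r * sin θ) := by
  have h := integrableOn_polarCoord hf
  rw [← integral_comp_polarCoord_symm]
  rw [IntegrableOn, restrict_polarCoord_target] at h
  rw [restrict_polarCoord_target, integral_prod _ h]
  rfl

lemma integral_polar' {E : Type*} [NormedAddCommGroup E] [NormedSpace ℝ E]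
    {f : ℝ × ℝ → E} (hf : Integrable f) :
    ∫ x, f x = ∫ θ in Ioo (-π) π, ∫ r in Ioi (0 : ℝ), r • f (r * cos θ, r * sin θ) := by
  have h := integrableOn_polarCoord hf
  rw [← integral_comp_polarCoord_symm]
  rw [IntegrableOn, restrict_polarCoord_target] at h
  rw [restrict_polarCoord_target, integral_prod_symm _ h]
  rfl

lemma lintegral_inv_rad_le {R : ℝ} :
    ∫⁻ x in {x : ℝ × ℝ | rad x < R}, ofReal (1 / rad x) ≤ ofReal (2 * π * R) := by
  have hm : MeasurableSet {x : ℝ × ℝ | rad x < R} := measurableSet_lt measurable_rad measurable_const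
  rw [← lintegral_indicator hm, ← lintegral_comp_polarCoord_symm]
  calc _ ≤ ∫⁻ p in polarCoord.target, (Ioo 0 R ×ˢ Ioo (-π) π).indicator 1 p := by
        refine setLIntegral_mono_ae' polarCoord.open_target.measurableSet (.of_forall fun p hp => ?_)
        have hp1 : 0 < p.1 := hp.1
        by_cases h : p.1 < R
        · rw [indicator_of_mem (show polarCoord.symm p ∈ {x : ℝ × ℝ | rad x < R} from
              (rad_polar hp1).trans_lt h),
            indicator_of_mem (show p ∈ Ioo 0 R ×ˢ Ioo (-π) π from ⟨⟨hp1, h⟩, hp.2⟩), rad_polar hp1, smul_eq_mul,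
            ← ofReal_mul hp1.le, mul_one_div, div_self hp1.ne']
          simp
        · rw [indicator_of_notMem (show polarCoord.symm p ∉ {x : ℝ × ℝ | rad x < R} from
            fun h' => h ((rad_polar hp1).symm.trans_lt h'))]
          simp
    _ ≤ ∫⁻ p, (Ioo 0 R ×ˢ Ioo (-π) π).indicator 1 p := setLIntegral_le_lintegral _ _
    _ = volume (Ioo 0 R ×ˢ Ioo (-π) π) :=
        lintegral_indicator_one (measurableSet_Ioo.prod measurableSet_Ioo)
    _ = ofReal (2 * π * R) := by
        rw [Measure.volume_eq_prod, Measure.prod_prod, Real.volume_Ioo, Real.volume_Ioo, mul_comm,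
          ← ofReal_mul (by linarith [pi_pos])]
        congr 1; ring

lemma setLIntegral_inv_rad_sub_le (E : Set (ℝ × ℝ)) (y : ℝ × ℝ) {R : ℝ} (hR : 0 < R) :
    ∫⁻ x in E, ofReal (1 / rad (x - y))
      ≤ ofReal (2 * π * R) + ofReal (1 / R) * volume E := by
  have hm : MeasurableSet {x : ℝ × ℝ | rad x < R} := measurableSet_lt measurable_rad measurable_const
  calc _ ≤ ∫⁻ x in E, (({x : ℝ × ℝ | rad x < R}.indicator fun x => ofReal (1 / rad x)) (x - y)
        + ofReal (1 / R)) := by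
        refine lintegral_mono fun x => ?_
        by_cases h : rad (x - y) < R
        · rw [indicator_of_mem (by simpa using h)]
          exact le_self_add
        · push Not at h
          refine (ofReal_le_ofReal ?_).trans le_add_self
          gcongr
    _ = (∫⁻ x in E, ({x : ℝ × ℝ | rad x < R}.indicator fun x => ofReal (1 / rad x)) (x - y))
        + ofReal (1 / R) * volume E := by
        rw [lintegral_add_right _ measurable_const, setLIntegral_const]
    _ ≤ (∫⁻ x, ({x : ℝ × ℝ | rad x < R}.indicator fun x => ofReal (1 / rad x)) (x - y))
        + ofReal (1 / R) * volume E := by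
        exact add_le_add_left (setLIntegral_le_lintegral _ _) _
    _ ≤ _ := by
        rw [lintegral_sub_right_eq_self (μ := volume)
          ({x : ℝ × ℝ | rad x < R}.indicator fun x => ofReal (1 / rad x)) y,
          lintegral_indicator hm]
        gcongr
        exact lintegral_inv_rad_le

lemma integrableOn_inv_rad_sub {E : Set (ℝ × ℝ)} (hE : volume E ≠ ⊤) (y : ℝ × ℝ) :
    IntegrableOn (fun x => 1 / rad (x - y)) E := by
  refine ⟨?_, ?_⟩
  · have : Measurable fun x => 1 / rad (x - y) :=
      (measurable_rad.comp (measurable_id.sub_const y)).const_div 1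
    exact this.aestronglyMeasurable
  · rw [hasFiniteIntegral_iff_ofReal (.of_forall fun x => by have := rad_nonneg (x - y); positivity)]
    refine (setLIntegral_inv_rad_sub_le E y one_pos).trans_lt ?_
    exact ENNReal.add_lt_top.2 ⟨ofReal_lt_top,
      ENNReal.mul_lt_top ofReal_lt_top hE.lt_top⟩

lemma integrable_of_le_inv_rad {f : ℝ × ℝ → ℝ} {E : Set (ℝ × ℝ)} (hE : volume E ≠ ⊤) (y : ℝ × ℝ)
    (hf : AEStronglyMeasurable f) {C : ℝ} (hC : ∀ x ∈ E, |f x| ≤ C * (1 / rad (x - y)))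
    (hE0 : ∀ x ∉ E, f x = 0) : Integrable f := by
  have h0 : Integrable f (volume.restrict (toMeasurable volume E)) := by
    have h1 : IntegrableOn (fun x => |C| * (1 / rad (x - y))) (toMeasurable volume E) :=
      (integrableOn_inv_rad_sub (by rwa [measure_toMeasurable]) y).const_mul _
    refine Integrable.mono' h1 hf.restrict (.of_forall fun x => ?_)
    have hr := rad_nonneg (x - y)
    by_cases hx : x ∈ E
    · refine (hC x hx).trans ?_
      gcongr
      exact le_abs_self C
    · rw [hE0 x hx, norm_zero]; positivity
  refine IntegrableOn.integrable_of_forall_notMem_eq_zero h0 fun x hx => hE0 x fun h => hx ?_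
  exact subset_toMeasurable _ _ h

end

section

variable {α : ℝ}

/-! ### The kernel `K_α` in closed form -/

lemma volume_rad_sub_lt_ne_top (y : ℝ × ℝ) (R : ℝ) : volume {x : ℝ × ℝ | rad (x - y) < R} ≠ ⊤ := by
  refine ne_top_of_le_ne_top (measure_ball_lt_top (x := y) (r := R)).ne (measure_mono fun x hx => ?_)
  rw [Metric.mem_ball, dist_eq_norm]
  exact (norm_le_rad _).trans_lt hx

lemma helmholtzGreen_nonneg (hα : 0 < α) (x : ℝ × ℝ) : 0 ≤ helmholtzGreen α x := by
  rw [helmholtzGreen_eq]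
  have := besselInt_nonneg α 1 (normSq x)
  have := pi_pos
  positivity

lemma exists_helmholtzGreen_le (hα : 0 < α) : ∃ C, 0 < C ∧ ∀ x : ℝ × ℝ, x ≠ 0 →
    helmholtzGreen α x ≤ C / rad x := by
  obtain ⟨C, hC, h⟩ := exists_besselInt_one_le hα
  have := pi_pos
  refine ⟨1 / (4 * π * α) * C, by positivity, fun x hx => ?_⟩
  rw [helmholtzGreen_eq, mul_div_assoc]
  exact mul_le_mul_of_nonneg_left (h _ (normSq_pos hx)) (by positivity)

lemma measurable_helmholtzGreen (α : ℝ) : Measurable (helmholtzGreen α) := by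
  have : helmholtzGreen α = fun x => 1 / (4 * π * α) * besselInt α 1 (normSq x) :=
    funext (helmholtzGreen_eq α)
  rw [this]
  exact ((measurable_besselInt α 1).comp measurable_normSq).const_mul _

/-- The mass of `G_α` in the disc of radius `R`. -/
lemma integral_radial_helmholtzGreen (hα : 0 < α) {R : ℝ} (hR : 0 < R) :
    IntegrableOn (fun r => r * besselInt α 1 (r ^ 2)) (Ioo 0 R) ∧
    ∫ r in Ioo 0 R, r * besselInt α 1 (r ^ 2) = 2 * α * (1 - besselInt α 0 (R ^ 2)) := by
  obtain ⟨C, hC, h⟩ := exists_besselInt_one_le hα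
  have hint : IntegrableOn (fun r => r * besselInt α 1 (r ^ 2)) (Ioo 0 R) := by
    refine Measure.integrableOn_of_bounded (M := C) (by simp) ?_ ?_
    · exact (measurable_id.mul ((measurable_besselInt α 1).comp (measurable_id.pow_const 2)))
        |>.aestronglyMeasurable
    · refine ae_restrict_of_forall_mem measurableSet_Ioo fun r hr => ?_
      have hr0 : 0 < r := hr.1
      rw [norm_of_nonneg (mul_nonneg hr0.le (besselInt_nonneg _ _ _))]
      have h1 := h (r ^ 2) (by positivity)
      rw [sqrt_sq hr0.le, le_div_iff₀ hr0] at h1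
      linarith
  refine ⟨hint, ?_⟩
  rw [← integral_Ioc_eq_integral_Ioo, ← intervalIntegral.integral_of_le hR.le]
  have h1 := intervalIntegral.integral_eq_sub_of_hasDerivAt_of_tendsto (a := 0) (b := R)
    (f := fun r => -(2 * α) * besselInt α 0 (r ^ 2)) (f' := fun r => r * besselInt α 1 (r ^ 2))
    (fa := -(2 * α)) (fb := -(2 * α) * besselInt α 0 (R ^ 2)) hR ?_ ?_ ?_ ?_
  · rw [h1]; ring
  · intro r hr
    have hr0 : 0 < r := hr.1
    have h2 := (hasDerivAt_besselInt hα 0 (ρ := r ^ 2) (by positivity)).comp r (hasDerivAt_pow 2 r)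
    convert! h2.const_mul (-(2 * α)) using 1
    field_simp
    ring
  · rw [intervalIntegrable_iff_integrableOn_Ioo_of_le hR.le]
    exact hint
  · have h2 : Tendsto (fun r : ℝ => r ^ 2) (nhdsWithin 0 (Ioi 0)) (nhdsWithin 0 (Ici 0)) := by
      refine tendsto_nhdsWithin_iff.2 ⟨?_, .of_forall fun r => by simp [sq_nonneg]⟩
      have : Tendsto (fun r : ℝ => r ^ 2) (nhds 0) (nhds (0 ^ 2)) := (continuous_pow 2).tendsto 0
      rw [zero_pow two_ne_zero] at this
      exact this.mono_left nhdsWithin_le_nhds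
    have := ((tendsto_besselInt_zero hα).comp h2).const_mul (-(2 * α))
    rwa [mul_one] at this
  · have h2 := (hasDerivAt_besselInt hα 0 (ρ := R ^ 2) (by positivity)).comp R (hasDerivAt_pow 2 R)
    exact ((h2.continuousAt.tendsto).const_mul (-(2 * α))).mono_left nhdsWithin_le_nhds

/-- Averages of `w ↦ (z - w)⁻¹` over circles around the origin. -/
lemma circleAverage_sub_inv_of_lt {z : ℂ} {r : ℝ} (hr : 0 ≤ r) (h : r < ‖z‖) :
    circleAverage (fun w => (z - w)⁻¹) 0 r = z⁻¹ := by
  have h1 : DiffContOnCl ℂ (fun w => (z - w)⁻¹) (Metric.ball 0 |r|) := by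
    refine DiffContOnCl.inv (DiffContOnCl.const_sub (differentiable_id.diffContOnCl) z) ?_
    intro w hw h0
    have hw' := Metric.closure_ball_subset_closedBall hw
    rw [mem_closedBall_zero_iff, abs_of_nonneg hr] at hw'
    have : z = w := sub_eq_zero.1 h0
    rw [← this] at hw'
    linarith
  rw [h1.circleAverage, sub_zero]

lemma circleAverage_sub_inv_of_gt {z : ℂ} (hz : z ≠ 0) {r : ℝ} (h : ‖z‖ < r) :
    circleAverage (fun w => (z - w)⁻¹) 0 r = 0 := by
  have hr : 0 ≤ r := (norm_nonneg z).trans h.le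
  have hball : z ∈ Metric.ball (0 : ℂ) |r| := by
    rw [mem_ball_zero_iff, abs_of_nonneg hr]; exact h
  have h1 := DiffContOnCl.circleAverage_smul_div (f := fun _ => (1 : ℂ)) (c := 0) (R := r)
    diffContOnCl_const hball
  have hne : ∀ w ∈ Metric.sphere (0 : ℂ) |r|, w - z ≠ 0 := by
    intro w hw h0
    rw [mem_sphere_zero_iff_norm, abs_of_nonneg hr] at hw
    rw [sub_eq_zero.1 h0] at hw
    linarith
  have hci : CircleIntegrable (fun w => (z - w)⁻¹) 0 r := by
    refine ContinuousOn.circleIntegrable hr ?_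
    rw [abs_of_nonneg hr] at hne
    refine ContinuousOn.inv₀ (by fun_prop) fun w hw h0 => hne w hw ?_
    rw [← neg_sub, h0, neg_zero]
  have h2 : circleAverage (fun w => ((w - 0) / (w - z)) • (1 : ℂ)) 0 r
      = circleAverage (fun w => (1 : ℂ) + (-z) • (z - w)⁻¹) 0 r := by
    refine circleAverage_congr_sphere fun w hw => ?_
    have hwz := hne w hw
    have hzw : z - w ≠ 0 := by rw [← neg_sub]; exact neg_ne_zero.2 hwz
    simp only [sub_zero, smul_eq_mul, mul_one]
    field_simp
    ring
  rw [h2] at h1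
  have h3 := circleAverage_add (f₁ := fun _ => (1 : ℂ)) (f₂ := fun w => (-z) • (z - w)⁻¹) (c := 0) (R := r)
    (circleIntegrable_const _ _ _) (hci.const_smul (a := -z))
  have h4 : (fun w : ℂ => (1 : ℂ) + (-z) • (z - w)⁻¹) = (fun _ => (1 : ℂ)) + fun w => (-z) • (z - w)⁻¹ := rfl
  rw [h4, h3, circleAverage_const] at h1
  have h5 := circleAverage_smul (a := -z) (f := fun w : ℂ => (z - w)⁻¹) (c := 0) (R := r)
  have h6 : ((-z) • fun w : ℂ => (z - w)⁻¹) = fun w => (-z) • (z - w)⁻¹ := rfl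
  rw [← h6, h5, add_eq_left, smul_eq_zero] at h1
  exact h1.resolve_left (neg_ne_zero.2 hz)

lemma integral_Ioo_circleMap {E : Type*} [NormedAddCommGroup E] [NormedSpace ℝ E] (f : ℂ → E) (r : ℝ) :
    ∫ θ in Ioo (-π) π, f (circleMap 0 r θ) = (2 * π) • circleAverage f 0 r := by
  have hp : Function.Periodic (fun θ => f (circleMap 0 r θ)) (2 * π) := fun θ => by
    simp only [periodic_circleMap 0 r θ]
  have h := hp.intervalIntegral_add_eq (-π) 0
  have e : -π + 2 * π = π := by ring
  rw [e, zero_add, intervalIntegral.integral_of_le (by linarith [pi_pos]),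
    integral_Ioc_eq_integral_Ioo] at h
  rw [h, circleAverage_def, smul_smul, mul_inv_cancel₀ (by positivity), one_smul]

/-- The complex number `x₁ + i x₂`. -/
def toComplex (x : ℝ × ℝ) : ℂ := ⟨x.1, x.2⟩

lemma norm_toComplex (x : ℝ × ℝ) : ‖toComplex x‖ = rad x := (rad_eq_norm x).symm

lemma toComplex_ne_zero {x : ℝ × ℝ} (hx : x ≠ 0) : toComplex x ≠ 0 := by
  rw [← norm_ne_zero_iff, norm_toComplex]
  exact (rad_pos hx).ne'

lemma measurable_toComplex : Measurable toComplex := by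
  have : toComplex = fun x : ℝ × ℝ => (x.1 : ℂ) + x.2 * I := by
    funext x; exact (Complex.mk_eq_add_mul_I _ _)
  rw [this]; fun_prop

lemma integrable_inv_mul_helmholtzGreen (hα : 0 < α) {x : ℝ × ℝ} (hx : x ≠ 0) :
    Integrable fun y => (toComplex (x - y))⁻¹ * (helmholtzGreen α y : ℂ) := by
  obtain ⟨C, hC, h⟩ := exists_helmholtzGreen_le hα
  have hR := rad_pos hx
  have hmeas : Measurable fun y => (toComplex (x - y))⁻¹ * (helmholtzGreen α y : ℂ) :=
    ((measurable_toComplex.comp (measurable_const.sub measurable_id)).inv).mul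
      (Complex.measurable_ofReal.comp (measurable_helmholtzGreen α))
  have hn : ∀ y, ‖(toComplex (x - y))⁻¹ * (helmholtzGreen α y : ℂ)‖
      = 1 / rad (x - y) * helmholtzGreen α y := fun y => by
    rw [norm_mul, norm_inv, norm_toComplex, norm_real,
      norm_of_nonneg (helmholtzGreen_nonneg hα y), one_div]
  set E := {y : ℝ × ℝ | rad (y - x) < rad x / 2} with hE
  have hEm : MeasurableSet E :=
    measurableSet_lt (measurable_rad.comp (measurable_id.sub_const x)) measurable_const
  have h1 : IntegrableOn (fun y => (toComplex (x - y))⁻¹ * (helmholtzGreen α y : ℂ)) E := by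
    have h2 : IntegrableOn (fun y => C / (rad x / 2) * (1 / rad (y - x))) E :=
      (integrableOn_inv_rad_sub (volume_rad_sub_lt_ne_top x _) x).const_mul _
    refine Integrable.mono' h2 hmeas.aestronglyMeasurable
      ((ae_restrict_of_forall_mem hEm fun y hy => ?_))
    have h3 : rad x ≤ rad (x - y) + rad y := by simpa using rad_add_le (x - y) y
    have h4 : rad (x - y) = rad (y - x) := by rw [← rad_neg, neg_sub]
    have h5 : rad (y - x) < rad x / 2 := hy
    have h6 : rad x / 2 ≤ rad y := by linarith
    have hy0 : y ≠ 0 := by rintro rfl; rw [rad_zero] at h6; linarith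
    rw [hn, h4, mul_comm]
    have := rad_nonneg (y - x)
    gcongr
    exact (h y hy0).trans (by gcongr)
  have h2 : IntegrableOn (fun y => (toComplex (x - y))⁻¹ * (helmholtzGreen α y : ℂ)) Eᶜ := by
    have h2 : IntegrableOn (fun y => 1 / (rad x / 2) * helmholtzGreen α y) Eᶜ :=
      ((integrable_helmholtzGreen hα).const_mul _).integrableOn
    refine Integrable.mono' h2 hmeas.aestronglyMeasurable
      ((ae_restrict_iff' hEm.compl).2 (.of_forall fun y hy => ?_))
    have h4 : rad (x - y) = rad (y - x) := by rw [← rad_neg, neg_sub]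
    have h5 : rad x / 2 ≤ rad (y - x) := not_lt.1 hy
    have := helmholtzGreen_nonneg hα y
    rw [hn, h4]
    gcongr
  have := h1.union h2
  rwa [union_compl_self, integrableOn_univ] at this

lemma integral_inv_mul_helmholtzGreen (hα : 0 < α) {x : ℝ × ℝ} (hx : x ≠ 0) :
    ∫ y, (toComplex (x - y))⁻¹ * (helmholtzGreen α y : ℂ)
      = (toComplex x)⁻¹ * ((1 - besselInt α 0 (normSq x) : ℝ) : ℂ) := by
  have hR := rad_pos hx
  have hpi := pi_pos
  obtain ⟨hI, hM⟩ := integral_radial_helmholtzGreen hα hR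
  rw [integral_polar (integrable_inv_mul_helmholtzGreen hα hx)]
  have hinner : ∀ r ∈ Ioi (0 : ℝ), r ≠ rad x → ∫ θ in Ioo (-π) π,
      r • ((toComplex (x - (r * cos θ, r * sin θ)))⁻¹ * (helmholtzGreen α (r * cos θ, r * sin θ) : ℂ))
      = (Ioo 0 (rad x)).indicator (fun r => (toComplex x)⁻¹ *
          ((1 / (2 * α) * (r * besselInt α 1 (r ^ 2)) : ℝ) : ℂ)) r := by
    intro r hr hne
    have hr : 0 < r := hr
    have e1 : ∀ θ, r • ((toComplex (x - (r * cos θ, r * sin θ)))⁻¹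
        * (helmholtzGreen α (r * cos θ, r * sin θ) : ℂ))
        = ((r * (1 / (4 * π * α) * besselInt α 1 (r ^ 2)) : ℝ) : ℂ)
          * (toComplex x - circleMap 0 r θ)⁻¹ := by
      intro θ
      have e2 : toComplex (x - (r * cos θ, r * sin θ)) = toComplex x - circleMap 0 r θ := by
        rw [circleMap, zero_add, Complex.exp_mul_I]
        apply Complex.ext <;> simp [toComplex, Complex.cos_ofReal_re, Complex.sin_ofReal_re]
      have e3 : normSq (r * cos θ, r * sin θ) = r ^ 2 := normSq_polar (r, θ)
      rw [e2, helmholtzGreen_eq, e3, Complex.real_smul]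
      push_cast
      ring
    simp_rw [e1]
    rw [integral_const_mul, integral_Ioo_circleMap (fun w => (toComplex x - w)⁻¹) r]
    rcases lt_or_gt_of_ne hne with h | h
    · rw [circleAverage_sub_inv_of_lt hr.le (by rwa [norm_toComplex]),
        indicator_of_mem (show r ∈ Ioo 0 (rad x) from ⟨hr, h⟩), Complex.real_smul]
      have : (π : ℂ) ≠ 0 := by exact_mod_cast hpi.ne'
      have : (α : ℂ) ≠ 0 := by exact_mod_cast hα.ne'
      push_cast
      field_simp
      ring
    · rw [circleAverage_sub_inv_of_gt (toComplex_ne_zero hx) (by rwa [norm_toComplex]),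
        indicator_of_notMem (fun h' => h.not_gt h'.2)]
      simp
  have hae : ∀ᵐ r : ℝ, r ≠ rad x := by
    simp [ae_iff]
  have hss : Ioi (0 : ℝ) ∩ Ioo 0 (rad x) = Ioo 0 (rad x) :=
    inter_eq_self_of_subset_right fun r hr => hr.1
  rw [setIntegral_congr_ae measurableSet_Ioi (hae.mono fun r hr hr0 => hinner r hr0 hr),
    setIntegral_indicator measurableSet_Ioo,
    hss, integral_const_mul,
    integral_complex_ofReal, integral_const_mul, hM, rad_sq]
  congr 2
  field_simp

/-- The radial profile `(1 - S(ρ)) / (2πρ)` of `K_α`. -/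
def velProfile (α ρ : ℝ) : ℝ := (1 - besselInt α 0 ρ) / (2 * π * ρ)

lemma toComplex_inv_re (x : ℝ × ℝ) : ((toComplex x)⁻¹).re = x.1 / normSq x := by
  rw [Complex.inv_re, toComplex, Complex.normSq_mk, normSq]; ring_nf

lemma toComplex_inv_im (x : ℝ × ℝ) : ((toComplex x)⁻¹).im = -x.2 / normSq x := by
  rw [Complex.inv_im, toComplex, Complex.normSq_mk, normSq]; ring_nf

theorem smoothedBiotSavart_eq (hα : 0 < α) (x : ℝ × ℝ) : smoothedBiotSavart α x
    = (-x.2 * velProfile α (normSq x), x.1 * velProfile α (normSq x)) := by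
  have hpi := pi_pos
  by_cases hx : x = 0
  · subst hx
    have h : ∀ f : ℝ × ℝ → ℝ, (∀ y, f (-y) = -f y) → ∫ y, f y = 0 := by
      intro f hf
      have := integral_neg_eq_self f volume
      simp_rw [hf, integral_neg] at this
      linarith
    have hG : ∀ y, helmholtzGreen α (0 - -y) = helmholtzGreen α (0 - y) := fun y => by
      simp only [zero_sub, helmholtzGreen_eq, normSq_neg]
    have h1 := h (fun y => (biotSavart y).1 * helmholtzGreen α (0 - y)) fun y => by
      rw [hG]; simp only [biotSavart, normSq_neg, Prod.snd_neg]; ring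
    have h2 := h (fun y => (biotSavart y).2 * helmholtzGreen α (0 - y)) fun y => by
      rw [hG]; simp only [biotSavart, normSq_neg, Prod.fst_neg]; ring
    rw [smoothedBiotSavart, h1, h2]
    simp
  have hI := integrable_inv_mul_helmholtzGreen hα hx
  have key := integral_inv_mul_helmholtzGreen hα hx
  have hr : ∀ f : ℝ × ℝ → ℝ, ∫ y, f y * helmholtzGreen α (x - y)
      = ∫ y, f (x - y) * helmholtzGreen α y := fun f => by
    rw [← integral_sub_left_eq_self _ volume x]
    simp
  have him : ∀ z : ℂ, ∀ r : ℝ, (z * (r : ℂ)).im = z.im * r := fun z r => by simp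
  have hre : ∀ z : ℂ, ∀ r : ℝ, (z * (r : ℂ)).re = z.re * r := fun z r => by simp
  have k1 := congrArg Complex.im key
  have k2 := congrArg Complex.re key
  rw [← RCLike.im_eq_complex_im, ← integral_im hI] at k1
  rw [← RCLike.re_eq_complex_re, ← integral_re hI] at k2
  simp only [RCLike.im_eq_complex_im, RCLike.re_eq_complex_re, him, hre, toComplex_inv_im,
    toComplex_inv_re] at k1 k2
  rw [smoothedBiotSavart, hr, hr]
  refine Prod.ext ?_ ?_
  · have e : ∀ y, (biotSavart (x - y)).1 * helmholtzGreen α y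
        = 1 / (2 * π) * (-(x - y).2 / normSq (x - y) * helmholtzGreen α y) := fun y => by
      rw [biotSavart, mul_comm (2 * π), ← div_div]; ring
    simp_rw [e]
    rw [integral_const_mul, k1, velProfile, mul_comm (2 * π), ← div_div]
    ring
  · have e : ∀ y, (biotSavart (x - y)).2 * helmholtzGreen α y
        = 1 / (2 * π) * ((x - y).1 / normSq (x - y) * helmholtzGreen α y) := fun y => by
      rw [biotSavart, mul_comm (2 * π), ← div_div]; ring
    simp_rw [e]
    rw [integral_const_mul, k2, velProfile, mul_comm (2 * π), ← div_div]
    ring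

end

section

variable {α : ℝ}

/-! ### Smooth functions and test functions -/

section Smooth

variable {φ ψ : ℝ × ℝ → ℝ}

lemma hasDerivAt_fst_fderiv {x : ℝ × ℝ} (h : DifferentiableAt ℝ φ x) :
    HasDerivAt (fun s => φ (s, x.2)) (fderiv ℝ φ x (1, 0)) x.1 :=
  HasFDerivAt.comp_hasDerivAt (f := fun s : ℝ => (s, x.2)) x.1 h.hasFDerivAt
    ((hasDerivAt_id _).prodMk (hasDerivAt_const _ _))

lemma hasDerivAt_snd_fderiv {x : ℝ × ℝ} (h : DifferentiableAt ℝ φ x) :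
    HasDerivAt (fun s => φ (x.1, s)) (fderiv ℝ φ x (0, 1)) x.2 :=
  HasFDerivAt.comp_hasDerivAt (f := fun s : ℝ => (x.1, s)) x.2 h.hasFDerivAt
    ((hasDerivAt_const _ _).prodMk (hasDerivAt_id _))

lemma d1_eq_fderiv (h : Differentiable ℝ φ) : d1 φ = fun x => fderiv ℝ φ x (1, 0) :=
  funext fun x => (hasDerivAt_fst_fderiv (h x)).deriv

lemma d2_eq_fderiv (h : Differentiable ℝ φ) : d2 φ = fun x => fderiv ℝ φ x (0, 1) :=
  funext fun x => (hasDerivAt_snd_fderiv (h x)).deriv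

lemma smooth_differentiable (h : ContDiff ℝ ∞ φ) : Differentiable ℝ φ :=
  h.differentiable (by simp)

lemma smooth_hasDerivAt_d1 (h : ContDiff ℝ ∞ φ) (a b : ℝ) :
    HasDerivAt (fun s => φ (s, b)) (d1 φ (a, b)) a := by
  rw [d1_eq_fderiv (smooth_differentiable h)]
  exact hasDerivAt_fst_fderiv (x := (a, b)) (smooth_differentiable h _)

lemma smooth_hasDerivAt_d2 (h : ContDiff ℝ ∞ φ) (a b : ℝ) :
    HasDerivAt (fun s => φ (a, s)) (d2 φ (a, b)) b := by
  rw [d2_eq_fderiv (smooth_differentiable h)]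
  exact hasDerivAt_snd_fderiv (x := (a, b)) (smooth_differentiable h _)

lemma smooth_hasDerivAt_comp (h : ContDiff ℝ ∞ φ) {c d : ℝ → ℝ} {c' d' t : ℝ}
    (hc : HasDerivAt c c' t) (hd : HasDerivAt d d' t) :
    HasDerivAt (fun t => φ (c t, d t)) (c' * d1 φ (c t, d t) + d' * d2 φ (c t, d t)) t := by
  have h1 := HasFDerivAt.comp_hasDerivAt (f := fun t : ℝ => (c t, d t)) t
    (smooth_differentiable h _).hasFDerivAt (hc.prodMk hd)
  rw [d1_eq_fderiv (smooth_differentiable h), d2_eq_fderiv (smooth_differentiable h)]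
  convert! h1 using 1
  have : (c', d') = c' • ((1, 0) : ℝ × ℝ) + d' • ((0, 1) : ℝ × ℝ) := by simp
  rw [this, map_add, map_smul, map_smul]
  rfl

lemma smooth_d1 (h : ContDiff ℝ ∞ φ) : ContDiff ℝ ∞ (d1 φ) := by
  rw [d1_eq_fderiv (smooth_differentiable h)]
  exact (h.fderiv_right (m := ∞) (by simp)).clm_apply contDiff_const

lemma smooth_d2 (h : ContDiff ℝ ∞ φ) : ContDiff ℝ ∞ (d2 φ) := by
  rw [d2_eq_fderiv (smooth_differentiable h)]
  exact (h.fderiv_right (m := ∞) (by simp)).clm_apply contDiff_const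

lemma smooth_lap (h : ContDiff ℝ ∞ φ) : ContDiff ℝ ∞ (lap φ) :=
  (smooth_d1 (smooth_d1 h)).add (smooth_d2 (smooth_d2 h))

lemma smooth_d1_d2 (h : ContDiff ℝ ∞ φ) : d1 (d2 φ) = d2 (d1 φ) := by
  have hd := smooth_differentiable h
  have hd' : Differentiable ℝ (fderiv ℝ φ) :=
    (h.fderiv_right (m := 1) (by norm_cast)).differentiable (by simp)
  rw [d1_eq_fderiv (smooth_differentiable (smooth_d2 h)),
    d2_eq_fderiv (smooth_differentiable (smooth_d1 h)), d1_eq_fderiv hd, d2_eq_fderiv hd]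
  funext x
  have e1 : fderiv ℝ (fun x => fderiv ℝ φ x (0, 1)) x (1, 0)
      = fderiv ℝ (fderiv ℝ φ) x (1, 0) (0, 1) := by
    rw [fderiv_clm_apply (hd' x) (differentiableAt_const _)]; simp
  have e2 : fderiv ℝ (fun x => fderiv ℝ φ x (1, 0)) x (0, 1)
      = fderiv ℝ (fderiv ℝ φ) x (0, 1) (1, 0) := by
    rw [fderiv_clm_apply (hd' x) (differentiableAt_const _)]; simp
  rw [e1, e2]
  exact (h.contDiffAt.isSymmSndFDerivAt
    (by rw [minSmoothness_of_isRCLikeNormedField]; exact WithTop.coe_le_coe.2 (le_top : (2 : ℕ∞) ≤ ⊤))).eq _ _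

lemma d1_add (h : ContDiff ℝ ∞ φ) (h' : ContDiff ℝ ∞ ψ) :
    d1 (fun x => φ x + ψ x) = fun x => d1 φ x + d1 ψ x := funext fun x =>
  ((smooth_hasDerivAt_d1 h x.1 x.2).add (smooth_hasDerivAt_d1 h' x.1 x.2)).deriv

lemma d2_add (h : ContDiff ℝ ∞ φ) (h' : ContDiff ℝ ∞ ψ) :
    d2 (fun x => φ x + ψ x) = fun x => d2 φ x + d2 ψ x := funext fun x =>
  ((smooth_hasDerivAt_d2 h x.1 x.2).add (smooth_hasDerivAt_d2 h' x.1 x.2)).deriv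

lemma d1_const_mul (c : ℝ) (h : ContDiff ℝ ∞ φ) :
    d1 (fun x => c * φ x) = fun x => c * d1 φ x := funext fun x =>
  ((smooth_hasDerivAt_d1 h x.1 x.2).const_mul c).deriv

lemma d2_const_mul (c : ℝ) (h : ContDiff ℝ ∞ φ) :
    d2 (fun x => c * φ x) = fun x => c * d2 φ x := funext fun x =>
  ((smooth_hasDerivAt_d2 h x.1 x.2).const_mul c).deriv

lemma d1_sub (h : ContDiff ℝ ∞ φ) (h' : ContDiff ℝ ∞ ψ) :
    d1 (fun x => φ x - ψ x) = fun x => d1 φ x - d1 ψ x := funext fun x =>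
  ((smooth_hasDerivAt_d1 h x.1 x.2).sub (smooth_hasDerivAt_d1 h' x.1 x.2)).deriv

lemma d2_sub (h : ContDiff ℝ ∞ φ) (h' : ContDiff ℝ ∞ ψ) :
    d2 (fun x => φ x - ψ x) = fun x => d2 φ x - d2 ψ x := funext fun x =>
  ((smooth_hasDerivAt_d2 h x.1 x.2).sub (smooth_hasDerivAt_d2 h' x.1 x.2)).deriv

lemma d1_mul (h : ContDiff ℝ ∞ φ) (h' : ContDiff ℝ ∞ ψ) :
    d1 (fun x => φ x * ψ x) = fun x => d1 φ x * ψ x + φ x * d1 ψ x := funext fun x =>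
  ((smooth_hasDerivAt_d1 h x.1 x.2).mul (smooth_hasDerivAt_d1 h' x.1 x.2)).deriv

lemma d2_mul (h : ContDiff ℝ ∞ φ) (h' : ContDiff ℝ ∞ ψ) :
    d2 (fun x => φ x * ψ x) = fun x => d2 φ x * ψ x + φ x * d2 ψ x := funext fun x =>
  ((smooth_hasDerivAt_d2 h x.1 x.2).mul (smooth_hasDerivAt_d2 h' x.1 x.2)).deriv

lemma d1_helmholtz (h : ContDiff ℝ ∞ φ) (α : ℝ) :
    d1 (fun z => φ z - α * lap φ z) = fun z => d1 φ z - α * lap (d1 φ) z := by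
  rw [d1_sub h (contDiff_const.mul (smooth_lap h)), d1_const_mul α (smooth_lap h)]
  have : d1 (lap φ) = lap (d1 φ) := by
    have e : lap φ = fun x => d1 (d1 φ) x + d2 (d2 φ) x := rfl
    rw [e, d1_add (smooth_d1 (smooth_d1 h)) (smooth_d2 (smooth_d2 h)), smooth_d1_d2 (smooth_d2 h),
      smooth_d1_d2 h]
    rfl
  rw [this]

lemma d2_helmholtz (h : ContDiff ℝ ∞ φ) (α : ℝ) :
    d2 (fun z => φ z - α * lap φ z) = fun z => d2 φ z - α * lap (d2 φ) z := by
  rw [d2_sub h (contDiff_const.mul (smooth_lap h)), d2_const_mul α (smooth_lap h)]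
  have : d2 (lap φ) = lap (d2 φ) := by
    have e : lap φ = fun x => d1 (d1 φ) x + d2 (d2 φ) x := rfl
    rw [e, d2_add (smooth_d1 (smooth_d1 h)) (smooth_d2 (smooth_d2 h)),
      ← smooth_d1_d2 (smooth_d1 h), ← smooth_d1_d2 h]
    rfl
  rw [this]

lemma tsupport_d1_subset (h : ContDiff ℝ ∞ φ) : tsupport (d1 φ) ⊆ tsupport φ := by
  refine (closure_minimal ?_ (isClosed_tsupport φ))
  intro x hx
  by_contra hn
  rw [d1_eq_fderiv (smooth_differentiable h)] at hx
  have : fderiv ℝ φ x = 0 := by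
    by_contra hne
    exact hn (support_fderiv_subset ℝ (f := φ) hne)
  exact hx (by simp [this])

lemma tsupport_d2_subset (h : ContDiff ℝ ∞ φ) : tsupport (d2 φ) ⊆ tsupport φ := by
  refine (closure_minimal ?_ (isClosed_tsupport φ))
  intro x hx
  by_contra hn
  rw [d2_eq_fderiv (smooth_differentiable h)] at hx
  have : fderiv ℝ φ x = 0 := by
    by_contra hne
    exact hn (support_fderiv_subset ℝ (f := φ) hne)
  exact hx (by simp [this])

lemma IsTest.d1 (h : IsTest φ) : IsTest (d1 φ) :=
  ⟨smooth_d1 h.1, h.2.of_isClosed_subset (isClosed_tsupport _) (tsupport_d1_subset h.1)⟩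

lemma IsTest.d2 (h : IsTest φ) : IsTest (d2 φ) :=
  ⟨smooth_d2 h.1, h.2.of_isClosed_subset (isClosed_tsupport _) (tsupport_d2_subset h.1)⟩

lemma IsTest.add (h : IsTest φ) (h' : IsTest ψ) : IsTest (fun x => φ x + ψ x) :=
  ⟨h.1.add h'.1, h.2.add h'.2⟩

lemma IsTest.const_mul (c : ℝ) (h : IsTest φ) : IsTest (fun x => c * φ x) :=
  ⟨contDiff_const.mul h.1, h.2.mul_left⟩

lemma IsTest.sub (h : IsTest φ) (h' : IsTest ψ) : IsTest (fun x => φ x - ψ x) := by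
  have := h.add (h'.const_mul (-1))
  simpa [sub_eq_add_neg] using this

lemma IsTest.lap (h : IsTest φ) : IsTest (lap φ) := h.d1.d1.add h.d2.d2

lemma IsTest.helmholtz (h : IsTest φ) (α : ℝ) : IsTest (fun z => φ z - α * AlphaEuler.lap φ z) :=
  h.sub (h.lap.const_mul α)

lemma IsTest.continuous (h : IsTest φ) : Continuous φ := h.1.continuous

lemma IsTest.integrable (h : IsTest φ) : Integrable φ := h.continuous.integrable_of_hasCompactSupport h.2

lemma IsTest.exists_bound (h : IsTest φ) : ∃ C, 0 ≤ C ∧ ∀ x, |φ x| ≤ C := by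
  obtain ⟨C, hC⟩ := h.2.exists_bound_of_continuous h.continuous
  exact ⟨C, (norm_nonneg _).trans (hC 0), hC⟩

lemma IsTest.translate (h : IsTest φ) (y : ℝ × ℝ) : IsTest (fun x => φ (x + y)) :=
  ⟨h.1.comp (contDiff_id.add contDiff_const),
    h.2.comp_homeomorph (Homeomorph.addRight y)⟩

lemma d1_translate (y : ℝ × ℝ) : d1 (fun x => φ (x + y)) = fun x => d1 φ (x + y) := funext fun x => by
  simp only [d1, Prod.add_def]
  exact deriv_comp_add_const (f := fun s => φ (s, x.2 + y.2)) y.1 x.1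

lemma d2_translate (y : ℝ × ℝ) : d2 (fun x => φ (x + y)) = fun x => d2 φ (x + y) := funext fun x => by
  simp only [d2, Prod.add_def]
  exact deriv_comp_add_const (f := fun s => φ (x.1 + y.1, s)) y.2 x.2

lemma IsTest.volume_ne_top (h : IsTest φ) : volume (tsupport φ) ≠ ⊤ := h.2.measure_lt_top.ne

lemma IsTest.exists_radius (h : IsTest φ) : ∃ R, 0 < R ∧ ∀ x, R ≤ rad x → φ x = 0 := by
  obtain ⟨R, hR⟩ := h.2.isBounded.subset_ball_lt 0 0
  refine ⟨2 * R, by linarith [hR.1], fun x hx => ?_⟩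
  by_contra hne
  have := hR.2 (subset_tsupport _ hne)
  rw [mem_ball_zero_iff, Prod.norm_def, max_lt_iff] at this
  have h1 : rad x < 2 * R := by
    rw [rad, Real.sqrt_lt' (by linarith [hR.1]), normSq]
    have h2 := sq_lt_sq' (neg_lt_of_abs_lt this.1) (lt_of_abs_lt this.1)
    have h3 := sq_lt_sq' (neg_lt_of_abs_lt this.2) (lt_of_abs_lt this.2)
    nlinarith [hR.1]
  linarith

end Smooth

lemma measurableSet_halfPlane : MeasurableSet halfPlane := measurableSet_lt measurable_const measurable_snd

lemma halfPlane_eq : halfPlane = (univ : Set ℝ) ×ˢ Ioi (0 : ℝ) := by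
  ext x; simp [halfPlane]

lemma restrict_halfPlane : (volume : Measure (ℝ × ℝ)).restrict halfPlane
    = (volume : Measure ℝ).prod (volume.restrict (Ioi (0 : ℝ))) := by
  rw [halfPlane_eq, Measure.volume_eq_prod, ← Measure.prod_restrict, Measure.restrict_univ]

lemma isOpen_halfPlane : IsOpen halfPlane := isOpen_lt continuous_const continuous_snd

section GaussGreen

variable {f f₁ f₂ φ : ℝ × ℝ → ℝ} {p : ℝ × ℝ} {C : ℝ}

lemma integrable_singular_mul_test (hm : Measurable f)
    (hb : ∀ x, x ≠ p → |f x| ≤ C * (1 / rad (x - p))) (hφ : IsTest φ) :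
    Integrable fun x => f x * φ x := by
  obtain ⟨B, hB0, hB⟩ := hφ.exists_bound
  have hn := hφ.volume_ne_top
  have h0 : Integrable fun x => (({p} : Set (ℝ × ℝ))ᶜ.indicator f x) * φ x := by
    refine integrable_of_le_inv_rad (C := B * C) hn p ?_ ?_ ?_
    · exact ((hm.indicator (measurableSet_singleton p).compl).mul
        hφ.continuous.measurable).aestronglyMeasurable
    · intro x _
      by_cases hx : x = p
      · subst hx; simp [rad_zero]
      · rw [indicator_of_mem (by simpa using hx), abs_mul, mul_comm, mul_assoc]
        have := hb x hx
        have := hB x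
        gcongr
    · intro x hx
      rw [image_eq_zero_of_notMem_tsupport hx, mul_zero]
  refine h0.congr ?_
  have : ∀ᵐ x : ℝ × ℝ, x ≠ p := by simp [ae_iff]
  filter_upwards [this] with x hx
  rw [indicator_of_mem (by simpa using hx)]

lemma ae_ne_real (c : ℝ) : ∀ᵐ s : ℝ, s ≠ c := by simp [ae_iff]

lemma integral_singular_mul_d1 {ν : Measure ℝ} [SFinite ν] (hν : ν ≤ volume)
    (hm : Measurable f) (hm1 : Measurable f₁)
    (hb : ∀ x, x ≠ p → |f x| ≤ C * (1 / rad (x - p)))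
    (hb1 : ∀ x, x ≠ p → |f₁ x| ≤ C * (1 / rad (x - p)))
    (hd1 : ∀ x, x ≠ p → HasDerivAt (fun s => f (s, x.2)) (f₁ x) x.1) (hφ : IsTest φ) :
    ∫ x, f x * d1 φ x ∂((volume : Measure ℝ).prod ν)
      = -∫ x, f₁ x * φ x ∂((volume : Measure ℝ).prod ν) := by
  have hle : (volume : Measure ℝ).prod ν ≤ volume := by
    rw [Measure.volume_eq_prod]; exact Measure.prod_mono le_rfl hν
  have i1 := (integrable_singular_mul_test hm hb hφ.d1).mono_measure hle
  have i2 := (integrable_singular_mul_test hm1 hb1 hφ).mono_measure hle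
  have i3 := (integrable_singular_mul_test hm hb hφ).mono_measure hle
  rw [integral_prod_symm _ i1, integral_prod_symm _ i2, ← integral_neg]
  refine integral_congr_ae ?_
  filter_upwards [i1.prod_left_ae, i2.prod_left_ae, i3.prod_left_ae,
    (Measure.absolutelyContinuous_of_le hν).ae_le (ae_ne_real p.2)] with b h1 h2 h3 hb
  exact integral_mul_deriv_eq_deriv_mul_of_integrable
    (u := fun s => f (s, b)) (v := fun s => φ (s, b)) (u' := fun s => f₁ (s, b))
    (v' := fun s => d1 φ (s, b))
    (fun s _ => hd1 (s, b) (fun h => hb (congrArg Prod.snd h)))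
    (fun s _ => smooth_hasDerivAt_d1 hφ.1 s b) h1 h2 h3

lemma integral_singular_mul_d2 (hm : Measurable f) (hm2 : Measurable f₂)
    (hb : ∀ x, x ≠ p → |f x| ≤ C * (1 / rad (x - p)))
    (hb2 : ∀ x, x ≠ p → |f₂ x| ≤ C * (1 / rad (x - p)))
    (hd2 : ∀ x, x ≠ p → HasDerivAt (fun s => f (x.1, s)) (f₂ x) x.2) (hφ : IsTest φ) :
    ∫ x, f x * d2 φ x = -∫ x, f₂ x * φ x := by
  have i1 := integrable_singular_mul_test hm hb hφ.d2
  have i2 := integrable_singular_mul_test hm2 hb2 hφ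
  have i3 := integrable_singular_mul_test hm hb hφ
  rw [Measure.volume_eq_prod] at *
  rw [integral_prod _ i1, integral_prod _ i2, ← integral_neg]
  refine integral_congr_ae ?_
  filter_upwards [i1.prod_right_ae, i2.prod_right_ae, i3.prod_right_ae, ae_ne_real p.1]
    with a h1 h2 h3 ha
  exact integral_mul_deriv_eq_deriv_mul_of_integrable
    (u := fun s => f (a, s)) (v := fun s => φ (a, s)) (u' := fun s => f₂ (a, s))
    (v' := fun s => d2 φ (a, s))
    (fun s _ => hd2 (a, s) (fun h => ha (congrArg Prod.fst h)))
    (fun s _ => smooth_hasDerivAt_d2 hφ.1 a s) h1 h2 h3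

lemma IsTest.boundary (hφ : IsTest φ) (c : ℝ) :
    Continuous (fun s => φ (s, c)) ∧ HasCompactSupport (fun s => φ (s, c)) := by
  refine ⟨hφ.continuous.comp (by fun_prop), ?_⟩
  obtain ⟨R, hR, h⟩ := hφ.exists_radius
  refine HasCompactSupport.intro (isCompact_closedBall (0 : ℝ) R) fun s hs => h _ ?_
  rw [mem_closedBall_zero_iff, not_le] at hs
  exact hs.le.trans (abs_fst_le_rad (s, c))

lemma integral_halfPlane_singular_mul_d2 (hm : Measurable f) (hm2 : Measurable f₂) {M : ℝ}
    (hM : ∀ x, |f x| ≤ M)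
    (hb : ∀ x, x ≠ p → |f x| ≤ C * (1 / rad (x - p)))
    (hb2 : ∀ x, x ≠ p → |f₂ x| ≤ C * (1 / rad (x - p)))
    (hd2 : ∀ x, x ≠ p → HasDerivAt (fun s => f (x.1, s)) (f₂ x) x.2) (hφ : IsTest φ) :
    ∫ x in halfPlane, f x * d2 φ x
      = -(∫ x in halfPlane, f₂ x * φ x) - ∫ a : ℝ, f (a, 0) * φ (a, 0) := by
  have hle : (volume : Measure (ℝ × ℝ)).restrict halfPlane ≤ volume := Measure.restrict_le_self
  have i1 := (integrable_singular_mul_test hm hb hφ.d2).mono_measure hle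
  have i2 := (integrable_singular_mul_test hm2 hb2 hφ).mono_measure hle
  have i3 := (integrable_singular_mul_test hm hb hφ).mono_measure hle
  have i4 : Integrable fun a : ℝ => f (a, 0) * φ (a, 0) := by
    obtain ⟨hc, hs⟩ := hφ.boundary 0
    refine (hc.integrable_of_hasCompactSupport hs).bdd_mul (c := M) ?_ (.of_forall fun a => hM _)
    exact (hm.comp (by fun_prop : Measurable fun a : ℝ => (a, (0 : ℝ)))).aestronglyMeasurable
  rw [restrict_halfPlane] at *
  have i5 : Integrable fun a => -∫ s in Ioi (0 : ℝ), f₂ (a, s) * φ (a, s) := i2.integral_prod_left.neg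
  rw [integral_prod _ i1, integral_prod _ i2, ← integral_neg, ← integral_sub i5 i4]
  refine integral_congr_ae ?_
  filter_upwards [i1.prod_right_ae, i2.prod_right_ae, i3.prod_right_ae, ae_ne_real p.1]
    with a h1 h2 h3 ha
  have hne : ∀ s, ((a, s) : ℝ × ℝ) ≠ p := fun s h => ha (congrArg Prod.fst h)
  obtain ⟨R, hR, h0⟩ := hφ.exists_radius
  have hlim0 : Tendsto ((fun s => f (a, s)) * fun s => φ (a, s)) (nhdsWithin 0 (Ioi 0))
      (nhds (f (a, 0) * φ (a, 0))) :=
    (((hd2 (a, 0) (hne 0)).continuousAt.tendsto).mul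
      ((smooth_hasDerivAt_d2 hφ.1 a 0).continuousAt.tendsto)).mono_left nhdsWithin_le_nhds
  have hlim1 : Tendsto ((fun s => f (a, s)) * fun s => φ (a, s)) atTop (nhds 0) := by
    refine tendsto_const_nhds.congr' ?_
    filter_upwards [eventually_ge_atTop R] with s hs
    rw [Pi.mul_apply, h0 (a, s) ((hs.trans (le_abs_self _)).trans (abs_snd_le_rad (a, s))), mul_zero]
  have := integral_Ioi_mul_deriv_eq_deriv_mul (a := 0)
    (u := fun s => f (a, s)) (v := fun s => φ (a, s)) (u' := fun s => f₂ (a, s))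
    (v' := fun s => d2 φ (a, s))
    (fun s _ => hd2 (a, s) (hne s))
    (fun s _ => smooth_hasDerivAt_d2 hφ.1 a s) h1 h2 hlim0 hlim1
  rw [this]
  ring

end GaussGreen

end

section

variable {α : ℝ}

/-! ### Derivatives and bounds of the kernels -/

/-- The derivative of `velProfile`. -/
def velProfileDeriv (α ρ : ℝ) : ℝ :=
  (1 / (4 * α) * besselInt α 1 ρ * (2 * π * ρ) - (1 - besselInt α 0 ρ) * (2 * π)) / (2 * π * ρ) ^ 2

lemma hasDerivAt_velProfile (hα : 0 < α) {ρ : ℝ} (hρ : 0 < ρ) :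
    HasDerivAt (velProfile α) (velProfileDeriv α ρ) ρ := by
  have h1 : HasDerivAt (fun r => 1 - besselInt α 0 r) (1 / (4 * α) * besselInt α 1 ρ) ρ := by
    convert! (hasDerivAt_besselInt hα 0 hρ).const_sub 1 using 1
    ring
  have h2 : HasDerivAt (fun r : ℝ => 2 * π * r) (2 * π) ρ := by
    simpa using (hasDerivAt_id ρ).const_mul (2 * π)
  exact h1.div h2 (by have := pi_pos; positivity)

lemma measurable_velProfile (α : ℝ) : Measurable (velProfile α) := by
  unfold velProfile
  exact ((measurable_besselInt α 0).const_sub 1).div (measurable_const.mul measurable_id)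

lemma measurable_velProfileDeriv (α : ℝ) : Measurable (velProfileDeriv α) := by
  have h0 := measurable_besselInt α 0
  have h1 := measurable_besselInt α 1
  unfold velProfileDeriv
  fun_prop

lemma velProfile_nonneg (hα : 0 < α) {ρ : ℝ} (hρ : 0 ≤ ρ) : 0 ≤ velProfile α ρ := by
  have := besselInt_zero_le_one hα hρ
  have := pi_pos
  exact div_nonneg (by linarith) (by positivity)

lemma exists_velProfile_bounds (hα : 0 < α) : ∃ C, 0 < C ∧ ∀ r, 0 < r →
    velProfile α (r ^ 2) * r ≤ C ∧ velProfile α (r ^ 2) * r ≤ C / r ∧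
    |velProfileDeriv α (r ^ 2)| * r ^ 3 ≤ C := by
  obtain ⟨C₁, hC₁, h1⟩ := exists_besselInt_one_le hα
  obtain ⟨C₂, hC₂, h2⟩ := exists_one_sub_besselInt_le hα
  have hpi := pi_gt_three
  refine ⟨1 / (4 * α) * C₁ + C₂ + 1, by positivity, fun r hr => ?_⟩
  have a1 := h1 (r ^ 2) (by positivity)
  have a2 := h2 (r ^ 2) (by positivity)
  have a3 := besselInt_zero_le_one hα (ρ := r ^ 2) (by positivity)
  have a4 := besselInt_nonneg α 0 (r ^ 2)
  have a5 := besselInt_nonneg α 1 (r ^ 2)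
  rw [sqrt_sq hr.le] at a1 a2
  have e1 : velProfile α (r ^ 2) * r = (1 - besselInt α 0 (r ^ 2)) / r * (1 / (2 * π)) := by
    unfold velProfile; field_simp
  have hq : 1 / (2 * π) ≤ 1 := by rw [div_le_one (by positivity)]; linarith
  have hp : 0 ≤ 1 / (4 * α) * C₁ := by positivity
  have b1 : (1 - besselInt α 0 (r ^ 2)) / r ≤ C₂ := by rw [div_le_iff₀ hr]; exact a2
  have b2 : (1 - besselInt α 0 (r ^ 2)) / r ≤ 1 / r := by gcongr; linarith
  have b0 : 0 ≤ (1 - besselInt α 0 (r ^ 2)) / r := div_nonneg (by linarith) hr.le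
  refine ⟨?_, ?_, ?_⟩
  · rw [e1]; nlinarith
  · rw [e1]
    calc _ ≤ 1 / r * 1 := by gcongr
      _ ≤ _ := by rw [mul_one]; gcongr; linarith
  · have e2 : velProfileDeriv α (r ^ 2) * r ^ 3
        = 1 / (4 * α) * (besselInt α 1 (r ^ 2) * r) * (1 / (2 * π))
          - (1 - besselInt α 0 (r ^ 2)) / r * (1 / (2 * π)) := by
      unfold velProfileDeriv; field_simp
    have e3 : |velProfileDeriv α (r ^ 2)| * r ^ 3 = |velProfileDeriv α (r ^ 2) * r ^ 3| := by
      rw [abs_mul, abs_of_pos (by positivity : 0 < r ^ 3)]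
    rw [e3, e2]
    rw [le_div_iff₀ hr] at a1
    have c1 : 0 ≤ 1 / (4 * α) * (besselInt α 1 (r ^ 2) * r) := by positivity
    have c2 : 1 / (4 * α) * (besselInt α 1 (r ^ 2) * r) ≤ 1 / (4 * α) * C₁ := by gcongr
    have hq0 : 0 ≤ 1 / (2 * π) := by positivity
    have c3 : 1 / (4 * α) * (besselInt α 1 (r ^ 2) * r) * (1 / (2 * π)) ≤ 1 / (4 * α) * C₁ * 1 := by
      gcongr
    have c4 : (1 - besselInt α 0 (r ^ 2)) / r * (1 / (2 * π)) ≤ C₂ * 1 := by gcongr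
    have c5 := mul_nonneg c1 hq0
    have c6 := mul_nonneg b0 hq0
    rw [abs_le]
    constructor <;> linarith

lemma hasDerivAt_normSq_fst (x : ℝ × ℝ) : HasDerivAt (fun s => normSq (s, x.2)) (2 * x.1) x.1 := by
  have := (hasDerivAt_pow 2 x.1).add_const (x.2 ^ 2)
  simpa [normSq] using this

lemma hasDerivAt_normSq_snd (x : ℝ × ℝ) : HasDerivAt (fun s => normSq (x.1, s)) (2 * x.2) x.2 := by
  have := (hasDerivAt_pow 2 x.2).const_add (x.1 ^ 2)
  simpa [normSq] using this

/-- The partial derivatives of `K_α` away from the origin. -/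
def gradKernel₁₁ (α : ℝ) (x : ℝ × ℝ) : ℝ := -(2 * x.1 * x.2 * velProfileDeriv α (normSq x))
/-- See `gradKernel₁₁`. -/
def gradKernel₁₂ (α : ℝ) (x : ℝ × ℝ) : ℝ :=
  -velProfile α (normSq x) - 2 * x.2 ^ 2 * velProfileDeriv α (normSq x)
/-- See `gradKernel₁₁`. -/
def gradKernel₂₁ (α : ℝ) (x : ℝ × ℝ) : ℝ :=
  velProfile α (normSq x) + 2 * x.1 ^ 2 * velProfileDeriv α (normSq x)
/-- See `gradKernel₁₁`. -/
def gradKernel₂₂ (α : ℝ) (x : ℝ × ℝ) : ℝ := 2 * x.1 * x.2 * velProfileDeriv α (normSq x)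

lemma smoothedBiotSavart_fst (hα : 0 < α) (x : ℝ × ℝ) :
    (smoothedBiotSavart α x).1 = -x.2 * velProfile α (normSq x) := by rw [smoothedBiotSavart_eq hα]

lemma smoothedBiotSavart_snd (hα : 0 < α) (x : ℝ × ℝ) :
    (smoothedBiotSavart α x).2 = x.1 * velProfile α (normSq x) := by rw [smoothedBiotSavart_eq hα]

lemma hasDerivAt_smoothedBiotSavart (hα : 0 < α) {x : ℝ × ℝ} (hx : x ≠ 0) :
    HasDerivAt (fun s => (smoothedBiotSavart α (s, x.2)).1) (gradKernel₁₁ α x) x.1 ∧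
    HasDerivAt (fun s => (smoothedBiotSavart α (x.1, s)).1) (gradKernel₁₂ α x) x.2 ∧
    HasDerivAt (fun s => (smoothedBiotSavart α (s, x.2)).2) (gradKernel₂₁ α x) x.1 ∧
    HasDerivAt (fun s => (smoothedBiotSavart α (x.1, s)).2) (gradKernel₂₂ α x) x.2 := by
  have hv := hasDerivAt_velProfile hα (normSq_pos hx)
  have h1 : HasDerivAt (fun s => velProfile α (normSq (s, x.2)))
      (velProfileDeriv α (normSq x) * (2 * x.1)) x.1 :=
    HasDerivAt.comp (h₂ := velProfile α) x.1 hv (hasDerivAt_normSq_fst x)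
  have h2 : HasDerivAt (fun s => velProfile α (normSq (x.1, s)))
      (velProfileDeriv α (normSq x) * (2 * x.2)) x.2 :=
    HasDerivAt.comp (h₂ := velProfile α) x.2 hv (hasDerivAt_normSq_snd x)
  simp only [smoothedBiotSavart_fst hα, smoothedBiotSavart_snd hα]
  refine ⟨?_, ?_, ?_, ?_⟩
  · convert! h1.const_mul (-x.2) using 1
    unfold gradKernel₁₁; ring
  · convert! ((hasDerivAt_id x.2).neg).mul h2 using 1
    unfold gradKernel₁₂; simp; ring
  · convert! (hasDerivAt_id x.1).mul h1 using 1
    unfold gradKernel₂₁; simp; ring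
  · convert! h2.const_mul x.1 using 1
    unfold gradKernel₂₂; ring

lemma exists_smoothedBiotSavart_bounds (hα : 0 < α) : ∃ C, 0 < C ∧
    (∀ x, |(smoothedBiotSavart α x).1| ≤ C ∧ |(smoothedBiotSavart α x).2| ≤ C) ∧
    ∀ x, x ≠ 0 → |(smoothedBiotSavart α x).1| ≤ C * (1 / rad x) ∧
      |(smoothedBiotSavart α x).2| ≤ C * (1 / rad x) ∧
      |gradKernel₁₁ α x| ≤ C * (1 / rad x) ∧ |gradKernel₁₂ α x| ≤ C * (1 / rad x) ∧
      |gradKernel₂₁ α x| ≤ C * (1 / rad x) ∧ |gradKernel₂₂ α x| ≤ C * (1 / rad x) := by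
  obtain ⟨C, hC, h⟩ := exists_velProfile_bounds hα
  refine ⟨3 * C, by positivity, fun x => ?_, fun x hx => ?_⟩
  · by_cases hx : x = 0
    · subst hx
      simp [smoothedBiotSavart_eq hα, hC.le]
    have hr := rad_pos hx
    obtain ⟨h1, -, -⟩ := h _ hr
    have hv := velProfile_nonneg hα (normSq_nonneg x)
    rw [rad_sq] at h1
    have hx1 := abs_fst_le_rad x
    have hx2 := abs_snd_le_rad x
    rw [smoothedBiotSavart_fst hα, smoothedBiotSavart_snd hα, abs_mul, abs_mul, abs_neg,
      abs_of_nonneg hv]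
    constructor <;> nlinarith
  · have hr := rad_pos hx
    obtain ⟨h1, h2, h3⟩ := h _ hr
    have hv := velProfile_nonneg hα (normSq_nonneg x)
    rw [rad_sq] at h1 h2 h3
    have hx1 := abs_fst_le_rad x
    have hx2 := abs_snd_le_rad x
    have ha1 := abs_nonneg x.1
    have ha2 := abs_nonneg x.2
    set D := |velProfileDeriv α (normSq x)| with hD
    have hD0 : 0 ≤ D := abs_nonneg _
    set V := velProfile α (normSq x) with hV
    have hVr : V ≤ C * (1 / rad x) := by
      rw [mul_one_div, le_div_iff₀ hr]; exact h1
    have hDr : rad x ^ 2 * D ≤ C * (1 / rad x) := by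
      rw [mul_one_div, le_div_iff₀ hr]; linarith
    have hCr : 0 ≤ C * (1 / rad x) := by positivity
    have k12 : |x.1| * |x.2| ≤ rad x ^ 2 := by rw [sq]; gcongr
    have k11 : |x.1| * |x.1| ≤ rad x ^ 2 := by rw [sq]; gcongr
    have k22 : |x.2| * |x.2| ≤ rad x ^ 2 := by rw [sq]; gcongr
    have m12 : |x.1| * |x.2| * D ≤ C * (1 / rad x) := (by gcongr : _ ≤ rad x ^ 2 * D).trans hDr
    have m11 : |x.1| * |x.1| * D ≤ C * (1 / rad x) := (by gcongr : _ ≤ rad x ^ 2 * D).trans hDr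
    have m22 : |x.2| * |x.2| * D ≤ C * (1 / rad x) := (by gcongr : _ ≤ rad x ^ 2 * D).trans hDr
    have n1 : |2 * x.1 * x.2 * velProfileDeriv α (normSq x)| = 2 * (|x.1| * |x.2| * D) := by
      rw [abs_mul, abs_mul, abs_mul, abs_two]; ring
    have n2 : |2 * x.2 ^ 2 * velProfileDeriv α (normSq x)| = 2 * (|x.2| * |x.2| * D) := by
      rw [abs_mul, abs_mul, abs_pow, abs_two]; ring
    have n3 : |2 * x.1 ^ 2 * velProfileDeriv α (normSq x)| = 2 * (|x.1| * |x.1| * D) := by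
      rw [abs_mul, abs_mul, abs_pow, abs_two]; ring
    rw [div_eq_mul_one_div] at h2
    have hVa : |V| = V := abs_of_nonneg hv
    refine ⟨?_, ?_, ?_, ?_, ?_, ?_⟩
    · rw [smoothedBiotSavart_fst hα, abs_mul, abs_neg, hVa]
      nlinarith
    · rw [smoothedBiotSavart_snd hα, abs_mul, hVa]
      nlinarith
    · rw [gradKernel₁₁, abs_neg, n1]; linarith
    · rw [gradKernel₁₂]
      refine (abs_sub _ _).trans ?_
      rw [abs_neg, hVa, n2]; linarith
    · rw [gradKernel₂₁]
      refine (abs_add_le _ _).trans ?_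
      rw [hVa, n3]; linarith
    · rw [gradKernel₂₂, n1]; linarith

lemma measurable_smoothedBiotSavart (hα : 0 < α) :
    Measurable (fun x => (smoothedBiotSavart α x).1) ∧
    Measurable (fun x => (smoothedBiotSavart α x).2) := by
  have h := (measurable_velProfile α).comp measurable_normSq
  simp only [smoothedBiotSavart_fst hα, smoothedBiotSavart_snd hα]
  exact ⟨measurable_snd.neg.mul h, measurable_fst.mul h⟩

lemma measurable_gradKernel (α : ℝ) : Measurable (gradKernel₁₁ α) ∧ Measurable (gradKernel₁₂ α) ∧
    Measurable (gradKernel₂₁ α) ∧ Measurable (gradKernel₂₂ α) := by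
  have h : Measurable fun x => velProfile α (normSq x) :=
    (measurable_velProfile α).comp measurable_normSq
  have h' : Measurable fun x => velProfileDeriv α (normSq x) :=
    (measurable_velProfileDeriv α).comp measurable_normSq
  refine ⟨?_, ?_, ?_, ?_⟩
  · unfold gradKernel₁₁; fun_prop
  · unfold gradKernel₁₂; fun_prop
  · unfold gradKernel₂₁; fun_prop
  · unfold gradKernel₂₂; fun_prop

lemma hasDerivAt_helmholtzGreen (hα : 0 < α) {x : ℝ × ℝ} (hx : x ≠ 0) :
    HasDerivAt (fun s => helmholtzGreen α (s, x.2))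
      (-(x.1 * besselInt α 0 (normSq x) / (2 * π * α * normSq x))) x.1 ∧
    HasDerivAt (fun s => helmholtzGreen α (x.1, s))
      (-(x.2 * besselInt α 0 (normSq x) / (2 * π * α * normSq x))) x.2 := by
  have hρ := normSq_pos hx
  have hpi := pi_pos
  have hv := hasDerivAt_besselInt hα 1 hρ
  have h0 := besselInt_zero_eq hα hρ
  simp only [helmholtzGreen_eq]
  constructor
  · convert! (hv.comp x.1 (hasDerivAt_normSq_fst x)).const_mul (1 / (4 * π * α)) using 1
    rw [h0]; field_simp; ring
  · convert! (hv.comp x.2 (hasDerivAt_normSq_snd x)).const_mul (1 / (4 * π * α)) using 1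
    rw [h0]; field_simp; ring

lemma d2_helmholtzGreen (hα : 0 < α) {x : ℝ × ℝ} (hx : x ≠ 0) : d2 (helmholtzGreen α) x
    = -(x.2 * besselInt α 0 (normSq x) / (2 * π * α * normSq x)) :=
  (hasDerivAt_helmholtzGreen hα hx).2.deriv

/-- `∂₂H_α = -K_α¹` away from the origin. -/
lemma d2_kernelH (hα : 0 < α) {x : ℝ × ℝ} (hx : x ≠ 0) :
    d2 (kernelH α) x = x.2 * velProfile α (normSq x) := by
  have hρ := normSq_pos hx
  have hpi := pi_pos
  have h1 := (hasDerivAt_helmholtzGreen hα hx).2.const_mul α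
  have h2 : HasDerivAt (fun s => laplaceGreen (x.1, s)) (1 / (2 * π) * (x.2 / normSq x)) x.2 := by
    have h3 := (hasDerivAt_normSq_snd x).log hρ.ne'
    have h4 : (fun s => laplaceGreen (x.1, s)) = fun s => 1 / (2 * π) * (log (normSq (x.1, s)) / 2) := by
      funext s
      rw [laplaceGreen, Real.log_sqrt (normSq_nonneg _)]
    rw [h4]
    convert! (h3.div_const 2).const_mul (1 / (2 * π)) using 1
    simp only [Prod.mk.eta]
    ring
  have h := (h1.add h2).deriv
  have e : d2 (kernelH α) x = deriv ((fun s => α * helmholtzGreen α (x.1, s))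
    + fun s => laplaceGreen (x.1, s)) x.2 := rfl
  rw [e, h, velProfile]
  field_simp
  ring

/-! ### Fundamental solutions -/

lemma hasDerivAt_radial_profile (hα : 0 < α) {r : ℝ} (hr : 0 < r) :
    HasDerivAt (fun r => 1 - besselInt α 0 (r ^ 2)) (1 / (2 * α) * (r * besselInt α 1 (r ^ 2))) r := by
  have h2 := (hasDerivAt_besselInt hα 0 (ρ := r ^ 2) (by positivity)).comp r (hasDerivAt_pow 2 r)
  convert! h2.const_sub 1 using 1
  field_simp
  ring

lemma integral_radial_profile_mul_deriv (hα : 0 < α) {g g' : ℝ → ℝ}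
    (hg : ∀ r, HasDerivAt g (g' r) r) (hg' : Continuous g') {R : ℝ} (hR : ∀ r, R ≤ r → g r = 0)
    (hR' : ∀ r, R ≤ r → g' r = 0) :
    ∫ r in Ioi (0 : ℝ), (1 - besselInt α 0 (r ^ 2)) * g' r
      = -∫ r in Ioi (0 : ℝ), 1 / (2 * α) * (r * besselInt α 1 (r ^ 2)) * g r := by
  obtain ⟨C, hC, hb⟩ := exists_besselInt_one_le hα
  have hgc : Continuous g := continuous_iff_continuousAt.2 fun r => (hg r).continuousAt
  have hint : ∀ u : ℝ → ℝ, Continuous u → (∀ r, R ≤ r → u r = 0) → IntegrableOn u (Ioi 0) := by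
    intro u hu h0
    have h1 : IntegrableOn u (Icc 0 R) := hu.continuousOn.integrableOn_Icc
    refine (h1.of_forall_sdiff_eq_zero measurableSet_Ioi fun r hr => h0 r ?_)
    by_contra hlt
    exact hr.2 ⟨(show 0 < r from hr.1).le, (not_le.1 hlt).le⟩
  have hm0 : Measurable fun r : ℝ => 1 - besselInt α 0 (r ^ 2) :=
    ((measurable_besselInt α 0).comp (measurable_id.pow_const 2)).const_sub 1
  have hm1 : Measurable fun r : ℝ => 1 / (2 * α) * (r * besselInt α 1 (r ^ 2)) :=
    (measurable_id.mul ((measurable_besselInt α 1).comp (measurable_id.pow_const 2))).const_mul _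
  have i1 : IntegrableOn ((fun r => 1 - besselInt α 0 (r ^ 2)) * g') (Ioi 0) := by
    refine (hint g' hg' hR').bdd_mul (c := 1) hm0.aestronglyMeasurable (.of_forall fun r => ?_)
    have := besselInt_zero_le_one hα (sq_nonneg r)
    have := besselInt_nonneg α 0 (r ^ 2)
    rw [norm_eq_abs, abs_le]; constructor <;> linarith
  have i2 : IntegrableOn ((fun r => 1 / (2 * α) * (r * besselInt α 1 (r ^ 2))) * g) (Ioi 0) := by
    refine (hint g hgc hR).bdd_mul (c := 1 / (2 * α) * C) hm1.aestronglyMeasurable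
      ((ae_restrict_of_forall_mem measurableSet_Ioi fun r hr => ?_))
    have hr : 0 < r := hr
    have h1 := hb (r ^ 2) (by positivity)
    rw [sqrt_sq hr.le, le_div_iff₀ hr] at h1
    have := besselInt_nonneg α 1 (r ^ 2)
    rw [norm_eq_abs, abs_of_nonneg (by positivity)]
    gcongr
    linarith
  have hlim0 : Tendsto ((fun r => 1 - besselInt α 0 (r ^ 2)) * g) (nhdsWithin 0 (Ioi 0))
      (nhds 0) := by
    have h2 : Tendsto (fun r : ℝ => r ^ 2) (nhdsWithin 0 (Ioi 0)) (nhdsWithin 0 (Ici 0)) := by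
      refine tendsto_nhdsWithin_iff.2 ⟨?_, .of_forall fun r => by simp [sq_nonneg]⟩
      have : Tendsto (fun r : ℝ => r ^ 2) (nhds 0) (nhds (0 ^ 2)) := (continuous_pow 2).tendsto 0
      rw [zero_pow two_ne_zero] at this
      exact this.mono_left nhdsWithin_le_nhds
    have h3 := (((tendsto_besselInt_zero hα).comp h2).const_sub 1).mul
      ((hgc.tendsto 0).mono_left (nhdsWithin_le_nhds (s := Ioi 0)))
    rw [sub_self, zero_mul] at h3
    exact h3
  have hlim1 : Tendsto ((fun r => 1 - besselInt α 0 (r ^ 2)) * g) atTop (nhds 0) := by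
    refine tendsto_const_nhds.congr' ?_
    filter_upwards [eventually_ge_atTop R] with s hs
    rw [Pi.mul_apply, hR s hs, mul_zero]
  have := integral_Ioi_mul_deriv_eq_deriv_mul (a := 0)
    (fun r (hr : r ∈ Ioi (0 : ℝ)) => hasDerivAt_radial_profile hα hr) (fun r _ => hg r) i1 i2 hlim0 hlim1
  rw [this]
  ring

section Fundamental

variable {φ : ℝ × ℝ → ℝ}

lemma radial_test_facts (hφ : IsTest φ) (θ : ℝ) :
    (∀ r, HasDerivAt (fun r => φ (r * cos θ, r * sin θ))
      (cos θ * d1 φ (r * cos θ, r * sin θ) + sin θ * d2 φ (r * cos θ, r * sin θ)) r) ∧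
    Continuous (fun r => cos θ * d1 φ (r * cos θ, r * sin θ) + sin θ * d2 φ (r * cos θ, r * sin θ)) ∧
    ∃ R, 0 < R ∧ (∀ r, R ≤ r → φ (r * cos θ, r * sin θ) = 0) ∧
      ∀ r, R ≤ r → cos θ * d1 φ (r * cos θ, r * sin θ) + sin θ * d2 φ (r * cos θ, r * sin θ) = 0 := by
  refine ⟨fun r => ?_, ?_, ?_⟩
  · have h1 : HasDerivAt (fun r : ℝ => r * cos θ) (cos θ) r := by
      simpa using (hasDerivAt_id r).mul_const (cos θ)
    have h2 : HasDerivAt (fun r : ℝ => r * sin θ) (sin θ) r := by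
      simpa using (hasDerivAt_id r).mul_const (sin θ)
    exact smooth_hasDerivAt_comp hφ.1 h1 h2
  · have h1 := hφ.d1.continuous
    have h2 := hφ.d2.continuous
    exact (continuous_const.mul (h1.comp (by fun_prop))).add (continuous_const.mul (h2.comp (by fun_prop)))
  · obtain ⟨R₀, p0, h0⟩ := hφ.exists_radius
    obtain ⟨R₁, p1, h1⟩ := hφ.d1.exists_radius
    obtain ⟨R₂, p2, h2⟩ := hφ.d2.exists_radius
    have hrad : ∀ r, 0 < r → rad (r * cos θ, r * sin θ) = r := fun r hr => rad_polar (p := (r, θ)) hr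
    refine ⟨R₀ + R₁ + R₂, by positivity, fun r hr => h0 _ ?_, fun r hr => ?_⟩
    · rw [hrad r (by linarith)]; linarith
    · rw [h1 _ (by rw [hrad r (by linarith)]; linarith), h2 _ (by rw [hrad r (by linarith)]; linarith)]
      simp

lemma integrable_helmholtzGreen_mul_test (hα : 0 < α) (hφ : IsTest φ) :
    Integrable fun x => helmholtzGreen α x * φ x := by
  obtain ⟨B, -, hB⟩ := hφ.exists_bound
  exact (integrable_helmholtzGreen hα).mul_bdd (c := B) hφ.continuous.aestronglyMeasurable (.of_forall hB)

lemma integral_helmholtzGreen_mul_polar (hα : 0 < α) (hφ : IsTest φ) :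
    ∫ x, helmholtzGreen α x * φ x = ∫ θ in Ioo (-π) π, 1 / (2 * π) *
      ∫ r in Ioi (0 : ℝ), 1 / (2 * α) * (r * besselInt α 1 (r ^ 2)) * φ (r * cos θ, r * sin θ) := by
  rw [integral_polar' (integrable_helmholtzGreen_mul_test hα hφ)]
  refine integral_ext fun θ => ?_
  rw [← integral_const_mul]
  refine setIntegral_congr_fun measurableSet_Ioi fun r hr => ?_
  have e3 : normSq (r * cos θ, r * sin θ) = r ^ 2 := normSq_polar (r, θ)
  have := pi_pos
  simp only [helmholtzGreen_eq, e3, smul_eq_mul]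
  field_simp
  ring

/-- `∇^⊥ · K_α = G_α` in the sense of distributions. -/
lemma integral_velProfile_mul_radial (hα : 0 < α) (hφ : IsTest φ) :
    ∫ x, velProfile α (normSq x) * (x.1 * d1 φ x + x.2 * d2 φ x)
      = -∫ x, helmholtzGreen α x * φ x := by
  obtain ⟨C, hC, hb, -⟩ := exists_smoothedBiotSavart_bounds hα
  have hpi := pi_pos
  have hm := measurable_smoothedBiotSavart hα
  have hi : Integrable fun x => velProfile α (normSq x) * (x.1 * d1 φ x + x.2 * d2 φ x) := by
    have h1 : Integrable fun x => (smoothedBiotSavart α x).2 * d1 φ x :=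
      hφ.d1.integrable.bdd_mul (c := C) hm.2.aestronglyMeasurable (.of_forall fun x => (hb x).2)
    have h2 : Integrable fun x => (smoothedBiotSavart α x).1 * d2 φ x :=
      hφ.d2.integrable.bdd_mul (c := C) hm.1.aestronglyMeasurable (.of_forall fun x => (hb x).1)
    refine (h1.sub h2).congr (.of_forall fun x => ?_)
    simp only [Pi.sub_apply, smoothedBiotSavart_fst hα, smoothedBiotSavart_snd hα]
    ring
  rw [integral_polar' hi, integral_helmholtzGreen_mul_polar hα hφ, ← integral_neg]
  refine integral_ext fun θ => ?_
  obtain ⟨h1, h2, R, hR, h3, h4⟩ := radial_test_facts hφ θ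
  have key := integral_radial_profile_mul_deriv hα h1 h2 h3 h4
  simp only
  rw [← mul_neg, ← key, ← integral_const_mul]
  refine setIntegral_congr_fun measurableSet_Ioi fun r hr => ?_
  have hr : 0 < r := hr
  have e3 : normSq (r * cos θ, r * sin θ) = r ^ 2 := normSq_polar (r, θ)
  simp only [e3, smul_eq_mul, velProfile]
  field_simp

/-- `G_α` is the fundamental solution of `I - αΔ`. -/
lemma integral_helmholtzGreen_mul_helmholtz (hα : 0 < α) (hφ : IsTest φ) :
    ∫ x, helmholtzGreen α x * (φ x - α * lap φ x) = φ 0 := by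
  have hpi := pi_pos
  obtain ⟨C, hC, hG⟩ := exists_helmholtzGreen_le hα
  set g₁ : ℝ × ℝ → ℝ := fun x => -(x.1 * besselInt α 0 (normSq x) / (2 * π * α * normSq x)) with hg₁
  set g₂ : ℝ × ℝ → ℝ := fun x => -(x.2 * besselInt α 0 (normSq x) / (2 * π * α * normSq x)) with hg₂
  have hmS : Measurable fun x => besselInt α 0 (normSq x) := (measurable_besselInt α 0).comp measurable_normSq
  have hmN := measurable_normSq
  have hm₁ : Measurable g₁ := by fun_prop
  have hm₂ : Measurable g₂ := by fun_prop
  set C' := C + 1 / (2 * π * α) with hC'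
  have hCpos : 0 < 1 / (2 * π * α) := by positivity
  have hbG : ∀ x : ℝ × ℝ, x ≠ 0 → |helmholtzGreen α x| ≤ C' * (1 / rad (x - 0)) := fun x hx => by
    have := rad_pos hx
    rw [abs_of_nonneg (helmholtzGreen_nonneg hα x), sub_zero]
    refine (hG x hx).trans ?_
    rw [div_eq_mul_one_div]
    gcongr
    linarith
  have hbg : ∀ x : ℝ × ℝ, x ≠ 0 → ∀ t : ℝ, |t| ≤ rad x →
      |-(t * besselInt α 0 (normSq x) / (2 * π * α * normSq x))| ≤ C' * (1 / rad (x - 0)) := by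
    intro x hx t ht
    have hr := rad_pos hx
    have h0 := besselInt_nonneg α 0 (normSq x)
    have h1 := besselInt_zero_le_one hα (normSq_nonneg x)
    rw [abs_neg, abs_div, abs_mul, abs_of_nonneg h0, sub_zero, ← rad_sq,
      abs_of_pos (by positivity : 0 < 2 * π * α * rad x ^ 2)]
    calc _ ≤ rad x * 1 / (2 * π * α * rad x ^ 2) := by
          rw [rad_sq]; have := normSq_pos hx; gcongr
      _ = 1 / (2 * π * α) * (1 / rad x) := by field_simp
      _ ≤ _ := by gcongr; linarith
  have hb₁ : ∀ x : ℝ × ℝ, x ≠ 0 → |g₁ x| ≤ C' * (1 / rad (x - 0)) := fun x hx =>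
    hbg x hx _ (abs_fst_le_rad x)
  have hb₂ : ∀ x : ℝ × ℝ, x ≠ 0 → |g₂ x| ≤ C' * (1 / rad (x - 0)) := fun x hx =>
    hbg x hx _ (abs_snd_le_rad x)
  have k1 := integral_singular_mul_d1 (ν := volume) le_rfl (measurable_helmholtzGreen α) hm₁ hbG hb₁
    (fun x hx => (hasDerivAt_helmholtzGreen hα hx).1) hφ.d1
  have k2 := integral_singular_mul_d2 (measurable_helmholtzGreen α) hm₂ hbG hb₂
    (fun x hx => (hasDerivAt_helmholtzGreen hα hx).2) hφ.d2
  rw [← Measure.volume_eq_prod] at k1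
  have iG := integrable_helmholtzGreen_mul_test hα hφ
  have i1 := integrable_helmholtzGreen_mul_test hα hφ.d1.d1
  have i2 := integrable_helmholtzGreen_mul_test hα hφ.d2.d2
  have j1 := integrable_singular_mul_test hm₁ hb₁ hφ.d1
  have j2 := integrable_singular_mul_test hm₂ hb₂ hφ.d2
  have i12 : Integrable fun x => α * (helmholtzGreen α x * d1 (d1 φ) x
      + helmholtzGreen α x * d2 (d2 φ) x) := (i1.add i2).const_mul α
  have e1 : ∫ x, helmholtzGreen α x * (φ x - α * lap φ x) = (∫ x, helmholtzGreen α x * φ x)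
      - α * ((∫ x, helmholtzGreen α x * d1 (d1 φ) x) + ∫ x, helmholtzGreen α x * d2 (d2 φ) x) := by
    rw [← integral_add i1 i2, ← integral_const_mul, ← integral_sub iG i12]
    refine integral_ext fun x => ?_
    simp only [lap]; ring
  have j3 : Integrable fun x => g₁ x * d1 φ x + g₂ x * d2 φ x := j1.add j2
  have e2 : (∫ x, g₁ x * d1 φ x) + ∫ x, g₂ x * d2 φ x
      = ∫ θ in Ioo (-π) π, (1 / (2 * π * α) * φ 0
        - 1 / (2 * π * α) * ∫ r in Ioi (0 : ℝ), 1 / (2 * α) * (r * besselInt α 1 (r ^ 2))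
          * φ (r * cos θ, r * sin θ)) := by
    rw [← integral_add j1 j2, integral_polar' j3]
    refine integral_ext fun θ => ?_
    obtain ⟨h1, h2, R, hR, h3, h4⟩ := radial_test_facts hφ θ
    have key := integral_radial_profile_mul_deriv hα h1 h2 h3 h4
    set g := fun r => φ (r * cos θ, r * sin θ) with hg
    set g' := fun r => cos θ * d1 φ (r * cos θ, r * sin θ) + sin θ * d2 φ (r * cos θ, r * sin θ) with hg'
    have hgi : IntegrableOn g' (Ioi 0) := by
      have h5 : IntegrableOn g' (Icc 0 R) := h2.continuousOn.integrableOn_Icc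
      refine (h5.of_forall_sdiff_eq_zero measurableSet_Ioi fun r hr => h4 r ?_)
      by_contra hlt
      exact hr.2 ⟨(show 0 < r from hr.1).le, (not_le.1 hlt).le⟩
    have hgi2 : IntegrableOn (fun r => (1 - besselInt α 0 (r ^ 2)) * g' r) (Ioi 0) := by
      have hm0 : Measurable fun r : ℝ => 1 - besselInt α 0 (r ^ 2) :=
        ((measurable_besselInt α 0).comp (measurable_id.pow_const 2)).const_sub 1
      refine hgi.bdd_mul (c := 1) hm0.aestronglyMeasurable (.of_forall fun r => ?_)
      have := besselInt_zero_le_one hα (sq_nonneg r)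
      have := besselInt_nonneg α 0 (r ^ 2)
      rw [norm_eq_abs, abs_le]; constructor <;> linarith
    have hFTC : ∫ r in Ioi (0 : ℝ), g' r = -φ 0 := by
      have h5 : Tendsto g atTop (nhds 0) := by
        refine tendsto_const_nhds.congr' ?_
        filter_upwards [eventually_ge_atTop R] with s hs
        exact (h3 s hs).symm
      rw [integral_Ioi_of_hasDerivAt_of_tendsto' (fun r _ => h1 r) hgi h5]
      simp [hg]
      rfl
    have e4 : ∫ r in Ioi (0 : ℝ), besselInt α 0 (r ^ 2) * g' r
        = -φ 0 + ∫ r in Ioi (0 : ℝ), 1 / (2 * α) * (r * besselInt α 1 (r ^ 2)) * g r := by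
      rw [← neg_eq_iff_eq_neg.2 key, ← hFTC, ← sub_eq_add_neg, ← integral_sub hgi hgi2]
      refine integral_ext fun r => ?_
      ring
    have e5 : 1 / (2 * π * α) * φ 0 - 1 / (2 * π * α) * ∫ r in Ioi (0 : ℝ),
        1 / (2 * α) * (r * besselInt α 1 (r ^ 2)) * g r
        = -(1 / (2 * π * α)) * ∫ r in Ioi (0 : ℝ), besselInt α 0 (r ^ 2) * g' r := by rw [e4]; ring
    rw [e5, ← integral_const_mul]
    refine setIntegral_congr_fun measurableSet_Ioi fun r hr => ?_
    have hr : 0 < r := hr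
    have e3 : normSq (r * cos θ, r * sin θ) = r ^ 2 := normSq_polar (r, θ)
    simp only [hg₁, hg₂, e3, smul_eq_mul, hg']
    field_simp
    ring
  have e6 : ∫ θ in Ioo (-π) π, (1 / (2 * π * α) * φ 0
        - 1 / (2 * π * α) * ∫ r in Ioi (0 : ℝ), 1 / (2 * α) * (r * besselInt α 1 (r ^ 2))
          * φ (r * cos θ, r * sin θ)) = 1 / α * φ 0 - 1 / α * ∫ x, helmholtzGreen α x * φ x := by
    have hI : Integrable (fun θ => ∫ r in Ioi (0 : ℝ), 1 / (2 * α) * (r * besselInt α 1 (r ^ 2))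
          * φ (r * cos θ, r * sin θ)) (volume.restrict (Ioo (-π) π)) := by
      have h := integrableOn_polarCoord iG
      rw [IntegrableOn, restrict_polarCoord_target] at h
      refine (h.integral_prod_right.const_mul (2 * π)).congr (.of_forall fun θ => ?_)
      simp only
      rw [← integral_const_mul]
      refine setIntegral_congr_fun measurableSet_Ioi fun r hr => ?_
      have e3 : normSq (r * cos θ, r * sin θ) = r ^ 2 := normSq_polar (r, θ)
      simp only [polarCoord_symm_apply, helmholtzGreen_eq, e3, smul_eq_mul]
      field_simp
      ring
    rw [integral_sub (integrable_const _) (hI.const_mul _), integral_helmholtzGreen_mul_polar hα hφ,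
      setIntegral_const, integral_const_mul, integral_const_mul]
    simp only [Measure.real, Real.volume_Ioo, smul_eq_mul]
    rw [toReal_ofReal (by linarith)]
    field_simp
    ring
  rw [e1, k1, k2, ← neg_add, e2, e6]
  field_simp
  ring

/-- `curl (I - αΔ) K_α = δ` in the sense of distributions. -/
theorem integral_smoothedBiotSavart_mul_helmholtz (hα : 0 < α) (hφ : IsTest φ) (y : ℝ × ℝ) :
    ∫ x, ((smoothedBiotSavart α (x - y)).1 * d2 (fun z => φ z - α * lap φ z) x
      - (smoothedBiotSavart α (x - y)).2 * d1 (fun z => φ z - α * lap φ z) x) = φ y := by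
  have hχ := hφ.helmholtz α
  set χ := fun z => φ z - α * lap φ z with hχdef
  rw [← integral_add_right_eq_self _ y]
  have hφy := hφ.translate y
  have h1 := integral_velProfile_mul_radial hα (hχ.translate y)
  rw [d1_translate, d2_translate] at h1
  have h2 := integral_helmholtzGreen_mul_helmholtz hα hφy
  have e : (fun x => χ (x + y)) = fun x => φ (x + y) - α * lap (fun x => φ (x + y)) x := by
    funext x
    simp only [hχdef, lap, d1_translate, d2_translate]
  have e' : ∀ x, φ (x + y) - α * lap (fun x => φ (x + y)) x = χ (x + y) := fun x =>
    (congrFun e x).symm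
  simp only [e', zero_add] at h2
  rw [← h2, ← neg_eq_iff_eq_neg.2 h1, ← integral_neg]
  refine integral_ext fun x => ?_
  simp only [add_sub_cancel_right, smoothedBiotSavart_fst hα, smoothedBiotSavart_snd hα]
  ring

end Fundamental

end

section

/-! ### Integration against signed measures -/

section Signed

variable {X : Type*} [MeasurableSpace X]

instance isFiniteMeasure_variation (q : SignedMeasure X) : IsFiniteMeasure q.variation := by
  rw [← SignedMeasure.totalVariation_eq_variation]
  unfold SignedMeasure.totalVariation
  infer_instance

/-- A signed measure is a function of modulus at most one times its variation. -/
lemma exists_signedMeasure_density (q : SignedMeasure X) : ∃ σ : X → ℝ, Measurable σ ∧ (∀ x, |σ x| ≤ 1) ∧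
    ∀ f : X → ℝ, Integrable f q.variation →
      q.integral f (lsmul ℝ ℝ) = ∫ x, f x * σ x ∂q.variation := by
  set j := q.toJordanDecomposition with hj
  obtain ⟨S, hS, h1, h2⟩ := j.mutuallySingular
  have hq : q = j.posPart.toSignedMeasure - j.negPart.toSignedMeasure :=
    (q.toSignedMeasure_toJordanDecomposition).symm
  have hv : q.variation = j.posPart + j.negPart := by
    rw [← SignedMeasure.totalVariation_eq_variation]; rfl
  classical
  refine ⟨fun x => if x ∈ S then -1 else 1, Measurable.ite hS measurable_const measurable_const,
    fun x => by by_cases h : x ∈ S <;> simp [h], fun f hf => ?_⟩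
  rw [hv] at hf ⊢
  have hf1 := hf.left_of_add_measure
  have hf2 := hf.right_of_add_measure
  have e : q.integral f (lsmul ℝ ℝ)
      = (∫ x, f x ∂j.posPart) - ∫ x, f x ∂j.negPart := by
    conv_lhs => rw [hq]
    have h3 : j.posPart.toSignedMeasure.Integrable f := by
      rw [VectorMeasure.Integrable, Measure.variation_toSignedMeasure]; exact hf1
    have h4 : j.negPart.toSignedMeasure.Integrable f := by
      rw [VectorMeasure.Integrable, Measure.variation_toSignedMeasure]; exact hf2
    have h5 : j.posPart.toSignedMeasure.integral f (lsmul ℝ ℝ)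
        = ∫ x, f x ∂j.posPart := by
      rw [← VectorMeasure.integral_toSignedMeasure]
      congr 1
      ext; simp
    have h6 : j.negPart.toSignedMeasure.integral f (lsmul ℝ ℝ)
        = ∫ x, f x ∂j.negPart := by
      rw [← VectorMeasure.integral_toSignedMeasure]
      congr 1
      ext; simp
    rw [VectorMeasure.integral_sub_vectorMeasure h3 h4, h5, h6]
  have hp : ∀ᵐ x ∂j.posPart, x ∉ S := by simpa [ae_iff] using h1
  have hn : ∀ᵐ x ∂j.negPart, x ∈ S := h2
  have a1 : (fun x => f x * if x ∈ S then (-1 : ℝ) else 1) =ᵐ[j.posPart] f := by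
    filter_upwards [hp] with x hx; simp [hx]
  have a2 : (fun x => f x * if x ∈ S then (-1 : ℝ) else 1) =ᵐ[j.negPart] fun x => -f x := by
    filter_upwards [hn] with x hx; simp [hx]
  rw [integral_add_measure (hf1.congr a1.symm) (hf2.neg.congr a2.symm), integral_congr_ae a1,
    integral_congr_ae a2, integral_neg, e, sub_eq_add_neg]

lemma SignedMeasure.integrable_of_bounded (q : SignedMeasure X) {f : X → ℝ} (hf : Measurable f)
    {C : ℝ} (hC : ∀ x, |f x| ≤ C) : q.Integrable f :=
  Integrable.of_bound hf.aestronglyMeasurable C (.of_forall hC)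

end Signed

lemma measurable_coe_halfPlane : Measurable fun y : halfPlane => (y : ℝ × ℝ) := measurable_subtype_coe

lemma measurable_reflect_halfPlane : Measurable fun y : halfPlane => ((y.1.1, -y.1.2) : ℝ × ℝ) := by
  fun_prop

lemma oddExtension_integrable (q : SignedMeasure halfPlane) {F : ℝ × ℝ → ℝ} (hF : Measurable F) {C : ℝ}
    (hC : ∀ x, |F x| ≤ C) : (oddExtension q).Integrable F :=
  SignedMeasure.integrable_of_bounded _ hF hC

lemma oddExtension_integral (q : SignedMeasure halfPlane) {F : ℝ × ℝ → ℝ} (hF : Measurable F) {C : ℝ}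
    (hC : ∀ x, |F x| ≤ C) : (oddExtension q).integral F (lsmul ℝ ℝ)
      = q.integral (fun y : halfPlane => F y - F (y.1.1, -y.1.2)) (lsmul ℝ ℝ) := by
  have h1 := measurable_coe_halfPlane
  have h2 := measurable_reflect_halfPlane
  unfold oddExtension
  rw [VectorMeasure.integral_sub_vectorMeasure (SignedMeasure.integrable_of_bounded _ hF hC)
    (SignedMeasure.integrable_of_bounded _ hF hC)]
  have i1 : q.Integrable (F ∘ fun y : halfPlane => (y : ℝ × ℝ)) :=
    SignedMeasure.integrable_of_bounded _ (hF.comp h1) (fun y => hC _)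
  have i2 : q.Integrable (F ∘ fun y : halfPlane => ((y.1.1, -y.1.2) : ℝ × ℝ)) :=
    SignedMeasure.integrable_of_bounded _ (hF.comp h2) (fun y => hC _)
  rw [VectorMeasure.integral_map h1 hF.aestronglyMeasurable i1,
    VectorMeasure.integral_map h2 hF.aestronglyMeasurable i2]
  exact (VectorMeasure.integral_fun_sub i1 i2).symm

/-! ### Weak `L²` -/

section Weak

variable {X : Type*} [MeasurableSpace X] {μ : Measure X} {f g : X → ℝ}

/-- The Lorentz space `L^{2,∞}` of a measure. -/
def WeakL2On (μ : Measure X) (f : X → ℝ) : Prop :=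
  AEStronglyMeasurable f μ ∧ ∃ C : ℝ, ∀ r : ℝ, 0 < r → μ {x | r < |f x|} ≤ ofReal (C / r ^ 2)

lemma weakL2_iff {f : ℝ × ℝ → ℝ} : WeakL2 f ↔ WeakL2On (volume.restrict halfPlane) f := Iff.rfl

lemma WeakL2On.exists_pos (hf : WeakL2On μ f) : ∃ C : ℝ, 0 ≤ C ∧
    ∀ r : ℝ, 0 < r → μ {x | r < |f x|} ≤ ofReal (C / r ^ 2) := by
  obtain ⟨-, C, hC⟩ := hf
  refine ⟨|C|, abs_nonneg _, fun r hr => (hC r hr).trans (ofReal_le_ofReal ?_)⟩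
  gcongr
  exact le_abs_self C

lemma WeakL2On.congr (hf : WeakL2On μ f) (h : f =ᵐ[μ] g) : WeakL2On μ g := by
  refine ⟨hf.1.congr h, hf.2.imp fun C hC r hr => le_trans (le_of_eq (measure_congr ?_)) (hC r hr)⟩
  filter_upwards [h] with x hx
  simp only [eq_iff_iff]
  change (r < |g x|) ↔ (r < |f x|)
  rw [hx]

lemma WeakL2On.add (hf : WeakL2On μ f) (hg : WeakL2On μ g) : WeakL2On μ fun x => f x + g x := by
  obtain ⟨C₁, h1, hC₁⟩ := hf.exists_pos
  obtain ⟨C₂, h2, hC₂⟩ := hg.exists_pos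
  refine ⟨hf.1.add hg.1, 4 * (C₁ + C₂), fun r hr => ?_⟩
  have hr2 : 0 < r / 2 := by positivity
  have hsub : {x | r < |f x + g x|} ⊆ {x | r / 2 < |f x|} ∪ {x | r / 2 < |g x|} := by
    intro x hx
    by_contra hn
    simp only [mem_union, mem_ofPred_eq, not_or, not_lt] at hn hx
    have := abs_add_le (f x) (g x)
    linarith
  refine (measure_mono hsub).trans ((measure_union_le _ _).trans
    ((add_le_add (hC₁ _ hr2) (hC₂ _ hr2)).trans ?_))
  rw [← ofReal_add (by positivity) (by positivity)]
  refine ofReal_le_ofReal (le_of_eq ?_)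
  field_simp
  ring

lemma WeakL2On.zero : WeakL2On μ fun _ => 0 := by
  refine ⟨aestronglyMeasurable_const, 0, fun r hr => ?_⟩
  have : {x : X | r < |(0 : ℝ)|} = ∅ := by ext; simp [hr.le]
  rw [this]
  simp

lemma WeakL2On.const_mul (hf : WeakL2On μ f) (c : ℝ) : WeakL2On μ fun x => c * f x := by
  by_cases hc : c = 0
  · subst hc
    simpa using WeakL2On.zero (μ := μ)
  obtain ⟨C, h0, hC⟩ := hf.exists_pos
  have hc' : 0 < |c| := abs_pos.2 hc
  refine ⟨hf.1.const_mul c, C * c ^ 2, fun r hr => ?_⟩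
  have e : {x | r < |c * f x|} = {x | r / |c| < |f x|} := by
    ext x
    simp only [mem_ofPred_eq, abs_mul, div_lt_iff₀ hc', mul_comm]
  rw [e]
  refine (hC _ (by positivity)).trans (ofReal_le_ofReal (le_of_eq ?_))
  rw [div_pow, sq_abs]
  field_simp

lemma WeakL2On.sub (hf : WeakL2On μ f) (hg : WeakL2On μ g) : WeakL2On μ fun x => f x - g x := by
  refine (hf.add (hg.const_mul (-1))).congr (.of_forall fun x => ?_)
  simp [sub_eq_add_neg]

lemma WeakL2On.of_integrable_sq (hf : AEStronglyMeasurable f μ) (h : Integrable (fun x => f x ^ 2) μ) :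
    WeakL2On μ f := by
  refine ⟨hf, ∫ x, f x ^ 2 ∂μ, fun r hr => ?_⟩
  have h1 := mul_meas_ge_le_integral_of_nonneg (.of_forall fun x => sq_nonneg (f x)) h (r ^ 2)
  have hfin := h.measure_ge_lt_top (ε := r ^ 2) (by positivity)
  have hsub : {x | r < |f x|} ⊆ {x | r ^ 2 ≤ f x ^ 2} := fun x hx => by
    have hx : r < |f x| := hx
    rw [mem_ofPred_eq, ← sq_abs (f x)]
    exact pow_le_pow_left₀ hr.le hx.le 2
  refine (measure_mono hsub).trans ?_
  rw [ENNReal.le_ofReal_iff_toReal_le hfin.ne (by positivity), le_div_iff₀ (by positivity), mul_comm]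
  exact h1

lemma WeakL2On.lintegral_tail_ne_top (hf : WeakL2On μ f) {δ : ℝ} (hδ : 0 < δ) :
    ∫⁻ x, ofReal ({x | δ < |f x|}.indicator (fun x => |f x|) x) ∂μ ≠ ⊤ := by
  obtain ⟨C, h0, hC⟩ := hf.exists_pos
  have hns : NullMeasurableSet {x | δ < |f x|} μ :=
    nullMeasurableSet_lt aemeasurable_const hf.1.norm.aemeasurable
  have hm : AEMeasurable ({x | δ < |f x|}.indicator (fun x => |f x|)) μ :=
    hf.1.norm.aemeasurable.indicator₀ hns
  rw [lintegral_eq_lintegral_meas_lt μ (.of_forall fun x => indicator_nonneg (fun _ _ => abs_nonneg _) x) hm]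
  have hle : ∀ t ∈ Ioi (0 : ℝ), μ {a | t < {x | δ < |f x|}.indicator (fun x => |f x|) a}
      ≤ ofReal (C / max t δ ^ 2) := by
    intro t ht
    refine (measure_mono ?_).trans (hC (max t δ) (lt_max_of_lt_right hδ))
    intro x hx
    have ht : 0 < t := ht
    by_cases hx' : x ∈ {x | δ < |f x|}
    · simp only [mem_ofPred_eq, indicator_of_mem hx'] at hx
      exact max_lt hx hx'
    · simp only [mem_ofPred_eq, indicator_of_notMem hx'] at hx
      exact absurd hx (not_lt.2 ht.le)
  refine ne_top_of_le_ne_top ?_ (setLIntegral_mono' measurableSet_Ioi hle)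
  have hi : IntegrableOn (fun t : ℝ => C / max t δ ^ 2) (Ioi 0) := by
    rw [← Ioc_union_Ioi_eq_Ioi hδ.le, integrableOn_union]
    constructor
    · have : Continuous fun t : ℝ => C / max t δ ^ 2 :=
        continuous_const.div ((continuous_id.max continuous_const).pow 2)
          fun t => (pow_pos (lt_max_of_lt_right hδ) 2).ne'
      exact (this.integrableOn_Icc (a := 0) (b := δ)).mono_set Ioc_subset_Icc_self
    · have := (integrableOn_Ioi_rpow_of_lt (a := -2) (by norm_num) hδ).const_mul C
      refine IntegrableOn.congr_fun this (fun t ht => ?_) measurableSet_Ioi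
      have ht : δ < t := ht
      rw [max_eq_left ht.le, Real.rpow_neg (hδ.trans ht).le, div_eq_mul_inv, Real.rpow_two]
  exact hi.lintegral_lt_top.ne

/-- A weak `L²` function is the sum of an integrable function and a small bounded function. -/
lemma WeakL2On.exists_tail (hf : WeakL2On μ f) {δ : ℝ} (hδ : 0 < δ) : ∃ F : X → ℝ, Integrable F μ ∧
    (∀ x, 0 ≤ F x) ∧ ∀ x, |f x| ≤ F x + δ := by
  have hns : NullMeasurableSet {x | δ < |f x|} μ :=
    nullMeasurableSet_lt aemeasurable_const hf.1.norm.aemeasurable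
  set F := {x | δ < |f x|}.indicator (fun x => |f x|) with hF
  have hm : AEStronglyMeasurable F μ := hf.1.norm.indicator₀ hns
  have hF0 : ∀ x, 0 ≤ F x := fun x => indicator_nonneg (fun _ _ => abs_nonneg _) x
  refine ⟨F, ⟨hm, ?_⟩, hF0, fun x => ?_⟩
  · rw [hasFiniteIntegral_iff_norm]
    have := hf.lintegral_tail_ne_top hδ
    simp only [norm_eq_abs, abs_of_nonneg (hF0 _)]
    exact lt_top_iff_ne_top.2 this
  · by_cases hx : x ∈ {x | δ < |f x|}
    · rw [hF, indicator_of_mem hx]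
      linarith
    · rw [hF, indicator_of_notMem hx, zero_add]
      exact not_lt.1 hx

lemma WeakL2On.integrable_mul (hf : WeakL2On μ f) {w : X → ℝ} {M : ℝ} (hw : Integrable w μ)
    (hM : ∀ x, |w x| ≤ M) : Integrable (fun x => f x * w x) μ := by
  obtain ⟨F, hF, hF0, h⟩ := hf.exists_tail one_pos
  refine ((hF.const_mul M).add hw.abs).mono' (hf.1.mul hw.1) (.of_forall fun x => ?_)
  rw [norm_eq_abs, abs_mul]
  have := mul_le_mul_of_nonneg_right (h x) (abs_nonneg (w x))
  have := mul_le_mul_of_nonneg_left (hM x) (hF0 x)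
  simp only [Pi.add_apply]
  linarith

end Weak

lemma WeakL2On.integrable_mul_test {μ : Measure (ℝ × ℝ)} (hμ : μ ≤ volume) {f φ : ℝ × ℝ → ℝ}
    (hf : WeakL2On μ f) (hφ : IsTest φ) : Integrable (fun x => f x * φ x) μ := by
  obtain ⟨B, -, hB⟩ := hφ.exists_bound
  exact hf.integrable_mul (hφ.integrable.mono_measure hμ) hB

lemma WeakL2.integrable_mul_test {f φ : ℝ × ℝ → ℝ} (hf : WeakL2 f) (hφ : IsTest φ) :
    IntegrableOn (fun x => f x * φ x) halfPlane :=
  WeakL2On.integrable_mul_test Measure.restrict_le_self hf hφ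

/-! ### Superpositions of kernels bounded by `1 / |x|` -/

section Superposition

variable {Y : Type*} [MeasurableSpace Y] {μ : Measure Y} [IsFiniteMeasure μ] {p : Y → ℝ × ℝ}
  {σ : Y → ℝ} {k : ℝ × ℝ → ℝ} {C : ℝ}

lemma measurable_superposition (hp : Measurable p) (hσ : Measurable σ) (hk : Measurable k) :
    Measurable (fun z : (ℝ × ℝ) × Y => k (z.1 - p z.2) * σ z.2) :=
  (hk.comp (measurable_fst.sub (hp.comp measurable_snd))).mul (hσ.comp measurable_snd)

lemma lintegral_superposition_le (hp : Measurable p) (hC : 0 ≤ C) (E : Set (ℝ × ℝ)) {R : ℝ} (hR : 0 < R) :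
    ∫⁻ x in E, ∫⁻ y, ofReal (C * (1 / rad (x - p y))) ∂μ
      ≤ ofReal C * (ofReal (2 * π * R) + ofReal (1 / R) * volume E) * μ univ := by
  have hm : Measurable (uncurry fun (x : ℝ × ℝ) (y : Y) =>
      ofReal (C * (1 / rad (x - p y)))) := by
    have := measurable_rad.comp (measurable_fst.sub (hp.comp measurable_snd) :
      Measurable fun z : (ℝ × ℝ) × Y => z.1 - p z.2)
    exact ((measurable_const.div this).const_mul C).ennreal_ofReal
  rw [lintegral_lintegral_swap hm.aemeasurable]
  refine (lintegral_mono fun y => ?_).trans (by rw [lintegral_const])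
  simp only [ofReal_mul hC]
  rw [lintegral_const_mul' _ _ ofReal_ne_top]
  gcongr
  exact setLIntegral_inv_rad_sub_le E (p y) hR

lemma weakL2On_superposition (hp : Measurable p) (hσ : Measurable σ) (hσ1 : ∀ y, |σ y| ≤ 1)
    (hk : Measurable k) (hC : 0 < C) (hb : ∀ x, |k x| ≤ C * (1 / rad x)) :
    WeakL2On volume (fun x => ∫ y, k (x - p y) * σ y ∂μ) := by
  set f := fun x => ∫ y, k (x - p y) * σ y ∂μ with hf
  have hfm : StronglyMeasurable f :=
    (measurable_superposition hp hσ hk).stronglyMeasurable.integral_prod_right (ν := μ)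
  refine ⟨hfm.aestronglyMeasurable, ?_⟩
  set m := (μ univ).toReal with hm
  have hm0 : 0 ≤ m := ENNReal.toReal_nonneg
  have hμ : μ univ = ofReal m := (ofReal_toReal (measure_ne_top _ _)).symm
  refine ⟨8 * π * (C * (m + 1)) ^ 2, fun r hr => ?_⟩
  have hpi := pi_pos
  have hmeas : MeasurableSet {x | r < |f x|} :=
    measurableSet_lt measurable_const hfm.measurable.abs
  have hpt : ∀ x, ofReal |f x| ≤ ∫⁻ y, ofReal (C * (1 / rad (x - p y))) ∂μ := by
    intro x
    have h1 : ofReal |f x| = ‖f x‖ₑ := by rw [← norm_eq_abs, ofReal_norm]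
    rw [h1]
    refine (enorm_integral_le_lintegral_enorm _).trans (lintegral_mono fun y => ?_)
    rw [← ofReal_norm, norm_eq_abs, abs_mul]
    refine ofReal_le_ofReal ?_
    have := mul_le_mul (hb (x - p y)) (hσ1 y) (abs_nonneg _) ((abs_nonneg _).trans (hb _))
    linarith
  have key : ∀ n : ℕ, volume ({x | r < |f x|} ∩ Metric.closedBall 0 n)
      ≤ ofReal (8 * π * (C * (m + 1)) ^ 2 / r ^ 2) := by
    intro n
    set E := {x | r < |f x|} ∩ Metric.closedBall (0 : ℝ × ℝ) n with hE
    have hEm : MeasurableSet E := hmeas.inter Metric.isClosed_closedBall.measurableSet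
    have hEt : volume E ≠ ⊤ :=
      ((measure_mono inter_subset_right).trans_lt (isCompact_closedBall 0 (n : ℝ)).measure_lt_top).ne
    have hR : 0 < 2 * (C * (m + 1)) / r := by positivity
    have h1 : ofReal r * volume E ≤ ofReal C * (ofReal
        (2 * π * (2 * (C * (m + 1)) / r)) + ofReal (1 / (2 * (C * (m + 1)) / r)) * volume E)
          * ofReal m := by
      rw [← hμ]
      refine le_trans ?_ (lintegral_superposition_le hp hC.le E hR)
      rw [← setLIntegral_const]
      refine setLIntegral_mono' hEm fun x hx => le_trans ?_ (hpt x)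
      exact ofReal_le_ofReal (show r < |f x| from hx.1).le
    have hv : volume E = ofReal (volume E).toReal := (ofReal_toReal hEt).symm
    set v := (volume E).toReal with hvdef
    have hv0 : 0 ≤ v := ENNReal.toReal_nonneg
    rw [hv, ← ofReal_mul hr.le, ← ofReal_mul (by positivity),
      ← ofReal_add (by positivity) (by positivity), ← ofReal_mul hC.le,
      ← ofReal_mul (by positivity), ENNReal.ofReal_le_ofReal_iff (by positivity)] at h1
    rw [hv]
    refine ofReal_le_ofReal ?_
    rw [le_div_iff₀ (by positivity)]
    set D := C * (m + 1) with hD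
    have hD0 : 0 < D := by positivity
    have h2 : C * (2 * π * (2 * D / r) + 1 / (2 * D / r) * v) * m
        ≤ D * (2 * π * (2 * D / r) + 1 / (2 * D / r) * v) := by
      have : C * m ≤ D := by rw [hD]; nlinarith
      have h3 : 0 ≤ 2 * π * (2 * D / r) + 1 / (2 * D / r) * v := by positivity
      nlinarith
    have h4 : D * (2 * π * (2 * D / r) + 1 / (2 * D / r) * v) = 4 * π * D ^ 2 / r + r * v / 2 := by
      field_simp
      ring
    have h5 : r * v / 2 ≤ 4 * π * D ^ 2 / r := by linarith
    rw [le_div_iff₀ hr] at h5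
    nlinarith
  have hU : {x | r < |f x|} = ⋃ n : ℕ, {x | r < |f x|} ∩ Metric.closedBall 0 n := by
    rw [← inter_iUnion, Metric.iUnion_closedBall_nat, inter_univ]
  rw [hU, Monotone.measure_iUnion]
  · exact iSup_le key
  · intro i j hij
    exact inter_subset_inter_right _ (Metric.closedBall_subset_closedBall (by exact_mod_cast hij))

lemma integrable_superposition_mul_test (hp : Measurable p) (hσ : Measurable σ) (hσ1 : ∀ y, |σ y| ≤ 1)
    (hk : Measurable k) (hC : 0 < C) (hb : ∀ x, |k x| ≤ C * (1 / rad x)) {φ : ℝ × ℝ → ℝ} (hφ : IsTest φ) :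
    Integrable (fun z : (ℝ × ℝ) × Y => k (z.1 - p z.2) * σ z.2 * φ z.1) (volume.prod μ) := by
  obtain ⟨B, hB0, hB⟩ := hφ.exists_bound
  have hm : Measurable fun z : (ℝ × ℝ) × Y => k (z.1 - p z.2) * σ z.2 * φ z.1 :=
    (measurable_superposition hp hσ hk).mul (hφ.continuous.measurable.comp measurable_fst)
  refine ⟨hm.aestronglyMeasurable, ?_⟩
  rw [hasFiniteIntegral_iff_enorm, lintegral_prod _ hm.enorm.aemeasurable]
  have hle : ∀ x, ∫⁻ y, ‖k (x - p y) * σ y * φ x‖ₑ ∂μ ≤ (tsupport φ).indicator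
      (fun x => ofReal B * ∫⁻ y, ofReal (C * (1 / rad (x - p y))) ∂μ) x := by
    intro x
    by_cases hx : x ∈ tsupport φ
    · rw [indicator_of_mem hx, ← lintegral_const_mul' _ _ ofReal_ne_top]
      refine lintegral_mono fun y => ?_
      rw [← ofReal_norm, norm_eq_abs, ← ofReal_mul hB0, abs_mul, abs_mul]
      refine ofReal_le_ofReal ?_
      have h1 := hb (x - p y)
      have h2 := hσ1 y
      have h3 := hB x
      have h4 : 0 ≤ C * (1 / rad (x - p y)) := (abs_nonneg _).trans h1
      calc _ ≤ C * (1 / rad (x - p y)) * 1 * B := by gcongr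
        _ = _ := by ring
    · simp [image_eq_zero_of_notMem_tsupport hx]
  refine (lintegral_mono hle).trans_lt ?_
  rw [lintegral_indicator (isClosed_tsupport φ).measurableSet, lintegral_const_mul' _ _ ofReal_ne_top]
  refine ENNReal.mul_lt_top ofReal_lt_top
    ((lintegral_superposition_le hp hC.le _ one_pos).trans_lt ?_)
  refine ENNReal.mul_lt_top (ENNReal.mul_lt_top ofReal_lt_top (ENNReal.add_lt_top.2
    ⟨ofReal_lt_top, ENNReal.mul_lt_top ofReal_lt_top ?_⟩)) (measure_lt_top _ _)
  exact lt_top_iff_ne_top.2 hφ.volume_ne_top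

end Superposition

end

section

/-! ### The interior part -/

section Superposition

variable {Y : Type*} [MeasurableSpace Y] {μ : Measure Y} [IsFiniteMeasure μ] {p : Y → ℝ × ℝ}
  {σ : Y → ℝ} {k k₁ k₂ φ : ℝ × ℝ → ℝ} {C M : ℝ}

/-- The superposition of translates of a kernel. -/
def superpose (μ : Measure Y) (p : Y → ℝ × ℝ) (σ : Y → ℝ) (k : ℝ × ℝ → ℝ) (x : ℝ × ℝ) : ℝ :=
  ∫ y, k (x - p y) * σ y ∂μ

lemma integral_superpose_mul_test {ν : Measure (ℝ × ℝ)} [SFinite ν] (hν : ν ≤ volume)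
    (hp : Measurable p) (hσ : Measurable σ) (hσ1 : ∀ y, |σ y| ≤ 1)
    (hk : Measurable k) (hC : 0 < C) (hb : ∀ x, |k x| ≤ C * (1 / rad x)) (hφ : IsTest φ) :
    ∫ x, superpose μ p σ k x * φ x ∂ν = ∫ y, (∫ x, k (x - p y) * φ x ∂ν) * σ y ∂μ := by
  have hi := (integrable_superposition_mul_test (μ := μ) hp hσ hσ1 hk hC hb hφ).mono_measure
    (Measure.prod_mono hν (le_refl μ))
  calc _ = ∫ x, ∫ y, k (x - p y) * σ y * φ x ∂μ ∂ν := by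
        refine integral_ext fun x => ?_
        simp only [superpose]
        rw [integral_mul_const]
    _ = ∫ y, ∫ x, k (x - p y) * σ y * φ x ∂ν ∂μ := integral_integral_swap hi
    _ = _ := by
        refine integral_ext fun y => ?_
        rw [← integral_mul_const]
        refine integral_ext fun x => ?_
        ring

lemma integrable_integral_mul_test {ν : Measure (ℝ × ℝ)} [SFinite ν] (hν : ν ≤ volume)
    (hp : Measurable p) (hσ : Measurable σ) (hσ1 : ∀ y, |σ y| ≤ 1)
    (hk : Measurable k) (hC : 0 < C) (hb : ∀ x, |k x| ≤ C * (1 / rad x)) (hφ : IsTest φ) :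
    Integrable (fun y => (∫ x, k (x - p y) * φ x ∂ν) * σ y) μ := by
  have hi := (integrable_superposition_mul_test (μ := μ) hp hσ hσ1 hk hC hb hφ).mono_measure
    (Measure.prod_mono hν (le_refl μ))
  refine hi.integral_prod_right.congr (.of_forall fun y => ?_)
  simp only
  rw [← integral_mul_const]
  refine integral_ext fun x => ?_
  ring

/-- The Gauss-Green formula for a superposition of singular kernels. -/
lemma superpose_gaussGreen (hp : Measurable p) (hσ : Measurable σ) (hσ1 : ∀ y, |σ y| ≤ 1)
    (hk : Measurable k) (hk₁ : Measurable k₁) (hk₂ : Measurable k₂) (hC : 0 < C)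
    (hM : ∀ x, |k x| ≤ M) (hb : ∀ x, |k x| ≤ C * (1 / rad x)) (hb₁ : ∀ x, |k₁ x| ≤ C * (1 / rad x))
    (hb₂ : ∀ x, |k₂ x| ≤ C * (1 / rad x))
    (hd₁ : ∀ x, x ≠ 0 → HasDerivAt (fun s => k (s, x.2)) (k₁ x) x.1)
    (hd₂ : ∀ x, x ≠ 0 → HasDerivAt (fun s => k (x.1, s)) (k₂ x) x.2) (hφ : IsTest φ) :
    (∫ x in halfPlane, superpose μ p σ k x * d1 φ x)
        = -(∫ x in halfPlane, superpose μ p σ k₁ x * φ x) ∧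
    (∫ x in halfPlane, superpose μ p σ k x * d2 φ x)
        = -(∫ x in halfPlane, superpose μ p σ k₂ x * φ x)
          - ∫ a : ℝ, superpose μ p σ k (a, 0) * φ (a, 0) := by
  have hle : (volume : Measure (ℝ × ℝ)).restrict halfPlane ≤ volume := Measure.restrict_le_self
  have hs : ∀ {h : ℝ × ℝ → ℝ}, Measurable h → ∀ q : ℝ × ℝ, Measurable fun x => h (x - q) :=
    fun hh q => hh.comp (measurable_id.sub_const q)
  have hd₁' : ∀ q x : ℝ × ℝ, x ≠ q → HasDerivAt (fun s => k ((s, x.2) - q)) (k₁ (x - q)) x.1 := by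
    intro q x hx
    have := hd₁ (x - q) (sub_ne_zero.2 hx)
    exact HasDerivAt.comp_sub_const x.1 q.1 this
  have hd₂' : ∀ q x : ℝ × ℝ, x ≠ q → HasDerivAt (fun s => k ((x.1, s) - q)) (k₂ (x - q)) x.2 := by
    intro q x hx
    have := hd₂ (x - q) (sub_ne_zero.2 hx)
    exact HasDerivAt.comp_sub_const x.2 q.2 this
  constructor
  · rw [integral_superpose_mul_test hle hp hσ hσ1 hk hC hb hφ.d1,
      integral_superpose_mul_test hle hp hσ hσ1 hk₁ hC hb₁ hφ, ← integral_neg]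
    refine integral_ext fun y => ?_
    have := integral_singular_mul_d1 (ν := volume.restrict (Ioi 0)) Measure.restrict_le_self
      (hs hk (p y)) (hs hk₁ (p y)) (fun x _ => hb _) (fun x _ => hb₁ _) (hd₁' (p y)) hφ
    simp only [restrict_halfPlane, this, neg_mul]
  · have hiT : Integrable (fun z : ℝ × Y => k ((z.1, 0) - p z.2) * σ z.2 * φ (z.1, 0))
        ((volume : Measure ℝ).prod μ) := by
      obtain ⟨hc, hcs⟩ := hφ.boundary 0
      have h1 : Integrable (fun z : ℝ × Y => φ (z.1, 0)) ((volume : Measure ℝ).prod μ) :=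
        (hc.integrable_of_hasCompactSupport hcs).comp_fst μ
      refine h1.bdd_mul (c := M) ?_ (.of_forall fun z => ?_)
      · exact ((hk.comp (by fun_prop)).mul (hσ.comp measurable_snd)).aestronglyMeasurable
      · rw [norm_eq_abs, abs_mul]
        have := mul_le_mul (hM ((z.1, 0) - p z.2)) (hσ1 z.2) (abs_nonneg _) ((abs_nonneg _).trans (hM 0))
        linarith
    have hT : ∫ a : ℝ, superpose μ p σ k (a, 0) * φ (a, 0)
        = ∫ y, (∫ a : ℝ, k ((a, 0) - p y) * φ (a, 0)) * σ y ∂μ := by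
      calc _ = ∫ a : ℝ, ∫ y, k ((a, 0) - p y) * σ y * φ (a, 0) ∂μ := by
            refine integral_ext fun x => ?_
            simp only [superpose]
            rw [integral_mul_const]
        _ = ∫ y, (∫ a : ℝ, k ((a, 0) - p y) * σ y * φ (a, 0)) ∂μ := integral_integral_swap hiT
        _ = _ := by
            refine integral_ext fun y => ?_
            rw [← integral_mul_const]
            refine integral_ext fun x => ?_
            ring
    have hTi : Integrable (fun y => (∫ a : ℝ, k ((a, 0) - p y) * φ (a, 0)) * σ y) μ := by
      refine hiT.integral_prod_right.congr (.of_forall fun y => ?_)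
      simp only
      rw [← integral_mul_const]
      refine integral_ext fun x => ?_
      ring
    have hi₂ := integrable_integral_mul_test (μ := μ) hle hp hσ hσ1 hk₂ hC hb₂ hφ
    rw [hT, integral_superpose_mul_test hle hp hσ hσ1 hk hC hb hφ.d2,
      integral_superpose_mul_test hle hp hσ hσ1 hk₂ hC hb₂ hφ, ← integral_neg,
      ← integral_sub hi₂.fun_neg hTi]
    refine integral_ext fun y => ?_
    have := integral_halfPlane_singular_mul_d2
      (hs hk (p y)) (hs hk₂ (p y)) (fun x => hM _) (fun x _ => hb _) (fun x _ => hb₂ _) (hd₂' (p y)) hφ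
    simp only [this]
    ring

end Superposition

section Interior

variable {α : ℝ} (q : SignedMeasure halfPlane)

/-- The reflection of a point of the half-plane. -/
def reflect (y : halfPlane) : ℝ × ℝ := (y.1.1, -y.1.2)

lemma measurable_reflect : Measurable reflect := measurable_reflect_halfPlane

lemma exists_kernel_bounds (hα : 0 < α) : ∃ C, 0 < C ∧
    (∀ x, |(smoothedBiotSavart α x).1| ≤ C ∧ |(smoothedBiotSavart α x).2| ≤ C) ∧
    ∀ x, |(smoothedBiotSavart α x).1| ≤ C * (1 / rad x) ∧
      |(smoothedBiotSavart α x).2| ≤ C * (1 / rad x) ∧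
      |gradKernel₁₁ α x| ≤ C * (1 / rad x) ∧ |gradKernel₁₂ α x| ≤ C * (1 / rad x) ∧
      |gradKernel₂₁ α x| ≤ C * (1 / rad x) ∧ |gradKernel₂₂ α x| ≤ C * (1 / rad x) := by
  obtain ⟨C, h0, h1, h2⟩ := exists_smoothedBiotSavart_bounds hα
  refine ⟨C, h0, h1, fun x => ?_⟩
  by_cases hx : x = 0
  · subst hx
    simp [smoothedBiotSavart_eq hα, gradKernel₁₁, gradKernel₁₂, gradKernel₂₁, gradKernel₂₂,
      velProfile, normSq, rad_zero]
  · exact h2 x hx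

lemma interiorPart_integrable (hα : 0 < α) (x : ℝ × ℝ) :
    (oddExtension q).Integrable (fun y => (smoothedBiotSavart α (x - y)).1) ∧
    (oddExtension q).Integrable (fun y => (smoothedBiotSavart α (x - y)).2) := by
  obtain ⟨C, -, h1, -⟩ := exists_kernel_bounds hα
  obtain ⟨m1, m2⟩ := measurable_smoothedBiotSavart hα
  exact ⟨oddExtension_integrable q (m1.comp (measurable_id.const_sub x)) (fun y => (h1 _).1),
    oddExtension_integrable q (m2.comp (measurable_id.const_sub x)) (fun y => (h1 _).2)⟩

lemma boundaryDatum_kernel (hα : 0 < α) (x₁ : ℝ) (y : halfPlane) :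
    d2 (kernelH α) (x₁ - y.1.1, y.1.2) = y.1.2 * velProfile α (normSq (x₁ - y.1.1, y.1.2)) := by
  refine d2_kernelH hα fun h => ?_
  have : y.1.2 = 0 := congrArg Prod.snd h
  exact (show 0 < y.1.2 from y.2).ne' this

lemma measurable_boundaryDatum_kernel :
    Measurable fun z : ℝ × halfPlane => z.2.1.2 * velProfile α (normSq (z.1 - z.2.1.1, z.2.1.2)) := by
  have h := (measurable_velProfile α).comp measurable_normSq
  have h2 : Measurable fun z : ℝ × halfPlane => ((z.1 - z.2.1.1, z.2.1.2) : ℝ × ℝ) := by fun_prop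
  exact (by fun_prop : Measurable fun z : ℝ × halfPlane => z.2.1.2).mul (h.comp h2)

lemma exists_boundaryDatum_kernel_le (hα : 0 < α) : ∃ C, 0 < C ∧ ∀ (x₁ : ℝ) (y : halfPlane),
    |y.1.2 * velProfile α (normSq (x₁ - y.1.1, y.1.2))| ≤ C := by
  obtain ⟨C, h0, h1, -⟩ := exists_kernel_bounds hα
  refine ⟨C, h0, fun x₁ y => ?_⟩
  have := (h1 (x₁ - y.1.1, y.1.2)).1
  rwa [smoothedBiotSavart_fst hα, neg_mul, abs_neg] at this

lemma boundaryDatum_integrable (hα : 0 < α) (x₁ : ℝ) :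
    q.Integrable (fun y : halfPlane => d2 (kernelH α) (x₁ - y.1.1, y.1.2)) := by
  obtain ⟨C, h0, h1⟩ := exists_boundaryDatum_kernel_le hα
  simp only [boundaryDatum_kernel hα]
  exact SignedMeasure.integrable_of_bounded q
    (measurable_boundaryDatum_kernel.comp (measurable_const.prodMk measurable_id)) (h1 x₁)

/-- The interior part and the boundary datum in terms of a density of `q`. -/
lemma exists_interiorPart_eq (hα : 0 < α) : ∃ σ : halfPlane → ℝ, Measurable σ ∧ (∀ x, |σ x| ≤ 1) ∧
    (∀ f : halfPlane → ℝ, Integrable f q.variation →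
      q.integral f (lsmul ℝ ℝ) = ∫ x, f x * σ x ∂q.variation) ∧
    (∀ x, interiorPart α q x =
      (superpose q.variation (fun y : halfPlane => (y : ℝ × ℝ)) σ (fun x => (smoothedBiotSavart α x).1) x
        - superpose q.variation reflect σ (fun x => (smoothedBiotSavart α x).1) x,
      superpose q.variation (fun y : halfPlane => (y : ℝ × ℝ)) σ (fun x => (smoothedBiotSavart α x).2) x
        - superpose q.variation reflect σ (fun x => (smoothedBiotSavart α x).2) x)) ∧
    ∀ x₁, boundaryDatum α q x₁
      = -2 * ∫ y : halfPlane, y.1.2 * velProfile α (normSq (x₁ - y.1.1, y.1.2)) * σ y ∂q.variation := by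
  obtain ⟨σ, hσ, hσ1, h⟩ := exists_signedMeasure_density q
  obtain ⟨C, h0, h1, -⟩ := exists_kernel_bounds hα
  obtain ⟨m1, m2⟩ := measurable_smoothedBiotSavart hα
  have key : ∀ {k : ℝ × ℝ → ℝ}, Measurable k → (∀ x, |k x| ≤ C) → ∀ x,
      (oddExtension q).integral (fun y => k (x - y)) (lsmul ℝ ℝ)
        = superpose q.variation (fun y : halfPlane => (y : ℝ × ℝ)) σ k x
          - superpose q.variation reflect σ k x := by
    intro k hk hkC x
    have hm : Measurable fun y => k (x - y) := hk.comp (measurable_id.const_sub x)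
    have i1 : Integrable (fun y : halfPlane => k (x - y)) q.variation :=
      SignedMeasure.integrable_of_bounded q (hm.comp measurable_coe_halfPlane) fun y => hkC _
    have i2 : Integrable (fun y : halfPlane => k (x - reflect y)) q.variation :=
      SignedMeasure.integrable_of_bounded q (hm.comp measurable_reflect) fun y => hkC _
    rw [oddExtension_integral q hm (fun y => hkC _)]
    refine (h (fun y : halfPlane => k (x - y) - k (x - reflect y)) (i1.sub' i2)).trans ?_
    have j : ∀ {u : halfPlane → ℝ}, Integrable u q.variation → Integrable (fun y => u y * σ y) q.variation :=
      fun hu => hu.mul_bdd (c := 1) hσ.aestronglyMeasurable (.of_forall hσ1)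
    simp only [superpose]
    rw [← integral_sub (j i1) (j i2)]
    refine integral_ext fun y => ?_
    simp only [reflect]
    ring
  refine ⟨σ, hσ, hσ1, h, fun x => Prod.ext (key m1 (fun x => (h1 x).1) x) (key m2 (fun x => (h1 x).2) x),
    fun x₁ => ?_⟩
  rw [boundaryDatum, h _ (boundaryDatum_integrable q hα x₁)]
  simp only [boundaryDatum_kernel hα]

lemma locallyIntegrable_boundaryDatum (hα : 0 < α) : LocallyIntegrable (boundaryDatum α q) := by
  obtain ⟨σ, hσ, hσ1, -, -, hb⟩ := exists_interiorPart_eq q hα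
  obtain ⟨C, h0, h1⟩ := exists_boundaryDatum_kernel_le hα
  have hm : StronglyMeasurable (boundaryDatum α q) := by
    rw [funext hb]
    exact (measurable_const.mul ((measurable_boundaryDatum_kernel.mul
      (hσ.comp measurable_snd)).stronglyMeasurable.integral_prod_right
        (ν := q.variation)).measurable).stronglyMeasurable
  have hbd : ∀ x, ‖boundaryDatum α q x‖ ≤ 2 * (C * q.variation.real univ) := by
    intro x
    rw [hb, norm_mul]
    have := norm_integral_le_of_norm_le_const (μ := q.variation) (C := C)
      (f := fun y : halfPlane => y.1.2 * velProfile α (normSq (x - y.1.1, y.1.2)) * σ y) (.of_forall fun y => by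
        rw [norm_eq_abs, abs_mul]
        have := mul_le_mul (h1 x y) (hσ1 y) (abs_nonneg _) h0.le
        linarith)
    norm_num
    exact this
  intro x
  refine ⟨Metric.ball x 1, Metric.ball_mem_nhds x one_pos, ?_⟩
  exact Measure.integrableOn_of_bounded (M := 2 * (C * q.variation.real univ)) measure_ball_lt_top.ne
    hm.aestronglyMeasurable (.of_forall hbd)

lemma hasGradAndTrace_congr_trace {f : ℝ × ℝ → ℝ} {g g' : ℝ → ℝ} (h : HasGradAndTrace f g)
    (hg : ∀ x, g x = g' x) : HasGradAndTrace f g' := by rwa [← funext hg]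

/-- The interior part has weak gradient in `L^{2,∞}` and trace `(-g, 0)`; it is divergence free and
satisfies the vorticity equation. -/
theorem interiorPart_properties (hα : 0 < α) :
    HasGradAndTrace (fun x => (interiorPart α q x).1) (fun a => -boundaryDatum α q a) ∧
    HasGradAndTrace (fun x => (interiorPart α q x).2) 0 ∧
    DivFree (interiorPart α q) ∧
    ∀ φ, IsTestInHalfPlane φ →
      ∫ x in halfPlane, ((interiorPart α q x).1 * d2 (fun z => φ z - α * lap φ z) x
          - (interiorPart α q x).2 * d1 (fun z => φ z - α * lap φ z) x)
        = q.integral (fun y : halfPlane => φ y) (lsmul ℝ ℝ) := by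
  obtain ⟨σ, hσ, hσ1, hint, hi, hbd⟩ := exists_interiorPart_eq q hα
  obtain ⟨C, hC, hM, hb⟩ := exists_kernel_bounds hα
  obtain ⟨b1, b2, b11, b12, b21, b22⟩ : _ ∧ _ ∧ _ ∧ _ ∧ _ ∧ _ := by simpa only [forall_and] using hb
  obtain ⟨m1, m2⟩ := measurable_smoothedBiotSavart hα
  obtain ⟨m11, m12, m21, m22⟩ := measurable_gradKernel α
  have hp1 := measurable_coe_halfPlane
  have hp2 := measurable_reflect
  set μ := q.variation with hμ
  set k₁ : ℝ × ℝ → ℝ := fun x => (smoothedBiotSavart α x).1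
  set k₂ : ℝ × ℝ → ℝ := fun x => (smoothedBiotSavart α x).2
  set c : halfPlane → ℝ × ℝ := fun y => (y : ℝ × ℝ) with hc
  have hle : (volume : Measure (ℝ × ℝ)).restrict halfPlane ≤ volume := Measure.restrict_le_self
  have W : ∀ {k : ℝ × ℝ → ℝ}, Measurable k → (∀ x, |k x| ≤ C * (1 / rad x)) →
      WeakL2On volume (superpose μ c σ k) ∧ WeakL2On volume (superpose μ reflect σ k) := fun hk hkb =>
    ⟨weakL2On_superposition hp1 hσ hσ1 hk hC hkb, weakL2On_superposition hp2 hσ hσ1 hk hC hkb⟩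
  let S : (ℝ × ℝ → ℝ) → ℝ × ℝ → ℝ := fun k x => superpose μ c σ k x - superpose μ reflect σ k x
  replace hi : ∀ x, interiorPart α q x = (S k₁ x, S k₂ x) := hi
  have WH : ∀ {k : ℝ × ℝ → ℝ}, Measurable k → (∀ x, |k x| ≤ C * (1 / rad x)) →
      WeakL2 (S k) := fun {k} hk hkb => by
    obtain ⟨w1, w2⟩ := W hk hkb
    obtain ⟨w, B, hB⟩ := w1.sub w2
    exact ⟨w.mono_measure hle, B, fun r hr => (hle _).trans (hB r hr)⟩
  have GG : ∀ {k k₁ k₂ : ℝ × ℝ → ℝ}, Measurable k → Measurable k₁ → Measurable k₂ →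
      (∀ x, |k x| ≤ C) → (∀ x, |k x| ≤ C * (1 / rad x)) → (∀ x, |k₁ x| ≤ C * (1 / rad x)) →
      (∀ x, |k₂ x| ≤ C * (1 / rad x)) →
      (∀ x, x ≠ 0 → HasDerivAt (fun s => k (s, x.2)) (k₁ x) x.1) →
      (∀ x, x ≠ 0 → HasDerivAt (fun s => k (x.1, s)) (k₂ x) x.2) → ∀ {φ : ℝ × ℝ → ℝ}, IsTest φ →
      (∫ x in halfPlane, S k x * d1 φ x)
        = -(∫ x in halfPlane, S k₁ x * φ x) ∧
      (∫ x in halfPlane, S k x * d2 φ x)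
        = -(∫ x in halfPlane, S k₂ x * φ x)
          - ∫ a : ℝ, S k (a, 0) * φ (a, 0) := by
    intro k k₁ k₂ hk hk₁ hk₂ hkM hkb hkb₁ hkb₂ hd₁ hd₂ φ hφ
    obtain ⟨a1, a2⟩ := superpose_gaussGreen (μ := μ) hp1 hσ hσ1 hk hk₁ hk₂ hC hkM hkb hkb₁ hkb₂ hd₁ hd₂ hφ
    obtain ⟨b1, b2⟩ := superpose_gaussGreen (μ := μ) hp2 hσ hσ1 hk hk₁ hk₂ hC hkM hkb hkb₁ hkb₂ hd₁ hd₂ hφ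
    have I : ∀ {h : ℝ × ℝ → ℝ}, Measurable h → (∀ x, |h x| ≤ C * (1 / rad x)) → ∀ {ψ : ℝ × ℝ → ℝ},
        IsTest ψ → Integrable (fun x => superpose μ c σ h x * ψ x) (volume.restrict halfPlane) ∧
          Integrable (fun x => superpose μ reflect σ h x * ψ x) (volume.restrict halfPlane) := by
      intro h hh hhb ψ hψ
      obtain ⟨w1, w2⟩ := W hh hhb
      exact ⟨(w1.integrable_mul_test le_rfl hψ).mono_measure hle,
        (w2.integrable_mul_test le_rfl hψ).mono_measure hle⟩
    have T : ∀ {p : halfPlane → ℝ × ℝ}, Measurable p →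
        Integrable fun a : ℝ => superpose μ p σ k (a, 0) * φ (a, 0) := by
      intro p hp
      obtain ⟨hcc, hcs⟩ := hφ.boundary 0
      refine (hcc.integrable_of_hasCompactSupport hcs).bdd_mul (c := C * μ.real univ) ?_
        (.of_forall fun a => ?_)
      · have h1 : StronglyMeasurable (superpose μ p σ k) :=
          (measurable_superposition hp hσ hk).stronglyMeasurable.integral_prod_right (ν := μ)
        exact (h1.measurable.comp
          (by fun_prop : Measurable fun a : ℝ => (a, (0 : ℝ)))).aestronglyMeasurable
      · refine norm_integral_le_of_norm_le_const (.of_forall fun y => ?_)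
        rw [norm_eq_abs, abs_mul]
        have := mul_le_mul (hkM ((a, 0) - p y)) (hσ1 y) (abs_nonneg _) hC.le
        linarith
    simp only [S, sub_mul]
    rw [integral_sub (I hk hkb hφ.d1).1 (I hk hkb hφ.d1).2, integral_sub (I hk hkb hφ.d2).1 (I hk hkb hφ.d2).2,
      integral_sub (I hk₁ hkb₁ hφ).1 (I hk₁ hkb₁ hφ).2, integral_sub (I hk₂ hkb₂ hφ).1 (I hk₂ hkb₂ hφ).2,
      integral_sub (T hp1) (T hp2), a1, a2, b1, b2]
    constructor <;> ring
  have hD := fun x hx => hasDerivAt_smoothedBiotSavart hα (x := x) hx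
  have G1 := @GG _ _ _ m1 m11 m12 (fun x => (hM x).1) b1 b11 b12 (fun x hx => (hD x hx).1) (fun x hx => (hD x hx).2.1)
  have G2 := @GG _ _ _ m2 m21 m22 (fun x => (hM x).2) b2 b21 b22 (fun x hx => (hD x hx).2.2.1) (fun x hx => (hD x hx).2.2.2)
  have t1 : ∀ a : ℝ, S k₁ (a, 0) = -boundaryDatum α q a := by
    intro a
    rw [hbd]
    have e1 : ∀ y : halfPlane, (smoothedBiotSavart α ((a, 0) - c y)).1
        = y.1.2 * velProfile α (normSq (a - y.1.1, y.1.2)) := fun y => by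
      rw [smoothedBiotSavart_fst hα]; simp [hc, normSq]
    have e2 : ∀ y : halfPlane, (smoothedBiotSavart α ((a, 0) - reflect y)).1
        = -(y.1.2 * velProfile α (normSq (a - y.1.1, y.1.2))) := fun y => by
      rw [smoothedBiotSavart_fst hα]; simp [reflect, normSq]
    simp only [S, k₁, superpose, e1, e2, neg_mul]
    rw [integral_neg]
    ring
  have t2 : ∀ a : ℝ, S k₂ (a, 0) = 0 := by
    intro a
    have e1 : ∀ y : halfPlane, (smoothedBiotSavart α ((a, 0) - c y)).2
        = (smoothedBiotSavart α ((a, 0) - reflect y)).2 := fun y => by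
      rw [smoothedBiotSavart_snd hα, smoothedBiotSavart_snd hα]; simp [hc, reflect, normSq]
    simp only [S, k₂, superpose, e1, sub_self]
  have w1 := WH m1 b1
  have w2 := WH m2 b2
  refine ⟨⟨?_, (locallyIntegrable_boundaryDatum q hα).neg, _, _, WH m11 b11,
      WH m12 b12, fun φ hφ => ?_⟩,
    ⟨?_, locallyIntegrable_zero, _, _, WH m21 b21,
      WH m22 b22, fun φ hφ => ?_⟩, fun φ hφ => ?_, fun φ hφ => ?_⟩
  · simpa only [hi] using w1
  · have := G1 hφ
    simp only [t1] at this
    simpa only [hi] using this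
  · simpa only [hi] using w2
  · have := G2 hφ
    simp only [t2] at this
    simp only [hi]
    exact this
  · simp only [hi]
    rw [integral_add (w1.integrable_mul_test hφ.1.d1) (w2.integrable_mul_test hφ.1.d2),
      (G1 hφ.1).1, (G2 hφ.1).2]
    simp only [t2, zero_mul, integral_zero, sub_zero]
    rw [← neg_add, ← integral_add ((WH m11 b11).integrable_mul_test hφ.1)
      ((WH m22 b22).integrable_mul_test hφ.1), neg_eq_zero]
    refine integral_eq_zero_of_ae (.of_forall fun x => ?_)
    have e : ∀ p : halfPlane → ℝ × ℝ, superpose μ p σ (gradKernel₂₂ α) x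
        = -superpose μ p σ (gradKernel₁₁ α) x := fun p => by
      simp only [superpose]
      rw [← integral_neg]
      refine integral_ext fun y => ?_
      simp only [gradKernel₁₁, gradKernel₂₂]
      ring
    simp only [S, e, Pi.zero_apply]
    ring
  · have hχ := hφ.1.helmholtz α
    set χ := fun z => φ z - α * lap φ z with hχd
    have hs : tsupport χ ⊆ tsupport φ := closure_minimal (fun z hz' => by_contra fun hz => hz' (by
      have a0 : φ z = 0 := image_eq_zero_of_notMem_tsupport hz
      have a1 : d1 (d1 φ) z = 0 := image_eq_zero_of_notMem_tsupport fun h =>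
        hz (tsupport_d1_subset hφ.1.1 (tsupport_d1_subset hφ.1.d1.1 h))
      have a2 : d2 (d2 φ) z = 0 := image_eq_zero_of_notMem_tsupport fun h =>
        hz (tsupport_d2_subset hφ.1.1 (tsupport_d2_subset hφ.1.d2.1 h))
      simp [hχd, lap, a0, a1, a2])) (isClosed_tsupport φ)
    have hz1 : ∀ x, x ∉ halfPlane → d1 χ x = 0 := fun x hx =>
      image_eq_zero_of_notMem_tsupport fun h => hx (hφ.2 (hs (tsupport_d1_subset hχ.1 h)))
    have hz2 : ∀ x, x ∉ halfPlane → d2 χ x = 0 := fun x hx =>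
      image_eq_zero_of_notMem_tsupport fun h => hx (hφ.2 (hs (tsupport_d2_subset hχ.1 h)))
    rw [setIntegral_eq_integral_of_forall_compl_eq_zero (fun x hx => by rw [hz1 x hx, hz2 x hx]; ring)]
    simp only [hi]
    have K : ∀ {p : halfPlane → ℝ × ℝ}, Measurable p →
        Integrable (fun x => superpose μ p σ k₁ x * d2 χ x
          - superpose μ p σ k₂ x * d1 χ x) ∧
        ∫ x, (superpose μ p σ k₁ x * d2 χ x
          - superpose μ p σ k₂ x * d1 χ x)
          = ∫ y, φ (p y) * σ y ∂μ := by
      intro p hp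
      have j1 := (weakL2On_superposition (μ := μ) hp hσ hσ1 m1 hC b1).integrable_mul_test
        le_rfl hχ.d2
      have j2 := (weakL2On_superposition (μ := μ) hp hσ hσ1 m2 hC b2).integrable_mul_test
        le_rfl hχ.d1
      refine ⟨j1.sub' j2, ?_⟩
      refine (integral_sub j1 j2).trans ?_
      have e1 := integral_superpose_mul_test (μ := μ) (ν := volume) le_rfl hp hσ hσ1 m1 hC b1 hχ.d2
      have e2 := integral_superpose_mul_test (μ := μ) (ν := volume) le_rfl hp hσ hσ1 m2 hC b2 hχ.d1
      have f1 := integrable_integral_mul_test (μ := μ) (ν := volume) le_rfl hp hσ hσ1 m1 hC b1 hχ.d2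
      have f2 := integrable_integral_mul_test (μ := μ) (ν := volume) le_rfl hp hσ hσ1 m2 hC b2 hχ.d1
      refine (congrArg₂ (· - ·) e1 e2).trans ?_
      refine (integral_sub f1 f2).symm.trans ?_
      refine integral_ext fun y => ?_
      rw [← integral_smoothedBiotSavart_mul_helmholtz hα hφ.1 (p y), ← sub_mul, ← integral_sub]
      · have s := integrable_singular_mul_test (p := p y) (m1.comp (measurable_id.sub_const (p y)))
          (fun x _ => b1 _) hχ.d2
        exact s
      · have s := integrable_singular_mul_test (p := p y) (m2.comp (measurable_id.sub_const (p y)))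
          (fun x _ => b2 _) hχ.d1
        exact s
    have hsplit : ∀ x, S k₁ x * d2 χ x - S k₂ x * d1 χ x = (superpose μ c σ k₁ x * d2 χ x - superpose μ c σ k₂ x * d1 χ x)
        - (superpose μ reflect σ k₁ x * d2 χ x - superpose μ reflect σ k₂ x * d1 χ x) := fun x => by
      simp only [S]; ring
    simp only [hsplit]
    rw [integral_sub (K hp1).1 (K hp2).1, (K hp1).2, (K hp2).2]
    have hz : ∀ y : halfPlane, φ (reflect y) = 0 := fun y =>
      image_eq_zero_of_notMem_tsupport fun h => by
        have h1 : 0 < (reflect y).2 := hφ.2 h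
        have h2 : 0 < y.1.2 := y.2
        simp only [reflect] at h1
        linarith
    obtain ⟨B, -, hB⟩ := hφ.1.exists_bound
    have hq := hint (fun y : halfPlane => φ y) (SignedMeasure.integrable_of_bounded q
      (hφ.1.continuous.measurable.comp measurable_coe_halfPlane) fun y => hB _)
    refine Eq.trans ?_ hq.symm
    simp only [hz, zero_mul, integral_zero, sub_zero, hc, hμ]

end Interior

end

section

/-! ### Fourier synthesis on the line -/

/-- The superposition of the plane waves `e^{2πiξt}` with amplitudes `m(ξ)`. -/
def synth (m : ℝ → ℂ) (t : ℝ) : ℂ := ∫ ξ : ℝ, m ξ * cexp (2 * π * ξ * t * I)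

lemma norm_wave (ξ t : ℝ) : ‖cexp (2 * π * ξ * t * I)‖ = 1 := by
  have : (2 * π * ξ * t * I : ℂ) = ((2 * π * ξ * t : ℝ) : ℂ) * I := by push_cast; ring
  rw [this, Complex.norm_exp_ofReal_mul_I]

lemma synth_eq_fourierInv (m : ℝ → ℂ) : synth m = 𝓕⁻ m := by
  funext t
  rw [synth, Real.fourierInv_eq']
  refine integral_ext fun ξ => ?_
  simp only [smul_eq_mul]
  rw [mul_comm]
  congr 2
  simp
  ring

lemma fourier_eq_integral (g : ℝ → ℂ) (ξ : ℝ) :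
    𝓕 g ξ = ∫ y : ℝ, cexp (-(2 * π * ξ * y * I)) * g y := by
  rw [Real.fourier_real_eq_integral_exp_smul]
  refine integral_ext fun y => ?_
  simp only [smul_eq_mul]
  congr 2
  push_cast
  ring

lemma integrable_mul_wave {m : ℝ → ℂ} (hm : Integrable m) (t : ℝ) :
    Integrable fun ξ : ℝ => m ξ * cexp (2 * π * ξ * t * I) := by
  refine hm.mul_bdd (c := 1) (by fun_prop) (.of_forall fun ξ => (norm_wave ξ t).le)

lemma continuous_synth {m : ℝ → ℂ} (hm : Integrable m) : Continuous (synth m) := by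
  refine continuous_of_dominated (bound := fun ξ => ‖m ξ‖) (fun t => (integrable_mul_wave hm t).1)
    (fun t => .of_forall fun ξ => ?_) hm.norm (.of_forall fun ξ => by fun_prop)
  rw [norm_mul, norm_wave, mul_one]

lemma norm_synth_le (m : ℝ → ℂ) (t : ℝ) : ‖synth m t‖ ≤ ∫ ξ, ‖m ξ‖ := by
  refine (norm_integral_le_integral_norm _).trans (le_of_eq ?_)
  simp only [norm_mul, norm_wave, mul_one]

/-- Convolution with a Fourier synthesis is a Fourier multiplier. -/
lemma integral_mul_synth_sub {g : ℝ → ℂ} {m : ℝ → ℂ} (hg : Integrable g) (hm : Integrable m) (x : ℝ) :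
    ∫ y, g y * synth m (x - y) = synth (fun ξ => 𝓕 g ξ * m ξ) x := by
  have hi : Integrable (uncurry fun (y ξ : ℝ) => g y * (m ξ *
      cexp (2 * π * ξ * ((x - y : ℝ) : ℂ) * I))) (volume.prod volume) := by
    have h := hg.mul_prod hm
    have hb := h.mul_bdd (c := 1) (g := fun z : ℝ × ℝ =>
      cexp (2 * π * z.2 * ((x - z.1 : ℝ) : ℂ) * I))
      (by fun_prop) (.of_forall fun z => (norm_wave _ _).le)
    refine hb.congr (.of_forall fun z => ?_)
    simp only [uncurry]
    ring
  calc ∫ y, g y * synth m (x - y) = ∫ y, ∫ ξ, g y * (m ξ *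
      cexp (2 * π * ξ * ((x - y : ℝ) : ℂ) * I)) := by
        simp only [synth, ← integral_const_mul]
    _ = ∫ ξ, ∫ y, g y * (m ξ * cexp (2 * π * ξ * ((x - y : ℝ) : ℂ) * I)) :=
        integral_integral_swap hi
    _ = _ := by
        rw [synth]
        refine integral_ext fun ξ => ?_
        simp only [fourier_eq_integral]
        refine Eq.trans ?_ (mul_assoc _ _ _).symm
        refine Eq.trans ?_ (integral_mul_const _ _)
        refine integral_ext fun y => ?_
        have : cexp (2 * π * ξ * ((x - y : ℝ) : ℂ) * I)
            = cexp (-(2 * π * ξ * y * I)) * cexp (2 * π * ξ * x * I) := by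
          rw [← Complex.exp_add]; congr 1; push_cast; ring
        rw [this]; ring

lemma fourier_synth {m : ℝ → ℂ} (hm : Integrable m) (hc : Continuous m) (hs : Integrable (synth m)) :
    𝓕 (synth m) = m := by
  rw [synth_eq_fourierInv] at hs ⊢
  have h2 : Integrable (𝓕 m) := by
    have : 𝓕 m = fun t => 𝓕⁻ m (-t) := by
      funext t
      rw [fourierInv_eq_fourier_neg, neg_neg]
    rw [this]
    exact hs.comp_neg
  exact hc.fourier_fourierInv_eq hm h2

lemma norm_fourier_le {g : ℝ → ℂ} (ξ : ℝ) : ‖𝓕 g ξ‖ ≤ ∫ y, ‖g y‖ := by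
  rw [fourier_eq_integral]
  refine (norm_integral_le_integral_norm _).trans (le_of_eq ?_)
  refine integral_ext fun y => ?_
  have := norm_wave (-ξ) y
  simp only [norm_mul]
  rw [show (-(2 * π * ξ * y * I) : ℂ) = 2 * π * ((-ξ : ℝ) : ℂ) * y * I by push_cast; ring,
    this, one_mul]

lemma continuous_fourier {g : ℝ → ℂ} (hg : Integrable g) : Continuous (𝓕 g) :=
  VectorFourier.fourierIntegral_continuous Real.continuous_fourierChar
    (L := innerₗ ℝ) (by exact continuous_inner) hg

/-! ### Exponential weights -/

lemma integrable_exp_neg_mul_abs {c : ℝ} (hc : 0 < c) : Integrable fun ξ : ℝ => exp (-(c * |ξ|)) := by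
  rw [← integrableOn_univ, ← Iic_union_Ioi (a := (0 : ℝ)), integrableOn_union]
  constructor
  · refine (integrableOn_exp_mul_Iic hc 0).congr_fun (fun x hx => ?_) measurableSet_Iic
    simp only
    rw [abs_of_nonpos hx]; congr 1; ring
  · refine (integrableOn_exp_mul_Ioi (neg_neg_of_pos hc) 0).congr_fun (fun x hx => ?_) measurableSet_Ioi
    simp only
    rw [abs_of_pos hx]; congr 1; ring

lemma exists_pow_mul_exp_le (n : ℕ) {c : ℝ} (hc : 0 < c) : ∃ K, 0 < K ∧ ∀ x : ℝ, 0 ≤ x →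
    (1 + x) ^ n * exp (-(c * x)) ≤ K * exp (-(c / 2 * x)) := by
  refine ⟨n.factorial * (2 / c) ^ n * exp (c / 2), by positivity, fun x hx => ?_⟩
  have h := pow_div_factorial_le_exp (c / 2 * (1 + x)) (by positivity) n
  rw [div_le_iff₀ (by positivity), mul_pow] at h
  have h2 : (1 + x) ^ n ≤ n.factorial * (2 / c) ^ n * exp (c / 2 * (1 + x)) := by
    have e : (1 + x) ^ n = (2 / c) ^ n * ((c / 2) ^ n * (1 + x) ^ n) := by
      rw [← mul_assoc, ← mul_pow]
      field_simp
      simp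
    rw [e]
    calc _ ≤ (2 / c) ^ n * (exp (c / 2 * (1 + x)) * n.factorial) := by gcongr
      _ = _ := by ring
  calc _ ≤ n.factorial * (2 / c) ^ n * exp (c / 2 * (1 + x)) * exp (-(c * x)) := by gcongr
    _ = _ := by
      rw [mul_assoc, ← exp_add, mul_assoc _ (exp (c / 2)), ← exp_add]
      congr 2; ring

lemma integrable_pow_mul_exp_neg_mul_abs (n : ℕ) {c : ℝ} (hc : 0 < c) :
    Integrable fun ξ : ℝ => (1 + |ξ|) ^ n * exp (-(c * |ξ|)) := by
  obtain ⟨K, hK, h⟩ := exists_pow_mul_exp_le n hc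
  refine ((integrable_exp_neg_mul_abs (half_pos hc)).const_mul K).mono'
    (by fun_prop) (.of_forall fun ξ => ?_)
  rw [norm_of_nonneg (by positivity)]
  exact h _ (abs_nonneg _)

lemma integral_eq_integral_Ioi_add {F : ℝ → ℂ} (hF : Integrable F) :
    ∫ ξ, F ξ = ∫ ξ in Ioi (0 : ℝ), (F ξ + F (-ξ)) := by
  rw [integral_add hF.integrableOn hF.comp_neg.integrableOn, integral_comp_neg_Ioi, neg_zero,
    ← intervalIntegral.integral_Iic_add_Ioi hF.integrableOn hF.integrableOn, add_comm]

lemma integral_mul_exp_Ioi {c : ℂ} (hc : 0 < c.re) :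
    IntegrableOn (fun ξ : ℝ => (ξ : ℂ) * cexp (-c * ξ)) (Ioi 0) ∧
    ∫ ξ in Ioi (0 : ℝ), (ξ : ℂ) * cexp (-c * ξ) = 1 / c ^ 2 := by
  have hc0 : c ≠ 0 := fun h => by simp [h] at hc
  have hn : ∀ ξ : ℝ, ‖cexp (-c * ξ)‖ = exp (-(c.re * ξ)) := fun ξ => by
    rw [norm_exp]; simp
  have hint : IntegrableOn (fun ξ : ℝ => (ξ : ℂ) * cexp (-c * ξ)) (Ioi 0) := by
    refine Integrable.mono' (g := fun ξ => (1 + |ξ|) ^ 1 * exp (-(c.re * |ξ|)))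
      (integrable_pow_mul_exp_neg_mul_abs 1 hc).integrableOn
      (by fun_prop) ((ae_restrict_iff' measurableSet_Ioi).2
        (.of_forall fun ξ hξ => ?_))
    have hξ : 0 < ξ := hξ
    rw [norm_mul, hn, norm_real, norm_eq_abs, pow_one, abs_of_pos hξ]
    gcongr
    linarith
  refine ⟨hint, ?_⟩
  have hd : ∀ ξ ∈ Ici (0 : ℝ), HasDerivAt (fun ξ : ℝ => -((ξ : ℂ) / c + 1 / c ^ 2) * cexp (-c * ξ))
      ((ξ : ℂ) * cexp (-c * ξ)) ξ := by
    intro ξ _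
    have h1 : HasDerivAt (fun ξ : ℝ => (ξ : ℂ)) 1 ξ := ofRealCLM.hasDerivAt
    have h2 : HasDerivAt (fun ξ : ℝ => cexp (-c * ξ)) (cexp (-c * ξ) * (-c * 1)) ξ :=
      (h1.const_mul (-c)).cexp
    have h3 : HasDerivAt (fun ξ : ℝ => -((ξ : ℂ) / c + 1 / c ^ 2)) (-(1 / c)) ξ :=
      ((h1.div_const c).add_const _).fun_neg
    convert! h3.mul h2 using 1
    field_simp
    ring
  have ht : Tendsto (fun ξ : ℝ => -((ξ : ℂ) / c + 1 / c ^ 2) * cexp (-c * ξ))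
      atTop (nhds 0) := by
    obtain ⟨K, hK, hb⟩ := exists_pow_mul_exp_le 1 hc
    have hlim : Tendsto (fun ξ : ℝ => (1 / ‖c‖ + 1 / ‖c‖ ^ 2) * (K * exp (-(c.re / 2 * ξ))))
        atTop (nhds 0) := by
      have h1 : Tendsto (fun ξ : ℝ => exp (-(c.re / 2 * ξ))) atTop (nhds 0) :=
        Real.tendsto_exp_neg_atTop_nhds_zero.comp (tendsto_id.const_mul_atTop (half_pos hc))
      have h2 := (h1.const_mul K).const_mul (1 / ‖c‖ + 1 / ‖c‖ ^ 2)
      rwa [mul_zero, mul_zero] at h2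
    refine squeeze_zero_norm' ?_ hlim
    filter_upwards [eventually_ge_atTop 0] with ξ hξ
    rw [norm_mul, hn, norm_neg]
    have h1 : ‖(ξ : ℂ) / c + 1 / c ^ 2‖ ≤ (1 / ‖c‖ + 1 / ‖c‖ ^ 2) * (1 + ξ) := by
      refine (norm_add_le _ _).trans ?_
      rw [norm_div, norm_div, norm_one, norm_pow, norm_real, norm_of_nonneg hξ]
      have h3 : 0 ≤ 1 / ‖c‖ := by positivity
      have h4 : 0 ≤ 1 / ‖c‖ ^ 2 := by positivity
      rw [div_eq_mul_one_div]
      nlinarith [mul_nonneg h4 hξ]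
    have h2 := hb ξ hξ
    rw [pow_one] at h2
    calc _ ≤ (1 / ‖c‖ + 1 / ‖c‖ ^ 2) * (1 + ξ) * exp (-(c.re * ξ)) := by gcongr
      _ ≤ _ := by rw [mul_assoc]; gcongr
  rw [integral_Ioi_of_hasDerivAt_of_tendsto' hd hint ht]
  simp

/-! ### The kernels as Fourier syntheses -/

/-- `|2πξ|`. -/
def freq (ξ : ℝ) : ℝ := 2 * π * |ξ|

lemma freq_nonneg (ξ : ℝ) : 0 ≤ freq ξ := by have := pi_pos; unfold freq; positivity

lemma freq_neg (ξ : ℝ) : freq (-ξ) = freq ξ := by simp [freq]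

lemma continuous_freq : Continuous freq := by unfold freq; fun_prop

lemma integrable_mul_exp_freq {m : ℝ → ℂ} (hm : AEStronglyMeasurable m) {n : ℕ} {B : ℝ}
    (hB : ∀ ξ, ‖m ξ‖ ≤ B * (1 + |ξ|) ^ n) {σ : ℝ} (hσ : 0 < σ) :
    Integrable fun ξ => m ξ * (exp (-(freq ξ * σ)) : ℝ) := by
  have hpi := pi_pos
  have h := (integrable_pow_mul_exp_neg_mul_abs n (c := 2 * π * σ) (by positivity)).const_mul B
  refine h.mono' (hm.mul (Continuous.aestronglyMeasurable
    (by have := continuous_freq; fun_prop))) (.of_forall fun ξ => ?_)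
  rw [norm_mul, norm_real, norm_of_nonneg (exp_pos _).le, ← mul_assoc]
  have e : freq ξ * σ = 2 * π * σ * |ξ| := by unfold freq; ring
  rw [e]
  gcongr
  exact hB ξ

lemma exp_freq_wave {ξ : ℝ} (hξ : 0 < ξ) (σ t : ℝ) :
    ((exp (-(freq ξ * σ)) : ℝ) : ℂ) * cexp (2 * π * ξ * t * I)
      = cexp (-(2 * π * (σ - t * I)) * ξ) ∧
    ((exp (-(freq (-ξ) * σ)) : ℝ) : ℂ) * cexp (2 * π * ((-ξ : ℝ) : ℂ) * t * I)
      = cexp (-(2 * π * (σ + t * I)) * ξ) := by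
  rw [freq_neg, freq, abs_of_pos hξ]
  push_cast
  rw [← Complex.exp_add, ← Complex.exp_add]
  constructor <;> (congr 1; ring)

section Kernels

variable {σ : ℝ}

lemma re_pos_aux (hσ : 0 < σ) (t : ℝ) : 0 < (2 * π * (σ - t * I) : ℂ).re ∧
    0 < (2 * π * (σ + t * I) : ℂ).re := by
  have := pi_pos
  constructor <;> (simp; positivity)

lemma ne_zero_aux (hσ : 0 < σ) (t : ℝ) : (σ - t * I : ℂ) ≠ 0 ∧ (σ + t * I : ℂ) ≠ 0 := by
  constructor <;> intro h <;> (have := congrArg Complex.re h; simp at this; linarith)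

lemma synth_exp_freq (hσ : 0 < σ) (t : ℝ) :
    synth (fun ξ => ((exp (-(freq ξ * σ)) : ℝ) : ℂ)) t = ((σ / (π * (σ ^ 2 + t ^ 2)) : ℝ) : ℂ) := by
  have hi : Integrable fun ξ => ((exp (-(freq ξ * σ)) : ℝ) : ℂ) := by
    simpa using integrable_mul_exp_freq (m := fun _ => 1) (n := 0) (B := 1) aestronglyMeasurable_const
      (by simp) hσ
  obtain ⟨r1, r2⟩ := re_pos_aux hσ t
  obtain ⟨z1, z2⟩ := ne_zero_aux hσ t
  rw [synth, integral_eq_integral_Ioi_add (integrable_mul_wave hi t)]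
  rw [setIntegral_congr_fun measurableSet_Ioi (g := fun ξ : ℝ =>
    cexp (-(2 * π * (σ - t * I)) * ξ) + cexp (-(2 * π * (σ + t * I)) * ξ))
    (fun ξ hξ => by simp only [(exp_freq_wave hξ σ t).1, (exp_freq_wave hξ σ t).2])]
  rw [integral_add (integrableOn_exp_mul_complex_Ioi (by rw [Complex.neg_re]; linarith) 0)
    (integrableOn_exp_mul_complex_Ioi (by rw [Complex.neg_re]; linarith) 0),
    integral_exp_mul_complex_Ioi (by rw [Complex.neg_re]; linarith),
    integral_exp_mul_complex_Ioi (by rw [Complex.neg_re]; linarith)]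
  have hpi : (π : ℂ) ≠ 0 := by exact_mod_cast pi_ne_zero
  have hs : (σ ^ 2 + t ^ 2 : ℂ) = (σ - t * I) * (σ + t * I) := by
    ring_nf; rw [I_sq]; ring
  push_cast
  rw [hs]
  simp only [mul_zero, Complex.exp_zero]
  field_simp
  ring

lemma integrable_freq_mul_exp (hσ : 0 < σ) (c : ℂ) :
    Integrable (fun ξ : ℝ => c * (freq ξ : ℂ) * ((exp (-(freq ξ * σ)) : ℝ) : ℂ)) ∧
    Integrable (fun ξ : ℝ => c * (2 * π * ξ : ℂ) * ((exp (-(freq ξ * σ)) : ℝ) : ℂ)) := by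
  have hpi := pi_pos
  have := continuous_freq
  constructor
  · refine integrable_mul_exp_freq (n := 1) (B := ‖c‖ * (2 * π)) (by fun_prop)
      (fun ξ => ?_) hσ
    rw [norm_mul, norm_real, norm_of_nonneg (freq_nonneg ξ), freq, pow_one, ← mul_assoc]
    gcongr
    linarith
  · refine integrable_mul_exp_freq (n := 1) (B := ‖c‖ * (2 * π)) (by fun_prop)
      (fun ξ => ?_) hσ
    have : ‖(2 * π * ξ : ℂ)‖ = 2 * π * |ξ| := by
      rw [norm_mul, norm_mul]; simp [abs_of_pos hpi]
    rw [norm_mul, this, pow_one, ← mul_assoc]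
    gcongr
    linarith

lemma synth_eta1 (hσ : 0 < σ) (t : ℝ) :
    synth (fun ξ => (π : ℂ) * (freq ξ : ℂ) * ((exp (-(freq ξ * σ)) : ℝ) : ℂ)) t = ((eta1 (t, σ) : ℝ) : ℂ) := by
  have hi := (integrable_freq_mul_exp hσ (π : ℂ)).1
  obtain ⟨r1, r2⟩ := re_pos_aux hσ t
  obtain ⟨z1, z2⟩ := ne_zero_aux hσ t
  rw [synth, integral_eq_integral_Ioi_add (integrable_mul_wave hi t)]
  rw [setIntegral_congr_fun measurableSet_Ioi (g := fun ξ : ℝ =>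
    (2 * π ^ 2 : ℂ) * (ξ * cexp (-(2 * π * (σ - t * I)) * ξ))
      + (2 * π ^ 2 : ℂ) * (ξ * cexp (-(2 * π * (σ + t * I)) * ξ)))
    (fun ξ hξ => by
      simp only [mul_assoc ((π : ℂ) * _), (exp_freq_wave hξ σ t).1, (exp_freq_wave hξ σ t).2]
      rw [freq_neg, freq, abs_of_pos hξ]
      push_cast
      ring)]
  rw [integral_add ((integral_mul_exp_Ioi r1).1.const_mul _) ((integral_mul_exp_Ioi r2).1.const_mul _),
    integral_const_mul, integral_const_mul, (integral_mul_exp_Ioi r1).2, (integral_mul_exp_Ioi r2).2]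
  have hpi : (π : ℂ) ≠ 0 := by exact_mod_cast pi_ne_zero
  have hs : (t ^ 2 + σ ^ 2 : ℂ) = (σ - t * I) * (σ + t * I) := by
    ring_nf; rw [I_sq]; ring
  simp only [eta1, normSq]
  push_cast
  rw [hs]
  field_simp
  ring_nf
  rw [I_sq]
  ring

lemma synth_eta2 (hσ : 0 < σ) (t : ℝ) :
    synth (fun ξ => (-(I * π / 2) : ℂ) * (2 * π * ξ : ℂ) * ((exp (-(freq ξ * σ)) : ℝ) : ℂ)) t
      = ((eta2 (t, σ) : ℝ) : ℂ) := by
  have hi := (integrable_freq_mul_exp hσ (-(I * π / 2) : ℂ)).2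
  obtain ⟨r1, r2⟩ := re_pos_aux hσ t
  obtain ⟨z1, z2⟩ := ne_zero_aux hσ t
  rw [synth, integral_eq_integral_Ioi_add (integrable_mul_wave hi t)]
  rw [setIntegral_congr_fun measurableSet_Ioi (g := fun ξ : ℝ =>
    (-(I * π ^ 2) : ℂ) * (ξ * cexp (-(2 * π * (σ - t * I)) * ξ))
      + (I * π ^ 2 : ℂ) * (ξ * cexp (-(2 * π * (σ + t * I)) * ξ)))
    (fun ξ hξ => by
      simp only [mul_assoc ((-(I * π / 2) : ℂ) * _), (exp_freq_wave hξ σ t).1, (exp_freq_wave hξ σ t).2]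
      push_cast
      ring)]
  rw [integral_add ((integral_mul_exp_Ioi r1).1.const_mul _) ((integral_mul_exp_Ioi r2).1.const_mul _),
    integral_const_mul, integral_const_mul, (integral_mul_exp_Ioi r1).2, (integral_mul_exp_Ioi r2).2]
  have hpi : (π : ℂ) ≠ 0 := by exact_mod_cast pi_ne_zero
  have hs : (t ^ 2 + σ ^ 2 : ℂ) = (σ - t * I) * (σ + t * I) := by
    ring_nf; rw [I_sq]; ring
  have hab : I * ((σ - t * I) ^ 2 - (σ + t * I) ^ 2) = 4 * σ * t := by
    ring_nf; rw [I_sq]; ring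
  simp only [eta2, normSq]
  push_cast
  rw [hs]
  generalize (σ - t * I : ℂ) = a at *
  generalize (σ + t * I : ℂ) = b at *
  field_simp
  linear_combination hab

end Kernels

end

section

/-! ### Subordination -/

/-- A primitive of the Gaussian. -/
def erfInt (x : ℝ) : ℝ := ∫ s in (0 : ℝ)..x, exp (-1 * s ^ 2)

lemma hasDerivAt_erfInt (x : ℝ) : HasDerivAt erfInt (exp (-1 * x ^ 2)) x := by
  have hc : Continuous fun s : ℝ => exp (-1 * s ^ 2) := by fun_prop
  exact intervalIntegral.integral_hasDerivAt_right (hc.intervalIntegrable _ _)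
    (hc.stronglyMeasurableAtFilter _ _) hc.continuousAt

lemma tendsto_erfInt_atTop : Tendsto erfInt atTop (nhds (√π / 2)) := by
  have h := intervalIntegral_tendsto_integral_Ioi 0
    ((integrable_exp_neg_mul_sq one_pos).integrableOn (s := Ioi (0 : ℝ))) tendsto_id
  rw [integral_gaussian_Ioi, div_one] at h
  exact h

lemma erfInt_neg (x : ℝ) : erfInt (-x) = -erfInt x := by
  have h := intervalIntegral.integral_comp_neg (a := 0) (b := x) fun s : ℝ => exp (-1 * s ^ 2)
  simp only [neg_sq, neg_zero] at h
  rw [erfInt, erfInt, h, intervalIntegral.integral_symm]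

lemma tendsto_erfInt_atBot : Tendsto erfInt atBot (nhds (-(√π / 2))) := by
  have h := (tendsto_erfInt_atTop.comp tendsto_neg_atBot_atTop).neg
  refine h.congr fun x => ?_
  simp [erfInt_neg]

lemma integral_subordination {A B : ℝ} (hA : 0 < A) (hB : 0 < B) :
    ∫ u in Ioi (0 : ℝ), B / (u * √u) * exp (-(A ^ 2 * u + B ^ 2 * u⁻¹)) = √π * exp (-(2 * A * B)) := by
  set F : ℝ → ℝ := fun u => exp (-(2 * A * B)) * erfInt (A * √u - B / √u)
    - exp (2 * A * B) * erfInt (A * √u + B / √u) with hF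
  have hd : ∀ u ∈ Ioi (0 : ℝ), HasDerivAt F (B / (u * √u) * exp (-(A ^ 2 * u + B ^ 2 * u⁻¹))) u := by
    intro u hu
    have hu : 0 < u := hu
    have hs : 0 < √u := sqrt_pos.2 hu
    have hsq : √u ^ 2 = u := sq_sqrt hu.le
    have d0 := Real.hasDerivAt_sqrt hu.ne'
    have d1 : HasDerivAt (fun u => A * √u - B / √u) (A * (1 / (2 * √u)) + B * (1 / (2 * √u)) / √u ^ 2) u := by
      convert! (d0.const_mul A).sub ((hasDerivAt_const u B).div d0 hs.ne') using 1
      ring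
    have d2 : HasDerivAt (fun u => A * √u + B / √u) (A * (1 / (2 * √u)) - B * (1 / (2 * √u)) / √u ^ 2) u := by
      convert! (d0.const_mul A).add ((hasDerivAt_const u B).div d0 hs.ne') using 1
      ring
    have e1 := ((hasDerivAt_erfInt (A * √u - B / √u)).comp u d1).const_mul (exp (-(2 * A * B)))
    have e2 := ((hasDerivAt_erfInt (A * √u + B / √u)).comp u d2).const_mul (exp (2 * A * B))
    convert! e1.sub e2 using 1
    have x1 : exp (-(2 * A * B)) * exp (-1 * (A * √u - B / √u) ^ 2) = exp (-(A ^ 2 * u + B ^ 2 * u⁻¹)) := by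
      rw [← exp_add]; congr 1
      rw [sub_sq, mul_pow, div_pow, hsq]; field_simp; ring
    have x2 : exp (2 * A * B) * exp (-1 * (A * √u + B / √u) ^ 2) = exp (-(A ^ 2 * u + B ^ 2 * u⁻¹)) := by
      rw [← exp_add]; congr 1
      rw [add_sq, mul_pow, div_pow, hsq]; field_simp; ring
    rw [← mul_assoc, ← mul_assoc, x1, x2, hsq]
    field_simp
    ring
  have hlim0 : Tendsto F (nhdsWithin 0 (Ioi 0))
      (nhds (exp (-(2 * A * B)) * (-(√π / 2)) - exp (2 * A * B) * (√π / 2))) := by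
    have s0 : Tendsto (fun u : ℝ => √u) (nhdsWithin 0 (Ioi 0)) (nhds 0) := by
      have := (Real.continuous_sqrt.tendsto 0).mono_left (nhdsWithin_le_nhds (s := Ioi 0))
      rwa [sqrt_zero] at this
    have s1 : Tendsto (fun u : ℝ => √u) (nhdsWithin 0 (Ioi 0)) (nhdsWithin 0 (Ioi 0)) :=
      tendsto_nhdsWithin_iff.2 ⟨s0, eventually_nhdsWithin_of_forall fun u hu => sqrt_pos.2 hu⟩
    have s2 : Tendsto (fun u : ℝ => B / √u) (nhdsWithin 0 (Ioi 0)) atTop := by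
      simp only [div_eq_mul_inv]
      exact (tendsto_inv_nhdsGT_zero.comp s1).const_mul_atTop hB
    have s3 : Tendsto (fun u : ℝ => A * √u) (nhdsWithin 0 (Ioi 0)) (nhds 0) := by
      simpa using s0.const_mul A
    have p : Tendsto (fun u : ℝ => A * √u - B / √u) (nhdsWithin 0 (Ioi 0)) atBot := by
      simp only [sub_eq_add_neg]
      exact s3.add_atBot (tendsto_neg_atTop_atBot.comp s2)
    have q : Tendsto (fun u : ℝ => A * √u + B / √u) (nhdsWithin 0 (Ioi 0)) atTop :=
      s3.add_atTop s2
    exact ((tendsto_erfInt_atBot.comp p).const_mul _).sub ((tendsto_erfInt_atTop.comp q).const_mul _)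
  have hlim1 : Tendsto F atTop
      (nhds (exp (-(2 * A * B)) * (√π / 2) - exp (2 * A * B) * (√π / 2))) := by
    have s1 : Tendsto (fun u : ℝ => A * √u) atTop atTop :=
      tendsto_sqrt_atTop.const_mul_atTop hA
    have s2 : Tendsto (fun u : ℝ => B / √u) atTop (nhds 0) :=
      tendsto_sqrt_atTop.const_div_atTop B
    have p : Tendsto (fun u : ℝ => A * √u - B / √u) atTop atTop := by
      simp only [sub_eq_add_neg]
      exact s1.atTop_add s2.neg
    have q : Tendsto (fun u : ℝ => A * √u + B / √u) atTop atTop := s1.atTop_add s2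
    exact ((tendsto_erfInt_atTop.comp p).const_mul _).sub ((tendsto_erfInt_atTop.comp q).const_mul _)
  set L := exp (-(2 * A * B)) * (-(√π / 2)) - exp (2 * A * B) * (√π / 2) with hL
  have hcont : ContinuousWithinAt (Function.update F 0 L) (Ici 0) 0 := by
    rw [continuousWithinAt_update_same, Ici_sdiff_left]
    exact hlim0
  have hne : ∀ u ∈ Ioi (0 : ℝ), Function.update F 0 L =ᶠ[nhds u] F := fun u hu => by
    filter_upwards [Ioi_mem_nhds hu] with v hv
    exact Function.update_of_ne (ne_of_gt hv) _ _
  rw [integral_Ioi_of_hasDerivAt_of_nonneg hcont (fun u hu => (hd u hu).congr_of_eventuallyEq (hne u hu))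
    (fun u hu => by have : 0 < u := hu; positivity)
    (hlim1.congr' (by
      filter_upwards [eventually_gt_atTop 0] with u hu
      exact (Function.update_of_ne hu.ne' _ _).symm)), Function.update_self, hL]
  ring

/-! ### The Fourier transform of the Helmholtz kernel on lines -/

/-- `√(|2πξ|² + 1/α)`. -/
def kap (α ξ : ℝ) : ℝ := √(freq ξ ^ 2 + 1 / α)

variable {α : ℝ}

lemma continuous_kap (α : ℝ) : Continuous (kap α) := by
  unfold kap
  have := continuous_freq
  fun_prop

lemma kap_pos (hα : 0 < α) (ξ : ℝ) : 0 < kap α ξ := sqrt_pos.2 (by have := freq_nonneg ξ; positivity)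

lemma kap_sq (hα : 0 < α) (ξ : ℝ) : kap α ξ ^ 2 = freq ξ ^ 2 + 1 / α := sq_sqrt (by positivity)

lemma freq_le_kap (hα : 0 < α) (ξ : ℝ) : freq ξ ≤ kap α ξ := by
  refine le_sqrt_of_sq_le ?_
  have : 0 < 1 / α := by positivity
  linarith

lemma integral_gaussian_wave {b : ℝ} (hb : 0 < b) (t : ℝ) :
    ∫ ξ : ℝ, ((exp (-b * ξ ^ 2) : ℝ) : ℂ) * cexp (2 * π * ξ * t * I)
      = ((√(π / b) * exp (-(π ^ 2 * t ^ 2 / b)) : ℝ) : ℂ) := by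
  have h := fourierIntegral_gaussian (b := b) (by simpa using hb) (2 * π * t)
  have e : ∀ ξ : ℝ, ((exp (-b * ξ ^ 2) : ℝ) : ℂ) * cexp (2 * π * ξ * t * I)
      = cexp (I * (2 * π * t) * ξ) * cexp (-b * ξ ^ 2) := fun ξ => by
    rw [mul_comm]; push_cast; congr 2; ring
  simp_rw [e]
  rw [h]
  have h2 : ((π : ℂ) / b) ^ (1 / 2 : ℂ) = ((√(π / b) : ℝ) : ℂ) := by
    rw [sqrt_eq_rpow, Complex.ofReal_cpow (by have := pi_pos; positivity)]
    push_cast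
    rfl
  rw [h2]
  push_cast
  congr 2
  field_simp
  ring

/-- The heat kernel representation of `e^{-κs}`. -/
lemma integral_heat_eq (hα : 0 < α) {s : ℝ} (hs : 0 < s) (ξ : ℝ) :
    ∫ u in Ioi (0 : ℝ), exp (-u) * (u⁻¹ ^ 2 * exp (-(s ^ 2 / (4 * α) * u⁻¹)))
      * (√(4 * π * α * u) * exp (-(4 * π ^ 2 * α * u) * ξ ^ 2))
      = 4 * π * α / s * exp (-(kap α ξ * s)) := by
  have hpi := pi_pos
  have hk := kap_pos hα ξ
  have hsa : 0 < √α := sqrt_pos.2 hα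
  have hsq : √α ^ 2 = α := sq_sqrt hα.le
  have h := integral_subordination (A := √α * kap α ξ) (B := s / (2 * √α)) (by positivity) (by positivity)
  have e1 : 2 * (√α * kap α ξ) * (s / (2 * √α)) = kap α ξ * s := by field_simp
  rw [e1] at h
  have e2 : 4 * π * α / s * exp (-(kap α ξ * s))
      = 2 * √π * √α * (2 * √α / s) * (√π * exp (-(kap α ξ * s))) := by
    have : √π ^ 2 = π := sq_sqrt hpi.le
    have h4 : 4 * π * α / s = 4 * √π ^ 2 * √α ^ 2 / s := by rw [this, hsq]
    rw [h4]
    field_simp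
    norm_num
  rw [e2, ← h, ← integral_const_mul]
  refine setIntegral_congr_fun measurableSet_Ioi fun u hu => ?_
  have hu : 0 < u := hu
  have hsu : 0 < √u := sqrt_pos.2 hu
  have hsqu : √u ^ 2 = u := sq_sqrt hu.le
  have e3 : √(4 * π * α * u) = 2 * √π * √α * √u := by
    rw [sqrt_mul (by positivity), sqrt_mul (by positivity), sqrt_mul (by positivity)]
    congr 3
    rw [show (4 : ℝ) = 2 ^ 2 by norm_num, sqrt_sq (by norm_num)]
  have e4 : exp (-((√α * kap α ξ) ^ 2 * u + (s / (2 * √α)) ^ 2 * u⁻¹))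
      = exp (-u) * exp (-(s ^ 2 / (4 * α) * u⁻¹)) * exp (-(4 * π ^ 2 * α * u) * ξ ^ 2) := by
    rw [← exp_add, ← exp_add]
    congr 1
    rw [mul_pow, div_pow, mul_pow, hsq, kap_sq hα, freq, mul_pow, sq_abs]
    field_simp
    ring
  rw [e3, e4]
  rw [show u⁻¹ ^ 2 = 1 / (√u ^ 2 * u) by rw [hsqu]; field_simp]
  field_simp

/-- `∂₂G_α(·, s)` is the Fourier synthesis of `-(1/2α) e^{-κs}`. -/
theorem synth_exp_kap (hα : 0 < α) {s : ℝ} (hs : 0 < s) (t : ℝ) :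
    synth (fun ξ => ((-(1 / (2 * α)) * exp (-(kap α ξ * s)) : ℝ) : ℂ)) t
      = ((d2 (helmholtzGreen α) (t, s) : ℝ) : ℂ) := by
  have hpi := pi_pos
  set w : ℝ → ℝ → ℝ := fun ξ u => exp (-u) * (u⁻¹ ^ 2 * exp (-(s ^ 2 / (4 * α) * u⁻¹)))
      * (√(4 * π * α * u) * exp (-(4 * π ^ 2 * α * u) * ξ ^ 2)) with hw
  have hb : ∀ u : ℝ, 0 < u → 0 < 4 * π ^ 2 * α * u := fun u hu => by positivity
  have hg : ∀ u : ℝ, 0 < u → √(4 * π * α * u) * √(π / (4 * π ^ 2 * α * u)) = 1 := fun u hu => by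
    rw [← sqrt_mul (by positivity)]
    have : 4 * π * α * u * (π / (4 * π ^ 2 * α * u)) = 1 := by field_simp
    rw [this, Real.sqrt_one]
  have hwm : Measurable (uncurry fun (ξ u : ℝ) =>
      ((w ξ u : ℝ) : ℂ) * cexp (2 * π * ξ * t * I)) := by
    unfold uncurry
    simp only [hw]
    fun_prop
  have hs2 : 0 < s ^ 2 := by positivity
  have hi : Integrable (uncurry fun (ξ u : ℝ) =>
      ((w ξ u : ℝ) : ℂ) * cexp (2 * π * ξ * t * I))
      ((volume : Measure ℝ).prod (volume.restrict (Ioi (0 : ℝ)))) := by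
    rw [integrable_prod_iff' hwm.aestronglyMeasurable]
    have hn : ∀ u ∈ Ioi (0 : ℝ), ∀ ξ : ℝ, ‖((w ξ u : ℝ) : ℂ) * cexp (2 * π * ξ * t * I)‖
        = exp (-u) * (u⁻¹ ^ 2 * exp (-(s ^ 2 / (4 * α) * u⁻¹))) * √(4 * π * α * u)
          * exp (-(4 * π ^ 2 * α * u) * ξ ^ 2) := by
      intro u hu ξ
      have hu : 0 < u := hu
      rw [norm_mul, norm_wave, mul_one, norm_real, norm_of_nonneg]
      · simp only [hw]; ring
      · simp only [hw]; positivity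
    constructor
    · refine ae_restrict_of_forall_mem measurableSet_Ioi fun u hu => ?_
      have hm : Measurable fun ξ : ℝ => ((w ξ u : ℝ) : ℂ) * cexp (2 * π * ξ * t * I) :=
        hwm.comp (measurable_id.prodMk measurable_const)
      refine (integrable_norm_iff hm.aestronglyMeasurable).1 ?_
      simp only [hn u hu]
      exact (integrable_exp_neg_mul_sq (hb u hu)).const_mul _
    · refine (integrableOn_besselIntegrand hα 2 hs2).congr_fun (fun u hu => ?_) measurableSet_Ioi
      simp only [uncurry]
      simp only [hn u hu]
      rw [integral_const_mul, integral_gaussian, mul_assoc, hg u hu, mul_one]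
  have hne : ((t, s) : ℝ × ℝ) ≠ 0 := fun h => hs.ne' (congrArg Prod.snd h)
  have hρ := normSq_pos hne
  have h1 : ∀ ξ : ℝ, ((-(1 / (2 * α)) * exp (-(kap α ξ * s)) : ℝ) : ℂ) * cexp (2 * π * ξ * t * I)
      = ((-(s / (8 * π * α ^ 2)) : ℝ) : ℂ) * ∫ u in Ioi (0 : ℝ),
        ((w ξ u : ℝ) : ℂ) * cexp (2 * π * ξ * t * I) := by
    intro ξ
    rw [integral_mul_const, integral_complex_ofReal, ← mul_assoc, ← Complex.ofReal_mul]
    congr 2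
    simp only [hw]
    rw [integral_heat_eq hα hs ξ]
    field_simp
    norm_num
  rw [synth]
  simp_rw [h1]
  rw [integral_const_mul, integral_integral_swap hi]
  have h2 : ∀ u ∈ Ioi (0 : ℝ), ∫ ξ : ℝ, ((w ξ u : ℝ) : ℂ) * cexp (2 * π * ξ * t * I)
      = ((exp (-u) * (u⁻¹ ^ 2 * exp (-(normSq (t, s) / (4 * α) * u⁻¹))) : ℝ) : ℂ) := by
    intro u hu
    have hu : 0 < u := hu
    have e : ∀ ξ : ℝ, ((w ξ u : ℝ) : ℂ) * cexp (2 * π * ξ * t * I)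
        = ((exp (-u) * (u⁻¹ ^ 2 * exp (-(s ^ 2 / (4 * α) * u⁻¹))) * √(4 * π * α * u) : ℝ) : ℂ)
          * (((exp (-(4 * π ^ 2 * α * u) * ξ ^ 2) : ℝ) : ℂ) * cexp (2 * π * ξ * t * I)) := by
      intro ξ
      simp only [hw]
      push_cast
      ring
    simp_rw [e]
    rw [integral_const_mul, integral_gaussian_wave (hb u hu), ← Complex.ofReal_mul]
    congr 1
    have e2 : exp (-(normSq (t, s) / (4 * α) * u⁻¹))
        = exp (-(s ^ 2 / (4 * α) * u⁻¹)) * exp (-(π ^ 2 * t ^ 2 / (4 * π ^ 2 * α * u))) := by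
      rw [← exp_add]; congr 1
      simp only [normSq]
      field_simp
      ring
    rw [e2]
    linear_combination (exp (-u) * (u⁻¹ ^ 2 * exp (-(s ^ 2 / (4 * α) * u⁻¹)))
      * exp (-(π ^ 2 * t ^ 2 / (4 * π ^ 2 * α * u)))) * hg u hu
  have h3 : ∫ u in Ioi (0 : ℝ), exp (-u) * (u⁻¹ ^ 2 * exp (-(normSq (t, s) / (4 * α) * u⁻¹)))
    = besselInt α 2 (normSq (t, s)) := rfl
  rw [setIntegral_congr_fun measurableSet_Ioi h2, integral_complex_ofReal, ← Complex.ofReal_mul, h3,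
    d2_helmholtzGreen hα hne, besselInt_zero_eq hα hρ]
  congr 1
  field_simp
  ring

end

section

/-! ### The multiplier `∫₀ˢ e^{-κt - k(s-t)} dt` -/

/-- `∫₀ˢ e^{-κt - k(s-t)} dt` with `k = |2πξ|` and `κ = √(k² + 1/α)`. -/
def expConv (α ξ s : ℝ) : ℝ := α * (kap α ξ + freq ξ) * (exp (-(freq ξ * s)) - exp (-(kap α ξ * s)))

variable {α : ℝ}

lemma kap_sub_mul (hα : 0 < α) (ξ : ℝ) : α * ((kap α ξ + freq ξ) * (kap α ξ - freq ξ)) = 1 := by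
  have := kap_sq hα ξ
  have h : (kap α ξ + freq ξ) * (kap α ξ - freq ξ) = 1 / α := by linear_combination this
  rw [h]; field_simp

lemma hasDerivAt_expConv (hα : 0 < α) (ξ s : ℝ) :
    HasDerivAt (expConv α ξ) (exp (-(kap α ξ * s)) - freq ξ * expConv α ξ s) s := by
  have h : ∀ c : ℝ, HasDerivAt (fun s => exp (-(c * s))) (exp (-(c * s)) * -(c * 1)) s := fun c =>
    (((hasDerivAt_id s).const_mul c).fun_neg).exp
  convert! ((h (freq ξ)).sub (h (kap α ξ))).const_mul (α * (kap α ξ + freq ξ)) using 1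
  unfold expConv
  linear_combination (-exp (-(kap α ξ * s))) * kap_sub_mul hα ξ

lemma integral_eq_expConv (hα : 0 < α) (ξ s : ℝ) :
    ∫ t in (0 : ℝ)..s, exp (-(kap α ξ * t)) * exp (-(freq ξ * (s - t))) = expConv α ξ s := by
  have h1 : ∀ t ∈ uIcc 0 s, HasDerivAt
      (fun t => -(α * (kap α ξ + freq ξ)) * (exp (-(kap α ξ * t)) * exp (-(freq ξ * (s - t)))))
      (exp (-(kap α ξ * t)) * exp (-(freq ξ * (s - t)))) t := by
    intro t _
    have e1 : HasDerivAt (fun t => exp (-(kap α ξ * t))) (exp (-(kap α ξ * t)) * -(kap α ξ * 1)) t :=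
      (((hasDerivAt_id t).const_mul _).fun_neg).exp
    have e2 : HasDerivAt (fun t => exp (-(freq ξ * (s - t)))) (exp (-(freq ξ * (s - t))) * -(freq ξ * -1)) t :=
      ((((hasDerivAt_id t).const_sub s).const_mul _).fun_neg).exp
    convert! (e1.mul e2).const_mul (-(α * (kap α ξ + freq ξ))) using 1
    linear_combination (-(exp (-(kap α ξ * t)) * exp (-(freq ξ * (s - t))))) * kap_sub_mul hα ξ
  rw [intervalIntegral.integral_eq_sub_of_hasDerivAt h1
    (Continuous.intervalIntegrable (by fun_prop) _ _)]
  simp [expConv]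
  ring

lemma expConv_nonneg (hα : 0 < α) (ξ : ℝ) {s : ℝ} (hs : 0 ≤ s) : 0 ≤ expConv α ξ s := by
  rw [← integral_eq_expConv hα]
  exact intervalIntegral.integral_nonneg hs fun t _ => by positivity

lemma expConv_le (hα : 0 < α) (ξ : ℝ) {s : ℝ} (hs : 0 ≤ s) :
    expConv α ξ s ≤ s * exp (-(freq ξ * s)) := by
  rw [← integral_eq_expConv hα]
  have h : ∫ t in (0 : ℝ)..s, exp (-(freq ξ * s)) = s * exp (-(freq ξ * s)) := by simp
  rw [← h]
  refine intervalIntegral.integral_mono_on hs (Continuous.intervalIntegrable (by fun_prop) _ _)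
    (by simp) fun t ht => ?_
  rw [← exp_add]
  refine exp_le_exp.2 ?_
  nlinarith [mul_le_mul_of_nonneg_right (freq_le_kap hα ξ) ht.1]

lemma continuous_expConv (α : ℝ) : Continuous fun p : ℝ × ℝ => expConv α p.1 p.2 := by
  have := continuous_freq
  have := continuous_kap α
  unfold expConv
  fun_prop

lemma exp_sub_exp_le (hα : 0 < α) (ξ : ℝ) {s : ℝ} (hs : 0 < s) :
    |exp (-(freq ξ * s)) - exp (-(kap α ξ * s))| ≤ (1 + 1 / α) / (1 + ξ ^ 2) := by
  have hk := freq_nonneg ξ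
  have hK := kap_pos hα ξ
  have h0 : 0 ≤ exp (-(freq ξ * s)) - exp (-(kap α ξ * s)) := by
    rw [sub_nonneg]; refine exp_le_exp.2 ?_
    have := freq_le_kap hα ξ
    nlinarith
  rw [abs_of_nonneg h0, le_div_iff₀ (by positivity)]
  have h1 : exp (-(freq ξ * s)) - exp (-(kap α ξ * s)) ≤ 1 := by
    have : exp (-(freq ξ * s)) ≤ 1 := exp_le_one_iff.2 (by nlinarith)
    have := exp_pos (-(kap α ξ * s))
    linarith
  have h2 : (exp (-(freq ξ * s)) - exp (-(kap α ξ * s))) * ξ ^ 2 ≤ 1 / α := by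
    have h3 := expConv_le hα ξ hs.le
    have h4 := pow_mul_exp_neg_le (u := freq ξ * s) (by positivity) 1
    simp only [pow_one, Nat.factorial_one, Nat.cast_one] at h4
    have h5 : freq ξ ^ 2 * (exp (-(freq ξ * s)) - exp (-(kap α ξ * s))) * α ≤ 1 := by
      have h6 : freq ξ * expConv α ξ s ≤ 1 := by nlinarith
      unfold expConv at h6
      have h7 : 0 ≤ α * kap α ξ * freq ξ * (exp (-(freq ξ * s)) - exp (-(kap α ξ * s))) := by positivity
      nlinarith
    have h8 : ξ ^ 2 ≤ freq ξ ^ 2 := by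
      unfold freq
      rw [mul_pow, sq_abs]
      have h9 : 1 ≤ (2 * π) ^ 2 := by nlinarith [pi_gt_three]
      nlinarith [sq_nonneg ξ]
    rw [le_div_iff₀ hα]
    calc _ ≤ (exp (-(freq ξ * s)) - exp (-(kap α ξ * s))) * freq ξ ^ 2 * α := by gcongr
      _ ≤ 1 := by linarith
  linarith

/-! ### The boundary datum -/

lemma integrable_poisson {s : ℝ} (hs : 0 < s) : Integrable (fun t : ℝ => s / (π * (s ^ 2 + t ^ 2))) ∧
    ∫ t : ℝ, s / (π * (s ^ 2 + t ^ 2)) = 1 := by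
  have hpi := pi_pos
  have e : (fun t : ℝ => s / (π * (s ^ 2 + t ^ 2))) = fun t => 1 / (π * s) * (1 + (s⁻¹ * t) ^ 2)⁻¹ := by
    funext t
    field_simp
  rw [e]
  have hi := integrable_inv_one_add_sq.comp_mul_left' (inv_ne_zero hs.ne')
  refine ⟨hi.const_mul _, ?_⟩
  rw [integral_const_mul, Measure.integral_comp_mul_left (fun t : ℝ => (1 + t ^ 2)⁻¹), integral_univ_inv_one_add_sq,
    inv_inv, abs_of_pos hs, smul_eq_mul]
  field_simp

lemma integrable_exp_freq {s : ℝ} (hs : 0 < s) : Integrable fun ξ => ((exp (-(freq ξ * s)) : ℝ) : ℂ) := by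
  simpa using integrable_mul_exp_freq (m := fun _ => 1) (n := 0) (B := 1) aestronglyMeasurable_const
    (by simp) hs

lemma integrable_exp_kap (hα : 0 < α) {s : ℝ} (hs : 0 < s) :
    Integrable fun ξ => ((exp (-(kap α ξ * s)) : ℝ) : ℂ) := by
  have := continuous_kap α
  refine (integrable_exp_freq hs).mono (by fun_prop) (.of_forall fun ξ => ?_)
  rw [norm_real, norm_real, norm_of_nonneg (exp_pos _).le, norm_of_nonneg (exp_pos _).le]
  refine exp_le_exp.2 ?_
  have := freq_le_kap hα ξ
  nlinarith

/-- The kernel of the boundary datum is the Fourier synthesis of `(e^{-ks} - e^{-κs}) / 2`. -/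
lemma synth_boundaryDatum_kernel (hα : 0 < α) {s : ℝ} (hs : 0 < s) (t : ℝ) :
    synth (fun ξ => ((1 / 2 * (exp (-(freq ξ * s)) - exp (-(kap α ξ * s))) : ℝ) : ℂ)) t
      = ((s * velProfile α (normSq (t, s)) : ℝ) : ℂ) := by
  have hpi := pi_pos
  have hne : ((t, s) : ℝ × ℝ) ≠ 0 := fun h => hs.ne' (congrArg Prod.snd h)
  have h1 := synth_exp_freq hs t
  have h2 := synth_exp_kap hα hs t
  have i1 := (integrable_mul_wave (integrable_exp_freq hs) t).const_mul (1 / 2 : ℂ)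
  have i2 := (integrable_mul_wave ((integrable_exp_kap hα hs).const_mul (-(1 / (2 * α)) : ℂ)) t).const_mul (α : ℂ)
  have hα' : (α : ℂ) ≠ 0 := by exact_mod_cast hα.ne'
  have e : ∀ ξ : ℝ, ((1 / 2 * (exp (-(freq ξ * s)) - exp (-(kap α ξ * s))) : ℝ) : ℂ)
      * cexp (2 * π * ξ * t * I)
      = (1 / 2 : ℂ) * (((exp (-(freq ξ * s)) : ℝ) : ℂ) * cexp (2 * π * ξ * t * I))
      + (α : ℂ) * ((-(1 / (2 * α)) : ℂ) * ((exp (-(kap α ξ * s)) : ℝ) : ℂ)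
        * cexp (2 * π * ξ * t * I)) := by
    intro ξ
    push_cast
    field_simp
    ring
  unfold synth at h1 h2 ⊢
  simp_rw [e]
  rw [integral_add i1 i2, integral_const_mul, integral_const_mul, h1]
  have e2 : ∀ ξ : ℝ, (-(1 / (2 * α)) : ℂ) * ((exp (-(kap α ξ * s)) : ℝ) : ℂ)
      = ((-(1 / (2 * α)) * exp (-(kap α ξ * s)) : ℝ) : ℂ) := fun ξ => by push_cast; ring
  simp_rw [e2]
  rw [h2, d2_helmholtzGreen hα hne, velProfile]
  have hρ := normSq_pos hne
  have e3 : s ^ 2 + t ^ 2 = normSq (t, s) := by simp [normSq, add_comm]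
  rw [e3]
  set I0 := besselInt α 0 (normSq (t, s))
  set R := normSq (t, s)
  have e4 : s * ((1 - I0) / (2 * π * R)) = 1 / 2 * (s / (π * R)) + α * (-(s * I0 / (2 * π * α * R))) := by
    field_simp
    ring
  try simp only []
  rw [e4]
  push_cast
  ring

lemma integrable_boundaryDatum_kernel (hα : 0 < α) {s : ℝ} (hs : 0 < s) :
    Integrable (fun t : ℝ => s * velProfile α (normSq (t, s))) ∧
    ∫ t : ℝ, |s * velProfile α (normSq (t, s))| ≤ 1 ∧
    ∀ ξ, ‖𝓕 (fun t : ℝ => ((s * velProfile α (normSq (t, s)) : ℝ) : ℂ)) ξ‖ ≤ (1 + 1 / α) / (1 + ξ ^ 2) := by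
  have hpi := pi_pos
  obtain ⟨p1, p2⟩ := integrable_poisson hs
  have hb : ∀ t : ℝ, |s * velProfile α (normSq (t, s))| ≤ s / (π * (s ^ 2 + t ^ 2)) := by
    intro t
    have hne : ((t, s) : ℝ × ℝ) ≠ 0 := fun h => hs.ne' (congrArg Prod.snd h)
    have hρ := normSq_pos hne
    have e3 : s ^ 2 + t ^ 2 = normSq (t, s) := by simp [normSq, add_comm]
    have h0 := besselInt_nonneg α 0 (normSq (t, s))
    have h1 := besselInt_zero_le_one hα hρ.le
    rw [abs_of_nonneg (mul_nonneg hs.le (velProfile_nonneg hα hρ.le)), e3, velProfile, mul_div_assoc']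
    rw [div_le_div_iff₀ (by positivity) (by positivity)]
    have : s * (1 - besselInt α 0 (normSq (t, s))) ≤ s * 2 := by gcongr; linarith
    calc _ ≤ s * 2 * (π * normSq (t, s)) := by gcongr
      _ = _ := by ring
  have hm : Measurable fun t : ℝ => s * velProfile α (normSq (t, s)) := by
    have h := (measurable_velProfile α).comp measurable_normSq
    exact (h.comp (by fun_prop : Measurable fun t : ℝ => (t, s))).const_mul s
  have hi : Integrable (fun t : ℝ => s * velProfile α (normSq (t, s))) :=
    p1.mono' hm.aestronglyMeasurable (.of_forall hb)
  refine ⟨hi, (integral_mono hi.abs p1 hb).trans p2.le, fun ξ => ?_⟩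
  set m : ℝ → ℂ := fun ξ => ((1 / 2 * (exp (-(freq ξ * s)) - exp (-(kap α ξ * s))) : ℝ) : ℂ) with hmd
  have hmi : Integrable m := by
    refine (((integrable_exp_freq hs).sub (integrable_exp_kap hα hs)).const_mul (1 / 2 : ℂ)).congr
      (.of_forall fun ξ => ?_)
    simp [hmd]
  have hmc : Continuous m := by
    have := continuous_freq
    have := continuous_kap α
    fun_prop
  have e : (fun t : ℝ => ((s * velProfile α (normSq (t, s)) : ℝ) : ℂ)) = synth m :=
    funext fun t => (synth_boundaryDatum_kernel hα hs t).symm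
  rw [e, fourier_synth hmi hmc (by rw [← e]; exact hi.ofReal), hmd]
  rw [norm_real, norm_eq_abs, abs_mul, abs_of_pos (by norm_num : (0 : ℝ) < 1 / 2)]
  have := exp_sub_exp_le hα ξ hs
  have h0 : 0 ≤ |exp (-(freq ξ * s)) - exp (-(kap α ξ * s))| := abs_nonneg _
  linarith

/-- The boundary datum is in `L¹ ∩ H^{1/2}`. -/
theorem memL1Hhalf_boundaryDatum (hα : 0 < α) (q : SignedMeasure halfPlane) :
    MemL1Hhalf (boundaryDatum α q) := by
  obtain ⟨σ, hσ, hσ1, -, -, hbd⟩ := exists_interiorPart_eq q hα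
  set μ := q.variation with hμ
  have hk := fun y : halfPlane => integrable_boundaryDatum_kernel hα (show 0 < y.1.2 from y.2)
  have hm := measurable_boundaryDatum_kernel (α := α)
  have hi : Integrable (uncurry fun (x : ℝ) (y : halfPlane) =>
      y.1.2 * velProfile α (normSq (x - y.1.1, y.1.2)) * σ y) ((volume : Measure ℝ).prod μ) := by
    have hm' : Measurable (uncurry fun (x : ℝ) (y : halfPlane) =>
      y.1.2 * velProfile α (normSq (x - y.1.1, y.1.2)) * σ y) := hm.mul (hσ.comp measurable_snd)
    rw [integrable_prod_iff' hm'.aestronglyMeasurable]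
    constructor
    · refine .of_forall fun y => ?_
      exact ((hk y).1.comp_sub_right y.1.1).mul_const (σ y)
    · have hsm : StronglyMeasurable fun y : halfPlane => ∫ x : ℝ,
          ‖(uncurry fun (x : ℝ) (y : halfPlane) =>
            y.1.2 * velProfile α (normSq (x - y.1.1, y.1.2)) * σ y) (x, y)‖ :=
        hm'.norm.stronglyMeasurable.integral_prod_left'
      refine Integrable.of_bound hsm.aestronglyMeasurable 1 (.of_forall fun y => ?_)
      rw [norm_of_nonneg (integral_nonneg fun _ => norm_nonneg _)]
      simp only [uncurry, norm_eq_abs, abs_mul _ (σ y)]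
      rw [integral_mul_const, integral_sub_right_eq_self (fun x => |y.1.2 * velProfile α (normSq (x, y.1.2))|)]
      exact mul_le_one₀ (hk y).2.1 (abs_nonneg _) (hσ1 y)
  have hg : Integrable (boundaryDatum α q) := by
    rw [funext hbd]
    exact hi.integral_prod_left.const_mul (-2)
  refine ⟨hg, ?_⟩
  set m := μ.real univ with hmdef
  have hF : ∀ ξ, ‖𝓕 (fun t : ℝ => (boundaryDatum α q t : ℂ)) ξ‖ ≤ 2 * ((1 + 1 / α) / (1 + ξ ^ 2) * m) := by
    intro ξ
    have hi2 : Integrable (uncurry fun (x : ℝ) (y : halfPlane) =>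
        cexp (-(2 * π * ξ * x * I)) *
          ((y.1.2 * velProfile α (normSq (x - y.1.1, y.1.2)) * σ y : ℝ) : ℂ)) ((volume : Measure ℝ).prod μ) := by
      refine hi.ofReal.bdd_mul (c := 1) (f := fun z : ℝ × halfPlane =>
        cexp (-(2 * π * ξ * z.1 * I))) ?_ (.of_forall fun z => ?_)
      · fun_prop
      · have := norm_wave (-ξ) z.1
        rw [show (-(2 * π * ξ * z.1 * I) : ℂ) = 2 * π * ((-ξ : ℝ) : ℂ) * z.1 * I by
          push_cast; ring, this]
    have e1 : 𝓕 (fun t : ℝ => (boundaryDatum α q t : ℂ)) ξ = -2 * ∫ y, (∫ x : ℝ,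
        cexp (-(2 * π * ξ * x * I)) *
          ((y.1.2 * velProfile α (normSq (x - y.1.1, y.1.2)) * σ y : ℝ) : ℂ)) ∂μ := by
      rw [fourier_eq_integral, ← integral_integral_swap hi2, ← integral_const_mul]
      refine integral_ext fun x => ?_
      rw [integral_const_mul, integral_complex_ofReal, hbd]
      push_cast
      ring
    rw [e1, norm_mul, norm_neg, Complex.norm_ofNat]
    gcongr
    refine norm_integral_le_of_norm_le_const (.of_forall fun y => ?_)
    have e2 : ∫ x : ℝ, cexp (-(2 * π * ξ * x * I)) *
          ((y.1.2 * velProfile α (normSq (x - y.1.1, y.1.2)) * σ y : ℝ) : ℂ)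
        = cexp (2 * π * ((-ξ : ℝ) : ℂ) * y.1.1 * I) * (σ y : ℂ)
          * 𝓕 (fun t : ℝ => ((y.1.2 * velProfile α (normSq (t, y.1.2)) : ℝ) : ℂ)) ξ := by
      rw [fourier_eq_integral, ← integral_const_mul]
      refine Eq.trans ?_ (integral_sub_right_eq_self _ y.1.1)
      refine integral_ext fun x => ?_
      have : cexp (-(2 * π * ξ * x * I))
          = cexp (2 * π * ((-ξ : ℝ) : ℂ) * y.1.1 * I)
            * cexp (-(2 * π * ξ * ((x - y.1.1 : ℝ) : ℂ) * I)) := by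
        rw [← Complex.exp_add]; congr 1; push_cast; ring
      rw [this]
      push_cast
      ring
    rw [e2, norm_mul, norm_mul, norm_wave, one_mul, norm_real, norm_eq_abs]
    have := mul_le_mul (hσ1 y) ((hk y).2.2 ξ) (norm_nonneg _) zero_le_one
    linarith
  have hc := continuous_fourier hg.ofReal
  have hα' : 0 < 1 / α := by positivity
  have hm0 : 0 ≤ m := measureReal_nonneg
  refine (integrable_inv_one_add_sq.const_mul (2 * (2 * (1 + 1 / α) * m) ^ 2)).mono'
    (by fun_prop) (.of_forall fun ξ => ?_)
  rw [norm_of_nonneg (by positivity)]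
  have h1 : 1 + |ξ| ≤ 2 * (1 + ξ ^ 2) := by nlinarith [sq_abs ξ, sq_nonneg (|ξ| - 1), abs_nonneg ξ]
  calc _ ≤ 2 * (1 + ξ ^ 2) * (2 * ((1 + 1 / α) / (1 + ξ ^ 2) * m)) ^ 2 := by
        gcongr
        exact hF ξ
    _ = _ := by field_simp

end

section

/-! ### The boundary corrector as a Fourier synthesis -/

variable {α : ℝ}

/-- The Fourier transform of a real function, with complex values. -/
def ghat (g : ℝ → ℝ) : ℝ → ℂ := 𝓕 (fun t : ℝ => (g t : ℂ))

lemma continuous_ghat {g : ℝ → ℝ} (hg : Integrable g) : Continuous (ghat g) :=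
  continuous_fourier hg.ofReal

lemma exists_norm_ghat_le {g : ℝ → ℝ} : ∃ B, 0 ≤ B ∧ ∀ ξ, ‖ghat g ξ‖ ≤ B :=
  ⟨_, integral_nonneg fun _ => norm_nonneg _, fun ξ => norm_fourier_le ξ⟩

lemma integrable_greenMult (hα : 0 < α) {s : ℝ} (hs : 0 < s) :
    Integrable fun ξ => ((-(1 / (2 * α)) * exp (-(kap α ξ * s)) : ℝ) : ℂ) := by
  refine ((integrable_exp_kap hα hs).const_mul (-(1 / (2 * α)) : ℂ)).congr (.of_forall fun ξ => ?_)
  push_cast; ring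

lemma integrable_conv1_integrand (hα : 0 < α) {g : ℝ → ℝ} (hg : Integrable g) (t : ℝ) {s : ℝ} (hs : 0 < s) :
    Integrable (fun y : ℝ => g y * d2 (helmholtzGreen α) (t - y, s)) := by
  have hm := integrable_greenMult hα hs
  have hc := continuous_synth hm
  have e : ∀ y, d2 (helmholtzGreen α) (t - y, s)
      = (synth (fun ξ => ((-(1 / (2 * α)) * exp (-(kap α ξ * s)) : ℝ) : ℂ)) (t - y)).re := fun y => by
    rw [synth_exp_kap hα hs]; rfl
  simp_rw [e]
  refine hg.mul_bdd (c := ∫ ξ, ‖((-(1 / (2 * α)) * exp (-(kap α ξ * s)) : ℝ) : ℂ)‖)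
    (by fun_prop) (.of_forall fun y => ?_)
  exact (abs_re_le_norm _).trans (norm_synth_le _ _)

lemma conv1_eq_synth (hα : 0 < α) {g : ℝ → ℝ} (hg : Integrable g) (t : ℝ) {s : ℝ} (hs : 0 < s) :
    ((conv1 g (d2 (helmholtzGreen α)) (t, s) : ℝ) : ℂ)
      = synth (fun ξ => ghat g ξ * ((-(1 / (2 * α)) * exp (-(kap α ξ * s)) : ℝ) : ℂ)) t := by
  have hgc : Integrable fun t : ℝ => (g t : ℂ) := hg.ofReal
  rw [ghat, ← integral_mul_synth_sub hgc (integrable_greenMult hα hs) t, conv1, ← integral_complex_ofReal]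
  refine integral_ext fun y => ?_
  simp only
  rw [synth_exp_kap hα hs]
  push_cast
  rfl

/-- A kernel on the half-plane which is a Fourier multiplier in the first variable, with symbol
`m(ξ) e^{-|2πξ|x₂}` of first order. -/
structure IsPoissonKernel (η : ℝ × ℝ → ℝ) (m : ℝ → ℂ) : Prop where
  cont : Continuous m
  bound : ∃ B, 0 ≤ B ∧ ∀ ξ, ‖m ξ‖ ≤ B * (1 + |ξ|) ^ 1
  eq : ∀ σ > 0, ∀ t, synth (fun ξ => m ξ * ((exp (-(freq ξ * σ)) : ℝ) : ℂ)) t = ((η (t, σ) : ℝ) : ℂ)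
  int : ∀ σ > 0, Integrable fun t => η (t, σ)

lemma isPoissonKernel_eta1 : IsPoissonKernel eta1 (fun ξ => (π : ℂ) * (freq ξ : ℂ)) where
  cont := by have := continuous_freq; fun_prop
  bound := by
    refine ⟨π * (2 * π), by positivity, fun ξ => ?_⟩
    rw [norm_mul, norm_real, norm_real, norm_of_nonneg pi_pos.le,
      norm_of_nonneg (freq_nonneg ξ), freq, pow_one, mul_assoc π]
    have := pi_pos
    gcongr
    linarith
  eq := fun σ hσ t => synth_eta1 hσ t
  int := by
    intro σ hσ
    have hpi := pi_pos
    refine ((integrable_poisson hσ).1.const_mul (π / σ)).mono' ?_ (.of_forall fun t => ?_)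
    · exact Measurable.aestronglyMeasurable (by unfold eta1 normSq; fun_prop)
    · simp only [eta1, normSq]
      have h : 0 < t ^ 2 + σ ^ 2 := by positivity
      rw [norm_eq_abs, abs_div, abs_of_pos (pow_pos h 2), div_le_iff₀ (by positivity)]
      have e : π / σ * (σ / (π * (σ ^ 2 + t ^ 2))) * (t ^ 2 + σ ^ 2) ^ 2 = t ^ 2 + σ ^ 2 := by
        rw [add_comm (σ ^ 2)]; field_simp
      rw [e, abs_le]
      constructor <;> nlinarith [sq_nonneg t, sq_nonneg σ]

lemma isPoissonKernel_eta2 : IsPoissonKernel eta2 (fun ξ => (-(I * π / 2) : ℂ) * (2 * π * ξ : ℂ)) where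
  cont := by fun_prop
  bound := by
    have hpi := pi_pos
    refine ⟨π * π, by positivity, fun ξ => ?_⟩
    have : ‖(2 * π * ξ : ℂ)‖ = 2 * π * |ξ| := by
      rw [norm_mul, norm_mul]; simp [abs_of_pos hpi]
    rw [norm_mul, this, norm_neg, norm_div, norm_mul, norm_I, norm_real,
      norm_of_nonneg hpi.le, pow_one, Complex.norm_ofNat]
    nlinarith [mul_pos hpi hpi, abs_nonneg ξ]
  eq := fun σ hσ t => synth_eta2 hσ t
  int := by
    intro σ hσ
    have hpi := pi_pos
    refine ((integrable_poisson hσ).1.const_mul (π / σ)).mono' ?_ (.of_forall fun t => ?_)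
    · exact Measurable.aestronglyMeasurable (by unfold eta2 normSq; fun_prop)
    · simp only [eta2, normSq]
      have h : 0 < t ^ 2 + σ ^ 2 := by positivity
      rw [norm_eq_abs, abs_div, abs_of_pos (pow_pos h 2), div_le_iff₀ (by positivity)]
      have e : π / σ * (σ / (π * (σ ^ 2 + t ^ 2))) * (t ^ 2 + σ ^ 2) ^ 2 = t ^ 2 + σ ^ 2 := by
        rw [add_comm (σ ^ 2)]; field_simp
      rw [e, abs_le]
      constructor <;> nlinarith [sq_nonneg (t + σ), sq_nonneg (t - σ)]

lemma convH_integral (hα : 0 < α) {g : ℝ → ℝ} (hg : Integrable g) {η : ℝ × ℝ → ℝ} {m : ℝ → ℂ}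
    (hη : IsPoissonKernel η m) (t : ℝ) {s σ : ℝ} (hs : 0 < s) (hσ : 0 < σ) :
    Integrable (fun y : ℝ => conv1 g (d2 (helmholtzGreen α)) (y, s) * η (t - y, σ)) ∧
    ((∫ y : ℝ, conv1 g (d2 (helmholtzGreen α)) (y, s) * η (t - y, σ) : ℝ) : ℂ)
      = synth (fun ξ => m ξ * ((exp (-(freq ξ * σ)) : ℝ) : ℂ) * (ghat g ξ *
        ((-(1 / (2 * α)) * exp (-(kap α ξ * s)) : ℝ) : ℂ))) t := by
  obtain ⟨B, hB0, hB⟩ := hη.bound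
  obtain ⟨D, hD0, hD⟩ := exists_norm_ghat_le (g := g)
  set M : ℝ → ℂ := fun ξ => ghat g ξ * ((-(1 / (2 * α)) * exp (-(kap α ξ * s)) : ℝ) : ℂ) with hM
  have hMi : Integrable M := (integrable_greenMult hα hs).bdd_mul
    (continuous_ghat hg).aestronglyMeasurable (.of_forall hD)
  have e : ∀ y, conv1 g (d2 (helmholtzGreen α)) (y, s) = (synth M y).re := fun y => by
    rw [← conv1_eq_synth hα hg y hs]; rfl
  have hc := continuous_synth hMi
  have hsm : Integrable (synth (fun ξ => m ξ * ((exp (-(freq ξ * σ)) : ℝ) : ℂ))) := by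
    rw [funext (hη.eq σ hσ)]; exact (hη.int σ hσ).ofReal
  have hF := fourier_synth (integrable_mul_exp_freq hη.cont.aestronglyMeasurable hB hσ)
    (by have := hη.cont; have := continuous_freq; fun_prop) hsm
  rw [funext (hη.eq σ hσ)] at hF
  constructor
  · have h1 : Integrable fun y => η (t - y, σ) := (hη.int σ hσ).comp_sub_left t
    simp_rw [e]
    refine h1.bdd_mul (c := ∫ ξ, ‖M ξ‖) (by fun_prop) (.of_forall fun y => ?_)
    exact (abs_re_le_norm _).trans (norm_synth_le _ _)
  · have hηc : Integrable fun t : ℝ => (η (t, σ) : ℂ) := (hη.int σ hσ).ofReal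
    have h2 := integral_mul_synth_sub hηc hMi t
    rw [hF] at h2
    refine Eq.trans ?_ h2
    rw [← integral_complex_ofReal, ← integral_sub_left_eq_self _ _ t]
    refine integral_ext fun y => ?_
    rw [hM, ← conv1_eq_synth hα hg _ hs]
    push_cast
    rw [sub_sub_cancel, mul_comm]

/-- The iterated integral `(g ∗₁ ∂₂G_α) ⋆ η` converges absolutely and is a Fourier multiplier. -/
theorem convH_eq_synth (hα : 0 < α) {g : ℝ → ℝ} (hg : Integrable g) {η : ℝ × ℝ → ℝ} {m : ℝ → ℂ}
    (hη : IsPoissonKernel η m) {x : ℝ × ℝ} (hx : x ∈ halfPlane) :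
    ConvHConverges (conv1 g (d2 (helmholtzGreen α))) η x ∧
    ((convH (conv1 g (d2 (helmholtzGreen α))) η x : ℝ) : ℂ)
      = synth (fun ξ => ghat g ξ * ((-(1 / (2 * α)) : ℝ) : ℂ) * m ξ * (expConv α ξ x.2 : ℂ)) x.1 := by
  have hx2 : 0 < x.2 := hx
  obtain ⟨B, hB0, hB⟩ := hη.bound
  obtain ⟨D, hD0, hD⟩ := exists_norm_ghat_le (g := g)
  have hI := fun s (hs : s ∈ Ioo 0 x.2) => convH_integral hα hg hη x.1 hs.1 (sub_pos.2 hs.2)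
  set f : ℝ → ℝ → ℂ := fun s ξ => m ξ * ((exp (-(freq ξ * (x.2 - s))) : ℝ) : ℂ) * (ghat g ξ *
        ((-(1 / (2 * α)) * exp (-(kap α ξ * s)) : ℝ) : ℂ)) * cexp (2 * π * ξ * x.1 * I) with hf
  have hck := continuous_kap α
  have hcf := continuous_freq
  have hcm := hη.cont
  have hcg := continuous_ghat hg
  have hbi : Integrable fun ξ => (1 / (2 * α) * D) * (B * (1 + |ξ|) ^ 1 * exp (-(freq ξ * x.2))) := by
    have h := (integrable_mul_exp_freq (m := fun ξ : ℝ => ((B * (1 + |ξ|) ^ 1 : ℝ) : ℂ)) (n := 1) (B := B)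
      (by fun_prop) (fun ξ => by
        rw [norm_real, norm_of_nonneg (by positivity)]) hx2).re
    refine (h.const_mul (1 / (2 * α) * D)).congr (.of_forall fun ξ => ?_)
    simp only [← Complex.ofReal_mul]
    rfl
  have hfi : Integrable (uncurry f) ((volume.restrict (Ioo 0 x.2)).prod volume) := by
    refine Integrable.mono' ((integrable_const (μ := volume.restrict (Ioo 0 x.2)) (1 : ℝ)).mul_prod hbi)
      (Continuous.aestronglyMeasurable (by unfold uncurry; fun_prop)) ?_
    rw [← Measure.restrict_univ (μ := (volume : Measure ℝ)), Measure.prod_restrict,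
      ae_restrict_iff' (measurableSet_Ioo.prod MeasurableSet.univ)]
    refine .of_forall fun z hz => ?_
    have hz1 : z.1 ∈ Ioo 0 x.2 := hz.1
    simp only [uncurry, hf, one_mul]
    rw [norm_mul, norm_wave, mul_one, norm_mul, norm_mul, norm_mul, norm_real, norm_real,
      norm_of_nonneg (exp_pos _).le, norm_mul, norm_neg, norm_of_nonneg (exp_pos _).le,
      norm_of_nonneg (by positivity)]
    have h1 : exp (-(freq z.2 * (x.2 - z.1))) * exp (-(kap α z.2 * z.1)) ≤ exp (-(freq z.2 * x.2)) := by
      rw [← exp_add]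
      refine exp_le_exp.2 ?_
      nlinarith [mul_le_mul_of_nonneg_right (freq_le_kap hα z.2) hz1.1.le]
    calc _ = ‖m z.2‖ * ‖ghat g z.2‖ * (1 / (2 * α)) *
          (exp (-(freq z.2 * (x.2 - z.1))) * exp (-(kap α z.2 * z.1))) := by ring
      _ ≤ (B * (1 + |z.2|) ^ 1) * D * (1 / (2 * α)) * exp (-(freq z.2 * x.2)) := by
        gcongr
        · exact hB _
        · exact hD _
      _ = _ := by ring
  have hJ := hfi.integral_prod_left
  refine ⟨⟨fun s hs => (hI s hs).1, ?_⟩, ?_⟩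
  · rw [intervalIntegrable_iff_integrableOn_Ioo_of_le hx2.le]
    refine (hJ.re).congr ((ae_restrict_of_forall_mem measurableSet_Ioo fun s hs => ?_))
    change RCLike.re (synth _ x.1) = _
    rw [← (hI s hs).2]
    exact Complex.ofReal_re _
  · rw [convH, intervalIntegral.integral_of_le hx2.le, integral_Ioc_eq_integral_Ioo, ← integral_complex_ofReal]
    rw [setIntegral_congr_fun measurableSet_Ioo (g := fun s => ∫ ξ, f s ξ) (fun s hs => (hI s hs).2),
      integral_integral_swap hfi, synth]
    refine integral_ext fun ξ => ?_
    rw [← integral_Ioc_eq_integral_Ioo, ← intervalIntegral.integral_of_le hx2.le, ← integral_eq_expConv hα]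
    rw [← intervalIntegral.integral_ofReal, ← intervalIntegral.integral_const_mul,
      ← intervalIntegral.integral_mul_const]
    refine intervalIntegral.integral_congr fun s _ => ?_
    simp only [hf]
    push_cast
    ring

/-- The boundary corrector as a Fourier synthesis. -/
theorem boundaryPart_eq (hα : 0 < α) {g : ℝ → ℝ} (hg : Integrable g) {x : ℝ × ℝ} (hx : x ∈ halfPlane) :
    (((boundaryPart α g x).1 : ℝ) : ℂ) = synth (fun ξ => ghat g ξ *
      ((exp (-(kap α ξ * x.2)) - freq ξ * expConv α ξ x.2 : ℝ) : ℂ)) x.1 ∧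
    (((boundaryPart α g x).2 : ℝ) : ℂ) = synth (fun ξ => ghat g ξ * (-(2 * π * ξ * I)) *
      (expConv α ξ x.2 : ℂ)) x.1 := by
  have hx2 : 0 < x.2 := hx
  have hα' : (α : ℂ) ≠ 0 := by exact_mod_cast hα.ne'
  have hpi : (π : ℂ) ≠ 0 := by exact_mod_cast pi_ne_zero
  obtain ⟨D, hD0, hD⟩ := exists_norm_ghat_le (g := g)
  have h1 := (convH_eq_synth hα hg isPoissonKernel_eta1 hx).2
  have h2 := (convH_eq_synth hα hg isPoissonKernel_eta2 hx).2
  have h0 := conv1_eq_synth hα hg x.1 hx2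
  simp only [boundaryPart]
  push_cast
  constructor
  · change _ * ((conv1 g (d2 (helmholtzGreen α)) (x.1, x.2) : ℝ) : ℂ) + _ = _
    rw [h0, h1]
    unfold synth
    have hi0 : Integrable (fun ξ => ghat g ξ * ((-(1 / (2 * α)) * exp (-(kap α ξ * x.2)) : ℝ) : ℂ)) :=
      (integrable_greenMult hα hx2).bdd_mul (continuous_ghat hg).aestronglyMeasurable (.of_forall hD)
    have hi1 : Integrable (fun ξ => ghat g ξ * ((-(1 / (2 * α)) : ℝ) : ℂ) * ((π : ℂ) * (freq ξ : ℂ)) *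
        (expConv α ξ x.2 : ℂ)) := by
      have hb := ((integrable_freq_mul_exp hx2 (π : ℂ)).1.norm.const_mul (D * (1 / (2 * α)) * x.2))
      have := continuous_ghat hg
      have := continuous_freq
      have hE : Continuous fun ξ => expConv α ξ x.2 :=
        (continuous_expConv α).comp (by fun_prop : Continuous fun ξ : ℝ => (ξ, x.2))
      refine hb.mono' (by fun_prop) (.of_forall fun ξ => ?_)
      rw [norm_mul, norm_mul, norm_mul, norm_mul _ ((exp _ : ℝ) : ℂ), norm_real (expConv _ _ _),
        norm_of_nonneg (expConv_nonneg hα ξ hx2.le), norm_real (-_), norm_neg,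
        norm_of_nonneg (by positivity), norm_real (exp _), norm_of_nonneg (exp_pos _).le]
      calc _ ≤ D * (1 / (2 * α)) * ‖(π : ℂ) * (freq ξ : ℂ)‖ * (x.2 * exp (-(freq ξ * x.2))) := by
            gcongr
            · exact expConv_nonneg hα ξ hx2.le
            · exact hD ξ
            · exact expConv_le hα ξ hx2.le
        _ = _ := by ring
    rw [← integral_const_mul, ← integral_const_mul, ← integral_add
      ((integrable_mul_wave hi0 _).const_mul _) ((integrable_mul_wave hi1 _).const_mul _)]
    refine integral_ext fun ξ => ?_
    simp only
    push_cast
    field_simp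
    ring
  · rw [h2]
    unfold synth
    rw [← integral_const_mul]
    refine integral_ext fun ξ => ?_
    simp only
    push_cast
    field_simp
    ring

end

section

/-! ### Duality and Plancherel's inequality for Fourier synthesis -/

lemma integral_mul_synth_comm {f m : ℝ → ℂ} (hf : Integrable f) (hm : Integrable m) :
    ∫ t, f t * synth m t = ∫ ξ, m ξ * synth f ξ := by
  have hi : Integrable (uncurry fun (t ξ : ℝ) => f t * (m ξ *
      cexp (2 * π * ξ * t * I))) (volume.prod volume) := by
    have h := hf.mul_prod hm
    have hb := h.mul_bdd (c := 1) (g := fun z : ℝ × ℝ =>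
      cexp (2 * π * z.2 * z.1 * I))
      (by fun_prop) (.of_forall fun z => (norm_wave _ _).le)
    refine hb.congr (.of_forall fun z => ?_)
    simp only [uncurry]
    ring
  calc ∫ t, f t * synth m t = ∫ t, ∫ ξ, f t * (m ξ * cexp (2 * π * ξ * t * I)) := by
        simp only [synth, ← integral_const_mul]
    _ = ∫ ξ, ∫ t, f t * (m ξ * cexp (2 * π * ξ * t * I)) :=
        integral_integral_swap hi
    _ = _ := by
        refine integral_ext fun ξ => ?_
        simp only [synth]
        rw [← integral_const_mul]
        refine integral_ext fun t => ?_
        have : (2 * π * ξ * t * I : ℂ) = 2 * π * t * ξ * I := by ring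
        rw [this]; ring

lemma synth_ae_eq_fourierInv {m : ℝ → ℂ} (hm : Integrable m) (hm2 : MemLp m 2) :
    synth m =ᵐ[volume] (𝓕⁻ (hm2.toLp m) : Lp (α := ℝ) ℂ 2 volume) := by
  set F : Lp (α := ℝ) ℂ 2 volume := 𝓕⁻ (hm2.toLp m) with hF
  refine ae_eq_of_integral_contDiff_smul_eq (continuous_synth hm).locallyIntegrable
    ((Lp.memLp F).locallyIntegrable (by norm_num)) fun g hg hgc => ?_
  have hg1 : HasCompactSupport (fun t : ℝ => (g t : ℂ)) := hgc.comp_left (g := fun r : ℝ => (r : ℂ)) (by simp)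
  have hg2 : ContDiff ℝ ∞ (fun t : ℝ => (g t : ℂ)) := ofRealCLM.contDiff.comp hg
  set G := hg1.toSchwartzMap hg2 with hG
  have hGi : Integrable (fun t : ℝ => (g t : ℂ)) := hg2.continuous.integrable_of_hasCompactSupport hg1
  have h1 : ∫ t, (g t : ℂ) * F t = ∫ t, 𝓕⁻ G t * (hm2.toLp m) t := by
    have h := congrArg (fun T => T G) (Lp.fourierInv_toTemperedDistribution_eq (hm2.toLp m))
    rw [TemperedDistribution.fourierInv_apply, Lp.toTemperedDistribution_apply,
      Lp.toTemperedDistribution_apply] at h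
    exact h.symm
  have h2 : ∫ t, 𝓕⁻ G t * (hm2.toLp m) t = ∫ t, m t * synth (fun t : ℝ => (g t : ℂ)) t := by
    refine integral_congr_ae ?_
    filter_upwards [hm2.coeFn_toLp] with t ht
    rw [ht, mul_comm, synth_eq_fourierInv, SchwartzMap.fourierInv_coe]
    rfl
  have h3 := integral_mul_synth_comm hGi hm
  simp only [Complex.real_smul]
  rw [h1, h2, h3]

/-- Plancherel's theorem. -/
lemma integral_sq_synth {m : ℝ → ℂ} (hm : Integrable m) (hm2 : Integrable fun ξ => ‖m ξ‖ ^ 2) :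
    Integrable (fun t => ‖synth m t‖ ^ 2) ∧ ∫ t, ‖synth m t‖ ^ 2 = ∫ ξ, ‖m ξ‖ ^ 2 := by
  have hL : MemLp m 2 := (memLp_two_iff_integrable_sq_norm hm.1).2 hm2
  have he := synth_ae_eq_fourierInv hm hL
  set F : Lp (α := ℝ) ℂ 2 volume := 𝓕⁻ (hL.toLp m) with hF
  have hS : MemLp (synth m) 2 := (memLp_congr_ae he).2 (Lp.memLp F)
  refine ⟨(memLp_two_iff_integrable_sq_norm hS.1).1 hS, ?_⟩
  have hn : ‖F‖ = ‖hL.toLp m‖ := by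
    rw [← Lp.norm_fourier_eq F, hF, FourierTransform.fourier_fourierInv_eq]
  have e : ∀ G : Lp (α := ℝ) ℂ 2 volume, ‖G‖ ^ 2 = ∫ t, ‖G t‖ ^ 2 := by
    intro G
    have h := L2.inner_def (𝕜 := ℂ) G G
    rw [inner_self_eq_norm_sq_to_K] at h
    simp_rw [inner_self_eq_norm_sq_to_K] at h
    have h2 : ((‖G‖ ^ 2 : ℝ) : ℂ) = ((∫ t, ‖G t‖ ^ 2 : ℝ) : ℂ) := by
      rw [← integral_complex_ofReal]
      push_cast
      exact h
    exact_mod_cast h2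
  have h1 : ∫ t, ‖synth m t‖ ^ 2 = ∫ t, ‖F t‖ ^ 2 := integral_congr_ae (by
    filter_upwards [he] with t ht; rw [ht])
  have h2 : ∫ t, ‖m t‖ ^ 2 = ∫ t, ‖(hL.toLp m) t‖ ^ 2 := integral_congr_ae (by
    filter_upwards [hL.coeFn_toLp] with t ht; rw [ht])
  rw [h1, h2, ← e, ← e, hn]

/-! ### Slices of test functions -/

variable {φ : ℝ × ℝ → ℝ}

lemma IsTest.integrable_slice (hφ : IsTest φ) (s : ℝ) : Integrable fun t : ℝ => (φ (t, s) : ℂ) :=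
  ((hφ.boundary s).1.integrable_of_hasCompactSupport (hφ.boundary s).2).ofReal

lemma synth_slice_d1 (hφ : IsTest φ) (s ξ : ℝ) :
    synth (fun t : ℝ => (d1 φ (t, s) : ℂ)) ξ = -(2 * π * ξ * I) * synth (fun t : ℝ => (φ (t, s) : ℂ)) ξ := by
  have hd : ∀ t, HasDerivAt (fun t : ℝ => (φ (t, s) : ℂ)) ((d1 φ (t, s) : ℝ) : ℂ) t := fun t =>
    (smooth_hasDerivAt_d1 hφ.1 t s).ofReal_comp
  have h := Real.fourier_deriv (f := fun t : ℝ => (φ (t, s) : ℂ)) (hφ.integrable_slice s)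
    (fun t => (hd t).differentiableAt) (by rw [deriv_eq hd]; exact hφ.d1.integrable_slice s)
  rw [deriv_eq hd] at h
  have h2 := congrFun h (-ξ)
  rw [synth_eq_fourierInv, synth_eq_fourierInv, fourierInv_eq_fourier_neg, fourierInv_eq_fourier_neg, h2]
  simp only [smul_eq_mul]
  push_cast
  ring

lemma IsTest.exists_slice_bound (hφ : IsTest φ) : ∃ C, 0 ≤ C ∧ ∀ s, ∫ t : ℝ, ‖(φ (t, s) : ℂ)‖ ≤ C := by
  obtain ⟨R, hR, h⟩ := hφ.exists_radius
  obtain ⟨D, hD, hb⟩ := hφ.exists_bound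
  refine ⟨2 * R * D, by positivity, fun s => ?_⟩
  have h1 : ∫ t : ℝ, ‖(φ (t, s) : ℂ)‖ = ∫ t in Icc (-R) R, ‖(φ (t, s) : ℂ)‖ := by
    refine (setIntegral_eq_integral_of_forall_compl_eq_zero fun t ht => ?_).symm
    have : φ (t, s) = 0 := h _ (by
      have h2 := abs_fst_le_rad (t, s)
      have h3 : R < |t| := by
        by_contra hn; exact ht (abs_le.1 (not_lt.1 hn))
      exact h3.le.trans h2)
    simp [this]
  rw [h1]
  have h2 := setIntegral_mono (μ := volume) (s := Icc (-R) R) (hφ.integrable_slice s).norm.integrableOn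
    (g := fun _ => D) (by simp) (fun t => by
      simp only [norm_real]; exact hb _)
  refine h2.trans (le_of_eq ?_)
  rw [setIntegral_const, smul_eq_mul, Real.volume_real_Icc_of_le (by linarith)]
  ring

lemma IsTest.exists_synth_slice_le (hφ : IsTest φ) : ∃ C, 0 ≤ C ∧ ∀ s ξ,
    ‖synth (fun t : ℝ => (φ (t, s) : ℂ)) ξ‖ ≤ C * (1 + ξ ^ 2)⁻¹ := by
  obtain ⟨C, hC, h⟩ := hφ.exists_slice_bound
  obtain ⟨C', hC', h'⟩ := hφ.d1.d1.exists_slice_bound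
  refine ⟨C + C', by positivity, fun s ξ => ?_⟩
  have h1 := (norm_synth_le (fun t : ℝ => (φ (t, s) : ℂ)) ξ).trans (h s)
  have h2 := (norm_synth_le (fun t : ℝ => (AlphaEuler.d1 (AlphaEuler.d1 φ) (t, s) : ℂ)) ξ).trans (h' s)
  rw [synth_slice_d1 hφ.d1, synth_slice_d1 hφ, ← mul_assoc, norm_mul] at h2
  set N := ‖synth (fun t : ℝ => (φ (t, s) : ℂ)) ξ‖ with hN
  have h0 : 0 ≤ N := norm_nonneg _
  have h3 : ‖(-(2 * π * ξ * I) * -(2 * π * ξ * I) : ℂ)‖ = (2 * π) ^ 2 * ξ ^ 2 := by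
    rw [norm_mul, norm_neg, norm_mul, norm_mul, norm_mul, norm_I, norm_real, norm_real,
      Complex.norm_ofNat, norm_of_nonneg pi_pos.le, norm_eq_abs]
    rw [← sq_abs ξ]
    ring
  rw [h3] at h2
  rw [← div_eq_mul_inv, le_div_iff₀ (by positivity)]
  have h9 : 1 ≤ (2 * π) ^ 2 := by nlinarith [pi_gt_three]
  have h4 : N * ξ ^ 2 ≤ (2 * π) ^ 2 * ξ ^ 2 * N := by
    nlinarith [mul_nonneg h0 (sq_nonneg ξ)]
  linarith

/-- Fourier representation of the pairing of an integrable function with a test function. -/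
lemma integral_mul_slice (hφ : IsTest φ) (s : ℝ) {g : ℝ → ℝ} (hg : Integrable g) :
    ((∫ t, g t * φ (t, s) : ℝ) : ℂ) = ∫ ξ, ghat g ξ * synth (fun t : ℝ => (φ (t, s) : ℂ)) ξ := by
  obtain ⟨C, hC, hb⟩ := hφ.exists_synth_slice_le
  have hφi := hφ.integrable_slice s
  have hsi : Integrable (synth (fun t : ℝ => (φ (t, s) : ℂ))) :=
    (integrable_inv_one_add_sq.const_mul C).mono' (continuous_synth hφi).aestronglyMeasurable
      (.of_forall fun ξ => hb s ξ)
  have hF := fourier_synth hφi (Complex.continuous_ofReal.comp (hφ.boundary s).1) hsi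
  have h1 : ∀ t : ℝ, (φ (t, s) : ℂ) = synth (fun ξ => synth (fun t : ℝ => (φ (t, s) : ℂ)) (-ξ)) t := by
    intro t
    have h2 := congrFun hF t
    rw [fourier_eq_integral] at h2
    rw [← h2, synth, ← integral_neg_eq_self]
    refine integral_ext fun ξ => ?_
    rw [mul_comm]
    congr 2
    push_cast; ring
  have hgc : Integrable fun t : ℝ => (g t : ℂ) := hg.ofReal
  rw [← integral_complex_ofReal]
  have h3 := integral_mul_synth_comm hgc (m := fun ξ => synth (fun t : ℝ => (φ (t, s) : ℂ)) (-ξ)) hsi.comp_neg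
  refine Eq.trans ?_ (h3.trans ?_)
  · refine integral_ext fun t => ?_
    rw [← h1]; push_cast; rfl
  · rw [← integral_neg_eq_self]
    refine integral_ext fun ξ => ?_
    rw [neg_neg, mul_comm, ghat, synth_eq_fourierInv, fourierInv_eq_fourier_neg, neg_neg]

end

section

/-! ### Superpositions of the modes `e^{-κx₂}` and `∫₀^{x₂} e^{-κt - k(x₂-t)} dt` -/

variable {α : ℝ} {A B A' B' : ℝ → ℂ}

/-- Measurable functions of polynomial growth. -/
def IsAmplitude (A : ℝ → ℂ) : Prop :=
  Measurable A ∧ ∃ (C : ℝ) (n : ℕ), 0 ≤ C ∧ ∀ ξ, ‖A ξ‖ ≤ C * (1 + |ξ|) ^ n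

lemma IsAmplitude.add (hA : IsAmplitude A) (hB : IsAmplitude B) : IsAmplitude fun ξ => A ξ + B ξ := by
  obtain ⟨mA, C, n, hC, h⟩ := hA
  obtain ⟨mB, C', n', hC', h'⟩ := hB
  refine ⟨mA.add mB, C + C', n + n', by positivity, fun ξ => (norm_add_le _ _).trans ?_⟩
  have h1 : (1 : ℝ) ≤ 1 + |ξ| := by linarith [abs_nonneg ξ]
  have h2 := h ξ
  have h3 := h' ξ
  calc _ ≤ C * (1 + |ξ|) ^ n + C' * (1 + |ξ|) ^ n' := add_le_add h2 h3
    _ ≤ C * (1 + |ξ|) ^ (n + n') + C' * (1 + |ξ|) ^ (n + n') := by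
      gcongr <;> first | exact h1 | omega
    _ = _ := by ring

lemma IsAmplitude.mul (hA : IsAmplitude A) (hB : IsAmplitude B) : IsAmplitude fun ξ => A ξ * B ξ := by
  obtain ⟨mA, C, n, hC, h⟩ := hA
  obtain ⟨mB, C', n', hC', h'⟩ := hB
  refine ⟨mA.mul mB, C * C', n + n', by positivity, fun ξ => ?_⟩
  rw [norm_mul]
  calc _ ≤ (C * (1 + |ξ|) ^ n) * (C' * (1 + |ξ|) ^ n') :=
        mul_le_mul (h ξ) (h' ξ) (norm_nonneg _) (by positivity)
    _ = _ := by ring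

lemma IsAmplitude.const (c : ℂ) : IsAmplitude fun _ => c :=
  ⟨measurable_const, ‖c‖, 0, norm_nonneg _, fun ξ => by simp⟩

lemma IsAmplitude.neg (hA : IsAmplitude A) : IsAmplitude fun ξ => -A ξ := by
  simpa using (IsAmplitude.const (-1)).mul hA

lemma isAmplitude_id : IsAmplitude fun ξ => (ξ : ℂ) :=
  ⟨by fun_prop, 1, 1, zero_le_one, fun ξ => by simp⟩

lemma isAmplitude_freq : IsAmplitude fun ξ => (freq ξ : ℂ) := by
  have := continuous_freq.measurable
  refine ⟨by fun_prop, 2 * π, 1, by positivity, fun ξ => ?_⟩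
  rw [norm_real, norm_of_nonneg (freq_nonneg ξ), freq, pow_one]
  have := pi_pos
  gcongr
  linarith

lemma kap_le_freq_add (hα : 0 < α) (ξ : ℝ) : kap α ξ ≤ freq ξ + (1 + 1 / α) := by
  have h1 := kap_sq hα ξ
  have h2 := freq_nonneg ξ
  have h3 : 0 < 1 / α := by positivity
  refine abs_le_of_sq_le_sq' ?_ (by positivity) |>.2
  nlinarith [mul_nonneg h2 h3.le]

lemma isAmplitude_kap (hα : 0 < α) : IsAmplitude fun ξ => (kap α ξ : ℂ) := by
  have := (continuous_kap α).measurable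
  have hpi := pi_pos
  have h3 : 0 < 1 / α := by positivity
  refine ⟨by fun_prop, 2 * π + (1 + 1 / α), 1, by positivity, fun ξ => ?_⟩
  rw [norm_real, norm_of_nonneg (kap_pos hα ξ).le, pow_one]
  refine (kap_le_freq_add hα ξ).trans ?_
  unfold freq
  nlinarith [abs_nonneg ξ, mul_nonneg h3.le (abs_nonneg ξ)]

lemma IsAmplitude.of_bounded (hm : Measurable A) {C : ℝ} (h : ∀ ξ, ‖A ξ‖ ≤ C) : IsAmplitude A :=
  ⟨hm, C, 0, (norm_nonneg _).trans (h 0), fun ξ => by simpa using h ξ⟩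

/-- The amplitude at height `s` of a superposition of modes. -/
def modeAmp (α : ℝ) (A B : ℝ → ℂ) (s ξ : ℝ) : ℂ :=
  A ξ * ((exp (-(kap α ξ * s)) : ℝ) : ℂ) + B ξ * (expConv α ξ s : ℂ)

/-- The superposition of modes with amplitudes `A`, `B`. -/
def mode (α : ℝ) (A B : ℝ → ℂ) (x : ℝ × ℝ) : ℝ := (synth (modeAmp α A B x.2) x.1).re

lemma measurable_modeAmp (hA : IsAmplitude A) (hB : IsAmplitude B) :
    Measurable fun p : ℝ × ℝ => modeAmp α A B p.1 p.2 := by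
  have h1 := (continuous_kap α).measurable
  have h2 : Measurable fun p : ℝ × ℝ => expConv α p.2 p.1 :=
    ((continuous_expConv α).comp (by fun_prop : Continuous fun p : ℝ × ℝ => (p.2, p.1))).measurable
  have h3 := hA.1
  have h4 := hB.1
  unfold modeAmp
  fun_prop

lemma exists_modeAmp_bound (hα : 0 < α) (hA : IsAmplitude A) (hB : IsAmplitude B) {s₀ : ℝ} (hs₀ : 0 < s₀)
    (S : ℝ) : ∃ b : ℝ → ℝ, Integrable b ∧ ∀ s, s₀ ≤ s → s ≤ S → ∀ ξ, ‖modeAmp α A B s ξ‖ ≤ b ξ := by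
  obtain ⟨mA, C, n, hC, h⟩ := hA
  obtain ⟨mB, C', n', hC', h'⟩ := hB
  have key : ∀ {A : ℝ → ℂ} {C : ℝ} {n : ℕ}, Measurable A → (∀ ξ, ‖A ξ‖ ≤ C * (1 + |ξ|) ^ n) →
      Integrable fun ξ => ‖A ξ‖ * exp (-(freq ξ * s₀)) := by
    intro A C n mA h
    refine (integrable_mul_exp_freq mA.aestronglyMeasurable h hs₀).norm.congr (.of_forall fun ξ => ?_)
    simp only
    rw [norm_mul, norm_real, norm_of_nonneg (exp_pos _).le]
  refine ⟨fun ξ => ‖A ξ‖ * exp (-(freq ξ * s₀)) + S * (‖B ξ‖ * exp (-(freq ξ * s₀))),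
    (key mA h).add ((key mB h').const_mul S), fun s hs hS ξ => ?_⟩
  have hs0 : 0 < s := hs₀.trans_le hs
  have e1 : exp (-(kap α ξ * s)) ≤ exp (-(freq ξ * s₀)) := exp_le_exp.2 (by
    have := freq_le_kap hα ξ
    have := freq_nonneg ξ
    have := kap_pos hα ξ
    nlinarith)
  have e2 : expConv α ξ s ≤ S * exp (-(freq ξ * s₀)) := by
    refine (expConv_le hα ξ hs0.le).trans ?_
    have : exp (-(freq ξ * s)) ≤ exp (-(freq ξ * s₀)) := exp_le_exp.2 (by
      have := freq_nonneg ξ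
      nlinarith)
    gcongr
    exact hs0.le.trans hS
  refine (norm_add_le _ _).trans ?_
  rw [norm_mul, norm_mul, norm_real, norm_real, norm_of_nonneg (exp_pos _).le,
    norm_of_nonneg (expConv_nonneg hα ξ hs0.le)]
  have := mul_le_mul_of_nonneg_left e1 (norm_nonneg (A ξ))
  have := mul_le_mul_of_nonneg_left e2 (norm_nonneg (B ξ))
  linarith

lemma integrable_modeAmp (hα : 0 < α) (hA : IsAmplitude A) (hB : IsAmplitude B) {s : ℝ} (hs : 0 < s) :
    Integrable (modeAmp α A B s) := by
  obtain ⟨b, hb, h⟩ := exists_modeAmp_bound hα hA hB hs s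
  exact hb.mono' ((measurable_modeAmp hA hB).comp (by fun_prop : Measurable fun ξ : ℝ => (s, ξ))).aestronglyMeasurable
    (.of_forall (h s le_rfl le_rfl))

lemma hasDerivAt_modeAmp (hα : 0 < α) (s ξ : ℝ) : HasDerivAt (fun s => modeAmp α A B s ξ)
    (modeAmp α (fun ξ => -((kap α ξ : ℂ) * A ξ) + B ξ) (fun ξ => -((freq ξ : ℂ) * B ξ)) s ξ) s := by
  have h1 : HasDerivAt (fun s => exp (-(kap α ξ * s))) (exp (-(kap α ξ * s)) * -(kap α ξ * 1)) s :=
    (((hasDerivAt_id s).const_mul (kap α ξ)).fun_neg).exp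
  have h2 := (hasDerivAt_expConv hα ξ s).ofReal_comp
  convert! (h1.ofReal_comp.const_mul (A ξ)).add (h2.const_mul (B ξ)) using 1
  simp only [modeAmp]
  push_cast
  ring

lemma isAmplitude_d1 (hA : IsAmplitude A) : IsAmplitude fun ξ => (2 * π * ξ * I) * A ξ := by
  have := ((IsAmplitude.const (2 * π * I)).mul isAmplitude_id).mul hA
  refine ⟨?_, ?_⟩
  · have := hA.1; fun_prop
  · obtain ⟨-, C, n, hC, h⟩ := this
    refine ⟨C, n, hC, fun ξ => ?_⟩
    beta_reduce
    rw [show (2 * π * ξ * I) * A ξ = 2 * π * I * ξ * A ξ by ring]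
    exact h ξ

lemma isAmplitude_d2 (hα : 0 < α) (hA : IsAmplitude A) (hB : IsAmplitude B) :
    IsAmplitude (fun ξ => -((kap α ξ : ℂ) * A ξ) + B ξ) ∧ IsAmplitude (fun ξ => -((freq ξ : ℂ) * B ξ)) :=
  ⟨((isAmplitude_kap hα).mul hA).neg.add hB, (isAmplitude_freq.mul hB).neg⟩

lemma hasDerivAt_mode_d1 (hα : 0 < α) (hA : IsAmplitude A) (hB : IsAmplitude B) (t : ℝ) {s : ℝ} (hs : 0 < s) :
    HasDerivAt (fun t => mode α A B (t, s))
      (mode α (fun ξ => (2 * π * ξ * I) * A ξ) (fun ξ => (2 * π * ξ * I) * B ξ) (t, s)) t := by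
  have hi := integrable_modeAmp hα (isAmplitude_d1 hA) (isAmplitude_d1 hB) hs
  have e : ∀ ξ, modeAmp α (fun ξ => (2 * π * ξ * I) * A ξ) (fun ξ => (2 * π * ξ * I) * B ξ) s ξ
      = modeAmp α A B s ξ * (2 * π * ξ * I) := fun ξ => by simp only [modeAmp]; ring
  have hm := ((measurable_modeAmp (α := α) hA hB).comp (by fun_prop : Measurable fun ξ : ℝ => (s, ξ)))
  have h := hasDerivAt_integral_of_dominated_loc_of_deriv_le (μ := (volume : Measure ℝ)) (x₀ := t) (s := univ)
    (F := fun (t : ℝ) ξ => modeAmp α A B s ξ * cexp (2 * π * ξ * t * I))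
    (F' := fun (t : ℝ) ξ => modeAmp α A B s ξ * (cexp (2 * π * ξ * t * I) * (2 * π * ξ * I)))
    (bound := fun ξ => ‖modeAmp α A B s ξ * (2 * π * ξ * I)‖)
    univ_mem (.of_forall fun t => (integrable_mul_wave (integrable_modeAmp hα hA hB hs) t).1)
    (integrable_mul_wave (integrable_modeAmp hα hA hB hs) t)
    (hm.mul (by fun_prop)).aestronglyMeasurable
    (.of_forall fun ξ t _ => by rw [norm_mul, norm_mul, norm_wave, one_mul, ← norm_mul])
    (by simp_rw [← e]; exact hi.norm)
    (.of_forall fun ξ t _ => by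
      have h1 : HasDerivAt (fun t : ℝ => (t : ℂ)) 1 t := ofRealCLM.hasDerivAt
      have h2 : HasDerivAt (fun t : ℝ => (2 * π * ξ * t * I : ℂ)) (2 * π * ξ * I) t := by
        convert! (h1.const_mul (2 * π * ξ : ℂ)).mul_const I using 1; ring
      exact h2.cexp.const_mul _)
  have h3 := reCLM.hasFDerivAt.comp_hasDerivAt t h.2
  convert! h3 using 1
  simp only [mode, synth, e, Complex.reCLM_apply]
  congr 1
  refine integral_ext fun ξ => ?_
  ring

lemma hasDerivAt_mode_d2 (hα : 0 < α) (hA : IsAmplitude A) (hB : IsAmplitude B) (t : ℝ) {s : ℝ} (hs : 0 < s) :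
    HasDerivAt (fun s => mode α A B (t, s))
      (mode α (fun ξ => -((kap α ξ : ℂ) * A ξ) + B ξ) (fun ξ => -((freq ξ : ℂ) * B ξ)) (t, s)) s := by
  obtain ⟨hA', hB'⟩ := isAmplitude_d2 hα hA hB
  obtain ⟨b, hb, hbd⟩ := exists_modeAmp_bound hα hA' hB' (half_pos hs) (2 * s)
  have hm := ((measurable_modeAmp (α := α) hA' hB').comp (by fun_prop : Measurable fun ξ : ℝ => (s, ξ)))
  have h := hasDerivAt_integral_of_dominated_loc_of_deriv_le (μ := (volume : Measure ℝ)) (x₀ := s)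
    (s := Icc (s / 2) (2 * s))
    (F := fun s ξ => modeAmp α A B s ξ * cexp (2 * π * ξ * t * I))
    (F' := fun s ξ => modeAmp α (fun ξ => -((kap α ξ : ℂ) * A ξ) + B ξ) (fun ξ => -((freq ξ : ℂ) * B ξ)) s ξ *
      cexp (2 * π * ξ * t * I))
    (bound := b)
    (Icc_mem_nhds (by linarith) (by linarith))
    (by
      filter_upwards [lt_mem_nhds hs] with s hs
      exact (integrable_mul_wave (integrable_modeAmp hα hA hB hs) t).1)
    (integrable_mul_wave (integrable_modeAmp hα hA hB hs) t)
    (hm.mul (by fun_prop)).aestronglyMeasurable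
    (.of_forall fun ξ s' hs' => by rw [norm_mul, norm_wave, mul_one]; exact hbd s' hs'.1 hs'.2 ξ) hb
    (.of_forall fun ξ s' _ => (hasDerivAt_modeAmp hα s' ξ).mul_const _)
  exact reCLM.hasFDerivAt.comp_hasDerivAt s h.2

lemma continuousOn_mode (hα : 0 < α) (hA : IsAmplitude A) (hB : IsAmplitude B) :
    ContinuousOn (mode α A B) halfPlane := by
  intro x hx
  have hs : 0 < x.2 := hx
  obtain ⟨b, hb, hbd⟩ := exists_modeAmp_bound hα hA hB (half_pos hs) (2 * x.2)
  have hn : {y : ℝ × ℝ | y.2 ∈ Icc (x.2 / 2) (2 * x.2)} ∈ 𝓝 x :=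
    continuous_snd.continuousAt.preimage_mem_nhds (Icc_mem_nhds (by linarith) (by linarith))
  have h : ContinuousAt (fun y : ℝ × ℝ => ∫ ξ, modeAmp α A B y.2 ξ * cexp (2 * π * ξ * y.1 * I)) x := by
    refine continuousAt_of_dominated (bound := b) ?_ ?_ hb (.of_forall fun ξ => ?_)
    · filter_upwards [hn] with y hy
      exact (integrable_mul_wave (integrable_modeAmp hα hA hB ((half_pos hs).trans_le hy.1)) y.1).1
    · filter_upwards [hn] with y hy
      refine .of_forall fun ξ => ?_
      rw [norm_mul, norm_wave, mul_one]
      exact hbd _ hy.1 hy.2 ξ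
    · have hE : Continuous fun s => modeAmp α A B s ξ := by
        have : Continuous fun s => expConv α ξ s :=
          (continuous_expConv α).comp (by fun_prop : Continuous fun s : ℝ => (ξ, s))
        unfold modeAmp
        fun_prop
      fun_prop
  exact (Complex.continuous_re.continuousAt.comp h).continuousWithinAt

/-! ### Square integrability -/

lemma expConv_le' (hα : 0 < α) (ξ : ℝ) {s : ℝ} (hs : 0 ≤ s) :
    expConv α ξ s ≤ 2 / kap α ξ * exp (-(freq ξ * s / 2)) := by
  have hK := kap_pos hα ξ
  have hk := freq_nonneg ξ
  have hkK := freq_le_kap hα ξ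
  have h1 : ∀ t ∈ uIcc 0 s, HasDerivAt (fun t => -(2 / kap α ξ) * exp (-(kap α ξ / 2 * t)) * exp (-(freq ξ * s / 2)))
      (exp (-(kap α ξ / 2 * t)) * exp (-(freq ξ * s / 2))) t := by
    intro t _
    have e1 : HasDerivAt (fun t => exp (-(kap α ξ / 2 * t))) (exp (-(kap α ξ / 2 * t)) * -(kap α ξ / 2 * 1)) t :=
      (((hasDerivAt_id t).const_mul _).fun_neg).exp
    convert! (e1.const_mul (-(2 / kap α ξ))).mul_const (exp (-(freq ξ * s / 2))) using 1
    field_simp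
  have h2 := intervalIntegral.integral_eq_sub_of_hasDerivAt h1 (Continuous.intervalIntegrable (by fun_prop) _ _)
  rw [← integral_eq_expConv hα]
  refine (intervalIntegral.integral_mono_on hs (Continuous.intervalIntegrable (by fun_prop) _ _)
    (Continuous.intervalIntegrable (by fun_prop) _ _) (g := fun t => exp (-(kap α ξ / 2 * t)) * exp (-(freq ξ * s / 2)))
    fun t ht => ?_).trans ?_
  · rw [← exp_add, ← exp_add]
    refine exp_le_exp.2 ?_
    nlinarith [mul_le_mul_of_nonneg_right hkK ht.1, mul_le_mul_of_nonneg_left ht.2 hk]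
  · rw [h2]
    have : 0 ≤ 2 / kap α ξ * exp (-(kap α ξ / 2 * s)) * exp (-(freq ξ * s / 2)) := by positivity
    simp only [mul_zero, neg_zero, exp_zero]
    linarith

/-- The square integral in `s` of `a e^{-cs}`. -/
lemma lintegral_sq_exp_le {a c : ℝ} (hc : 0 < c) :
    ∫⁻ s in Ioi (0 : ℝ), ofReal (a * exp (-(c * s))) ≤ ofReal (a / c) := by
  rcases le_or_gt a 0 with ha | ha
  · refine le_of_eq_of_le ?_ zero_le
    refine (lintegral_congr fun s => ENNReal.ofReal_of_nonpos ?_).trans lintegral_zero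
    exact mul_nonpos_of_nonpos_of_nonneg ha (exp_pos _).le
  have hi := (integrableOn_exp_mul_Ioi (neg_neg_of_pos hc) 0).const_mul a
  have e : ∀ s : ℝ, -c * s = -(c * s) := fun s => by ring
  simp_rw [e] at hi
  rw [← ofReal_integral_eq_lintegral_ofReal hi (.of_forall fun s => by positivity), integral_const_mul]
  have h := integral_exp_mul_Ioi (neg_neg_of_pos hc) 0
  simp_rw [e] at h
  rw [h]
  refine ofReal_le_ofReal (le_of_eq ?_)
  simp
  field_simp

lemma norm_modeAmp_sq_le (hα : 0 < α) {D s : ℝ} (hs : 0 < s) {ξ : ℝ}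
    (hA : ‖A ξ‖ ≤ D * kap α ξ) (hB : ‖B ξ‖ ≤ D * (freq ξ * kap α ξ)) :
    ‖modeAmp α A B s ξ‖ ^ 2 ≤ 2 * D ^ 2 * kap α ξ ^ 2 * exp (-(2 * kap α ξ * s))
      + 8 * D ^ 2 * freq ξ ^ 2 * exp (-(freq ξ * s)) := by
  have hK := kap_pos hα ξ
  have hk := freq_nonneg ξ
  have hD : 0 ≤ D := by
    by_contra hn
    have := (norm_nonneg _).trans hA
    nlinarith
  have h1 : ‖modeAmp α A B s ξ‖ ≤ D * kap α ξ * exp (-(kap α ξ * s)) + 2 * D * freq ξ * exp (-(freq ξ * s / 2)) := by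
    refine (norm_add_le _ _).trans ?_
    rw [norm_mul, norm_mul, norm_real, norm_real, norm_of_nonneg (exp_pos _).le,
      norm_of_nonneg (expConv_nonneg hα ξ hs.le)]
    refine add_le_add (by gcongr) ?_
    calc _ ≤ D * (freq ξ * kap α ξ) * (2 / kap α ξ * exp (-(freq ξ * s / 2))) :=
          mul_le_mul hB (expConv_le' hα ξ hs.le) (expConv_nonneg hα ξ hs.le) (by positivity)
      _ = _ := by field_simp
  have e1 : exp (-(2 * kap α ξ * s)) = exp (-(kap α ξ * s)) ^ 2 := by
    rw [← exp_nat_mul]; congr 1; push_cast; ring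
  have e2 : exp (-(freq ξ * s)) = exp (-(freq ξ * s / 2)) ^ 2 := by
    rw [← exp_nat_mul]; congr 1; push_cast; ring
  rw [e1, e2]
  calc _ ≤ (D * kap α ξ * exp (-(kap α ξ * s)) + 2 * D * freq ξ * exp (-(freq ξ * s / 2))) ^ 2 := by gcongr
    _ ≤ _ := by nlinarith [sq_nonneg (D * kap α ξ * exp (-(kap α ξ * s)) - 2 * D * freq ξ * exp (-(freq ξ * s / 2)))]

/-- Superpositions of modes are square integrable when their amplitudes are controlled by a function
in `H^{1/2}`. -/
lemma integrable_sq_mode (hα : 0 < α) (hA : IsAmplitude A) (hB : IsAmplitude B) {a : ℝ → ℝ}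
    (ha : Integrable fun ξ => kap α ξ * a ξ ^ 2)
    (hAa : ∀ ξ, ‖A ξ‖ ≤ a ξ * kap α ξ) (hBa : ∀ ξ, ‖B ξ‖ ≤ a ξ * (freq ξ * kap α ξ)) :
    Integrable (fun x => mode α A B x ^ 2) (volume.restrict halfPlane) := by
  have hmA := measurable_modeAmp (α := α) hA hB
  have hmk := (continuous_kap α).measurable
  have hmf := continuous_freq.measurable
  have hmode := (continuousOn_mode hα hA hB).aestronglyMeasurable (μ := volume) measurableSet_halfPlane
  have hinner : ∀ ξ, ∫⁻ s in Ioi (0 : ℝ), ofReal (‖modeAmp α A B s ξ‖ ^ 2)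
      ≤ ofReal (9 * (kap α ξ * a ξ ^ 2)) := by
    intro ξ
    have hK := kap_pos hα ξ
    have hk := freq_nonneg ξ
    have hkK := freq_le_kap hα ξ
    calc _ ≤ ∫⁻ s in Ioi (0 : ℝ), (ofReal (2 * a ξ ^ 2 * kap α ξ ^ 2 * exp (-(2 * kap α ξ * s)))
          + ofReal (8 * a ξ ^ 2 * freq ξ ^ 2 * exp (-(freq ξ * s)))) := by
          refine setLIntegral_mono' measurableSet_Ioi fun s hs => ?_
          rw [← ofReal_add (by positivity) (by positivity)]
          exact ofReal_le_ofReal (norm_modeAmp_sq_le hα hs (hAa ξ) (hBa ξ))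
      _ = (∫⁻ s in Ioi (0 : ℝ), ofReal (2 * a ξ ^ 2 * kap α ξ ^ 2 * exp (-(2 * kap α ξ * s))))
          + ∫⁻ s in Ioi (0 : ℝ), ofReal (8 * a ξ ^ 2 * freq ξ ^ 2 * exp (-(freq ξ * s))) :=
          lintegral_add_left (by fun_prop) _
      _ ≤ ofReal (kap α ξ * a ξ ^ 2) + ofReal (8 * (kap α ξ * a ξ ^ 2)) := by
          refine add_le_add ((lintegral_sq_exp_le (by positivity)).trans (ofReal_le_ofReal
            (le_of_eq (by field_simp)))) ?_
          rcases hk.eq_or_lt with h0 | h0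
          · simp [← h0]
          · refine (lintegral_sq_exp_le h0).trans (ofReal_le_ofReal ?_)
            have e : 8 * a ξ ^ 2 * freq ξ ^ 2 / freq ξ = 8 * a ξ ^ 2 * freq ξ := by field_simp
            rw [e]
            nlinarith [sq_nonneg (a ξ)]
      _ = _ := by
          rw [← ofReal_add (by positivity) (by positivity)]; congr 1; ring
  have hslice : ∀ᵐ s ∂(volume.restrict (Ioi (0 : ℝ))), ∫⁻ t, ofReal (mode α A B (t, s) ^ 2)
      ≤ ∫⁻ ξ, ofReal (‖modeAmp α A B s ξ‖ ^ 2) := by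
    refine ae_restrict_of_forall_mem measurableSet_Ioi fun s hs => ?_
    by_cases hf : Integrable fun ξ => ‖modeAmp α A B s ξ‖ ^ 2
    · obtain ⟨p1, p2⟩ := integral_sq_synth (integrable_modeAmp hα hA hB hs) hf
      calc _ ≤ ∫⁻ t, ofReal (‖synth (modeAmp α A B s) t‖ ^ 2) := by
            refine lintegral_mono fun t => ofReal_le_ofReal ?_
            rw [← sq_abs]
            have : |mode α A B (t, s)| ≤ ‖synth (modeAmp α A B s) t‖ := abs_re_le_norm _
            gcongr
        _ = _ := by
            rw [← ofReal_integral_eq_lintegral_ofReal p1 (.of_forall fun _ => by positivity), p2,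
              ofReal_integral_eq_lintegral_ofReal hf (.of_forall fun _ => by positivity)]
    · have : ∫⁻ ξ, ofReal (‖modeAmp α A B s ξ‖ ^ 2) = ⊤ := by
        by_contra hn
        refine hf ⟨?_, ?_⟩
        · exact ((hmA.comp (by fun_prop : Measurable fun ξ : ℝ => (s, ξ))).norm.pow_const 2).aestronglyMeasurable
        · rw [hasFiniteIntegral_iff_ofReal (.of_forall fun _ => by positivity)]
          exact lt_top_iff_ne_top.2 hn
      rw [this]; exact le_top
  refine ⟨hmode.pow 2, ?_⟩
  rw [hasFiniteIntegral_iff_ofReal (.of_forall fun _ => by positivity)]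
  rw [restrict_halfPlane] at hmode ⊢
  rw [lintegral_prod_symm _ (by
    exact (hmode.pow 2).aemeasurable.ennreal_ofReal)]
  refine lt_of_le_of_lt (lintegral_mono_ae hslice) ?_
  rw [lintegral_lintegral_swap (f := fun s ξ => ofReal (‖modeAmp α A B s ξ‖ ^ 2))
    (by exact ((hmA.norm.pow_const 2).ennreal_ofReal).aemeasurable)]
  refine lt_of_le_of_lt (lintegral_mono hinner) ?_
  have h9 := (ha.const_mul 9).lintegral_lt_top
  exact h9

end

section

/-! ### The Gauss-Green formula for functions differentiable in the half-plane -/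

variable {α : ℝ} {f f₁ f₂ φ : ℝ × ℝ → ℝ}

lemma restrict_strip (ε : ℝ) : (volume : Measure (ℝ × ℝ)).restrict {x | ε < x.2}
    = (volume : Measure ℝ).prod (volume.restrict (Ioi ε)) := by
  have : {x : ℝ × ℝ | ε < x.2} = univ ×ˢ Ioi ε := by ext x; simp
  rw [this, Measure.volume_eq_prod, ← Measure.prod_restrict, Measure.restrict_univ]

lemma measurableSet_strip (ε : ℝ) : MeasurableSet {x : ℝ × ℝ | ε < x.2} :=
  (isOpen_lt continuous_const continuous_snd).measurableSet

lemma gaussGreen_fst (hd : ∀ x ∈ halfPlane, HasDerivAt (fun t => f (t, x.2)) (f₁ x) x.1) (hφ : IsTest φ)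
    (i0 : Integrable (fun x => f x * φ x) (volume.restrict halfPlane))
    (i1 : Integrable (fun x => f x * d1 φ x) (volume.restrict halfPlane))
    (i2 : Integrable (fun x => f₁ x * φ x) (volume.restrict halfPlane)) :
    ∫ x in halfPlane, f x * d1 φ x = -∫ x in halfPlane, f₁ x * φ x := by
  rw [restrict_halfPlane] at *
  have h : ∫ x, (f₁ x * φ x + f x * d1 φ x) ∂((volume : Measure ℝ).prod (volume.restrict (Ioi (0 : ℝ)))) = 0 := by
    rw [integral_prod_symm _ (by exact i2.add i1)]
    refine integral_eq_zero_of_ae ?_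
    filter_upwards [i0.prod_left_ae, (i2.add i1).prod_left_ae, ae_restrict_mem measurableSet_Ioi] with s h0 h1 hs
    exact integral_eq_zero_of_hasDerivAt_of_integrable
      (fun t => (hd (t, s) hs).mul (smooth_hasDerivAt_d1 hφ.1 t s)) h1 h0
  rw [integral_add i2 i1] at h
  linarith

lemma gaussGreen_snd {ε : ℝ} (hε : 0 < ε)
    (hd : ∀ x ∈ halfPlane, HasDerivAt (fun t => f (x.1, t)) (f₂ x) x.2) (hφ : IsTest φ)
    (i1 : Integrable (fun x => f x * d2 φ x) (volume.restrict {x | ε < x.2}))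
    (i2 : Integrable (fun x => f₂ x * φ x) (volume.restrict {x | ε < x.2})) :
    ∫ x in {x | ε < x.2}, f x * d2 φ x
      = -(∫ x in {x | ε < x.2}, f₂ x * φ x) - ∫ t : ℝ, f (t, ε) * φ (t, ε) := by
  rw [restrict_strip] at *
  obtain ⟨R, hR, hR0⟩ := hφ.exists_radius
  have h : ∫ x, (f₂ x * φ x + f x * d2 φ x) ∂((volume : Measure ℝ).prod (volume.restrict (Ioi ε)))
      = ∫ t : ℝ, -(f (t, ε) * φ (t, ε)) := by
    rw [integral_prod _ (by exact i2.add i1)]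
    refine integral_congr_ae ?_
    filter_upwards [(i2.add i1).prod_right_ae] with t h1
    have h2 := integral_Ioi_of_hasDerivAt_of_tendsto' (a := ε) (m := (0 : ℝ)) (f := fun s => f (t, s) * φ (t, s))
      (fun s hs => (hd (t, s) (hε.trans_le hs)).mul (smooth_hasDerivAt_d2 hφ.1 t s)) h1 (by
        refine tendsto_const_nhds.congr' ?_
        filter_upwards [eventually_ge_atTop R] with s hs
        rw [hR0 _ (hs.trans ((le_abs_self s).trans (abs_snd_le_rad (t, s)))), mul_zero])
    rw [zero_sub] at h2
    exact h2
  rw [integral_add i2 i1, integral_neg] at h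
  linarith

lemma tendsto_integral_strip {F : ℝ × ℝ → ℝ} (hF : Integrable F (volume.restrict halfPlane)) :
    Tendsto (fun n : ℕ => ∫ x in {x : ℝ × ℝ | 1 / ((n : ℝ) + 1) < x.2}, F x) atTop
      (𝓝 (∫ x in halfPlane, F x)) := by
  have e : halfPlane = ⋃ n : ℕ, {x : ℝ × ℝ | 1 / ((n : ℝ) + 1) < x.2} := by
    ext x
    simp only [mem_iUnion, mem_ofPred_eq, halfPlane]
    refine ⟨fun h => exists_nat_one_div_lt h, fun ⟨n, hn⟩ => lt_trans (by positivity) hn⟩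
  rw [e] at hF ⊢
  refine tendsto_setIntegral_of_monotone (fun n => measurableSet_strip _) (fun m n hmn x hx => ?_) hF
  refine lt_of_le_of_lt ?_ (show 1 / ((m : ℝ) + 1) < x.2 from hx)
  exact one_div_le_one_div_of_le (by positivity) (by exact_mod_cast Nat.succ_le_succ hmn)

/-- A function with a gradient in the half-plane whose restrictions to lines parallel to the boundary
converge weakly to `g` has trace `g`. -/
lemma hasGradAndTrace_of_tendsto {g : ℝ → ℝ} (hf : WeakL2 f) (hf₁ : WeakL2 f₁) (hf₂ : WeakL2 f₂)
    (hd₁ : ∀ x ∈ halfPlane, HasDerivAt (fun t => f (t, x.2)) (f₁ x) x.1)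
    (hd₂ : ∀ x ∈ halfPlane, HasDerivAt (fun t => f (x.1, t)) (f₂ x) x.2) (hg : LocallyIntegrable g)
    (ht : ∀ φ, IsTest φ → Tendsto (fun ε => ∫ t, f (t, ε) * φ (t, ε)) (𝓝[>] 0)
      (𝓝 (∫ t, g t * φ (t, 0)))) :
    HasGradAndTrace f g := by
  refine ⟨hf, hg, f₁, f₂, hf₁, hf₂, fun φ hφ => ⟨?_, ?_⟩⟩
  · exact gaussGreen_fst hd₁ hφ (hf.integrable_mul_test hφ) (hf.integrable_mul_test hφ.d1)
      (hf₁.integrable_mul_test hφ)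
  · have i1 := hf.integrable_mul_test hφ.d2
    have i2 := hf₂.integrable_mul_test hφ
    have hs : Tendsto (fun n : ℕ => 1 / ((n : ℝ) + 1)) atTop (𝓝[>] 0) :=
      tendsto_nhdsWithin_iff.2 ⟨tendsto_one_div_add_atTop_nhds_zero_nat,
        .of_forall fun n => show (0 : ℝ) < _ by positivity⟩
    have hle : ∀ n : ℕ, volume.restrict {x : ℝ × ℝ | 1 / ((n : ℝ) + 1) < x.2} ≤ volume.restrict halfPlane :=
      fun n => Measure.restrict_mono (fun (x : ℝ × ℝ) hx => lt_trans (by positivity)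
        (show 1 / ((n : ℝ) + 1) < x.2 from hx)) le_rfl
    refine tendsto_nhds_unique (tendsto_integral_strip i1) ?_
    refine (((tendsto_integral_strip i2).neg.sub ((ht φ hφ).comp hs))).congr fun n => ?_
    have hn : (0 : ℝ) < 1 / ((n : ℝ) + 1) := by positivity
    exact (gaussGreen_snd hn hd₂ hφ (Integrable.mono_measure i1 (hle n)) (Integrable.mono_measure i2 (hle n))).symm

lemma IsTestInHalfPlane.d1 (hφ : IsTestInHalfPlane φ) : IsTestInHalfPlane (AlphaEuler.d1 φ) :=
  ⟨hφ.1.d1, (tsupport_d1_subset hφ.1.1).trans hφ.2⟩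

lemma IsTestInHalfPlane.d2 (hφ : IsTestInHalfPlane φ) : IsTestInHalfPlane (AlphaEuler.d2 φ) :=
  ⟨hφ.1.d2, (tsupport_d2_subset hφ.1.1).trans hφ.2⟩

lemma IsTestInHalfPlane.integrable_mul (hφ : IsTestInHalfPlane φ) (hf : ContinuousOn f halfPlane) :
    Integrable (fun x => f x * φ x) (volume.restrict halfPlane) := by
  have hsub : tsupport (fun x => f x * φ x) ⊆ tsupport φ := closure_mono fun x hx => by
    intro h; exact hx (by simp [h])
  have hc : Continuous fun x => f x * φ x := by
    refine continuous_of_tsupport fun x hx => ?_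
    have := hf.continuousAt (isOpen_halfPlane.mem_nhds (hφ.2 (hsub hx)))
    exact this.mul hφ.1.continuous.continuousAt
  exact (hc.integrable_of_hasCompactSupport (hφ.1.2.of_isClosed_subset (isClosed_tsupport _) hsub)).integrableOn

lemma IsTestInHalfPlane.exists_strip (hφ : IsTestInHalfPlane φ) : ∃ ε, 0 < ε ∧ ∀ x, φ x ≠ 0 → ε < x.2 := by
  rcases (tsupport φ).eq_empty_or_nonempty with h | h
  · refine ⟨1, one_pos, fun x hx => ?_⟩
    have := subset_tsupport φ hx
    rw [h] at this
    exact absurd this (notMem_empty x)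
  · obtain ⟨z, hz, hmin⟩ := hφ.1.2.isCompact.exists_isMinOn h continuous_snd.continuousOn
    have hz0 : 0 < z.2 := hφ.2 hz
    refine ⟨z.2 / 2, half_pos hz0, fun x hx => ?_⟩
    have : z.2 ≤ x.2 := hmin (subset_tsupport φ hx)
    linarith

/-- Integration by parts against test functions supported in the open half-plane. -/
lemma IsTestInHalfPlane.integral_d1 (hφ : IsTestInHalfPlane φ) (hf : ContinuousOn f halfPlane)
    (hf₁ : ContinuousOn f₁ halfPlane)
    (hd₁ : ∀ x ∈ halfPlane, HasDerivAt (fun t => f (t, x.2)) (f₁ x) x.1) :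
    ∫ x in halfPlane, f x * AlphaEuler.d1 φ x = -∫ x in halfPlane, f₁ x * φ x :=
  gaussGreen_fst hd₁ hφ.1 (hφ.integrable_mul hf) (hφ.d1.integrable_mul hf) (hφ.integrable_mul hf₁)

lemma IsTestInHalfPlane.integral_d2 (hφ : IsTestInHalfPlane φ) (hf : ContinuousOn f halfPlane)
    (hf₂ : ContinuousOn f₂ halfPlane)
    (hd₂ : ∀ x ∈ halfPlane, HasDerivAt (fun t => f (x.1, t)) (f₂ x) x.2) :
    ∫ x in halfPlane, f x * AlphaEuler.d2 φ x = -∫ x in halfPlane, f₂ x * φ x := by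
  obtain ⟨ε, hε, h1⟩ := hφ.exists_strip
  obtain ⟨ε', hε', h2⟩ := hφ.d2.exists_strip
  set δ := min ε ε' with hδ
  have hδ0 : 0 < δ := lt_min hε hε'
  have hsub : {x : ℝ × ℝ | δ < x.2} ⊆ halfPlane := fun x hx => hδ0.trans (show δ < x.2 from hx)
  have hle := Measure.restrict_mono hsub (le_refl (volume : Measure (ℝ × ℝ)))
  have e1 : ∀ {F ψ : ℝ × ℝ → ℝ} {ε : ℝ}, δ ≤ ε → (∀ x, ψ x ≠ 0 → ε < x.2) →
      ∫ x in halfPlane, F x * ψ x = ∫ x in {x | δ < x.2}, F x * ψ x := by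
    intro F ψ ε hle h
    refine (setIntegral_eq_of_subset_of_forall_sdiff_eq_zero measurableSet_halfPlane hsub fun x hx => ?_)
    have : ψ x = 0 := by
      by_contra hn
      exact hx.2 (hle.trans_lt (h x hn))
    rw [this, mul_zero]
  have h3 := gaussGreen_snd hδ0 hd₂ hφ.1 ((hφ.d2.integrable_mul hf).mono_measure hle)
    ((hφ.integrable_mul hf₂).mono_measure hle)
  rw [e1 (min_le_right _ _) h2, e1 (min_le_left _ _) h1, h3]
  have h4 : ∀ t, f (t, δ) * φ (t, δ) = 0 := fun t => by
    have : φ (t, δ) = 0 := by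
      by_contra hn
      exact absurd (h1 _ hn) (not_lt.2 (min_le_left _ _))
    rw [this, mul_zero]
  simp [h4]

/-! ### Traces and the momentum equation for superpositions of modes -/

variable {A B A' B' : ℝ → ℂ}

lemma mode_add (hα : 0 < α) (hA : IsAmplitude A) (hB : IsAmplitude B) (hA' : IsAmplitude A')
    (hB' : IsAmplitude B') {x : ℝ × ℝ} (hx : x ∈ halfPlane) :
    mode α A B x + mode α A' B' x = mode α (fun ξ => A ξ + A' ξ) (fun ξ => B ξ + B' ξ) x := by
  rw [mode, mode, mode, ← Complex.add_re, synth, synth, synth, ← integral_add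
    (integrable_mul_wave (integrable_modeAmp hα hA hB hx) _)
    (integrable_mul_wave (integrable_modeAmp hα hA' hB' hx) _)]
  congr 1
  refine integral_ext fun ξ => ?_
  simp only [modeAmp]
  ring

lemma mode_const_mul (c : ℝ) (x : ℝ × ℝ) :
    c * mode α A B x = mode α (fun ξ => c * A ξ) (fun ξ => c * B ξ) x := by
  rw [mode, mode, ← re_ofReal_mul, synth, synth, ← integral_const_mul]
  congr 1
  refine integral_ext fun ξ => ?_
  simp only [modeAmp]
  ring

lemma tendsto_synth_slice (hφ : IsTest φ) (ξ : ℝ) :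
    Continuous fun s => synth (fun t : ℝ => (φ (t, s) : ℂ)) ξ := by
  obtain ⟨R, hR, h⟩ := hφ.exists_radius
  obtain ⟨D, hD, hb⟩ := hφ.exists_bound
  have hc := hφ.continuous
  unfold synth
  refine continuous_of_dominated (bound := (Icc (-R) R).indicator fun _ => D) (fun s => Continuous.aestronglyMeasurable (by fun_prop))
    (fun s => .of_forall fun t => ?_) ((integrable_indicator_iff measurableSet_Icc).2 (by simp))
    (.of_forall fun t => by fun_prop)
  rw [norm_mul, norm_wave, mul_one, norm_real]
  by_cases ht : t ∈ Icc (-R) R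
  · rw [indicator_of_mem ht]; exact hb _
  · rw [indicator_of_notMem ht, h (t, s) ?_, norm_zero]
    refine le_trans ?_ (abs_fst_le_rad (t, s))
    by_contra hn
    exact ht (abs_le.1 (not_le.1 hn).le)

lemma tendsto_mode_trace (hα : 0 < α) {g : ℝ → ℝ} (hg : Integrable g) (hB : IsAmplitude B) {D : ℝ}
    (hBD : ∀ ξ, ‖B ξ‖ ≤ D * freq ξ) (hφ : IsTest φ) :
    Tendsto (fun ε => ∫ t, mode α (ghat g) B (t, ε) * φ (t, ε)) (𝓝[>] 0)
      (𝓝 (∫ t, g t * φ (t, 0))) := by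
  obtain ⟨D', hD', hA⟩ := exists_norm_ghat_le (g := g)
  have hgA : IsAmplitude (ghat g) := .of_bounded (continuous_ghat hg).measurable hA
  obtain ⟨C, hC, hbd⟩ := hφ.exists_synth_slice_le
  have hm := measurable_modeAmp (α := α) hgA hB
  have e1 : ∀ ε > 0, ∫ t, mode α (ghat g) B (t, ε) * φ (t, ε)
      = (∫ ξ, modeAmp α (ghat g) B ε ξ * synth (fun t : ℝ => (φ (t, ε) : ℂ)) ξ).re := by
    intro ε hε
    have hi := integrable_modeAmp hα hgA hB hε
    rw [← integral_mul_synth_comm (hφ.integrable_slice ε) hi]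
    have h2 : Integrable fun t : ℝ => (φ (t, ε) : ℂ) * synth (modeAmp α (ghat g) B ε) t :=
      (hφ.integrable_slice ε).mul_bdd (continuous_synth hi).aestronglyMeasurable
        (.of_forall (norm_synth_le _))
    refine Eq.trans ?_ (integral_re h2)
    refine integral_ext fun t => ?_
    simp only [mode]
    exact (mul_comm _ _).trans (re_ofReal_mul _ _).symm
  have e2 : ∫ t, g t * φ (t, 0) = (∫ ξ, ghat g ξ * synth (fun t : ℝ => (φ (t, 0) : ℂ)) ξ).re := by
    rw [← integral_mul_slice hφ 0 hg, Complex.ofReal_re]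
  rw [e2]
  have key : Tendsto (fun ε => ∫ ξ, modeAmp α (ghat g) B ε ξ * synth (fun t : ℝ => (φ (t, ε) : ℂ)) ξ)
      (𝓝[>] 0) (𝓝 (∫ ξ, ghat g ξ * synth (fun t : ℝ => (φ (t, 0) : ℂ)) ξ)) := by
    refine tendsto_integral_filter_of_dominated_convergence (fun ξ => (D' + D * 2) * (C * (1 + ξ ^ 2)⁻¹))
      ?_ ?_ ((integrable_inv_one_add_sq.const_mul C).const_mul _) (.of_forall fun ξ => ?_)
    · refine .of_forall fun ε => ?_
      exact (hm.comp (by fun_prop : Measurable fun ξ : ℝ => (ε, ξ))).aestronglyMeasurable.mul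
        (continuous_synth (hφ.integrable_slice ε)).aestronglyMeasurable
    · filter_upwards [self_mem_nhdsWithin] with ε hε
      have hε : 0 < ε := hε
      refine .of_forall fun ξ => ?_
      rw [norm_mul]
      have hK := kap_pos hα ξ
      have hk := freq_nonneg ξ
      have h0 : ‖modeAmp α (ghat g) B ε ξ‖ ≤ D' + D * 2 := by
        refine (norm_add_le _ _).trans ?_
        rw [norm_mul, norm_mul, norm_real, norm_real, norm_of_nonneg (exp_pos _).le,
          norm_of_nonneg (expConv_nonneg hα ξ hε.le)]
        have h1 : exp (-(kap α ξ * ε)) ≤ 1 := exp_le_one_iff.2 (by have := mul_pos hK hε; linarith)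
        have h2 : exp (-(freq ξ * ε / 2)) ≤ 1 := exp_le_one_iff.2 (by have := mul_nonneg hk hε.le; linarith)
        have h3 : kap α ξ * expConv α ξ ε ≤ 2 := by
          have := mul_le_mul_of_nonneg_left (expConv_le' hα ξ hε.le) hK.le
          refine this.trans ?_
          rw [← mul_assoc, mul_div_cancel₀ _ hK.ne']
          linarith
        have hE := expConv_nonneg hα ξ hε.le
        have h4 : freq ξ * expConv α ξ ε ≤ 2 :=
          (mul_le_mul_of_nonneg_right (freq_le_kap hα ξ) hE).trans h3
        have hDk : 0 ≤ D * freq ξ := (norm_nonneg _).trans (hBD ξ)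
        refine add_le_add ?_ ?_
        · exact (mul_le_mul (hA ξ) h1 (exp_pos _).le hD').trans (mul_one _).le
        · refine (mul_le_mul_of_nonneg_right (hBD ξ) hE).trans ?_
          rcases hk.eq_or_lt with h | h
          · have hD : 0 ≤ D := by
              have := (norm_nonneg _).trans (hBD 1)
              have h1 : 0 < freq 1 := by unfold freq; simp [pi_pos]
              exact nonneg_of_mul_nonneg_left this h1
            rw [← h]; simpa using hD
          · have hD : 0 ≤ D := nonneg_of_mul_nonneg_left hDk h
            rw [mul_assoc]
            exact mul_le_mul_of_nonneg_left h4 hD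
      exact mul_le_mul h0 (hbd ε ξ) (norm_nonneg _) ((norm_nonneg _).trans h0)
    · have hE : Continuous fun s => modeAmp α (ghat g) B s ξ := by
        have : Continuous fun s => expConv α ξ s :=
          (continuous_expConv α).comp (by fun_prop : Continuous fun s : ℝ => (ξ, s))
        unfold modeAmp
        fun_prop
      have h1 : Tendsto (fun s => modeAmp α (ghat g) B s ξ * synth (fun t : ℝ => (φ (t, s) : ℂ)) ξ)
          (𝓝 0) (𝓝 (modeAmp α (ghat g) B 0 ξ * synth (fun t : ℝ => (φ (t, 0) : ℂ)) ξ)) :=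
        (hE.mul (tendsto_synth_slice hφ ξ)).tendsto 0
      have e3 : modeAmp α (ghat g) B 0 ξ = ghat g ξ := by simp [modeAmp, expConv]
      rw [e3] at h1
      exact h1.mono_left nhdsWithin_le_nhds
  refine ((Complex.continuous_re.tendsto _).comp key).congr' ?_
  filter_upwards [self_mem_nhdsWithin] with ε hε
  exact (e1 ε hε).symm

lemma integral_mul_helmholtz {F : ℝ × ℝ → ℝ} {μ : Measure (ℝ × ℝ)} (α : ℝ)
    (i0 : Integrable (fun x => F x * φ x) μ) (i1 : Integrable (fun x => F x * d1 (d1 φ) x) μ)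
    (i2 : Integrable (fun x => F x * d2 (d2 φ) x) μ) :
    ∫ x, F x * (φ x - α * lap φ x) ∂μ = (∫ x, F x * φ x ∂μ)
      - α * ((∫ x, F x * d1 (d1 φ) x ∂μ) + ∫ x, F x * d2 (d2 φ) x ∂μ) := by
  have e3 : ∀ x, F x * (φ x - α * lap φ x) = F x * φ x
      - α * (F x * d1 (d1 φ) x + F x * d2 (d2 φ) x) := fun x => by
    unfold lap; ring
  simp_rw [e3]
  have i3 : Integrable (fun x => α * (F x * d1 (d1 φ) x + F x * d2 (d2 φ) x)) μ := (i1.add i2).const_mul α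
  rw [integral_sub i0 i3, integral_const_mul, integral_add i1 i2]

/-- Two integrations by parts. -/
lemma integral_mode_helmholtz (hα : 0 < α) (hA : IsAmplitude A) (hB : IsAmplitude B)
    (hφ : IsTestInHalfPlane φ) :
    ∫ x in halfPlane, mode α A B x * (φ x - α * lap φ x)
      = ∫ x in halfPlane, mode α (fun ξ => α * (kap α ξ + freq ξ) * B ξ) B x * φ x := by
  have a1 := isAmplitude_d1 hA
  have b1 := isAmplitude_d1 hB
  have a11 := isAmplitude_d1 a1
  have b11 := isAmplitude_d1 b1
  obtain ⟨a2, b2⟩ := isAmplitude_d2 hα hA hB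
  obtain ⟨a22, b22⟩ := isAmplitude_d2 hα a2 b2
  have c0 := continuousOn_mode hα hA hB
  have c1 := continuousOn_mode hα a1 b1
  have c11 := continuousOn_mode hα a11 b11
  have c2 := continuousOn_mode hα a2 b2
  have c22 := continuousOn_mode hα a22 b22
  have e1 := (hφ.d1.integral_d1 c0 c1 (fun x hx => hasDerivAt_mode_d1 hα hA hB x.1 hx)).trans
    (congrArg _ (hφ.integral_d1 c1 c11 (fun x hx => hasDerivAt_mode_d1 hα a1 b1 x.1 hx)))
  have e2 := (hφ.d2.integral_d2 c0 c2 (fun x hx => hasDerivAt_mode_d2 hα hA hB x.1 hx)).trans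
    (congrArg _ (hφ.integral_d2 c2 c22 (fun x hx => hasDerivAt_mode_d2 hα a2 b2 x.1 hx)))
  rw [neg_neg] at e1 e2
  have i0 := hφ.integrable_mul c0
  have i1 := hφ.d1.d1.integrable_mul c0
  have i2 := hφ.d2.d2.integrable_mul c0
  have i3 : Integrable (fun x => α * (mode α (fun ξ => 2 * π * ξ * I * (2 * π * ξ * I * A ξ))
      (fun ξ => 2 * π * ξ * I * (2 * π * ξ * I * B ξ)) x * φ x
      + mode α (fun ξ => -(kap α ξ * (-(kap α ξ * A ξ) + B ξ)) + -(freq ξ * B ξ))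
        (fun ξ => -(freq ξ * -(freq ξ * B ξ))) x * φ x)) (volume.restrict halfPlane) :=
    ((hφ.integrable_mul c11).add (hφ.integrable_mul c22)).const_mul α
  rw [integral_mul_helmholtz α i0 i1 i2, e1, e2,
    ← integral_add (hφ.integrable_mul c11) (hφ.integrable_mul c22), ← integral_const_mul, ← integral_sub i0 i3]
  refine setIntegral_congr_fun measurableSet_halfPlane fun x hx => ?_
  rw [← add_mul, mode_add hα a11 b11 a22 b22 hx, ← mul_assoc, ← sub_mul, sub_eq_add_neg, ← neg_mul, mode_const_mul,
    mode_add hα hA hB ((IsAmplitude.const _).mul (a11.add a22)) ((IsAmplitude.const _).mul (b11.add b22)) hx]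
  congr 2
  · funext ξ
    have h := kap_sq hα ξ
    have h2 : (freq ξ : ℂ) ^ 2 = (2 * π * ξ) ^ 2 := by
      have : freq ξ ^ 2 = (2 * π * ξ) ^ 2 := by unfold freq; rw [mul_pow, sq_abs]; ring
      exact_mod_cast this
    have h3 : α * (kap α ξ ^ 2 - freq ξ ^ 2) = 1 := by rw [h]; field_simp; ring
    have h4 : (α : ℂ) * ((kap α ξ : ℂ) ^ 2 - (freq ξ : ℂ) ^ 2) = 1 := by exact_mod_cast h3
    push_cast
    linear_combination (-A ξ) * h4 - (α : ℂ) * A ξ * h2 - (α : ℂ) * A ξ * (2 * π * ξ) ^ 2 * I_sq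
  · funext ξ
    have h2 : (freq ξ : ℂ) ^ 2 = (2 * π * ξ) ^ 2 := by
      have : freq ξ ^ 2 = (2 * π * ξ) ^ 2 := by unfold freq; rw [mul_pow, sq_abs]; ring
      exact_mod_cast this
    push_cast
    linear_combination (-(α : ℂ)) * B ξ * h2 - (α : ℂ) * B ξ * (2 * π * ξ) ^ 2 * I_sq

end

section

variable {α : ℝ} {g : ℝ → ℝ} {f f' φ : ℝ × ℝ → ℝ} {u w : ℝ × ℝ → ℝ × ℝ}

/-! ### Invariance under modifications on null sets -/

lemma HasGradAndTrace.congr (h : HasGradAndTrace f g) (he : f =ᵐ[volume.restrict halfPlane] f') :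
    HasGradAndTrace f' g := by
  obtain ⟨h1, h2, v₁, v₂, h3, h4, h5⟩ := h
  have e : ∀ ψ : ℝ × ℝ → ℝ, ∫ x in halfPlane, f' x * ψ x = ∫ x in halfPlane, f x * ψ x := fun ψ =>
    integral_congr_ae (by filter_upwards [he] with x hx; rw [hx])
  refine ⟨WeakL2On.congr h1 he, h2, v₁, v₂, h3, h4, fun φ hφ => ?_⟩
  rw [e, e]
  exact h5 φ hφ

lemma DivFree.congr (h : DivFree u) (he : u =ᵐ[volume.restrict halfPlane] w) : DivFree w := fun φ hφ => by
  rw [← h φ hφ]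
  exact integral_congr_ae (by filter_upwards [he] with x hx; rw [hx])

lemma fst_congr (he : u =ᵐ[volume.restrict halfPlane] w) :
    (fun x => (u x).1) =ᵐ[volume.restrict halfPlane] fun x => (w x).1 := he.mono fun x hx => by simp only [hx]

lemma snd_congr (he : u =ᵐ[volume.restrict halfPlane] w) :
    (fun x => (u x).2) =ᵐ[volume.restrict halfPlane] fun x => (w x).2 := he.mono fun x hx => by simp only [hx]

lemma IsFilteredVelocity.congr {q : SignedMeasure halfPlane} (h : IsFilteredVelocity α q u)
    (he : u =ᵐ[volume.restrict halfPlane] w) : IsFilteredVelocity α q w := by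
  obtain ⟨h1, h2, h3, h4⟩ := h
  refine ⟨h1.congr (fst_congr he), h2.congr (snd_congr he), h3.congr he, fun φ hφ => ?_⟩
  rw [← h4 φ hφ]
  exact integral_congr_ae (by filter_upwards [he] with x hx; rw [hx])

lemma IsStokesSolution.congr (h : IsStokesSolution α g u)
    (he : u =ᵐ[volume.restrict halfPlane] w) : IsStokesSolution α g w := by
  obtain ⟨h1, h2, h3, p, hp, h4⟩ := h
  refine ⟨h1.congr (fst_congr he), h2.congr (snd_congr he), h3.congr he, p, hp, fun φ hφ => ?_⟩
  have e1 : ∀ ψ : ℝ × ℝ → ℝ, ∫ x in halfPlane, (w x).1 * ψ x = ∫ x in halfPlane, (u x).1 * ψ x := fun ψ =>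
    integral_congr_ae (by filter_upwards [he] with x hx; rw [hx])
  have e2 : ∀ ψ : ℝ × ℝ → ℝ, ∫ x in halfPlane, (w x).2 * ψ x = ∫ x in halfPlane, (u x).2 * ψ x := fun ψ =>
    integral_congr_ae (by filter_upwards [he] with x hx; rw [hx])
  rw [e1, e2]
  exact h4 φ hφ

lemma HasGradAndTrace.integrable_mul_test (h : HasGradAndTrace f g) (hφ : IsTest φ) :
    Integrable (fun x => f x * φ x) (volume.restrict halfPlane) := WeakL2.integrable_mul_test h.1 hφ

/-- The curl of the momentum equation. -/
lemma IsStokesSolution.curl (h : IsStokesSolution α g w) (hφ : IsTestInHalfPlane φ) :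
    ∫ x in halfPlane, ((w x).1 * d2 (fun z => φ z - α * lap φ z) x
        - (w x).2 * d1 (fun z => φ z - α * lap φ z) x) = 0 := by
  obtain ⟨h1, h2, -, p, hp, h4⟩ := h
  have i1 := h1.integrable_mul_test (hφ.d2.1.helmholtz α)
  have i2 := h2.integrable_mul_test (hφ.d1.1.helmholtz α)
  rw [d1_helmholtz hφ.1.1, d2_helmholtz hφ.1.1, integral_sub i1 i2]
  have e1 := (h4 _ hφ.d2).1
  have e2 := (h4 _ hφ.d1).2
  rw [smooth_d1_d2 hφ.1.1] at e1
  linarith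

/-! ### The boundary corrector solves the Stokes problem -/

lemma exists_one_le_mul_kap (hα : 0 < α) : ∃ C, 0 < C ∧ ∀ ξ, 1 ≤ C * kap α ξ := by
  refine ⟨√α, sqrt_pos.2 hα, fun ξ => ?_⟩
  have hK := kap_pos hα ξ
  have h : 1 ≤ (√α * kap α ξ) ^ 2 := by
    rw [mul_pow, sq_sqrt hα.le, kap_sq hα]
    have : α * (freq ξ ^ 2 + 1 / α) = α * freq ξ ^ 2 + 1 := by field_simp
    rw [this]
    have : 0 ≤ α * freq ξ ^ 2 := by positivity
    linarith
  have h0 : 0 ≤ √α * kap α ξ := by positivity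
  nlinarith

lemma norm_two_pi_mul_I (ξ : ℝ) : ‖(2 * π * ξ * I : ℂ)‖ = freq ξ := by
  rw [norm_mul, norm_mul, norm_mul, norm_I, norm_real, norm_real, Complex.norm_ofNat,
    norm_of_nonneg pi_pos.le, norm_eq_abs, mul_one, freq]

/-- Square integrability of the modes arising from a boundary value in `H^{1/2}`. -/
lemma weakL2_mode_ghat (hα : 0 < α) (hg : MemL1Hhalf g) {m n : ℝ → ℂ} (hm : IsAmplitude m) (hn : IsAmplitude n)
    {C : ℝ} (hmC : ∀ ξ, ‖m ξ‖ ≤ C * kap α ξ) (hnC : ∀ ξ, ‖n ξ‖ ≤ C * (freq ξ * kap α ξ)) :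
    WeakL2 (mode α (fun ξ => m ξ * ghat g ξ) (fun ξ => n ξ * ghat g ξ)) := by
  obtain ⟨D, hD, hgD⟩ := exists_norm_ghat_le (g := g)
  have hgA : IsAmplitude (ghat g) := .of_bounded (continuous_ghat hg.1).measurable hgD
  have ha := hm.mul hgA
  have hb := hn.mul hgA
  have hck := continuous_kap α
  have hcg := continuous_ghat hg.1
  have hi : Integrable fun ξ => kap α ξ * (C * ‖ghat g ξ‖) ^ 2 := by
    refine (hg.2.const_mul ((2 * π + (1 + 1 / α)) * C ^ 2)).mono' (by fun_prop)
      (.of_forall fun ξ => ?_)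
    have hK := kap_pos hα ξ
    rw [norm_of_nonneg (by positivity)]
    have h1 : kap α ξ ≤ (2 * π + (1 + 1 / α)) * (1 + |ξ|) := by
      refine (kap_le_freq_add hα ξ).trans ?_
      have hpi := pi_pos
      have h3 : 0 < 1 / α := by positivity
      unfold freq
      nlinarith [abs_nonneg ξ, mul_nonneg h3.le (abs_nonneg ξ)]
    have := mul_le_mul_of_nonneg_right h1 (sq_nonneg (C * ‖ghat g ξ‖))
    refine this.trans (le_of_eq ?_)
    change _ = _ * ((1 + |ξ|) * ‖ghat g ξ‖ ^ 2)
    ring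
  have h := integrable_sq_mode hα ha hb hi (fun ξ => by
    rw [norm_mul]
    calc _ ≤ C * kap α ξ * ‖ghat g ξ‖ := by gcongr; exact hmC ξ
      _ = _ := by ring) (fun ξ => by
    rw [norm_mul]
    calc _ ≤ C * (freq ξ * kap α ξ) * ‖ghat g ξ‖ := by gcongr; exact hnC ξ
      _ = _ := by ring)
  exact WeakL2On.of_integrable_sq ((continuousOn_mode hα ha hb).aestronglyMeasurable measurableSet_halfPlane) h

/-- The velocity of the Stokes flow with boundary value `(g, 0)` as a superposition of modes. -/
def stokesMode (α : ℝ) (g : ℝ → ℝ) (x : ℝ × ℝ) : ℝ × ℝ :=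
  (mode α (ghat g) (fun ξ => -(freq ξ : ℂ) * ghat g ξ) x,
   mode α (ghat 0) (fun ξ => -(2 * π * ξ * I) * ghat g ξ) x)

lemma ghat_zero : ghat 0 = fun _ => 0 := by
  funext ξ
  rw [ghat, fourier_eq_integral]
  simp

lemma boundaryPart_eq_stokesMode (hα : 0 < α) (hg : Integrable g) {x : ℝ × ℝ} (hx : x ∈ halfPlane) :
    boundaryPart α g x = stokesMode α g x := by
  obtain ⟨h1, h2⟩ := boundaryPart_eq hα hg hx
  refine Prod.ext ?_ ?_
  · rw [← Complex.ofReal_re (boundaryPart α g x).1, h1]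
    simp only [stokesMode, mode]
    congr 2
    funext ξ
    simp only [modeAmp]
    push_cast
    ring
  · rw [← Complex.ofReal_re (boundaryPart α g x).2, h2]
    simp only [stokesMode, mode]
    congr 2
    funext ξ
    simp only [modeAmp, ghat_zero]
    ring

lemma isStokesSolution_stokesMode (hα : 0 < α) (hg : MemL1Hhalf g) :
    IsStokesSolution α g (stokesMode α g) := by
  obtain ⟨D, hD, hgD⟩ := exists_norm_ghat_le (g := g)
  obtain ⟨c, hc, h1c⟩ := exists_one_le_mul_kap hα
  have hgA : IsAmplitude (ghat g) := .of_bounded (continuous_ghat hg.1).measurable hgD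
  have hKA := isAmplitude_kap hα
  have hkA := isAmplitude_freq
  have hiA : IsAmplitude fun ξ : ℝ => (2 * π * ξ * I : ℂ) := by
    simpa using isAmplitude_d1 (IsAmplitude.const 1)
  have hzA := IsAmplitude.const 0
  have hk0 := freq_nonneg
  have hK0 := fun ξ => (kap_pos hα ξ).le
  have hkK := freq_le_kap hα
  have nk : ∀ ξ, ‖(freq ξ : ℂ)‖ = freq ξ := fun ξ => by
    rw [norm_real, norm_of_nonneg (hk0 ξ)]
  have nK : ∀ ξ, ‖(kap α ξ : ℂ)‖ = kap α ξ := fun ξ => by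
    rw [norm_real, norm_of_nonneg (hK0 ξ)]
  have nI := norm_two_pi_mul_I
  have hC : (0 : ℝ) ≤ c + 2 := by positivity
  have hCk : ∀ ξ, kap α ξ ≤ (c + 2) * kap α ξ := fun ξ => by nlinarith [hK0 ξ]
  have hC1 : ∀ ξ, 1 ≤ (c + 2) * kap α ξ := fun ξ => by nlinarith [hK0 ξ, h1c ξ]
  have hCkk : ∀ ξ, freq ξ ≤ (c + 2) * (freq ξ * kap α ξ) := fun ξ => by nlinarith [hk0 ξ, hC1 ξ]
  have hC2 : ∀ ξ, freq ξ * freq ξ ≤ (c + 2) * (freq ξ * kap α ξ) := fun ξ => by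
    have h2 := mul_le_mul_of_nonneg_left (hkK ξ) (hk0 ξ)
    have h3 : 0 ≤ freq ξ * kap α ξ := mul_nonneg (hk0 ξ) (hK0 ξ)
    nlinarith
  have b1A := hkA.neg.mul hgA
  have b2A := hiA.neg.mul hgA
  have z0 : ∀ ξ, ghat 0 ξ = 0 := fun ξ => by rw [ghat_zero]
  have zA : IsAmplitude (ghat 0) := by rw [ghat_zero]; exact hzA
  have w1 : WeakL2 (mode α (ghat g) (fun ξ => -(freq ξ : ℂ) * ghat g ξ)) := by
    have h := weakL2_mode_ghat hα hg (IsAmplitude.const 1) hkA.neg (C := c + 2)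
      (fun ξ => by rw [norm_one]; exact hC1 ξ) (fun ξ => by rw [norm_neg, nk]; exact hCkk ξ)
    simpa using h
  have w2 : WeakL2 (mode α (ghat 0) (fun ξ => -(2 * π * ξ * I) * ghat g ξ)) := by
    have h := weakL2_mode_ghat hα hg (IsAmplitude.const 0) hiA.neg (C := c + 2)
      (fun ξ => by rw [norm_zero]; exact mul_nonneg hC (hK0 ξ)) (fun ξ => by rw [norm_neg, nI]; exact hCkk ξ)
    simpa [ghat_zero] using h
  have w11 : WeakL2 (mode α (fun ξ => (2 * π * ξ * I) * ghat g ξ)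
      (fun ξ => (2 * π * ξ * I) * (-(freq ξ : ℂ) * ghat g ξ))) := by
    have h := weakL2_mode_ghat hα hg hiA (hiA.mul hkA.neg) (C := c + 2)
      (fun ξ => by rw [nI]; exact (hkK ξ).trans (hCk ξ))
      (fun ξ => by rw [norm_mul, norm_neg, nI, nk]; exact hC2 ξ)
    simpa only [mul_assoc] using h
  have w12 : WeakL2 (mode α (fun ξ => -((kap α ξ : ℂ) * ghat g ξ) + -(freq ξ : ℂ) * ghat g ξ)
      (fun ξ => -((freq ξ : ℂ) * (-(freq ξ : ℂ) * ghat g ξ)))) := by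
    have h := weakL2_mode_ghat hα hg (hKA.neg.add hkA.neg) (hkA.mul hkA) (C := c + 2)
      (fun ξ => by
        refine (norm_add_le _ _).trans ?_
        rw [norm_neg, norm_neg, nK, nk]
        nlinarith [hkK ξ, hK0 ξ])
      (fun ξ => by rw [norm_mul, nk]; exact hC2 ξ)
    convert! h using 3 <;> ring
  have w21 : WeakL2 (mode α (fun ξ => (2 * π * ξ * I) * ghat 0 ξ)
      (fun ξ => (2 * π * ξ * I) * (-(2 * π * ξ * I) * ghat g ξ))) := by
    have h := weakL2_mode_ghat hα hg (IsAmplitude.const 0) (hiA.mul hiA.neg) (C := c + 2)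
      (fun ξ => by rw [norm_zero]; exact mul_nonneg hC (hK0 ξ))
      (fun ξ => by rw [norm_mul, norm_neg, nI]; exact hC2 ξ)
    simpa only [mul_assoc, z0, mul_zero, zero_mul] using h
  have w22 : WeakL2 (mode α (fun ξ => -((kap α ξ : ℂ) * ghat 0 ξ) + -(2 * π * ξ * I) * ghat g ξ)
      (fun ξ => -((freq ξ : ℂ) * (-(2 * π * ξ * I) * ghat g ξ)))) := by
    have h := weakL2_mode_ghat hα hg hiA.neg (hkA.mul hiA) (C := c + 2)
      (fun ξ => by rw [norm_neg, nI]; exact (hkK ξ).trans (hCk ξ))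
      (fun ξ => by rw [norm_mul, nI, nk]; exact hC2 ξ)
    convert! h using 3
    · rw [z0]; ring
    · ring
  have hp1 := fun (x : ℝ × ℝ) (hx : x ∈ halfPlane) => hasDerivAt_mode_d1 hα hgA b1A x.1 hx
  have hp2 := fun (x : ℝ × ℝ) (hx : x ∈ halfPlane) => hasDerivAt_mode_d2 hα hgA b1A x.1 hx
  have hq1 := fun (x : ℝ × ℝ) (hx : x ∈ halfPlane) => hasDerivAt_mode_d1 hα zA b2A x.1 hx
  have hq2 := fun (x : ℝ × ℝ) (hx : x ∈ halfPlane) => hasDerivAt_mode_d2 hα zA b2A x.1 hx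
  have cu := continuousOn_mode hα hgA b1A
  have cv := continuousOn_mode hα zA b2A
  have cu1 := continuousOn_mode hα (isAmplitude_d1 hgA) (isAmplitude_d1 b1A)
  have cv2 := continuousOn_mode hα (isAmplitude_d2 hα zA b2A).1 (isAmplitude_d2 hα zA b2A).2
  have bk : ∀ (z : ℂ) (ξ : ℝ), ‖z‖ = freq ξ → ‖-z * ghat g ξ‖ ≤ D * freq ξ := fun z ξ hz => by
    rw [norm_mul, norm_neg, hz, mul_comm]
    exact mul_le_mul_of_nonneg_right (hgD ξ) (hk0 ξ)
  have zero_mode : ∀ x, mode α (fun _ => 0) (fun _ => 0) x = 0 := fun x => by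
    simp [mode, synth, modeAmp]
  refine ⟨hasGradAndTrace_of_tendsto w1 w11 w12 hp1 hp2 hg.1.locallyIntegrable fun φ hφ =>
      tendsto_mode_trace hα hg.1 b1A (fun ξ => bk _ ξ (nk ξ)) hφ,
    hasGradAndTrace_of_tendsto w2 w21 w22 hq1 hq2 locallyIntegrable_zero fun φ hφ =>
      tendsto_mode_trace hα (integrable_zero _ _ _) b2A (fun ξ => bk _ ξ (nI ξ)) hφ, ?_, ?_⟩
  · intro φ hφ
    have e1 := hφ.integral_d1 cu cu1 hp1
    have e2 := hφ.integral_d2 cv cv2 hq2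
    have i1 := hφ.d1.integrable_mul cu
    have i2 := hφ.d2.integrable_mul cv
    refine (integral_add i1 i2).trans ?_
    rw [e1, e2, ← neg_add, ← integral_add (hφ.integrable_mul cu1) (hφ.integrable_mul cv2), neg_eq_zero]
    refine setIntegral_eq_zero_of_forall_eq_zero fun x hx => ?_
    rw [← add_mul, mode_add hα (isAmplitude_d1 hgA) (isAmplitude_d1 b1A) (isAmplitude_d2 hα zA b2A).1
      (isAmplitude_d2 hα zA b2A).2 hx]
    convert! zero_mul _ using 2
    convert! zero_mode x using 2
    · funext ξ; rw [z0]; ring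
    · funext ξ; ring
  · -- the pressure
    have sA : IsAmplitude fun ξ => -(I * ((ξ / |ξ| : ℝ) : ℂ)) * ghat g ξ := by
      refine (IsAmplitude.of_bounded (C := 1) ?_ fun ξ => ?_).mul hgA
      · fun_prop
      · rw [norm_neg, norm_mul, norm_I, one_mul, norm_real, norm_eq_abs, abs_div, abs_abs]
        exact div_self_le_one _
    have pA := ((IsAmplitude.const (α : ℂ)).mul (hKA.add hkA)).mul sA
    have cp := continuousOn_mode hα pA sA
    have hr1 := fun (x : ℝ × ℝ) (hx : x ∈ halfPlane) => hasDerivAt_mode_d1 hα pA sA x.1 hx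
    have hr2 := fun (x : ℝ × ℝ) (hx : x ∈ halfPlane) => hasDerivAt_mode_d2 hα pA sA x.1 hx
    have p1A := isAmplitude_d1 pA
    have s1A := isAmplitude_d1 sA
    obtain ⟨p2A, s2A⟩ := isAmplitude_d2 hα pA sA
    have cp1 := continuousOn_mode hα p1A s1A
    have cp2 := continuousOn_mode hα p2A s2A
    have q1A := ((IsAmplitude.const (α : ℂ)).mul (hKA.add hkA)).mul b1A
    have q2A := ((IsAmplitude.const (α : ℂ)).mul (hKA.add hkA)).mul b2A
    have hs1 : ∀ ξ : ℝ, (ξ : ℂ) * ((ξ / |ξ| : ℝ) : ℂ) = ((|ξ| : ℝ) : ℂ) := fun ξ => by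
      rw [← Complex.ofReal_mul]; congr 1
      rcases eq_or_ne ξ 0 with h | h
      · simp [h]
      · have : |ξ| ≠ 0 := abs_ne_zero.2 h
        field_simp
        exact (sq_abs ξ).symm
    have hs2 : ∀ ξ : ℝ, ((|ξ| : ℝ) : ℂ) * ((ξ / |ξ| : ℝ) : ℂ) = ξ := fun ξ => by
      rw [← Complex.ofReal_mul]; congr 1
      rcases eq_or_ne ξ 0 with h | h
      · simp [h]
      · have : |ξ| ≠ 0 := abs_ne_zero.2 h
        field_simp
    have hkf : ∀ ξ, (freq ξ : ℂ) = 2 * π * ((|ξ| : ℝ) : ℂ) := fun ξ => by unfold freq; push_cast; ring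
    refine ⟨_, cp.locallyIntegrableOn measurableSet_halfPlane, fun φ hφ => ⟨?_, ?_⟩⟩
    · have e1 := integral_mode_helmholtz hα hgA b1A hφ
      have e2 := hφ.integral_d1 cp cp1 hr1
      have cq := continuousOn_mode hα q1A b1A
      simp only [stokesMode]
      rw [e2, sub_neg_eq_add, e1, ← integral_add (hφ.integrable_mul cq) (hφ.integrable_mul cp1)]
      refine setIntegral_eq_zero_of_forall_eq_zero fun x hx => ?_
      rw [← add_mul, mode_add hα q1A b1A p1A s1A hx]
      convert! zero_mul _ using 2
      convert! zero_mode x using 2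
      · funext ξ
        rw [hkf]
        linear_combination (-(2 * π * I ^ 2) * α * (kap α ξ + 2 * π * ((|ξ| : ℝ) : ℂ)) * ghat g ξ) * hs1 ξ
          - (2 * π * α * (kap α ξ + 2 * π * ((|ξ| : ℝ) : ℂ)) * ghat g ξ * ((|ξ| : ℝ) : ℂ)) * I_sq
      · funext ξ
        rw [hkf]
        linear_combination (-(2 * π * I ^ 2) * ghat g ξ) * hs1 ξ
          - (2 * π * ghat g ξ * ((|ξ| : ℝ) : ℂ)) * I_sq
    · have e1 := integral_mode_helmholtz hα zA b2A hφ
      have e2 := hφ.integral_d2 cp cp2 hr2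
      have cq := continuousOn_mode hα q2A b2A
      simp only [stokesMode]
      rw [e2, sub_neg_eq_add, e1, ← integral_add (hφ.integrable_mul cq) (hφ.integrable_mul cp2)]
      refine setIntegral_eq_zero_of_forall_eq_zero fun x hx => ?_
      rw [← add_mul, mode_add hα q2A b2A p2A s2A hx]
      convert! zero_mul _ using 2
      convert! zero_mode x using 2
      · funext ξ
        have h := kap_sq hα ξ
        have h3 : α * (kap α ξ ^ 2 - freq ξ ^ 2) = 1 := by rw [h]; field_simp; ring
        have h4 : (α : ℂ) * ((kap α ξ : ℂ) ^ 2 - (freq ξ : ℂ) ^ 2) = 1 := by exact_mod_cast h3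
        rw [hkf] at h4 ⊢
        linear_combination (I * ((ξ / |ξ| : ℝ) : ℂ) * ghat g ξ) * h4
          + (I * ghat g ξ * α * (kap α ξ + 2 * π * ((|ξ| : ℝ) : ℂ)) * 2 * π) * hs2 ξ
      · funext ξ
        rw [hkf]
        linear_combination (2 * π * I * ghat g ξ) * hs2 ξ

theorem isStokesSolution_boundaryPart (hα : 0 < α) (hg : MemL1Hhalf g) :
    IsStokesSolution α g (boundaryPart α g) :=
  (isStokesSolution_stokesMode hα hg).congr ((ae_restrict_iff' measurableSet_halfPlane).2
    (.of_forall fun _ hx => (boundaryPart_eq_stokesMode hα hg.1 hx).symm))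

end

section

/-! ### A Liouville theorem in weak `L²` -/

variable {f ψ ρ : ℝ × ℝ → ℝ} {c : ℝ}

/-- The correlation of a function with a test function. -/
def corr (f ψ : ℝ × ℝ → ℝ) (z : ℝ × ℝ) : ℝ := ∫ x, f x * ψ (x + z)

/-- An envelope of the translates of a test function. -/
lemma IsTest.exists_envelope (hψ : IsTest ψ) (S : ℝ) : ∃ w : ℝ × ℝ → ℝ, Integrable w ∧ (∃ M, ∀ x, |w x| ≤ M) ∧
    ∀ z, rad z ≤ S → ∀ x, |ψ (x + z)| ≤ w x := by
  obtain ⟨R, hR, h0⟩ := hψ.exists_radius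
  obtain ⟨M, hM, hb⟩ := hψ.exists_bound
  refine ⟨(Metric.closedBall 0 (R + S)).indicator fun _ => M, ?_, ⟨M, fun x => ?_⟩, fun z hz x => ?_⟩
  · rw [integrable_indicator_iff Metric.isClosed_closedBall.measurableSet]
    exact integrableOn_const (isCompact_closedBall _ _).measure_lt_top.ne
  · refine abs_le.2 ⟨?_, ?_⟩
    · exact (neg_nonpos.2 hM).trans (indicator_nonneg (fun _ _ => hM) x)
    · exact indicator_le_self' (fun _ _ => hM) x
  · by_cases hx : x ∈ Metric.closedBall (0 : ℝ × ℝ) (R + S)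
    · rw [indicator_of_mem hx]; exact hb _
    · rw [indicator_of_notMem hx, h0, abs_zero]
      have h1 : R + S < ‖x‖ := by simpa using hx
      have h2 := norm_le_rad x
      have h3 := rad_add_le (x + z) (-z)
      rw [add_neg_cancel_right, rad_neg] at h3
      linarith

lemma continuous_corr (hf : WeakL2On volume f) (hψ : IsTest ψ) : Continuous (corr f ψ) := by
  refine continuous_iff_continuousAt.2 fun z => ?_
  obtain ⟨w, hw, ⟨M, hM⟩, h⟩ := hψ.exists_envelope (rad z + 1)
  have hc := hψ.continuous
  refine continuousAt_of_dominated (bound := fun x => |f x * w x|) ?_ ?_ (hf.integrable_mul hw hM).abs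
    (.of_forall fun x => by fun_prop)
  · exact .of_forall fun z => hf.1.mul (by fun_prop)
  · have : ∀ᶠ y in 𝓝 z, rad y < rad z + 1 := (continuous_rad.tendsto z).eventually (gt_mem_nhds (by linarith))
    filter_upwards [this] with y hy
    refine .of_forall fun x => ?_
    rw [norm_eq_abs, abs_mul, abs_mul]
    exact mul_le_mul_of_nonneg_left ((h y hy.le x).trans (le_abs_self _)) (abs_nonneg _)

lemma hasDerivAt_corr_fst (hf : WeakL2On volume f) (hψ : IsTest ψ) (a b : ℝ) :
    HasDerivAt (fun s => corr f ψ (s, b)) (corr f (d1 ψ) (a, b)) a := by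
  obtain ⟨w, hw, ⟨M, hM⟩, h⟩ := hψ.d1.exists_envelope (rad (a, b) + 1)
  have hc := hψ.continuous
  have hc' := hψ.d1.continuous
  refine (hasDerivAt_integral_of_dominated_loc_of_deriv_le (F := fun s x => f x * ψ (x + (s, b)))
    (F' := fun s x => f x * d1 ψ (x + (s, b))) (s := Metric.ball a 1) (bound := fun x => |f x * w x|)
    (Metric.ball_mem_nhds a one_pos) (.of_forall fun s => hf.1.mul (by fun_prop))
    (hf.integrable_mul_test le_rfl (hψ.translate _)) (hf.1.mul (by fun_prop))
    (.of_forall fun x s hs => ?_) (hf.integrable_mul hw hM).abs (.of_forall fun x s _ => ?_)).2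
  · rw [norm_eq_abs, abs_mul, abs_mul]
    refine mul_le_mul_of_nonneg_left ?_ (abs_nonneg _)
    refine (h _ ?_ x).trans (le_abs_self _)
    have h1 := rad_add_le (a, b) (s - a, 0)
    have h2 : rad (s - a, 0) = |s - a| := by simp [rad, normSq, sqrt_sq_eq_abs]
    have h3 : ((a, b) : ℝ × ℝ) + (s - a, 0) = (s, b) := by simp
    have h4 : |s - a| < 1 := by simpa [Real.dist_eq] using hs
    rw [h2, h3] at h1
    linarith
  · have h1 := smooth_hasDerivAt_d1 hψ.1 (x.1 + s) (x.2 + b)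
    have h2 := HasDerivAt.comp (h₂ := fun t => ψ (t, x.2 + b)) s h1 ((hasDerivAt_id s).const_add x.1)
    rw [mul_one] at h2
    exact h2.const_mul (f x)

lemma hasDerivAt_corr_snd (hf : WeakL2On volume f) (hψ : IsTest ψ) (a b : ℝ) :
    HasDerivAt (fun s => corr f ψ (a, s)) (corr f (d2 ψ) (a, b)) b := by
  obtain ⟨w, hw, ⟨M, hM⟩, h⟩ := hψ.d2.exists_envelope (rad (a, b) + 1)
  have hc := hψ.continuous
  have hc' := hψ.d2.continuous
  refine (hasDerivAt_integral_of_dominated_loc_of_deriv_le (F := fun s x => f x * ψ (x + (a, s)))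
    (F' := fun s x => f x * d2 ψ (x + (a, s))) (s := Metric.ball b 1) (bound := fun x => |f x * w x|)
    (Metric.ball_mem_nhds b one_pos) (.of_forall fun s => hf.1.mul (by fun_prop))
    (hf.integrable_mul_test le_rfl (hψ.translate _)) (hf.1.mul (by fun_prop))
    (.of_forall fun x s hs => ?_) (hf.integrable_mul hw hM).abs (.of_forall fun x s _ => ?_)).2
  · rw [norm_eq_abs, abs_mul, abs_mul]
    refine mul_le_mul_of_nonneg_left ?_ (abs_nonneg _)
    refine (h _ ?_ x).trans (le_abs_self _)
    have h1 := rad_add_le (a, b) (0, s - b)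
    have h2 : rad (0, s - b) = |s - b| := by simp [rad, normSq, sqrt_sq_eq_abs]
    have h3 : ((a, b) : ℝ × ℝ) + (0, s - b) = (a, s) := by simp
    have h4 : |s - b| < 1 := by simpa [Real.dist_eq] using hs
    rw [h2, h3] at h1
    linarith
  · have h1 := smooth_hasDerivAt_d2 hψ.1 (x.1 + a) (x.2 + s)
    have h2 := HasDerivAt.comp (h₂ := fun t => ψ (x.1 + a, t)) s h1 ((hasDerivAt_id s).const_add x.2)
    rw [mul_one] at h2
    exact h2.const_mul (f x)

lemma tendsto_corr_cocompact (hf : WeakL2On volume f) (hψ : IsTest ψ) :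
    Tendsto (corr f ψ) (cocompact _) (𝓝 0) := by
  obtain ⟨M, hM, hb⟩ := hψ.exists_bound
  obtain ⟨R, hR, h0⟩ := hψ.exists_radius
  have hc := hψ.continuous
  rw [Metric.tendsto_nhds]
  intro ε hε
  set I := ∫ x, |ψ x| with hI
  have hI0 : 0 ≤ I := integral_nonneg fun _ => abs_nonneg _
  obtain ⟨F, hF, hF0, hfF⟩ := hf.exists_tail (δ := ε / (2 * (I + 1))) (by positivity)
  have hdom : ∀ z, Integrable fun x => F x * |ψ (x + z)| := fun z =>
    hF.mul_bdd (c := M) (by fun_prop) (.of_forall fun x => by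
      rw [norm_eq_abs, abs_abs]; exact hb _)
  have hlim : Tendsto (fun z => ∫ x, F x * |ψ (x + z)|) (cocompact (ℝ × ℝ)) (𝓝 0) := by
    have : (cocompact (ℝ × ℝ)).IsCountablyGenerated := by
      rw [← Metric.cobounded_eq_cocompact, ← comap_norm_atTop]
      infer_instance
    rw [← integral_zero (ℝ × ℝ) ℝ (μ := volume)]
    refine tendsto_integral_filter_of_dominated_convergence (fun x => M * F x) (.of_forall fun z => (hdom z).1)
      (.of_forall fun z => .of_forall fun x => ?_) (hF.const_mul M) (.of_forall fun x => ?_)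
    · rw [norm_of_nonneg (mul_nonneg (hF0 x) (abs_nonneg _)), mul_comm]
      exact mul_le_mul_of_nonneg_right (hb _) (hF0 x)
    · refine tendsto_const_nhds.congr' ?_
      filter_upwards [(isCompact_closedBall (0 : ℝ × ℝ) (R + rad x)).compl_mem_cocompact] with z hz
      have h1 : R + rad x < ‖z‖ := by simpa using hz
      have h2 := norm_le_rad z
      have h3 := rad_add_le (x + z) (-x)
      rw [rad_neg, add_neg_cancel_comm] at h3
      rw [h0 _ (by linarith), abs_zero, mul_zero]
  filter_upwards [(Metric.tendsto_nhds.1 hlim) (ε / 2) (half_pos hε)] with z hz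
  rw [Real.dist_eq, sub_zero] at hz ⊢
  have hψi : Integrable fun x => |ψ (x + z)| := (hψ.translate z).integrable.abs
  have h1 : |corr f ψ z| ≤ ∫ x, (F x * |ψ (x + z)| + ε / (2 * (I + 1)) * |ψ (x + z)|) := by
    refine (norm_integral_le_integral_norm _).trans (integral_mono
      (hf.integrable_mul_test le_rfl (hψ.translate z)).norm ((hdom z).add (hψi.const_mul _)) fun x => ?_)
    simp only [norm_eq_abs, abs_mul, Pi.add_apply]
    rw [← add_mul]
    exact mul_le_mul_of_nonneg_right (hfF x) (abs_nonneg _)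
  rw [integral_add (hdom z) (hψi.const_mul _), integral_const_mul,
    integral_add_right_eq_self (fun x => |ψ x|) z] at h1
  have h2 : ε / (2 * (I + 1)) * I < ε / 2 := by
    rw [div_mul_eq_mul_div, div_lt_div_iff₀ (by positivity) (by positivity)]
    nlinarith
  have := le_abs_self (∫ x, F x * |ψ (x + z)|)
  linarith

/-- The second derivative is not positive at a local maximum. -/
lemma second_deriv_nonpos {g g' : ℝ → ℝ} {g'' x₀ : ℝ} (h1 : ∀ x, HasDerivAt g (g' x) x)
    (h2 : HasDerivAt g' g'' x₀) (hm : IsLocalMax g x₀) : g'' ≤ 0 := by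
  by_contra hn
  have hd : deriv g = g' := deriv_eq h1
  have h3 : deriv (deriv g) x₀ = g'' := by rw [hd]; exact h2.deriv
  have h4 := isLocalMin_of_deriv_deriv_pos (f := g) (by rw [h3]; exact not_le.1 hn) hm.deriv_eq_zero
    (h1 x₀).continuousAt
  have h5 : g =ᶠ[𝓝 x₀] fun _ => g x₀ := by
    filter_upwards [hm, h4] with x hx hx' using le_antisymm hx hx'
  have h6 : g' =ᶠ[𝓝 x₀] fun _ => 0 := by
    filter_upwards [h5.eventually_nhds] with x hx
    have h7 := EventuallyEq.deriv_eq (show g =ᶠ[𝓝 x] fun _ => g x₀ from hx)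
    rw [hd] at h7
    simpa using h7
  have := h6.deriv_eq
  rw [h2.deriv] at this
  simp at this
  exact hn this.le

/-- The maximum principle for `cu - Δu = 0` in the plane. -/
lemma nonpos_of_helmholtz_of_tendsto {u u1 u2 u11 u22 : ℝ × ℝ → ℝ} (hc : 0 ≤ c) (hu : Continuous u)
    (h0 : Tendsto u (cocompact _) (𝓝 0))
    (h1 : ∀ a b, HasDerivAt (fun s => u (s, b)) (u1 (a, b)) a)
    (h2 : ∀ a b, HasDerivAt (fun s => u (a, s)) (u2 (a, b)) b)
    (h11 : ∀ a b, HasDerivAt (fun s => u1 (s, b)) (u11 (a, b)) a)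
    (h22 : ∀ a b, HasDerivAt (fun s => u2 (a, s)) (u22 (a, b)) b)
    (he : ∀ z, c * u z - (u11 z + u22 z) = 0) (z₀ : ℝ × ℝ) : u z₀ ≤ 0 := by
  by_contra hn
  have hn : 0 < u z₀ := not_le.1 hn
  have hev : ∀ᶠ z in cocompact (ℝ × ℝ), u z < u z₀ / 2 := h0.eventually (gt_mem_nhds (half_pos hn))
  obtain ⟨K, hK, hsub⟩ := mem_cocompact.1 hev
  obtain ⟨r, hr⟩ := hK.isBounded.subset_closedBall z₀
  set r' := max r 1 with hr'
  have hr1 : 1 ≤ r' := le_max_right _ _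
  set B := Metric.closedBall z₀ r' with hB
  set δ := u z₀ / (4 * r' ^ 2) with hδ
  have hδ0 : 0 < δ := by positivity
  have hBδ : ∀ z ∈ B, δ * (z.1 - z₀.1) ^ 2 ≤ u z₀ / 4 := by
    intro z hz
    have h3 : |z.1 - z₀.1| ≤ r' := by
      have := (norm_fst_le (z - z₀)).trans (mem_closedBall_iff_norm.1 hz)
      simpa using this
    have h4 : (z.1 - z₀.1) ^ 2 ≤ r' ^ 2 := by rw [← sq_abs]; gcongr
    calc _ ≤ δ * r' ^ 2 := by gcongr
      _ = _ := by rw [hδ]; field_simp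
  set v : ℝ × ℝ → ℝ := fun z => u z + δ * (z.1 - z₀.1) ^ 2 with hv
  have hz₀B : z₀ ∈ B := Metric.mem_closedBall_self (by linarith)
  obtain ⟨z, hz, hmax⟩ := (isCompact_closedBall z₀ r').exists_isMaxOn ⟨z₀, hz₀B⟩
    (f := v) (Continuous.continuousOn (by fun_prop))
  have hvz : u z₀ ≤ v z := by
    have : v z₀ ≤ v z := hmax hz₀B
    simpa [hv] using this
  have huz : u z₀ * (3 / 4) ≤ u z := by
    have := hBδ z hz
    simp only [hv] at hvz
    linarith
  have hlt : ∀ y, u z₀ / 2 ≤ u y → dist y z₀ ≤ r := by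
    intro y hy
    by_contra hny
    have : y ∈ Kᶜ := fun hyK => hny (hr hyK)
    exact absurd (hsub this) (not_lt.2 hy)
  have hloc : IsLocalMax v z := by
    have hopen : {y | u z₀ / 2 < u y} ∈ 𝓝 z := (isOpen_lt continuous_const hu).mem_nhds (by
      show u z₀ / 2 < u z
      linarith)
    filter_upwards [hopen] with y hy
    exact hmax (Metric.mem_closedBall.2 ((hlt y (le_of_lt hy)).trans (le_max_left _ _)))
  have hl1 : IsLocalMax (fun s => v (s, z.2)) z.1 :=
    (IsLocalMax.comp_continuous (f := v) (g := fun s : ℝ => (s, z.2)) (b := z.1) hloc (by fun_prop))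
  have hl2 : IsLocalMax (fun s => v (z.1, s)) z.2 :=
    (IsLocalMax.comp_continuous (f := v) (g := fun s : ℝ => (z.1, s)) (b := z.2) hloc (by fun_prop))
  have e1 := second_deriv_nonpos (g' := fun s => u1 (s, z.2) + δ * (2 * (s - z₀.1))) (g'' := u11 z + δ * 2)
    (fun s => by
      have h3 := (((hasDerivAt_id s).sub_const z₀.1).fun_pow 2).const_mul δ
      convert! (h1 s z.2).add h3 using 1
      simp) (by
      have h3 := ((((hasDerivAt_id z.1).sub_const z₀.1).const_mul 2)).const_mul δ
      convert! (h11 z.1 z.2).add h3 using 1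
      simp) hl1
  have e2 := second_deriv_nonpos (g' := fun s => u2 (z.1, s)) (g'' := u22 z)
    (fun s => by
      exact (h2 z.1 s).add_const (δ * (z.1 - z₀.1) ^ 2)) (h22 z.1 z.2) hl2
  have e3 := he z
  have : 0 ≤ c * u z := mul_nonneg hc (by linarith)
  linarith

lemma corr_sub_lap (hf : WeakL2On volume f) (hψ : IsTest ψ) (z : ℝ × ℝ) :
    c * corr f ψ z - (corr f (d1 (d1 ψ)) z + corr f (d2 (d2 ψ)) z)
      = ∫ x, f x * (c * ψ (x + z) - lap ψ (x + z)) := by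
  have i := fun {ψ} (h : IsTest ψ) => hf.integrable_mul_test le_rfl (h.translate z)
  have i3 : Integrable fun x => f x * d1 (d1 ψ) (x + z) + f x * d2 (d2 ψ) (x + z) := (i hψ.d1.d1).add (i hψ.d2.d2)
  unfold corr
  rw [← integral_const_mul, ← integral_add (i hψ.d1.d1) (i hψ.d2.d2), ← integral_sub ((i hψ).const_mul c) i3]
  refine integral_ext fun x => ?_
  simp only [lap]
  ring

lemma lap_translate (z : ℝ × ℝ) : lap (fun x => ψ (x + z)) = fun x => lap ψ (x + z) := by
  funext x
  simp only [lap, d1_translate, d2_translate]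

lemma WeakL2On.locallyIntegrable (hf : WeakL2On volume f) : LocallyIntegrable f := by
  rw [locallyIntegrable_iff]
  intro K hK
  have h1 : Integrable (K.indicator fun _ => (1 : ℝ)) (volume : Measure (ℝ × ℝ)) :=
    (integrable_indicator_iff hK.measurableSet).2 (integrableOn_const hK.measure_lt_top.ne)
  have h2 := hf.integrable_mul h1 (M := 1) (fun x => by
    rw [abs_of_nonneg (indicator_nonneg (fun _ _ => zero_le_one) x)]
    exact indicator_le_self' (fun _ _ => zero_le_one) x)
  rw [← integrable_indicator_iff hK.measurableSet]
  refine h2.congr (.of_forall fun x => ?_)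
  by_cases hx : x ∈ K <;> simp [hx]

/-- Liouville's theorem: if `∂₁ⁿ(c - Δ)f = 0` in the plane and `f` is in weak `L²`, then `f = 0`. -/
theorem WeakL2On.eq_zero_of_helmholtz (hf : WeakL2On volume f) (hc : 0 ≤ c) (n : ℕ)
    (h : ∀ ρ, IsTest ρ → ∫ x, f x * (c * (d1^[n] ρ) x - lap (d1^[n] ρ) x) = 0) :
    f =ᵐ[volume] fun _ => 0 := by
  have iter : ∀ (n : ℕ) (ρ : ℝ × ℝ → ℝ), IsTest ρ → IsTest (d1^[n] ρ) := by
    intro n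
    induction n with
    | zero => exact fun ρ hρ => hρ
    | succ n ih => intro ρ hρ; rw [Function.iterate_succ_apply]; exact ih _ hρ.d1
  have htr : ∀ (n : ℕ) (ρ : ℝ × ℝ → ℝ) (z : ℝ × ℝ), d1^[n] (fun x => ρ (x + z)) = fun x => (d1^[n] ρ) (x + z) := by
    intro n
    induction n with
    | zero => exact fun ρ z => rfl
    | succ n ih => intro ρ z; rw [Function.iterate_succ_apply, d1_translate, ih, Function.iterate_succ_apply]
  have hz : ∀ (ρ : ℝ × ℝ → ℝ), IsTest ρ → ∀ z, corr f (d1^[n] ρ) z = 0 := by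
    intro ρ hρ z
    have hψ := iter n ρ hρ
    have he : ∀ z, c * corr f (d1^[n] ρ) z - (corr f (d1 (d1 (d1^[n] ρ))) z + corr f (d2 (d2 (d1^[n] ρ))) z) = 0 := by
      intro z
      rw [corr_sub_lap hf hψ]
      have := h _ (hρ.translate z)
      rw [htr, lap_translate] at this
      exact this
    refine le_antisymm ?_ ?_
    · exact nonpos_of_helmholtz_of_tendsto hc (continuous_corr hf hψ) (tendsto_corr_cocompact hf hψ)
        (hasDerivAt_corr_fst hf hψ) (hasDerivAt_corr_snd hf hψ) (hasDerivAt_corr_fst hf hψ.d1)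
        (hasDerivAt_corr_snd hf hψ.d2) he z
    · have h0 := (tendsto_corr_cocompact hf hψ).neg
      rw [neg_zero] at h0
      have := nonpos_of_helmholtz_of_tendsto (u := fun z => -corr f (d1^[n] ρ) z)
        (u1 := fun z => -corr f (d1 (d1^[n] ρ)) z) (u2 := fun z => -corr f (d2 (d1^[n] ρ)) z)
        (u11 := fun z => -corr f (d1 (d1 (d1^[n] ρ))) z) (u22 := fun z => -corr f (d2 (d2 (d1^[n] ρ))) z) hc (continuous_corr hf hψ).neg h0
        (fun a b => (hasDerivAt_corr_fst hf hψ a b).fun_neg) (fun a b => (hasDerivAt_corr_snd hf hψ a b).fun_neg)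
        (fun a b => (hasDerivAt_corr_fst hf hψ.d1 a b).fun_neg)
        (fun a b => (hasDerivAt_corr_snd hf hψ.d2 a b).fun_neg) (fun z => by have := he z; linarith) z
      linarith
  have step : ∀ ψ, IsTest ψ → (∀ z, corr f (d1 ψ) z = 0) → ∀ z, corr f ψ z = 0 := by
    intro ψ hψ h1 z
    have hconst : ∀ s, corr f ψ (s, z.2) = corr f ψ z := fun s =>
      is_const_of_deriv_eq_zero (f := fun s => corr f ψ (s, z.2))
        (fun a => (hasDerivAt_corr_fst hf hψ a z.2).differentiableAt)
        (fun a => by rw [(hasDerivAt_corr_fst hf hψ a z.2).deriv, h1]) s z.1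
    have hl : Tendsto (fun s : ℝ => ((s, z.2) : ℝ × ℝ)) atTop (cocompact _) := by
      rw [← Metric.cobounded_eq_cocompact, ← tendsto_norm_atTop_iff_cobounded]
      exact tendsto_atTop_mono (fun s => (le_abs_self s).trans (norm_fst_le ((s, z.2) : ℝ × ℝ)))
        tendsto_id
    have := (tendsto_corr_cocompact hf hψ).comp hl
    exact tendsto_nhds_unique (tendsto_const_nhds.congr fun s => (hconst s).symm) this
  have hz' : ∀ k ≤ n, ∀ ρ, IsTest ρ → ∀ z, corr f (d1^[n - k] ρ) z = 0 := by
    intro k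
    induction k with
    | zero => exact fun _ => hz
    | succ k ih =>
      intro hk ρ hρ
      refine step _ (iter _ ρ hρ) ?_
      have := ih (by omega) ρ hρ
      rwa [show n - k = n - (k + 1) + 1 by omega, Function.iterate_succ_apply'] at this
  have hfin : ∀ ρ, IsTest ρ → ∫ x, f x * ρ x = 0 := by
    intro ρ hρ
    have := hz' n le_rfl ρ hρ 0
    simpa [corr] using this
  exact ae_eq_zero_of_integral_contDiff_smul_eq_zero hf.locallyIntegrable fun φ h1 h2 => by
    rw [← hfin φ ⟨h1, h2⟩]
    exact integral_ext (fun x => mul_comm _ _)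

end

section

/-! ### Superpositions of boundary layers -/

variable {c : ℝ} {l : ℝ → ℝ} {f g M : ℝ → ℂ}

/-- Polynomially bounded functions. -/
def IsPolyBounded (f : ℝ → ℂ) : Prop := ∃ C, ∃ N : ℕ, 0 ≤ C ∧ ∀ ξ, ‖f ξ‖ ≤ C * (1 + |ξ|) ^ N

lemma IsPolyBounded.mul (hf : IsPolyBounded f) (hg : IsPolyBounded g) : IsPolyBounded (fun ξ => f ξ * g ξ) := by
  obtain ⟨C, N, hC, h⟩ := hf
  obtain ⟨C', N', hC', h'⟩ := hg
  refine ⟨C * C', N + N', by positivity, fun ξ => ?_⟩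
  rw [norm_mul, pow_add, mul_mul_mul_comm]
  exact mul_le_mul (h ξ) (h' ξ) (norm_nonneg _) (by positivity)

lemma IsPolyBounded.add (hf : IsPolyBounded f) (hg : IsPolyBounded g) : IsPolyBounded (fun ξ => f ξ + g ξ) := by
  obtain ⟨C, N, hC, h⟩ := hf
  obtain ⟨C', N', hC', h'⟩ := hg
  refine ⟨C + C', N + N', by positivity, fun ξ => ?_⟩
  have h1 : (1 : ℝ) ≤ 1 + |ξ| := by linarith [abs_nonneg ξ]
  refine (norm_add_le _ _).trans ?_
  rw [add_mul]
  refine add_le_add ((h ξ).trans ?_) ((h' ξ).trans ?_)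
  · exact mul_le_mul_of_nonneg_left (pow_le_pow_right₀ h1 (by omega)) hC
  · exact mul_le_mul_of_nonneg_left (pow_le_pow_right₀ h1 (by omega)) hC'

lemma isPolyBounded_const (a : ℂ) : IsPolyBounded (fun _ => a) := ⟨‖a‖, 0, norm_nonneg _, fun ξ => by simp⟩

lemma isPolyBounded_of_bounded {C : ℝ} (h : ∀ ξ, ‖f ξ‖ ≤ C) : IsPolyBounded f :=
  ⟨C, 0, (norm_nonneg _).trans (h 0), fun ξ => by simpa using h ξ⟩

/-- Multipliers with two polynomially bounded derivatives. -/
def IsMultiplier (M : ℝ → ℂ) : Prop := ∃ M₁ M₂ : ℝ → ℂ, (∀ ξ, HasDerivAt M (M₁ ξ) ξ) ∧ (∀ ξ, HasDerivAt M₁ (M₂ ξ) ξ) ∧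
  IsPolyBounded M ∧ IsPolyBounded M₁ ∧ IsPolyBounded M₂

lemma IsMultiplier.isPolyBounded (hM : IsMultiplier M) : IsPolyBounded M := by
  obtain ⟨_, _, _, _, h, _⟩ := hM; exact h

lemma IsMultiplier.mul (hf : IsMultiplier f) (hg : IsMultiplier g) : IsMultiplier (fun ξ => f ξ * g ξ) := by
  obtain ⟨f₁, f₂, h1, h2, b0, b1, b2⟩ := hf
  obtain ⟨g₁, g₂, k1, k2, c0, c1, c2⟩ := hg
  exact ⟨_, _, fun ξ => (h1 ξ).mul (k1 ξ), fun ξ => ((h2 ξ).mul (k1 ξ)).add ((h1 ξ).mul (k2 ξ)), b0.mul c0,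
    (b1.mul c0).add (b0.mul c1), ((b2.mul c0).add (b1.mul c1)).add ((b1.mul c1).add (b0.mul c2))⟩

lemma IsMultiplier.add (hf : IsMultiplier f) (hg : IsMultiplier g) : IsMultiplier (fun ξ => f ξ + g ξ) := by
  obtain ⟨f₁, f₂, h1, h2, b0, b1, b2⟩ := hf
  obtain ⟨g₁, g₂, k1, k2, c0, c1, c2⟩ := hg
  exact ⟨_, _, fun ξ => (h1 ξ).add (k1 ξ), fun ξ => (h2 ξ).add (k2 ξ), b0.add c0, b1.add c1, b2.add c2⟩

lemma isMultiplier_const (a : ℂ) : IsMultiplier (fun _ => a) :=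
  ⟨fun _ => 0, fun _ => 0, fun _ => hasDerivAt_const _ _, fun _ => hasDerivAt_const _ _, isPolyBounded_const _,
    isPolyBounded_const _, isPolyBounded_const _⟩

lemma isMultiplier_wave (t : ℝ) : IsMultiplier (fun ξ => cexp (-(I * ξ * t))) := by
  have h : ∀ ξ : ℝ, HasDerivAt (fun ξ : ℝ => cexp (-(I * ξ * t)))
      (cexp (-(I * ξ * t)) * (-(I * t))) ξ := fun ξ => by
    have := (((ofRealCLM.hasDerivAt (x := ξ)).const_mul I).mul_const (t : ℂ)).fun_neg.cexp
    convert! this using 1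
    simp
  have hb : IsPolyBounded (fun ξ : ℝ => cexp (-(I * ξ * t))) :=
    isPolyBounded_of_bounded (C := 1) fun ξ => by
      rw [norm_exp]; simp
  exact ⟨_, _, h, fun ξ => (h ξ).mul_const _, hb, hb.mul (isPolyBounded_const _),
    (hb.mul (isPolyBounded_const _)).mul (isPolyBounded_const _)⟩

lemma IsMultiplier.continuous (hM : IsMultiplier M) : Continuous M := by
  obtain ⟨M₁, M₂, h1, -⟩ := hM
  exact continuous_iff_continuousAt.2 fun ξ => (h1 ξ).continuousAt

/-- Decay rates of boundary layers, as functions of the tangential frequency. -/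
def IsRate (l : ℝ → ℝ) : Prop := (∃ C, 0 < C ∧ ∃ l₁ l₂ : ℝ → ℝ, (∀ ξ, HasDerivAt l (l₁ ξ) ξ) ∧ (∀ ξ, HasDerivAt l₁ (l₂ ξ) ξ) ∧
  ∀ ξ, |l ξ| ≤ C * (1 + |ξ|) ∧ |l₁ ξ| ≤ C ∧ |l₂ ξ| ≤ C) ∧ ∀ ξ, 0 ≤ ξ → ξ ≤ l ξ

lemma IsRate.isMultiplier (hl : IsRate l) : IsMultiplier (fun ξ => (l ξ : ℂ)) := by
  obtain ⟨⟨C, hC, l₁, l₂, h1, h2, hb⟩, -⟩ := hl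
  refine ⟨fun ξ => (l₁ ξ : ℂ), fun ξ => (l₂ ξ : ℂ), fun ξ => (h1 ξ).ofReal_comp, fun ξ => (h2 ξ).ofReal_comp,
    ⟨C, 1, hC.le, fun ξ => ?_⟩, isPolyBounded_of_bounded (C := C) fun ξ => ?_, isPolyBounded_of_bounded (C := C) fun ξ => ?_⟩
  · simpa using (hb ξ).1
  · simpa using (hb ξ).2.1
  · simpa using (hb ξ).2.2

lemma isRate_id : IsRate (fun ξ => ξ) :=
  ⟨⟨1, one_pos, fun _ => 1, fun _ => 0, fun ξ => hasDerivAt_id _, fun ξ => hasDerivAt_const _ _, fun ξ => by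
    refine ⟨by linarith, by simp, by simp⟩⟩, fun ξ _ => le_rfl⟩

lemma isMultiplier_id : IsMultiplier (fun ξ => (ξ : ℂ)) := isRate_id.isMultiplier

/-- The decay rate of the vorticity layer at the frequency `ξ`. -/
def vortRate (α ξ : ℝ) : ℝ := √(ξ ^ 2 + 1 / α)

lemma vortRate_sq {α : ℝ} (hα : 0 < α) (ξ : ℝ) : vortRate α ξ ^ 2 = ξ ^ 2 + 1 / α := sq_sqrt (by positivity)

lemma isRate_vortRate {α : ℝ} (hα : 0 < α) : IsRate (vortRate α) := by
  have ha : 0 < 1 / α := by positivity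
  have hpos : ∀ ξ, 0 < vortRate α ξ := fun ξ => sqrt_pos.2 (by positivity)
  have hge : ∀ ξ, |ξ| ≤ vortRate α ξ := fun ξ => le_sqrt_of_sq_le (by rw [sq_abs]; linarith)
  have hge2 : ∀ ξ, √(1 / α) ≤ vortRate α ξ := fun ξ => Real.sqrt_le_sqrt (by nlinarith [sq_nonneg ξ])
  have hs : 0 < √(1 / α) := sqrt_pos.2 ha
  have h1 : ∀ ξ, HasDerivAt (vortRate α) (ξ / vortRate α ξ) ξ := fun ξ => by
    have := (((hasDerivAt_id ξ).fun_pow 2).add_const (1 / α)).sqrt (by simp only [id]; positivity)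
    convert! this using 1
    simp only [id, vortRate]
    field_simp
    norm_num
    ring
  refine ⟨⟨1 + √(1 / α) + 1 / √(1 / α), by positivity, fun ξ => ξ / vortRate α ξ, _, h1,
    fun ξ => (hasDerivAt_id ξ).div (h1 ξ) (hpos ξ).ne', fun ξ => ⟨?_, ?_, ?_⟩⟩, fun ξ _ => (le_abs_self ξ).trans (hge ξ)⟩
  · have h2 : vortRate α ξ ≤ |ξ| + √(1 / α) := by
      rw [vortRate, Real.sqrt_le_left (by positivity), add_sq, sq_abs, sq_sqrt ha.le]
      have : 0 ≤ 2 * |ξ| * √(1 / α) := by positivity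
      linarith
    rw [abs_of_pos (hpos ξ)]
    have : 0 ≤ 1 / √(1 / α) := by positivity
    nlinarith [abs_nonneg ξ, mul_nonneg hs.le (abs_nonneg ξ), mul_nonneg this (abs_nonneg ξ)]
  · rw [abs_div, abs_of_pos (hpos ξ), div_le_iff₀ (hpos ξ)]
    have : 0 ≤ 1 / √(1 / α) := by positivity
    nlinarith [hge ξ, hpos ξ, mul_nonneg hs.le (hpos ξ).le, mul_nonneg this (hpos ξ).le]
  · have e : (1 * vortRate α ξ - id ξ * (ξ / vortRate α ξ)) / vortRate α ξ ^ 2 = (1 / α) / vortRate α ξ ^ 3 := by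
      have := vortRate_sq hα ξ
      have h0 := (hpos ξ).ne'
      have : 1 / α = vortRate α ξ ^ 2 - ξ ^ 2 := by linarith
      rw [this]
      simp only [id]
      field_simp
    rw [e, abs_of_nonneg (by have := hpos ξ; positivity)]
    have h3 : 1 / α / vortRate α ξ ^ 3 ≤ 1 / √(1 / α) := by
      rw [div_le_div_iff₀ (pow_pos (hpos ξ) 3) hs, one_mul]
      have : (1 / α : ℝ) = √(1 / α) ^ 2 := (sq_sqrt ha.le).symm
      calc 1 / α * √(1 / α) = √(1 / α) ^ 3 := by rw [pow_succ, ← this]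
        _ ≤ _ := pow_le_pow_left₀ hs.le (hge2 ξ) 3
    linarith

/-- The superposition of the layers `e^{iξx₁ - l(ξ)x₂}` with the amplitudes `e^{-cξ²}M(ξ)`. -/
def layer (c : ℝ) (l : ℝ → ℝ) (M : ℝ → ℂ) (x : ℝ × ℝ) : ℂ :=
  ∫ ξ in Ioi (0 : ℝ), ((exp (-c * ξ ^ 2) : ℝ) : ℂ) * M ξ * cexp (I * ξ * x.1 - l ξ * x.2)

lemma exists_pow_mul_exp_quadratic_le (N : ℕ) (hc : 0 < c) (L : ℝ) : ∃ K, 0 < K ∧ ∀ ξ, 0 ≤ ξ →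
    (1 + ξ) ^ N * exp (-c * ξ ^ 2 + L * ξ) ≤ K * exp (-ξ) := by
  obtain ⟨K, hK, h⟩ := exists_pow_mul_exp_le N one_pos
  refine ⟨K * exp ((L + 2) ^ 2 / (4 * c)), by positivity, fun ξ hξ => ?_⟩
  have h1 := h ξ hξ
  have h2 : -c * ξ ^ 2 + (L + 2) * ξ ≤ (L + 2) ^ 2 / (4 * c) := by
    rw [le_div_iff₀ (by positivity)]
    nlinarith [sq_nonneg (2 * c * ξ - (L + 2))]
  calc (1 + ξ) ^ N * exp (-c * ξ ^ 2 + L * ξ)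
      = ((1 + ξ) ^ N * exp (-(1 * ξ))) * exp (-c * ξ ^ 2 + (L + 2) * ξ) * exp (-ξ) := by
        rw [mul_assoc, mul_assoc, ← exp_add, ← exp_add]; congr 2; ring
    _ ≤ K * exp ((L + 2) ^ 2 / (4 * c)) * exp (-ξ) := by
        have h3 : exp (-(1 / 2 * ξ)) ≤ 1 := exp_le_one_iff.2 (by linarith)
        have h4 : (1 + ξ) ^ N * exp (-(1 * ξ)) ≤ K := h1.trans (mul_le_of_le_one_right hK.le h3)
        gcongr

/-- The integrands of layers are dominated, locally uniformly. -/
lemma exists_layer_bound (hc : 0 < c) (hl : IsRate l) (hM : IsPolyBounded M) (R : ℝ) : ∃ K, 0 < K ∧ ∀ ξ, 0 ≤ ξ → ∀ x : ℝ × ℝ, |x.2| ≤ R →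
    ‖((exp (-c * ξ ^ 2) : ℝ) : ℂ) * M ξ * cexp (I * ξ * x.1 - l ξ * x.2)‖ ≤ K * exp (-ξ) := by
  obtain ⟨⟨C, hC, l₁, l₂, -, -, hb⟩, -⟩ := hl
  obtain ⟨B, N, hB, hM⟩ := hM
  obtain ⟨K, hK, h⟩ := exists_pow_mul_exp_quadratic_le N hc (C * R)
  refine ⟨K * exp (C * R) * B + 1, by positivity, fun ξ hξ x hx => ?_⟩
  rw [norm_mul, norm_mul, norm_real, norm_exp, norm_of_nonneg (by positivity)]
  have e : (I * ξ * x.1 - l ξ * x.2 : ℂ).re = -(l ξ * x.2) := by simp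
  have h1 : -(l ξ * x.2) ≤ C * R + C * R * ξ := by
    have h2 := (hb ξ).1
    rw [abs_of_nonneg hξ] at h2
    have h3 : |l ξ * x.2| ≤ C * (1 + ξ) * R := by
      rw [abs_mul]; exact mul_le_mul h2 hx (abs_nonneg _) (by positivity)
    have h4 := neg_abs_le (l ξ * x.2)
    nlinarith
  have h5 := hM ξ
  rw [abs_of_nonneg hξ] at h5
  rw [e]
  calc exp (-c * ξ ^ 2) * ‖M ξ‖ * exp (-(l ξ * x.2))
      ≤ exp (-c * ξ ^ 2) * (B * (1 + ξ) ^ N) * exp (C * R + C * R * ξ) := by gcongr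
    _ = ((1 + ξ) ^ N * exp (-c * ξ ^ 2 + C * R * ξ)) * (exp (C * R) * B) := by
        rw [exp_add, exp_add]; ring
    _ ≤ (K * exp (-ξ)) * (exp (C * R) * B) := mul_le_mul_of_nonneg_right (h ξ hξ) (by positivity)
    _ ≤ _ := by nlinarith [exp_pos (-ξ)]

lemma integrableOn_exp_neg_mul (K : ℝ) : IntegrableOn (fun ξ : ℝ => K * exp (-ξ)) (Ioi 0) :=
  (integrableOn_exp_neg_Ioi 0).const_mul K

lemma aestronglyMeasurable_layer (c : ℝ) (hl : IsRate l) (hM : Measurable M) (x : ℝ × ℝ) :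
    AEStronglyMeasurable (fun ξ : ℝ => ((exp (-c * ξ ^ 2) : ℝ) : ℂ) * M ξ *
      cexp (I * ξ * x.1 - l ξ * x.2)) (volume.restrict (Ioi 0)) := by
  have h2 := hl.isMultiplier.continuous.measurable
  fun_prop

lemma integrableOn_layer (hc : 0 < c) (hl : IsRate l) (hm : Measurable M) (hM : IsPolyBounded M) (x : ℝ × ℝ) :
    IntegrableOn (fun ξ : ℝ => ((exp (-c * ξ ^ 2) : ℝ) : ℂ) * M ξ *
      cexp (I * ξ * x.1 - l ξ * x.2)) (Ioi 0) := by
  obtain ⟨K, hK, h⟩ := exists_layer_bound hc hl hM |x.2|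
  exact Integrable.mono' (integrableOn_exp_neg_mul K) (aestronglyMeasurable_layer c hl hm x)
    (ae_restrict_of_forall_mem measurableSet_Ioi fun ξ hξ => h ξ (le_of_lt hξ) x le_rfl)

lemma IsMultiplier.integrableOn_layer (hM : IsMultiplier M) (hc : 0 < c) (hl : IsRate l) (x : ℝ × ℝ) :
    IntegrableOn (fun ξ : ℝ => ((exp (-c * ξ ^ 2) : ℝ) : ℂ) * M ξ * cexp (I * ξ * x.1 - l ξ * x.2)) (Ioi 0) :=
  AlphaEuler.integrableOn_layer hc hl hM.continuous.measurable hM.isPolyBounded x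

lemma layer_const_mul (a : ℂ) (x : ℝ × ℝ) : layer c l (fun ξ => a * M ξ) x = a * layer c l M x := by
  rw [layer, layer, ← integral_const_mul]
  congr 1; funext ξ; ring

lemma layer_add (hc : 0 < c) (hl : IsRate l) (hf : IsMultiplier f) (hg : IsMultiplier g) (x : ℝ × ℝ) :
    layer c l (fun ξ => f ξ + g ξ) x = layer c l f x + layer c l g x := by
  rw [layer, layer, layer, ← integral_add (hf.integrableOn_layer hc hl x) (hg.integrableOn_layer hc hl x)]
  congr 1; funext ξ; ring

lemma isMultiplier_d1 (hM : IsMultiplier M) : IsMultiplier (fun ξ => I * ξ * M ξ) :=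
  ((isMultiplier_const _).mul isMultiplier_id).mul hM

lemma isMultiplier_d2 (hl : IsRate l) (hM : IsMultiplier M) : IsMultiplier (fun ξ => -(l ξ : ℂ) * M ξ) := by
  have := ((isMultiplier_const (-1)).mul hl.isMultiplier).mul hM
  simpa using this

lemma hasFDerivAt_layer (hc : 0 < c) (hl : IsRate l) (hM : IsMultiplier M) (x : ℝ × ℝ) :
    HasFDerivAt (layer c l M)
      ((ContinuousLinearMap.fst ℝ ℝ ℝ).smulRight (layer c l (fun ξ => I * ξ * M ξ) x) +
        (ContinuousLinearMap.snd ℝ ℝ ℝ).smulRight (layer c l (fun ξ => -(l ξ : ℂ) * M ξ) x)) x := by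
  have hM1 := isMultiplier_d1 hM
  have hM2 := isMultiplier_d2 hl hM
  obtain ⟨K1, hK1, h1⟩ := exists_layer_bound hc hl hM1.isPolyBounded (|x.2| + 1)
  obtain ⟨K2, hK2, h2⟩ := exists_layer_bound hc hl hM2.isPolyBounded (|x.2| + 1)
  have hI1 := hM1.integrableOn_layer hc hl x
  have hI2 := hM2.integrableOn_layer hc hl x
  set e1 : ℝ × ℝ → ℝ → ℂ := fun x ξ => ((exp (-c * ξ ^ 2) : ℝ) : ℂ) * (I * ξ * M ξ) *
      cexp (I * ξ * x.1 - l ξ * x.2) with he1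
  set e2 : ℝ × ℝ → ℝ → ℂ := fun x ξ => ((exp (-c * ξ ^ 2) : ℝ) : ℂ) * (-(l ξ : ℂ) * M ξ) *
      cexp (I * ξ * x.1 - l ξ * x.2) with he2
  let S1 : ℂ →L[ℝ] (ℝ × ℝ →L[ℝ] ℂ) := ContinuousLinearMap.smulRightL ℝ (ℝ × ℝ) ℂ (ContinuousLinearMap.fst ℝ ℝ ℝ)
  let S2 : ℂ →L[ℝ] (ℝ × ℝ →L[ℝ] ℂ) := ContinuousLinearMap.smulRightL ℝ (ℝ × ℝ) ℂ (ContinuousLinearMap.snd ℝ ℝ ℝ)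
  have hF : ∀ (ξ : ℝ) (y : ℝ × ℝ), HasFDerivAt (fun y : ℝ × ℝ => ((exp (-c * ξ ^ 2) : ℝ) : ℂ) * M ξ *
      cexp (I * ξ * y.1 - l ξ * y.2)) (S1 (e1 y ξ) + S2 (e2 y ξ)) y := by
    intro ξ y
    have a1 : HasFDerivAt (fun y : ℝ × ℝ => (y.1 : ℂ)) (ofRealCLM.comp (ContinuousLinearMap.fst ℝ ℝ ℝ)) y :=
      (ofRealCLM.comp (ContinuousLinearMap.fst ℝ ℝ ℝ)).hasFDerivAt
    have a2 : HasFDerivAt (fun y : ℝ × ℝ => (y.2 : ℂ)) (ofRealCLM.comp (ContinuousLinearMap.snd ℝ ℝ ℝ)) y :=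
      (ofRealCLM.comp (ContinuousLinearMap.snd ℝ ℝ ℝ)).hasFDerivAt
    have := (((a1.const_mul (I * ξ)).sub (a2.const_mul (l ξ : ℂ))).cexp).const_mul
      (((exp (-c * ξ ^ 2) : ℝ) : ℂ) * M ξ)
    convert! this using 1
    ext <;> simp [S1, S2, he1, he2] <;> ring
  have key := (hasFDerivAt_integral_of_dominated_of_fderiv_le (μ := volume.restrict (Ioi (0 : ℝ)))
    (F := fun (y : ℝ × ℝ) (ξ : ℝ) => ((exp (-c * ξ ^ 2) : ℝ) : ℂ) * M ξ *
      cexp (I * ξ * y.1 - l ξ * y.2)) (F' := fun y ξ => S1 (e1 y ξ) + S2 (e2 y ξ)) (x₀ := x)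
    (s := Metric.ball x 1) (bound := fun ξ => ‖S1‖ * (K1 * exp (-ξ)) + ‖S2‖ * (K2 * exp (-ξ)))
    (Metric.ball_mem_nhds x one_pos) (.of_forall fun y => aestronglyMeasurable_layer c hl hM.continuous.measurable y)
    (hM.integrableOn_layer hc hl x)
    ((S1.integrable_comp hI1).add (S2.integrable_comp hI2)).aestronglyMeasurable
    ((ae_restrict_of_forall_mem measurableSet_Ioi fun ξ hξ y hy => ?_))
    (((integrableOn_exp_neg_mul K1).const_mul _).add ((integrableOn_exp_neg_mul K2).const_mul _))
    (.of_forall fun ξ y _ => hF ξ y))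
  · convert! key using 1
    have i1 : Integrable (fun ξ => S1 (e1 x ξ)) (volume.restrict (Ioi (0 : ℝ))) := S1.integrable_comp hI1
    have i2 : Integrable (fun ξ => S2 (e2 x ξ)) (volume.restrict (Ioi (0 : ℝ))) := S2.integrable_comp hI2
    rw [integral_add i1 i2, S1.integral_comp_comm hI1, S2.integral_comp_comm hI2]
    rfl
  · have hy' : |y.2| ≤ |x.2| + 1 := by
      have h3 : |y.2 - x.2| < 1 := by
        have := (le_max_right _ _).trans_lt (Metric.mem_ball.1 hy)
        simpa [Real.dist_eq] using this
      have := abs_sub_abs_le_abs_sub y.2 x.2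
      linarith
    refine (norm_add_le _ _).trans (add_le_add ((S1.le_opNorm _).trans ?_) ((S2.le_opNorm _).trans ?_))
    · exact mul_le_mul_of_nonneg_left (h1 ξ (le_of_lt hξ) y hy') (norm_nonneg _)
    · exact mul_le_mul_of_nonneg_left (h2 ξ (le_of_lt hξ) y hy') (norm_nonneg _)

lemma contDiff_layer (hc : 0 < c) (hl : IsRate l) (hM : IsMultiplier M) : ContDiff ℝ ∞ (layer c l M) := by
  refine contDiff_infty.2 fun n => ?_
  induction n generalizing M with
  | zero =>
    refine contDiff_zero.2 (continuous_iff_continuousAt.2 fun x => (hasFDerivAt_layer hc hl hM x).continuousAt)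
  | succ n ih =>
    refine contDiff_succ_iff_hasFDerivAt.2 ⟨_, ?_, hasFDerivAt_layer hc hl hM⟩
    exact (contDiff_const.smulRight (ih (isMultiplier_d1 hM))).add
      (contDiff_const.smulRight (ih (isMultiplier_d2 hl hM)))

end

section

/-! ### Decay of layers -/

variable {c : ℝ} {l l₁ : ℝ → ℝ} {a a₁ M : ℝ → ℂ}

/-- The decay rate of layers in the half-plane. -/
def envelope (x : ℝ × ℝ) : ℝ := (1 + x.1 ^ 2)⁻¹ * (1 + x.2 ^ 2)⁻¹

lemma envelope_pos (x : ℝ × ℝ) : 0 < envelope x := by unfold envelope; positivity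

lemma envelope_le_one (x : ℝ × ℝ) : envelope x ≤ 1 := by
  unfold envelope
  exact mul_le_one₀ (inv_le_one_of_one_le₀ (by nlinarith [sq_nonneg x.1])) (by positivity)
    (inv_le_one_of_one_le₀ (by nlinarith [sq_nonneg x.2]))

lemma integrable_envelope : Integrable envelope :=
  integrable_inv_one_add_sq.mul_prod integrable_inv_one_add_sq

lemma exists_norm_layer_pow_le (hc : 0 < c) (hl : IsRate l) (ha : IsPolyBounded a) (k : ℕ) : ∃ C, 0 ≤ C ∧
    ∀ x : ℝ × ℝ, 0 ≤ x.2 → ‖layer c l (fun ξ => (ξ : ℂ) ^ k * a ξ) x‖ ≤ C / (1 + x.2) ^ (k + 1) := by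
  obtain ⟨B, N, hB, hb⟩ := ha
  obtain ⟨K, hK, h⟩ := exists_pow_mul_exp_quadratic_le N hc 0
  refine ⟨B * K * Gamma (k + 1), by positivity, fun x hx => ?_⟩
  have hτ : 0 < 1 + x.2 := by linarith
  have hv := integral_rpow_mul_exp_neg_mul_Ioi (a := k + 1) (by positivity) hτ
  simp only [add_sub_cancel_right, rpow_natCast] at hv
  have hi : IntegrableOn (fun ξ => ξ ^ k * exp (-((1 + x.2) * ξ))) (Ioi 0) := by
    by_contra hn
    rw [integral_undef hn] at hv
    have : 0 < (1 / (1 + x.2)) ^ ((k : ℝ) + 1) * Gamma (k + 1) := by positivity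
    linarith
  refine (norm_integral_le_of_norm_le (hi.const_mul (B * K))
    (ae_restrict_of_forall_mem measurableSet_Ioi fun ξ hξ => ?_)).trans (le_of_eq ?_)
  · have hξ : 0 ≤ ξ := le_of_lt hξ
    have h1 := h ξ hξ
    have h2 := hb ξ
    rw [abs_of_nonneg hξ] at h2
    have h3 := mul_le_mul_of_nonneg_right (hl.2 ξ hξ) hx
    rw [norm_mul, norm_mul, norm_mul, norm_pow, norm_real, norm_real, norm_exp,
      norm_of_nonneg (by positivity), norm_of_nonneg hξ]
    have e : (I * ξ * x.1 - l ξ * x.2 : ℂ).re = -(l ξ * x.2) := by simp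
    rw [e]
    calc exp (-c * ξ ^ 2) * (ξ ^ k * ‖a ξ‖) * exp (-(l ξ * x.2))
        ≤ exp (-c * ξ ^ 2) * (ξ ^ k * (B * (1 + ξ) ^ N)) * exp (-(ξ * x.2)) := by gcongr
      _ = ((1 + ξ) ^ N * exp (-c * ξ ^ 2 + 0 * ξ)) * (B * ξ ^ k * exp (-(ξ * x.2))) := by
          rw [zero_mul, add_zero]; ring
      _ ≤ (K * exp (-ξ)) * (B * ξ ^ k * exp (-(ξ * x.2))) := by gcongr
      _ = _ := by
          rw [show -((1 + x.2) * ξ) = -ξ + -(ξ * x.2) by ring, exp_add]; ring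
  · rw [integral_const_mul, hv, one_div, inv_rpow hτ.le]
    norm_cast
    ring

/-- The amplitude of the tangential derivative of the layer with amplitude `ξ ^ (k + 1) * a`. -/
def tangAmp (c : ℝ) (k : ℕ) (a a₁ : ℝ → ℂ) (ξ : ℝ) : ℂ := ((k + 1) + -(2 * c) * (ξ * ξ)) * a ξ + ξ * a₁ ξ

lemma IsPolyBounded.tangAmp (h : IsPolyBounded a) (h₁ : IsPolyBounded a₁) (c : ℝ) (k : ℕ) :
    IsPolyBounded (tangAmp c k a a₁) := by
  have hi := isMultiplier_id.isPolyBounded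
  exact (((isPolyBounded_const _).add ((isPolyBounded_const _).mul (hi.mul hi))).mul h).add (hi.mul h₁)

lemma layer_tangential (hc : 0 < c) (hl : IsRate l) (hl₁ : ∀ ξ, HasDerivAt l (l₁ ξ) ξ)
    (bl : IsPolyBounded fun ξ => (l₁ ξ : ℂ)) (h : ∀ ξ, HasDerivAt a (a₁ ξ) ξ) (ba : IsPolyBounded a)
    (ba₁ : IsPolyBounded a₁) (k : ℕ) (x : ℝ × ℝ) :
    I * x.1 * layer c l (fun ξ => (ξ : ℂ) ^ (k + 1) * a ξ) x =
      x.2 * layer c l (fun ξ => (ξ : ℂ) ^ (k + 1) * (l₁ ξ * a ξ)) x -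
        layer c l (fun ξ => (ξ : ℂ) ^ k * tangAmp c k a a₁ ξ) x := by
  have hm : Measurable a := (continuous_iff_continuousAt.2 fun ξ => (h ξ).continuousAt).measurable
  have hm₁ : Measurable a₁ := by
    rw [show a₁ = deriv a from funext fun ξ => (h ξ).deriv.symm]; exact measurable_deriv _
  have ml : Measurable l₁ := by
    rw [show l₁ = deriv l from funext fun ξ => (hl₁ ξ).deriv.symm]; exact measurable_deriv _
  have hp : ∀ n : ℕ, IsPolyBounded fun ξ : ℝ => (ξ : ℂ) ^ n := fun n => by
    refine ⟨1, n, zero_le_one, fun ξ => ?_⟩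
    rw [norm_pow, norm_real, norm_eq_abs, one_mul]
    exact pow_le_pow_left₀ (abs_nonneg _) (by linarith) n
  have i0 := integrableOn_layer hc hl (by fun_prop) ((hp (k + 1)).mul ba) x
  have i1 := integrableOn_layer hc hl (by fun_prop) ((hp (k + 1)).mul (bl.mul ba)) x
  have i2 := integrableOn_layer hc hl (by unfold tangAmp; fun_prop) ((hp k).mul (ba.tangAmp ba₁ c k)) x
  have hU : ∀ ξ : ℝ, HasDerivAt (fun ξ : ℝ => ((exp (-c * ξ ^ 2) : ℝ) : ℂ) * ((ξ : ℂ) ^ (k + 1) * a ξ) *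
      cexp (I * ξ * x.1 - l ξ * x.2))
      (I * x.1 * (((exp (-c * ξ ^ 2) : ℝ) : ℂ) * ((ξ : ℂ) ^ (k + 1) * a ξ) * cexp (I * ξ * x.1 - l ξ * x.2)) -
        x.2 * (((exp (-c * ξ ^ 2) : ℝ) : ℂ) * ((ξ : ℂ) ^ (k + 1) * (l₁ ξ * a ξ)) * cexp (I * ξ * x.1 - l ξ * x.2)) +
        ((exp (-c * ξ ^ 2) : ℝ) : ℂ) * ((ξ : ℂ) ^ k * tangAmp c k a a₁ ξ) * cexp (I * ξ * x.1 - l ξ * x.2)) ξ :=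
    fun ξ => by
    have d := ofRealCLM.hasDerivAt (x := ξ)
    have e1 := ((((hasDerivAt_id ξ).fun_pow 2).const_mul (-c)).exp).ofReal_comp
    convert! (e1.mul ((d.fun_pow (k + 1)).mul (h ξ))).mul
      (((d.const_mul I).mul_const (x.1 : ℂ)).sub ((hl₁ ξ).ofReal_comp.mul_const (x.2 : ℂ))).cexp using 1
    simp only [tangAmp, id, Pi.mul_apply, Pi.sub_apply, Complex.ofRealCLM_apply, Nat.add_sub_cancel]
    push_cast
    ring
  have hs := ((i0.const_mul (I * x.1)).sub (i1.const_mul (x.2 : ℂ))).add i2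
  have := (integral_add ((i0.const_mul (I * x.1)).sub (i1.const_mul (x.2 : ℂ))) i2).symm.trans
    (integral_Ioi_of_hasDerivAt_of_tendsto' (a := 0) (fun ξ _ => hU ξ) hs
      (tendsto_zero_of_hasDerivAt_of_integrableOn_Ioi (fun ξ _ => hU ξ) hs i0))
  rw [integral_sub' (i0.const_mul _) (i1.const_mul _),
    integral_const_mul, integral_const_mul] at this
  simp only [layer]
  simp only [Complex.ofReal_zero, ne_eq, Nat.add_eq_zero_iff, one_ne_zero, and_false, not_false_eq_true, zero_pow,
    zero_mul, mul_zero, sub_zero] at this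
  linear_combination this

/-- Layers whose amplitudes vanish to third order decay like the envelope. -/
lemma exists_norm_layer_le (hc : 0 < c) (hl : IsRate l) (hM : IsMultiplier M) : ∃ C, 0 < C ∧ ∀ x : ℝ × ℝ, 0 ≤ x.2 →
    ‖layer c l (fun ξ => (ξ : ℂ) ^ 3 * M ξ) x‖ ≤ C * envelope x := by
  obtain ⟨D, hD, l₁, l₂, hl₁, hl₂, hb⟩ := hl.1
  obtain ⟨M₁, M₂, hM₁, hM₂, b0, b1, b2⟩ := hM
  have bl₁ : IsPolyBounded fun ξ => (l₁ ξ : ℂ) := isPolyBounded_of_bounded fun ξ => by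
    rw [norm_real]; exact (hb ξ).2.1
  have bl₂ : IsPolyBounded fun ξ => (l₂ ξ : ℂ) := isPolyBounded_of_bounded fun ξ => by
    rw [norm_real]; exact (hb ξ).2.2
  have bi := isMultiplier_id.isPolyBounded
  have br := b0.tangAmp b1 c 2
  let r₁ : ℝ → ℂ := fun ξ => -(2 * c) * (ξ + ξ) * M ξ + (2 + 1 + -(2 * c) * (ξ * ξ)) * M₁ ξ + (M₁ ξ + ξ * M₂ ξ)
  have hr : ∀ ξ, HasDerivAt (tangAmp c 2 M M₁) (r₁ ξ) ξ := fun ξ => by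
    have d := ofRealCLM.hasDerivAt (x := ξ)
    convert! ((((d.mul d).const_mul (-(2 * c : ℂ))).const_add (((2 : ℕ) : ℂ) + 1)).mul (hM₁ ξ)).add (d.mul (hM₂ ξ)) using 1
    simp [r₁]
  have br₁ : IsPolyBounded r₁ :=
    ((((isPolyBounded_const _).mul (bi.add bi)).mul b0).add
      (((isPolyBounded_const _).add ((isPolyBounded_const _).mul (bi.mul bi))).mul b1)).add (b1.add (bi.mul b2))
  have hq : ∀ ξ, HasDerivAt (fun ξ => (l₁ ξ : ℂ) * M ξ) (l₂ ξ * M ξ + l₁ ξ * M₁ ξ) ξ := fun ξ =>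
    (hl₂ ξ).ofReal_comp.mul (hM₁ ξ)
  have bq := (bl₂.mul b0).add (bl₁.mul b1)
  obtain ⟨C0, p0, h0⟩ := exists_norm_layer_pow_le hc hl b0 3
  obtain ⟨C1, p1, h1⟩ := exists_norm_layer_pow_le hc hl (bl₁.mul (bl₁.mul b0)) 3
  obtain ⟨C2, p2, h2⟩ := exists_norm_layer_pow_le hc hl ((bl₁.mul b0).tangAmp bq c 2) 2
  obtain ⟨C3, p3, h3⟩ := exists_norm_layer_pow_le hc hl (bl₁.mul br) 2
  obtain ⟨C4, p4, h4⟩ := exists_norm_layer_pow_le hc hl (br.tangAmp br₁ c 1) 1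
  refine ⟨C0 + C1 + C2 + C3 + C4 + 1, by positivity, fun x hx => ?_⟩
  have e1 := layer_tangential hc hl hl₁ bl₁ hM₁ b0 b1 2 x
  have e2 := layer_tangential hc hl hl₁ bl₁ hq (bl₁.mul b0) bq 2 x
  have e3 := layer_tangential hc hl hl₁ bl₁ hr br br₁ 1 x
  simp only [Nat.reduceAdd] at e1 e2 e3
  replace h0 := h0 x hx
  replace h1 := h1 x hx
  replace h2 := h2 x hx
  replace h3 := h3 x hx
  replace h4 := h4 x hx
  set L := layer c l (fun ξ => (ξ : ℂ) ^ 3 * M ξ) x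
  have hn : (x.1 : ℂ) ^ 2 * L = -(x.2 * (x.2 * layer c l (fun ξ => (ξ : ℂ) ^ 3 * (l₁ ξ * (l₁ ξ * M ξ))) x)) +
      x.2 * layer c l (fun ξ => (ξ : ℂ) ^ 2 * tangAmp c 2 (fun ξ => l₁ ξ * M ξ) (fun ξ => l₂ ξ * M ξ + l₁ ξ * M₁ ξ) ξ) x +
      x.2 * layer c l (fun ξ => (ξ : ℂ) ^ 2 * (l₁ ξ * tangAmp c 2 M M₁ ξ)) x -
      layer c l (fun ξ => (ξ : ℂ) ^ 1 * tangAmp c 1 (tangAmp c 2 M M₁) r₁ ξ) x := by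
    linear_combination (-I * x.1) * e1 - x.2 * e2 + e3 + x.1 ^ 2 * L * I_sq
  have hτ : 0 < 1 + x.2 := by linarith
  have hy : ‖(x.2 : ℂ)‖ ≤ 1 + x.2 := by rw [norm_real, norm_of_nonneg hx]; linarith
  have k1 : x.1 ^ 2 * ‖L‖ ≤ (C1 + C2 + C3 + C4) / (1 + x.2) ^ 2 := by
    calc _ = ‖(x.1 : ℂ) ^ 2 * L‖ := by rw [norm_mul, norm_pow, norm_real, norm_eq_abs, sq_abs]
      _ ≤ (1 + x.2) * ((1 + x.2) * (C1 / (1 + x.2) ^ 4)) + (1 + x.2) * (C2 / (1 + x.2) ^ 3) +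
          (1 + x.2) * (C3 / (1 + x.2) ^ 3) + C4 / (1 + x.2) ^ 2 := by
        rw [hn]
        refine (norm_sub_le _ _).trans (add_le_add (norm_add₃_le.trans (add_le_add_three ?_ ?_ ?_)) h4)
        · rw [norm_neg, norm_mul, norm_mul]; gcongr
        · rw [norm_mul]; gcongr
        · rw [norm_mul]; gcongr
      _ = _ := by field_simp
  have k0 : ‖L‖ ≤ C0 / (1 + x.2) ^ 2 := h0.trans (div_le_div_of_nonneg_left p0 (by positivity)
    (pow_le_pow_right₀ (by linarith) (by norm_num)))
  have k2 : (1 + x.1 ^ 2) * ‖L‖ ≤ (C0 + C1 + C2 + C3 + C4 + 1) / (1 + x.2) ^ 2 := by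
    calc _ = ‖L‖ + x.1 ^ 2 * ‖L‖ := by ring
      _ ≤ C0 / (1 + x.2) ^ 2 + (C1 + C2 + C3 + C4) / (1 + x.2) ^ 2 := add_le_add k0 k1
      _ ≤ _ := by
        rw [← add_div]; exact div_le_div_of_nonneg_right (by linarith) (by positivity)
  rw [envelope, mul_left_comm, inv_mul_eq_div, le_div_iff₀ (by positivity), mul_comm, ← div_eq_mul_inv]
  refine k2.trans (div_le_div_of_nonneg_left (by positivity) (by positivity) (by nlinarith))

end

section

/-! ### Test functions which do not vanish near the boundary or at infinity -/

variable {f φ ψ h : ℝ × ℝ → ℝ} {α C : ℝ}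

lemma d1_germ {x : ℝ × ℝ} (h : φ =ᶠ[𝓝 x] ψ) : d1 φ =ᶠ[𝓝 x] d1 ψ := by
  filter_upwards [h.eventuallyEq_nhds] with y hy
  exact EventuallyEq.deriv_eq
    (((Continuous.prodMk_left y.2).tendsto y.1).eventually (p := fun z => φ z = ψ z) hy)

lemma d2_germ {x : ℝ × ℝ} (h : φ =ᶠ[𝓝 x] ψ) : d2 φ =ᶠ[𝓝 x] d2 ψ := by
  filter_upwards [h.eventuallyEq_nhds] with y hy
  exact EventuallyEq.deriv_eq
    (((Continuous.prodMk_right y.1).tendsto y.2).eventually (p := fun z => φ z = ψ z) hy)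

lemma lap_germ {x : ℝ × ℝ} (h : φ =ᶠ[𝓝 x] ψ) : lap φ x = lap ψ x := by
  rw [lap, lap, (d1_germ (d1_germ h)).eq_of_nhds, (d2_germ (d2_germ h)).eq_of_nhds]

lemma lap_mul (hφ : ContDiff ℝ ∞ φ) (hψ : ContDiff ℝ ∞ ψ) (x : ℝ × ℝ) :
    lap (fun x => φ x * ψ x) x = lap φ x * ψ x + 2 * (d1 φ x * d1 ψ x + d2 φ x * d2 ψ x) + φ x * lap ψ x := by
  rw [lap, d1_mul hφ hψ, d2_mul hφ hψ,
    d1_add ((smooth_d1 hφ).mul hψ) (hφ.mul (smooth_d1 hψ)), d2_add ((smooth_d2 hφ).mul hψ) (hφ.mul (smooth_d2 hψ)),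
    d1_mul (smooth_d1 hφ) hψ, d1_mul hφ (smooth_d1 hψ), d2_mul (smooth_d2 hφ) hψ, d2_mul hφ (smooth_d2 hψ), lap, lap]
  ring

lemma d1_scale (a : ℝ) : d1 (fun x => φ (a • x)) = fun x => a * d1 φ (a • x) := funext fun x => by
  have := deriv_comp_mul_left a (fun s => φ (s, a * x.2)) x.1
  simpa [d1] using this

lemma d2_scale (a : ℝ) : d2 (fun x => φ (a • x)) = fun x => a * d2 φ (a • x) := funext fun x => by
  have := deriv_comp_mul_left a (fun s => φ (a * x.1, s)) x.2
  simpa [d2] using this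

lemma smooth_scale (hφ : ContDiff ℝ ∞ φ) (a : ℝ) : ContDiff ℝ ∞ (fun x => φ (a • x)) :=
  hφ.comp (contDiff_const_smul a)

lemma lap_scale (hφ : ContDiff ℝ ∞ φ) (a : ℝ) : lap (fun x => φ (a • x)) = fun x => a ^ 2 * lap φ (a • x) :=
  funext fun x => by
    rw [lap, d1_scale, d2_scale, d1_const_mul a (smooth_scale (smooth_d1 hφ) a), d1_scale,
      d2_const_mul a (smooth_scale (smooth_d2 hφ) a), d2_scale, lap]
    ring

/-- Cutoff functions with bounded derivatives which exhaust the plane. -/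
lemma exists_cutoff : ∃ C, 0 ≤ C ∧ ∃ T : ℕ → ℝ × ℝ → ℝ, (∀ n, IsTest (T n)) ∧
    (∀ n x, |T n x| ≤ C ∧ |d1 (T n) x| ≤ C ∧ |d2 (T n) x| ≤ C ∧ |lap (T n) x| ≤ C) ∧
    ∀ x, ∀ᶠ n in atTop, T n =ᶠ[𝓝 x] fun _ => 1 := by
  let b : ContDiffBump (0 : ℝ × ℝ) := ⟨1, 2, one_pos, one_lt_two⟩
  have hb : IsTest b := ⟨b.contDiff, b.hasCompactSupport⟩
  obtain ⟨C0, h0, k0⟩ := hb.exists_bound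
  obtain ⟨C1, h1, k1⟩ := hb.d1.exists_bound
  obtain ⟨C2, h2, k2⟩ := hb.d2.exists_bound
  obtain ⟨C3, h3, k3⟩ := hb.lap.exists_bound
  have ha : ∀ n : ℕ, 0 < ((n : ℝ) + 1)⁻¹ ∧ ((n : ℝ) + 1)⁻¹ ≤ 1 := fun n =>
    ⟨by positivity, inv_le_one_of_one_le₀ (by linarith [(Nat.cast_nonneg n : (0 : ℝ) ≤ n)])⟩
  refine ⟨C0 + C1 + C2 + C3, by positivity, fun n x => b (((n : ℝ) + 1)⁻¹ • x), fun n => ⟨smooth_scale hb.1 _, ?_⟩,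
    fun n x => ⟨?_, ?_, ?_, ?_⟩, fun x => ?_⟩
  · exact hb.2.comp_homeomorph (Homeomorph.smulOfNeZero _ (ha n).1.ne')
  · exact (k0 _).trans (by linarith)
  · rw [d1_scale, abs_mul, abs_of_pos (ha n).1]
    exact (mul_le_of_le_one_left (abs_nonneg _) (ha n).2).trans ((k1 _).trans (by linarith))
  · rw [d2_scale, abs_mul, abs_of_pos (ha n).1]
    exact (mul_le_of_le_one_left (abs_nonneg _) (ha n).2).trans ((k2 _).trans (by linarith))
  · rw [lap_scale hb.1, abs_mul, abs_of_pos (pow_pos (ha n).1 2)]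
    exact (mul_le_of_le_one_left (abs_nonneg _) (pow_le_one₀ (ha n).1.le (ha n).2)).trans ((k3 _).trans (by linarith))
  · filter_upwards [eventually_ge_atTop ⌈‖x‖⌉₊] with n hn
    have hx : ‖x‖ < n + 1 := (Nat.le_of_ceil_le hn).trans_lt (by linarith)
    have : ∀ᶠ y in 𝓝 x, ‖y‖ < n + 1 := (continuous_norm.tendsto x).eventually (gt_mem_nhds hx)
    filter_upwards [this] with y hy
    refine b.one_of_mem_closedBall ?_
    rw [mem_closedBall_zero_iff, norm_smul, norm_of_nonneg (ha n).1.le, inv_mul_le_iff₀ (by positivity), mul_one]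
    exact hy.le

lemma exists_scaled_bound {θ : ℝ → ℝ} (hθ : Continuous θ) (h : ∀ s, s ∉ Icc (1 : ℝ) 2 → θ s = 0) :
    ∃ C, 0 ≤ C ∧ ∀ s, |θ s| ≤ C := by
  obtain ⟨C, hC⟩ := isCompact_Icc.exists_bound_of_continuousOn (hθ.continuousOn (s := Icc (1 : ℝ) 2))
  refine ⟨|C|, abs_nonneg _, fun s => ?_⟩
  by_cases hs : s ∈ Icc (1 : ℝ) 2
  · exact (hC s hs).trans (le_abs_self _)
  · rw [h s hs, abs_zero]; exact abs_nonneg _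

/-- Functions which vanish near the boundary of the half-plane and converge to `1` inside it. -/
lemma exists_boundary_cutoff : ∃ C, 0 ≤ C ∧ ∃ T : ℕ → ℝ × ℝ → ℝ, (∀ n, ContDiff ℝ ∞ (T n)) ∧
    (∀ n x, |T n x| ≤ C ∧ d1 (T n) x = 0 ∧ |x.2 * d2 (T n) x| ≤ C ∧ |x.2 ^ 2 * lap (T n) x| ≤ C) ∧
    (∀ n, tsupport (T n) ⊆ halfPlane) ∧
    ∀ x ∈ halfPlane, ∀ᶠ n in atTop, T n =ᶠ[𝓝 x] fun _ => 1 := by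
  let θ : ℝ → ℝ := fun s => smoothTransition (s - 1)
  have hθ : ContDiff ℝ ∞ θ := smoothTransition.contDiff.comp (contDiff_id.sub contDiff_const)
  have hθ' : ContDiff ℝ ∞ (deriv θ) := (contDiff_infty_iff_deriv.1 hθ).2
  have hθ'' : ContDiff ℝ ∞ (deriv (deriv θ)) := (contDiff_infty_iff_deriv.1 hθ').2
  have hconst : ∀ s, s ∉ Icc (1 : ℝ) 2 → ∃ a, θ =ᶠ[𝓝 s] fun _ => a := by
    intro s hs
    rw [mem_Icc, not_and_or, not_le, not_le] at hs
    rcases hs with hs | hs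
    · refine ⟨0, ?_⟩
      filter_upwards [gt_mem_nhds hs] with t ht
      exact smoothTransition.zero_of_nonpos (by linarith)
    · refine ⟨1, ?_⟩
      filter_upwards [lt_mem_nhds hs] with t ht
      exact smoothTransition.one_of_one_le (by linarith)
  have d0 : ∀ s, s ∉ Icc (1 : ℝ) 2 → deriv θ s = 0 ∧ deriv (deriv θ) s = 0 := fun s hs => by
    obtain ⟨a, ha⟩ := hconst s hs
    have h1 := ha.deriv
    have h2 := h1.deriv
    rw [h1.eq_of_nhds, h2.eq_of_nhds]
    simp
  obtain ⟨C1, h1, k1⟩ := exists_scaled_bound (continuous_id.mul hθ'.continuous)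
    fun s hs => by simp [(d0 s hs).1]
  obtain ⟨C2, h2, k2⟩ := exists_scaled_bound ((continuous_id.pow 2).mul hθ''.continuous)
    fun s hs => by simp [(d0 s hs).2]
  let Θ : ℝ × ℝ → ℝ := fun x => θ x.2
  have hΘ : ContDiff ℝ ∞ Θ := hθ.comp contDiff_snd
  have e1 : d1 Θ = fun _ => 0 := funext fun x => deriv_const x.1 (θ x.2)
  have e2 : d2 Θ = fun x => deriv θ x.2 := rfl
  have e3 : lap Θ = fun x => deriv (deriv θ) x.2 := funext fun x => by
    have : d1 (fun _ => (0 : ℝ)) x = 0 := deriv_const _ _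
    rw [lap, e1, this, zero_add, e2]; rfl
  have ha : ∀ n : ℕ, 0 < (n : ℝ) + 1 := fun n => by positivity
  refine ⟨1 + C1 + C2, by positivity, fun n x => Θ (((n : ℝ) + 1) • x), fun n => smooth_scale hΘ _,
    fun n x => ⟨?_, ?_, ?_, ?_⟩, fun n => ?_, fun x hx => ?_⟩
  · have h3 := smoothTransition.nonneg ((n + 1) * x.2 - 1)
    have h4 := smoothTransition.le_one ((n + 1) * x.2 - 1)
    change |smoothTransition ((n + 1) * x.2 - 1)| ≤ _
    rw [abs_of_nonneg h3]; linarith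
  · rw [d1_scale, e1]; exact mul_zero _
  · rw [d2_scale, e2]
    have := k1 ((n + 1) * x.2)
    have e : x.2 * ((n + 1) * deriv θ (((n + 1 : ℝ) • x).2)) = (n + 1) * x.2 * deriv θ ((n + 1) * x.2) := by
      simp only [Prod.smul_snd, smul_eq_mul]; ring
    rw [e]
    exact this.trans (by linarith)
  · rw [lap_scale hΘ, e3]
    have := k2 ((n + 1) * x.2)
    have e : x.2 ^ 2 * ((n + 1) ^ 2 * deriv (deriv θ) (((n + 1 : ℝ) • x).2))
        = ((n + 1) * x.2) ^ 2 * deriv (deriv θ) ((n + 1) * x.2) := by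
      simp only [Prod.smul_snd, smul_eq_mul]; ring
    rw [e]
    exact this.trans (by linarith)
  · have hc : IsClosed {x : ℝ × ℝ | 1 ≤ (n + 1) * x.2} := isClosed_le continuous_const (by fun_prop)
    refine (closure_minimal (fun x hx => ?_) hc).trans fun x hx => ?_
    · by_contra hn
      refine hx (smoothTransition.zero_of_nonpos ?_)
      have : (n + 1) * x.2 < 1 := not_le.1 hn
      simp only [Prod.smul_snd, smul_eq_mul]; linarith
    · have h1 : 1 ≤ (n + 1) * x.2 := hx
      exact pos_of_mul_pos_right (a := (n : ℝ) + 1) (by linarith) (ha n).le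
  · have hx : 0 < x.2 := hx
    filter_upwards [eventually_ge_atTop ⌈2 / x.2⌉₊] with n hn
    have hlt : 2 < (n + 1) * x.2 := by
      rw [← div_lt_iff₀ hx]; exact (Nat.le_of_ceil_le hn).trans_lt (by linarith)
    have : ∀ᶠ y : ℝ × ℝ in 𝓝 x, 2 < (n + 1) * y.2 :=
      ((show Continuous fun y : ℝ × ℝ => ((n : ℝ) + 1) * y.2 by fun_prop).tendsto x).eventually (lt_mem_nhds hlt)
    filter_upwards [this] with y hy
    exact smoothTransition.one_of_one_le (by simp only [Prod.smul_snd, smul_eq_mul]; linarith)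

lemma WeakL2.tendsto_integral_mul_of_tendsto (hf : WeakL2 f) {Ψ : ℕ → ℝ × ℝ → ℝ} (hΨ : ∀ n, Continuous (Ψ n)) {w : ℝ × ℝ → ℝ} {M : ℝ}
    (hw : Integrable w) (hM : ∀ x, |w x| ≤ M) (hb : ∀ n, ∀ x ∈ halfPlane, |Ψ n x| ≤ w x)
    (hlim : ∀ x ∈ halfPlane, Tendsto (fun n => Ψ n x) atTop (𝓝 (ψ x))) :
    Tendsto (fun n => ∫ x in halfPlane, f x * Ψ n x) atTop (𝓝 (∫ x in halfPlane, f x * ψ x)) := by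
  have hI := (WeakL2On.integrable_mul (weakL2_iff.1 hf) (hw.mono_measure Measure.restrict_le_self) hM).abs
  refine tendsto_integral_of_dominated_convergence _ (fun n => hf.1.mul (hΨ n).aestronglyMeasurable) hI (fun n => ?_) ?_
  · refine ae_restrict_of_forall_mem measurableSet_halfPlane fun x hx => ?_
    rw [norm_eq_abs, abs_mul, abs_mul]
    exact mul_le_mul_of_nonneg_left ((hb n x hx).trans (le_abs_self _)) (abs_nonneg _)
  · refine ae_restrict_of_forall_mem measurableSet_halfPlane fun x hx => ?_
    exact (hlim x hx).const_mul _

lemma WeakL2.tendsto_integral_mul (hf : WeakL2 f) {Ψ : ℕ → ℝ × ℝ → ℝ} (hΨ : ∀ n, Continuous (Ψ n)) {w : ℝ × ℝ → ℝ} {M : ℝ}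
    (hw : Integrable w) (hM : ∀ x, |w x| ≤ M) (hb : ∀ n, ∀ x ∈ halfPlane, |Ψ n x| ≤ w x)
    (hlim : ∀ x ∈ halfPlane, ∀ᶠ n in atTop, Ψ n x = ψ x) :
    Tendsto (fun n => ∫ x in halfPlane, f x * Ψ n x) atTop (𝓝 (∫ x in halfPlane, f x * ψ x)) :=
  hf.tendsto_integral_mul_of_tendsto hΨ hw hM hb fun x hx =>
    tendsto_const_nhds.congr' ((hlim x hx).mono fun _ hn => hn.symm)

/-- Smooth functions on the plane with values and gradient of integrable size in the half-plane. -/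
def IsDecaying (φ : ℝ × ℝ → ℝ) : Prop := ContDiff ℝ ∞ φ ∧ ∃ C, 0 ≤ C ∧ ∀ x ∈ halfPlane,
  |φ x| ≤ C * envelope x ∧ |d1 φ x| ≤ C * envelope x ∧ |d2 φ x| ≤ C * envelope x ∧ |lap φ x| ≤ C * envelope x

lemma abs_envelope_le (hC : 0 ≤ C) (x : ℝ × ℝ) : |C * envelope x| ≤ C := by
  rw [abs_of_nonneg (mul_nonneg hC (envelope_pos x).le)]
  exact mul_le_of_le_one_right hC (envelope_le_one x)

lemma WeakL2.integrable_mul_of_le_envelope (hf : WeakL2 f) (hψ : Continuous ψ) (hC : 0 ≤ C)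
    (hb : ∀ x ∈ halfPlane, |ψ x| ≤ C * envelope x) : IntegrableOn (fun x => f x * ψ x) halfPlane := by
  have hI := (WeakL2On.integrable_mul (weakL2_iff.1 hf)
    ((integrable_envelope.const_mul C).mono_measure Measure.restrict_le_self) (abs_envelope_le hC)).abs
  refine hI.mono' (hf.1.mul hψ.aestronglyMeasurable)
    ((ae_restrict_of_forall_mem measurableSet_halfPlane fun x hx => ?_))
  rw [norm_eq_abs, abs_mul, abs_mul]
  exact mul_le_mul_of_nonneg_left ((hb x hx).trans (le_abs_self _)) (abs_nonneg _)

lemma IsDecaying.integrable_mul (hφ : IsDecaying φ) (hf : WeakL2 f) : IntegrableOn (fun x => f x * φ x) halfPlane := by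
  obtain ⟨h, C, hC, hb⟩ := hφ
  exact hf.integrable_mul_of_le_envelope h.continuous hC fun x hx => (hb x hx).1

lemma IsDecaying.integrable_mul_lap (hφ : IsDecaying φ) (hf : WeakL2 f) :
    IntegrableOn (fun x => f x * lap φ x) halfPlane := by
  obtain ⟨h, C, hC, hb⟩ := hφ
  exact hf.integrable_mul_of_le_envelope (smooth_lap h).continuous hC fun x hx => (hb x hx).2.2.2

/-- Gauss-Green formulas for functions without trace, tested against decaying functions. -/
lemma IsDecaying.gaussGreen {f₁ f₂ : ℝ × ℝ → ℝ} (hh : IsDecaying h) (hf : WeakL2 f) (hf₁ : WeakL2 f₁) (hf₂ : WeakL2 f₂)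
    (hg : ∀ φ, IsTest φ → (∫ x in halfPlane, f x * d1 φ x) = -(∫ x in halfPlane, f₁ x * φ x) ∧
      (∫ x in halfPlane, f x * d2 φ x) = -(∫ x in halfPlane, f₂ x * φ x)) :
    (∫ x in halfPlane, f x * d1 h x) = -(∫ x in halfPlane, f₁ x * h x) ∧
      (∫ x in halfPlane, f x * d2 h x) = -(∫ x in halfPlane, f₂ x * h x) := by
  obtain ⟨hs, C, hC, hb⟩ := hh
  obtain ⟨B, hB, T, hT, hTb, hT1⟩ := exists_cutoff
  have ht : ∀ n, IsTest fun x => h x * T n x := fun n => ⟨hs.mul (hT n).1, (hT n).2.mul_left⟩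
  have hw := integrable_envelope.const_mul (C * B + C * B)
  have hM := abs_envelope_le (show 0 ≤ C * B + C * B by positivity)
  have he : ∀ x, ∀ᶠ n in atTop, (fun x => h x * T n x) =ᶠ[𝓝 x] h := fun x =>
    (hT1 x).mono fun n hn => hn.mono fun y hy => by beta_reduce at hy ⊢; rw [hy, mul_one]
  have l0 : ∀ F, WeakL2 F → Tendsto (fun n => ∫ x in halfPlane, F x * (h x * T n x)) atTop
      (𝓝 (∫ x in halfPlane, F x * h x)) := fun F hF =>
    hF.tendsto_integral_mul (fun n => (ht n).continuous) hw hM (fun n x hx => by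
      have e := envelope_pos x
      rw [abs_mul]
      have := mul_le_mul (hb x hx).1 (hTb n x).1 (abs_nonneg _) (by positivity)
      have p : 0 ≤ C * B * envelope x := by positivity
      linarith) fun x _ => (he x).mono fun n hn => hn.eq_of_nhds
  have l1 : Tendsto (fun n => ∫ x in halfPlane, f x * d1 (fun x => h x * T n x) x) atTop
      (𝓝 (∫ x in halfPlane, f x * d1 h x)) :=
    hf.tendsto_integral_mul (fun n => (ht n).d1.continuous) hw hM (fun n x hx => by
      have e := envelope_pos x
      rw [d1_mul hs (hT n).1]
      refine (abs_add_le _ _).trans ?_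
      rw [abs_mul, abs_mul]
      have a1 := mul_le_mul (hb x hx).1 (hTb n x).2.1 (abs_nonneg _) (by positivity)
      have a2 := mul_le_mul (hb x hx).2.1 (hTb n x).1 (abs_nonneg _) (by positivity)
      linarith) fun x _ => (he x).mono fun n hn => (d1_germ hn).eq_of_nhds
  have l2 : Tendsto (fun n => ∫ x in halfPlane, f x * d2 (fun x => h x * T n x) x) atTop
      (𝓝 (∫ x in halfPlane, f x * d2 h x)) :=
    hf.tendsto_integral_mul (fun n => (ht n).d2.continuous) hw hM (fun n x hx => by
      have e := envelope_pos x
      rw [d2_mul hs (hT n).1]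
      refine (abs_add_le _ _).trans ?_
      rw [abs_mul, abs_mul]
      have a1 := mul_le_mul (hb x hx).1 (hTb n x).2.2.1 (abs_nonneg _) (by positivity)
      have a2 := mul_le_mul (hb x hx).2.2.1 (hTb n x).1 (abs_nonneg _) (by positivity)
      linarith) fun x _ => (he x).mono fun n hn => (d2_germ hn).eq_of_nhds
  constructor
  · exact tendsto_nhds_unique l1 ((l0 f₁ hf₁).neg.congr fun n => ((hg _ (ht n)).1).symm)
  · exact tendsto_nhds_unique l2 ((l0 f₂ hf₂).neg.congr fun n => ((hg _ (ht n)).2).symm)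

/-- Test functions which vanish to second order on the boundary. -/
lemma IsTest.exists_boundary_bounds (hφ : IsTest φ) (h0 : ∀ s, φ (s, 0) = 0) (h1 : ∀ s, AlphaEuler.d2 φ (s, 0) = 0) :
    ∃ C, 0 ≤ C ∧ ∀ x ∈ halfPlane, |AlphaEuler.d2 φ x| ≤ C * x.2 ∧ |φ x| ≤ C * x.2 ^ 2 := by
  obtain ⟨C, hC, hb⟩ := hφ.d2.d2.exists_bound
  have key : ∀ (ψ : ℝ × ℝ → ℝ) (s t B : ℝ), ContDiff ℝ ∞ ψ → 0 ≤ t → ψ (s, 0) = 0 →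
      (∀ r ∈ Icc 0 t, |AlphaEuler.d2 ψ (s, r)| ≤ B) → |ψ (s, t)| ≤ B * t := by
    intro ψ s t B hψ ht h0 hB
    have := (convex_Icc 0 t).norm_image_sub_le_of_norm_hasDerivWithin_le (f := fun r => ψ (s, r))
      (fun r _ => (smooth_hasDerivAt_d2 hψ s r).hasDerivWithinAt) hB (left_mem_Icc.2 ht) (right_mem_Icc.2 ht)
    simpa [h0, abs_of_nonneg ht] using this
  have k1 : ∀ s t, 0 ≤ t → |AlphaEuler.d2 φ (s, t)| ≤ C * t := fun s t ht =>
    key _ s t C hφ.d2.1 ht (h1 s) fun r _ => hb _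
  refine ⟨C, hC, fun x hx => ⟨k1 x.1 x.2 (le_of_lt hx), ?_⟩⟩
  have hx : 0 < x.2 := hx
  have := key φ x.1 x.2 (C * x.2) hφ.1 hx.le (h0 _) fun r hr => (k1 x.1 r hr.1).trans
    (mul_le_mul_of_nonneg_left hr.2 hC)
  rwa [mul_assoc, ← pow_two] at this

lemma WeakL2.integral_helmholtz_of_isTest (hf : WeakL2 f)
    (h : ∀ φ, IsTestInHalfPlane φ → ∫ x in halfPlane, f x * (φ x - α * lap φ x) = 0)
    (hφ : IsTest φ) (h0 : ∀ s, φ (s, 0) = 0) (h1 : ∀ s, d2 φ (s, 0) = 0) :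
    ∫ x in halfPlane, f x * (φ x - α * lap φ x) = 0 := by
  obtain ⟨C, hC, hb⟩ := hφ.exists_boundary_bounds h0 h1
  obtain ⟨B, hB, T, hT, hTb, hTs, hT1⟩ := exists_boundary_cutoff
  obtain ⟨C0, hC0, k0⟩ := hφ.exists_bound
  obtain ⟨C1, hC1, k1⟩ := hφ.lap.exists_bound
  have ht : ∀ n, IsTestInHalfPlane fun x => φ x * T n x := fun n =>
    ⟨⟨hφ.1.mul (hT n), hφ.2.mul_right⟩, (tsupport_mul_subset_right (f := φ) (g := T n)).trans (hTs n)⟩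
  set K := C0 * B + |α| * (C1 * B + 2 * (C * B) + C * B) with hK
  have hK0 : 0 ≤ K := by positivity
  have hw : Integrable ((tsupport φ).indicator fun _ => K) :=
    (integrable_indicator_iff (isClosed_tsupport φ).measurableSet).2 (integrableOn_const hφ.volume_ne_top)
  have hM : ∀ x, |(tsupport φ).indicator (fun _ => K) x| ≤ K := fun x => by
    rw [abs_of_nonneg (indicator_nonneg (fun _ _ => hK0) x)]
    exact indicator_le_self' (fun _ _ => hK0) x
  have l := hf.tendsto_integral_mul (Ψ := fun n x => φ x * T n x - α * lap (fun x => φ x * T n x) x)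
    (ψ := fun x => φ x - α * lap φ x) (fun n => ((ht n).1.helmholtz α).continuous) hw hM (fun n x hx => ?_)
    fun x hx => (hT1 x hx).mono fun n hn => ?_
  · exact tendsto_nhds_unique l (tendsto_const_nhds.congr fun n => (h _ (ht n)).symm)
  · by_cases hs : x ∈ tsupport φ
    · rw [indicator_of_mem hs, lap_mul hφ.1 (hT n)]
      obtain ⟨t0, t1, t2, t3⟩ := hTb n x
      obtain ⟨b1, b2⟩ := hb x hx
      have hx : 0 < x.2 := hx
      rw [abs_mul, abs_of_pos hx] at t2
      rw [abs_mul, abs_of_pos (pow_pos hx 2)] at t3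
      rw [t1, mul_zero, zero_add]
      have a1 : |φ x * T n x| ≤ C0 * B := by rw [abs_mul]; exact mul_le_mul (k0 x) t0 (abs_nonneg _) hC0
      have a2 : |lap φ x * T n x| ≤ C1 * B := by rw [abs_mul]; exact mul_le_mul (k1 x) t0 (abs_nonneg _) hC1
      have a3 : |d2 φ x * d2 (T n) x| ≤ C * B := by
        rw [abs_mul]
        calc _ ≤ C * x.2 * |d2 (T n) x| := mul_le_mul_of_nonneg_right b1 (abs_nonneg _)
          _ ≤ C * B := by rw [mul_assoc]; exact mul_le_mul_of_nonneg_left t2 hC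
      have a4 : |φ x * lap (T n) x| ≤ C * B := by
        rw [abs_mul]
        calc _ ≤ C * x.2 ^ 2 * |lap (T n) x| := mul_le_mul_of_nonneg_right b2 (abs_nonneg _)
          _ ≤ C * B := by rw [mul_assoc]; exact mul_le_mul_of_nonneg_left t3 hC
      refine (abs_sub _ _).trans (add_le_add a1 ?_)
      rw [abs_mul]
      refine mul_le_mul_of_nonneg_left ?_ (abs_nonneg _)
      refine (abs_add_three _ _ _).trans (add_le_add (add_le_add a2 ?_) a4)
      rw [abs_mul, abs_two]; linarith
    · rw [indicator_of_notMem hs]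
      have hz : (fun x => φ x * T n x) =ᶠ[𝓝 x] fun _ => 0 :=
        (notMem_tsupport_iff_eventuallyEq.1 hs).mono fun y hy => by beta_reduce; rw [hy]; simp
      have hl : lap (fun _ => (0 : ℝ)) x = 0 := by simp [lap, d1, d2]
      rw [lap_germ hz, hz.eq_of_nhds, hl]; simp
  · have hz : (fun x => φ x * T n x) =ᶠ[𝓝 x] φ := hn.mono fun y hy => by beta_reduce at hy ⊢; rw [hy, mul_one]
    rw [lap_germ hz, hz.eq_of_nhds]

lemma WeakL2.integral_helmholtz_of_isDecaying (hf : WeakL2 f)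
    (h : ∀ φ, IsTestInHalfPlane φ → ∫ x in halfPlane, f x * (φ x - α * lap φ x) = 0)
    (hφ : IsDecaying φ) (h0 : ∀ s, φ (s, 0) = 0) (h1 : ∀ s, d2 φ (s, 0) = 0) :
    ∫ x in halfPlane, f x * (φ x - α * lap φ x) = 0 := by
  obtain ⟨hs, C, hC, hb⟩ := hφ
  obtain ⟨B, hB, T, hT, hTb, hT1⟩ := exists_cutoff
  have ht : ∀ n, IsTest fun x => φ x * T n x := fun n => ⟨hs.mul (hT n).1, (hT n).2.mul_left⟩
  set K := C * B + |α| * (6 * (C * B)) with hK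
  have hK0 : 0 ≤ K := by positivity
  have l := hf.tendsto_integral_mul (Ψ := fun n x => φ x * T n x - α * lap (fun x => φ x * T n x) x)
    (ψ := fun x => φ x - α * lap φ x) (fun n => ((ht n).helmholtz α).continuous) (integrable_envelope.const_mul K)
    (abs_envelope_le hK0) (fun n x hx => ?_) fun x hx => (hT1 x).mono fun n hn => ?_
  · refine tendsto_nhds_unique l (tendsto_const_nhds.congr fun n => (hf.integral_helmholtz_of_isTest h (ht n)
      (fun s => by rw [h0, zero_mul]) fun s => ?_).symm)
    rw [d2_mul hs (hT n).1]
    beta_reduce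
    rw [h0, h1, zero_mul, zero_mul, add_zero]
  · rw [lap_mul hs (hT n).1]
    obtain ⟨t0, t1, t2, t3⟩ := hTb n x
    obtain ⟨b0, b1, b2, b3⟩ := hb x hx
    have e := envelope_pos x
    have m : ∀ {a b : ℝ}, |a| ≤ C * envelope x → |b| ≤ B → |a * b| ≤ C * B * envelope x := fun ha hb' => by
      rw [abs_mul]
      calc _ ≤ C * envelope x * B := mul_le_mul ha hb' (abs_nonneg _) (by positivity)
        _ = _ := by ring
    rw [hK, add_mul]
    refine (abs_sub _ _).trans (add_le_add (m b0 t0) ?_)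
    rw [abs_mul, mul_assoc]
    refine mul_le_mul_of_nonneg_left ?_ (abs_nonneg _)
    refine (abs_add_three _ _ _).trans ?_
    have a1 := m b3 t0
    have a2 := m b0 t3
    have a3 : |2 * (d1 φ x * d1 (T n) x + d2 φ x * d2 (T n) x)| ≤ 4 * (C * B * envelope x) := by
      rw [abs_mul, abs_two]
      have := abs_add_le (d1 φ x * d1 (T n) x) (d2 φ x * d2 (T n) x)
      linarith [m b1 t1, m b2 t2]
    linarith
  · have hz : (fun x => φ x * T n x) =ᶠ[𝓝 x] φ := hn.mono fun y hy => by beta_reduce at hy ⊢; rw [hy, mul_one]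
    rw [lap_germ hz, hz.eq_of_nhds]

end

section

/-! ### Test functions corrected by boundary layers -/

variable {c α : ℝ} {l : ℝ → ℝ} {M N : ℝ → ℂ} {f : ℝ × ℝ → ℝ}

lemma smooth_re_layer (hc : 0 < c) (hl : IsRate l) (hM : IsMultiplier M) :
    ContDiff ℝ ∞ (fun x => (layer c l M x).re) := reCLM.contDiff.comp (contDiff_layer hc hl hM)

lemma hasDerivAt_re_layer (hc : 0 < c) (hl : IsRate l) (hM : IsMultiplier M) (x : ℝ × ℝ) :
    HasDerivAt (fun s => (layer c l M (s, x.2)).re) (layer c l (fun ξ => I * ξ * M ξ) x).re x.1 ∧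
    HasDerivAt (fun s => (layer c l M (x.1, s)).re) (layer c l (fun ξ => -(l ξ : ℂ) * M ξ) x).re x.2 := by
  have h := reCLM.hasFDerivAt.comp x (hasFDerivAt_layer hc hl hM x)
  have h1 := hasDerivAt_fst_fderiv h.differentiableAt
  have h2 := hasDerivAt_snd_fderiv h.differentiableAt
  rw [h.fderiv] at h1 h2
  constructor
  · convert! h1 using 1; simp
  · convert! h2 using 1; simp

lemma d1_re_layer (hc : 0 < c) (hl : IsRate l) (hM : IsMultiplier M) : d1 (fun x => (layer c l M x).re)
    = fun x => (layer c l (fun ξ => I * ξ * M ξ) x).re := funext fun x => (hasDerivAt_re_layer hc hl hM x).1.deriv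

lemma d2_re_layer (hc : 0 < c) (hl : IsRate l) (hM : IsMultiplier M) : d2 (fun x => (layer c l M x).re)
    = fun x => (layer c l (fun ξ => -(l ξ : ℂ) * M ξ) x).re := funext fun x => (hasDerivAt_re_layer hc hl hM x).2.deriv

lemma lap_re_layer (hc : 0 < c) (hl : IsRate l) (hM : IsMultiplier M) : lap (fun x => (layer c l M x).re)
    = fun x => (layer c l (fun ξ => ((l ξ : ℂ) ^ 2 - ξ ^ 2) * M ξ) x).re := funext fun x => by
  rw [lap, d1_re_layer hc hl hM, d2_re_layer hc hl hM, d1_re_layer hc hl (isMultiplier_d1 hM),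
    d2_re_layer hc hl (isMultiplier_d2 hl hM), ← Complex.add_re, ← layer_add hc hl
      (isMultiplier_d1 (isMultiplier_d1 hM)) (isMultiplier_d2 hl (isMultiplier_d2 hl hM))]
  congr 2; funext ξ
  linear_combination ((ξ : ℂ) ^ 2 * M ξ) * I_sq

/-- Multipliers which vanish to third order at the frequency zero. -/
def IsFlat (M : ℝ → ℂ) : Prop := ∃ N, IsMultiplier N ∧ M = fun ξ : ℝ => (ξ : ℂ) ^ 3 * N ξ

lemma isMultiplier_pow (k : ℕ) : IsMultiplier (fun ξ => (ξ : ℂ) ^ k) := by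
  induction k with
  | zero => simpa using isMultiplier_const 1
  | succ k ih => simpa [pow_succ] using ih.mul isMultiplier_id

lemma IsFlat.isMultiplier (h : IsFlat M) : IsMultiplier M := by
  obtain ⟨N, hN, rfl⟩ := h; exact (isMultiplier_pow 3).mul hN

lemma IsFlat.mul (h : IsFlat M) (hN : IsMultiplier N) : IsFlat (fun ξ => N ξ * M ξ) := by
  obtain ⟨M', hM, rfl⟩ := h
  exact ⟨_, hN.mul hM, funext fun ξ => by ring⟩

lemma IsRate.isMultiplier_neg (hl : IsRate l) : IsMultiplier (fun ξ => -(l ξ : ℂ)) := by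
  simpa using (isMultiplier_const (-1)).mul hl.isMultiplier

lemma IsFlat.exists_bound (h : IsFlat M) (hc : 0 < c) (hl : IsRate l) : ∃ C, 0 < C ∧ ∀ x : ℝ × ℝ, 0 ≤ x.2 →
    |(layer c l M x).re| ≤ C * envelope x := by
  obtain ⟨N, hN, rfl⟩ := h
  obtain ⟨C, hC, h⟩ := exists_norm_layer_le hc hl hN
  exact ⟨C, hC, fun x hx => (abs_re_le_norm _).trans (h x hx)⟩

lemma IsFlat.isDecaying (h : IsFlat M) (hc : 0 < c) (hl : IsRate l) : IsDecaying (fun x => (layer c l M x).re) := by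
  have hM := h.isMultiplier
  obtain ⟨C0, h0, k0⟩ := h.exists_bound hc hl
  obtain ⟨C1, h1, k1⟩ := (h.mul ((isMultiplier_const I).mul isMultiplier_id)).exists_bound hc hl
  obtain ⟨C2, h2, k2⟩ := (h.mul hl.isMultiplier_neg).exists_bound hc hl
  have hq : IsMultiplier fun ξ => ((l ξ : ℂ) ^ 2 - ξ ^ 2) := by
    have := (hl.isMultiplier.mul hl.isMultiplier).add ((isMultiplier_const (-1)).mul (isMultiplier_pow 2))
    simpa [pow_two, sub_eq_add_neg] using this
  obtain ⟨C3, h3, k3⟩ := (h.mul hq).exists_bound hc hl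
  refine ⟨smooth_re_layer hc hl hM, C0 + C1 + C2 + C3, by positivity, fun x hx => ?_⟩
  have hx : 0 ≤ x.2 := le_of_lt hx
  have e := envelope_pos x
  rw [d1_re_layer hc hl hM, d2_re_layer hc hl hM, lap_re_layer hc hl hM]
  refine ⟨(k0 x hx).trans ?_, (k1 x hx).trans ?_, (k2 x hx).trans ?_, (k3 x hx).trans ?_⟩ <;>
    exact mul_le_mul_of_nonneg_right (by linarith) e.le

lemma layer_boundary (c : ℝ) (l l' : ℝ → ℝ) (M : ℝ → ℂ) (s : ℝ) : layer c l M (s, 0) = layer c l' M (s, 0) := by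
  simp [layer]

/-- The derivatives of the heat kernel on the line, on the Fourier side. -/
def heatDeriv (c : ℝ) (k : ℕ) (s : ℝ) : ℝ := (layer c (fun ξ => ξ) (fun ξ => (I * ξ) ^ k) (s, 0)).re

lemma isMultiplier_I_pow (k : ℕ) : IsMultiplier (fun ξ => (I * ξ) ^ k) := by
  have := (isMultiplier_const (I ^ k)).mul (isMultiplier_pow k)
  simpa [mul_pow] using this

lemma contDiff_heatDeriv (hc : 0 < c) (k : ℕ) : ContDiff ℝ ∞ (heatDeriv c k) :=
  (smooth_re_layer hc isRate_id (isMultiplier_I_pow k)).comp (contDiff_id.prodMk contDiff_const)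

lemma hasDerivAt_heatDeriv (hc : 0 < c) (k : ℕ) (s : ℝ) : HasDerivAt (heatDeriv c k) (heatDeriv c (k + 1) s) s := by
  have := (hasDerivAt_re_layer hc isRate_id (isMultiplier_I_pow k) (s, 0)).1
  convert! this using 1
  simp only [heatDeriv, pow_succ']

lemma exists_heatDeriv_le (hc : 0 < c) (k : ℕ) : ∃ C, 0 < C ∧ ∀ s, |heatDeriv c (k + 3) s| ≤ C * (1 + s ^ 2)⁻¹ := by
  have h : IsFlat (fun ξ : ℝ => (I * ξ) ^ (k + 3)) := ⟨_, (isMultiplier_const (I ^ 3)).mul (isMultiplier_I_pow k),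
    funext fun ξ => by rw [pow_add]; ring⟩
  obtain ⟨C, hC, hb⟩ := h.exists_bound hc isRate_id
  exact ⟨C, hC, fun s => by simpa [envelope, heatDeriv] using hb (s, 0) le_rfl⟩

lemma one_add_sq_le (a b : ℝ) : (1 + (a - b) ^ 2)⁻¹ ≤ 2 * (1 + b ^ 2) * (1 + a ^ 2)⁻¹ := by
  rw [← div_eq_mul_inv, inv_eq_one_div, div_le_div_iff₀ (by positivity) (by positivity)]
  nlinarith [sq_nonneg (b * (a - b)), sq_nonneg (a - 2 * b)]

lemma heatDeriv_sub (c s t : ℝ) : heatDeriv c 4 (s - t)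
    = (layer c (fun ξ => ξ) (fun ξ => (ξ : ℂ) * cexp (-(I * ξ * t)) * ξ ^ 3) (s, 0)).re := by
  rw [heatDeriv, layer, layer]
  congr 2; funext ξ
  have e : cexp (I * ξ * ((s - t : ℝ) : ℂ) - ξ * ((0 : ℝ) : ℂ))
      = cexp (-(I * ξ * t)) * cexp (I * ξ * s - ξ * ((0 : ℝ) : ℂ)) := by
    rw [← Complex.exp_add]; push_cast; ring_nf
  rw [e, mul_pow, Complex.I_pow_four]; ring

lemma exists_compact_bound {m : ℝ → ℝ} (hm : ContDiff ℝ ∞ m) (hs : HasCompactSupport m) :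
    ∃ C, 0 ≤ C ∧ ∀ y, |m y| ≤ C * (1 + y ^ 2)⁻¹ := by
  have : HasCompactSupport fun y => (1 + y ^ 2) * m y := hs.mul_left
  obtain ⟨C, hC⟩ := this.exists_bound_of_continuous ((by fun_prop : Continuous fun y : ℝ => 1 + y ^ 2).mul hm.continuous)
  refine ⟨C, (norm_nonneg _).trans (hC 0), fun y => ?_⟩
  have h := hC y
  have hp : 0 < 1 + y ^ 2 := by positivity
  rw [norm_mul, norm_of_nonneg hp.le] at h
  rw [← div_eq_mul_inv, le_div_iff₀ hp, mul_comm]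
  exact h

/-- A vorticity in weak `L²` which solves the Helmholtz equation in the half-plane and is orthogonal to decaying harmonic
functions is orthogonal, up to the boundary, to the image of tensor products under the Helmholtz operator. -/
lemma WeakL2.integral_helmholtz_tensor (hα : 0 < α) (hf : WeakL2 f)
    (hi : ∀ φ, IsTestInHalfPlane φ → ∫ x in halfPlane, f x * (φ x - α * lap φ x) = 0)
    (hii : ∀ h k, IsDecaying h → IsDecaying k → d1 h = d2 k → (d2 h = fun x => -d1 k x) → ∫ x in halfPlane, f x * h x = 0)
    (hc : 0 < c) (t : ℝ) {m : ℝ → ℝ} (hm : ContDiff ℝ ∞ m) (hms : HasCompactSupport m) :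
    ∫ x in halfPlane, f x * (heatDeriv c 4 (x.1 - t) * (m x.2 - α * deriv (deriv m) x.2)
      - α * heatDeriv c 6 (x.1 - t) * m x.2) = 0 := by
  have hid := isRate_id
  have hκ := isRate_vortRate hα
  set p : ℂ := ((m 0 : ℝ) : ℂ)
  set r : ℂ := ((deriv m (0 : ℝ) : ℝ) : ℂ)
  let E : ℝ → ℂ := fun ξ => (ξ : ℂ) * cexp (-(I * ξ * t)) * ξ ^ 3
  have hE : IsFlat E := ⟨_, isMultiplier_id.mul (isMultiplier_wave t), funext fun ξ => mul_comm _ _⟩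
  let A' : ℝ → ℂ := fun ξ => α * ((vortRate α ξ : ℂ) + ξ) * ((vortRate α ξ : ℂ) * p + r)
  have hA' : IsMultiplier A' := ((isMultiplier_const _).mul (hκ.isMultiplier.add isMultiplier_id)).mul
    ((hκ.isMultiplier.mul (isMultiplier_const _)).add (isMultiplier_const _))
  have hB' : IsMultiplier (fun ξ => p + (-1) * A' ξ) := (isMultiplier_const _).add ((isMultiplier_const _).mul hA')
  let A : ℝ → ℂ := fun ξ => A' ξ * E ξ
  let B : ℝ → ℂ := fun ξ => (p + (-1) * A' ξ) * E ξ
  have hA : IsFlat A := hE.mul hA'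
  have hB : IsFlat B := hE.mul hB'
  have hdis : ∀ ξ : ℝ, (vortRate α ξ : ℂ) ^ 2 = ξ ^ 2 + 1 / α := fun ξ => by
    have := vortRate_sq hα ξ
    exact_mod_cast this
  have hα' : (α : ℂ) ≠ 0 := by exact_mod_cast hα.ne'
  let h : ℝ × ℝ → ℝ := fun x => (layer c (fun ξ => ξ) A x).re
  let k : ℝ × ℝ → ℝ := fun x => (layer c (vortRate α) B x).re
  have hhd : IsDecaying h := hA.isDecaying hc hid
  have hkd : IsDecaying k := hB.isDecaying hc hκ
  have hdm : ContDiff ℝ ∞ (deriv m) := (contDiff_infty_iff_deriv.1 hm).2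
  have hddm : ContDiff ℝ ∞ (deriv (deriv m)) := (contDiff_infty_iff_deriv.1 hdm).2
  have hH : ∀ j, ContDiff ℝ ∞ fun x : ℝ × ℝ => heatDeriv c j (x.1 - t) := fun j =>
    (contDiff_heatDeriv hc j).comp (contDiff_fst.sub contDiff_const)
  let a : ℝ × ℝ → ℝ := fun x => heatDeriv c 4 (x.1 - t) * m x.2
  have ha : ContDiff ℝ ∞ a := (hH 4).mul (hm.comp contDiff_snd)
  have hHd : ∀ j s, HasDerivAt (fun s => heatDeriv c j (s - t)) (heatDeriv c (j + 1) (s - t)) s := fun j s =>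
    (hasDerivAt_heatDeriv hc j (s - t)).comp_sub_const s t
  have a1 : ∀ j, d1 (fun x : ℝ × ℝ => heatDeriv c j (x.1 - t) * m x.2) = fun x => heatDeriv c (j + 1) (x.1 - t) * m x.2 :=
    fun j => funext fun x => ((hHd j x.1).mul_const (m x.2)).deriv
  have a2 : d2 a = fun x => heatDeriv c 4 (x.1 - t) * deriv m x.2 := funext fun x =>
    (((hm.differentiable (by simp) x.2).hasDerivAt).const_mul (heatDeriv c 4 (x.1 - t))).deriv
  have a22 : d2 (fun x : ℝ × ℝ => heatDeriv c 4 (x.1 - t) * deriv m x.2)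
      = fun x => heatDeriv c 4 (x.1 - t) * deriv (deriv m) x.2 := funext fun x =>
    (((hdm.differentiable (by simp) x.2).hasDerivAt).const_mul (heatDeriv c 4 (x.1 - t))).deriv
  have alap : lap a = fun x => heatDeriv c 6 (x.1 - t) * m x.2 + heatDeriv c 4 (x.1 - t) * deriv (deriv m) x.2 :=
    funext fun x => by rw [lap, a2, a22, a1 4, a1 5]
  have had : IsDecaying a := by
    have bd : ∀ j (m : ℝ → ℝ), ContDiff ℝ ∞ m → HasCompactSupport m → ∃ C, 0 ≤ C ∧ ∀ x : ℝ × ℝ,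
        |heatDeriv c (j + 3) (x.1 - t) * m x.2| ≤ C * envelope x := by
      intro j m hm hs
      obtain ⟨C, hC, hb⟩ := exists_heatDeriv_le hc j
      obtain ⟨D, hD, hd⟩ := exists_compact_bound hm hs
      refine ⟨C * (2 * (1 + t ^ 2)) * D, by positivity, fun x => ?_⟩
      have e1 := mul_le_mul_of_nonneg_left (one_add_sq_le x.1 t) hC.le
      rw [abs_mul]
      calc _ ≤ C * (2 * (1 + t ^ 2) * (1 + x.1 ^ 2)⁻¹) * (D * (1 + x.2 ^ 2)⁻¹) :=
            mul_le_mul ((hb _).trans e1) (hd _) (abs_nonneg _) (by positivity)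
        _ = _ := by rw [envelope]; ring
    obtain ⟨C0, h0, k0⟩ := bd 1 m hm hms
    obtain ⟨C1, h1, k1⟩ := bd 2 m hm hms
    obtain ⟨C2, h2, k2⟩ := bd 1 _ hdm hms.deriv
    obtain ⟨C3, h3, k3⟩ := bd 3 m hm hms
    obtain ⟨C4, h4, k4⟩ := bd 1 _ hddm hms.deriv.deriv
    refine ⟨ha, C0 + C1 + C2 + C3 + C4, by positivity, fun x _ => ?_⟩
    have e := (envelope_pos x).le
    rw [a2, alap, a1 4]
    refine ⟨(k0 x).trans ?_, (k1 x).trans ?_, (k2 x).trans ?_, (abs_add_le _ _).trans ((add_le_add (k3 x) (k4 x)).trans ?_)⟩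
    iterate 3 exact mul_le_mul_of_nonneg_right (by linarith) e
    rw [← add_mul]; exact mul_le_mul_of_nonneg_right (by linarith) e
  let φ : ℝ × ℝ → ℝ := fun x => a x - (h x + k x)
  have hhk : ContDiff ℝ ∞ fun x => h x + k x := hhd.1.add hkd.1
  have d1φ : d1 φ = fun x => d1 a x - (d1 h x + d1 k x) := by rw [d1_sub ha hhk, d1_add hhd.1 hkd.1]
  have d2φ : d2 φ = fun x => d2 a x - (d2 h x + d2 k x) := by rw [d2_sub ha hhk, d2_add hhd.1 hkd.1]
  have lapφ : lap φ = fun x => lap a x - (lap h x + lap k x) := funext fun x => by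
    rw [lap, d1φ, d2φ, d1_sub (smooth_d1 ha) ((smooth_d1 hhd.1).add (smooth_d1 hkd.1)),
      d1_add (smooth_d1 hhd.1) (smooth_d1 hkd.1), d2_sub (smooth_d2 ha) ((smooth_d2 hhd.1).add (smooth_d2 hkd.1)),
      d2_add (smooth_d2 hhd.1) (smooth_d2 hkd.1), lap, lap, lap]
    ring
  have hφd : IsDecaying φ := by
    obtain ⟨-, C1, h1, k1⟩ := had
    obtain ⟨-, C2, h2, k2⟩ := hhd
    obtain ⟨-, C3, h3, k3⟩ := hkd
    refine ⟨ha.sub hhk, C1 + (C2 + C3), by positivity, fun x hx => ?_⟩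
    have key : ∀ u v w : ℝ, |u| ≤ C1 * envelope x → |v| ≤ C2 * envelope x → |w| ≤ C3 * envelope x →
        |u - (v + w)| ≤ (C1 + (C2 + C3)) * envelope x := fun u v w hu hv hw => by
      refine (abs_sub _ _).trans ?_
      have := abs_add_le v w
      linarith
    obtain ⟨u0, u1, u2, u3⟩ := k1 x hx
    obtain ⟨v0, v1, v2, v3⟩ := k2 x hx
    obtain ⟨w0, w1, w2, w3⟩ := k3 x hx
    rw [d1φ, d2φ, lapφ]
    exact ⟨key _ _ _ u0 v0 w0, key _ _ _ u1 v1 w1, key _ _ _ u2 v2 w2, key _ _ _ u3 v3 w3⟩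
  have φ0 : ∀ s, φ (s, 0) = 0 := fun s => by
    have e : layer c (fun ξ => ξ) A (s, 0) + layer c (vortRate α) B (s, 0) = p * layer c (fun ξ => ξ) E (s, 0) := by
      rw [layer_boundary c (vortRate α) (fun ξ => ξ), ← layer_add hc hid hA.isMultiplier hB.isMultiplier, ← layer_const_mul]
      congr 1; funext ξ; simp only [A, B]; ring
    have e2 := congrArg Complex.re e
    rw [Complex.add_re, re_ofReal_mul] at e2
    simp only [φ, a, h, k]
    rw [e2, heatDeriv_sub]; ring
  have φ1 : ∀ s, d2 φ (s, 0) = 0 := fun s => by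
    have e : layer c (fun ξ => ξ) (fun ξ => -(ξ : ℂ) * A ξ) (s, 0) + layer c (vortRate α) (fun ξ => -(vortRate α ξ : ℂ) * B ξ) (s, 0)
        = r * layer c (fun ξ => ξ) E (s, 0) := by
      rw [layer_boundary c (vortRate α) (fun ξ => ξ), ← layer_add hc hid (isMultiplier_d2 hid hA.isMultiplier)
        (isMultiplier_d2 hκ hB.isMultiplier), ← layer_const_mul]
      congr 1; funext ξ
      simp only [A, B, A']
      have := hdis ξ
      field_simp at this
      linear_combination (E ξ * ((vortRate α ξ : ℂ) * p + r)) * this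
    have e2 := congrArg Complex.re e
    rw [Complex.add_re, re_ofReal_mul] at e2
    rw [d2φ, a2, d2_re_layer hc hid hA.isMultiplier, d2_re_layer hc hκ hB.isMultiplier]
    beta_reduce
    rw [e2, heatDeriv_sub]; ring
  have main := hf.integral_helmholtz_of_isDecaying hi hφd φ0 φ1
  have lap_h : lap h = fun _ => 0 := by
    rw [lap_re_layer hc hid hA.isMultiplier]
    funext x
    simp [layer]
  have lap_k : ∀ x, k x - α * lap k x = 0 := fun x => by
    rw [lap_re_layer hc hκ hB.isMultiplier]
    have e : layer c (vortRate α) B x = α * layer c (vortRate α) (fun ξ => ((vortRate α ξ : ℂ) ^ 2 - ξ ^ 2) * B ξ) x := by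
      rw [← layer_const_mul]
      congr 1; funext ξ
      rw [hdis]; field_simp; ring
    have e2 := congrArg Complex.re e
    rw [re_ofReal_mul] at e2
    simp only [k]
    linarith
  have hAI : IsFlat (fun ξ => -I * A ξ) := hA.mul (isMultiplier_const _)
  have hh0 : ∫ x in halfPlane, f x * h x = 0 := by
    refine hii h (fun x => (layer c (fun ξ => ξ) (fun ξ => -I * A ξ) x).re) hhd (hAI.isDecaying hc hid) ?_ ?_
    · rw [d1_re_layer hc hid hA.isMultiplier, d2_re_layer hc hid hAI.isMultiplier]
      funext x; congr 2; funext ξ; ring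
    · rw [d2_re_layer hc hid hA.isMultiplier, d1_re_layer hc hid hAI.isMultiplier]
      funext x
      have e : layer c (fun ξ => ξ) (fun ξ => -(ξ : ℂ) * A ξ) x
          = (-1 : ℂ) * layer c (fun ξ => ξ) (fun ξ => I * ξ * (-I * A ξ)) x := by
        rw [← layer_const_mul]
        congr 1; funext ξ
        linear_combination (-(ξ : ℂ) * A ξ) * I_sq
      rw [e]; simp
  have hdec : ∀ x, f x * (φ x - α * lap φ x) = f x * (heatDeriv c 4 (x.1 - t) * (m x.2 - α * deriv (deriv m) x.2)
      - α * heatDeriv c 6 (x.1 - t) * m x.2) - f x * h x := fun x => by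
    have e1 := lap_k x
    rw [lapφ, alap, lap_h]
    simp only [φ, a]
    linear_combination -(f x) * e1
  have i1 : IntegrableOn (fun x => f x * (φ x - α * lap φ x)) halfPlane := by
    refine ((hφd.integrable_mul hf).sub ((hφd.integrable_mul_lap hf).const_mul α)).congr (.of_forall fun x => ?_)
    simp only [Pi.sub_apply]; ring
  have e : ∀ x, f x * (heatDeriv c 4 (x.1 - t) * (m x.2 - α * deriv (deriv m) x.2)
      - α * heatDeriv c 6 (x.1 - t) * m x.2) = f x * (φ x - α * lap φ x) + f x * h x := fun x => by rw [hdec]; ring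
  simp_rw [e]
  rw [integral_add i1 (hhd.integrable_mul hf), main, hh0, add_zero]

end

section

/-! ### Vanishing of the vorticity -/

variable {c α : ℝ} {f φ : ℝ × ℝ → ℝ}

lemma IsTest.exists_envelope_bound (hφ : IsTest φ) : ∃ C, 0 ≤ C ∧ ∀ x : ℝ × ℝ, |φ x| ≤ C * ((1 + x.1 ^ 2)⁻¹ * envelope x) := by
  have : HasCompactSupport fun x : ℝ × ℝ => ((1 + x.1 ^ 2) ^ 2 * (1 + x.2 ^ 2)) * φ x := hφ.2.mul_left
  obtain ⟨C, hC⟩ := this.exists_bound_of_continuous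
    ((by fun_prop : Continuous fun x : ℝ × ℝ => (1 + x.1 ^ 2) ^ 2 * (1 + x.2 ^ 2)).mul hφ.continuous)
  refine ⟨C, (norm_nonneg _).trans (hC 0), fun x => ?_⟩
  have h := hC x
  have hp : 0 < (1 + x.1 ^ 2) ^ 2 * (1 + x.2 ^ 2) := by positivity
  rw [norm_mul, norm_of_nonneg hp.le] at h
  have e : (1 + x.1 ^ 2)⁻¹ * envelope x = ((1 + x.1 ^ 2) ^ 2 * (1 + x.2 ^ 2))⁻¹ := by
    rw [envelope]; field_simp
  rw [e, ← div_eq_mul_inv, le_div_iff₀ hp, mul_comm]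
  exact h

lemma IsTest.hasCompactSupport_slice (hφ : IsTest φ) (y : ℝ) : HasCompactSupport fun t => φ (t, y) := by
  obtain ⟨R, hR, h⟩ := hφ.exists_radius
  refine HasCompactSupport.intro (isCompact_Icc (a := -R) (b := R)) fun t ht => h _ ?_
  by_contra hn
  have := (norm_fst_le ((t, y) : ℝ × ℝ)).trans (norm_le_rad _)
  exact ht (abs_le.1 ((norm_eq_abs t ▸ this).trans (not_le.1 hn).le))

lemma IsTest.integrable_mul_slice (hφ : IsTest φ) {u : ℝ → ℝ} (hu : Continuous u) (y : ℝ) :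
    Integrable fun t => u t * φ (t, y) := by
  have hc := hφ.continuous
  exact Continuous.integrable_of_hasCompactSupport (by fun_prop) (hφ.hasCompactSupport_slice y).mul_left

lemma continuous_heatDeriv_sub (hc : 0 < c) (k : ℕ) (s : ℝ) : Continuous fun t => heatDeriv c k (s - t) :=
  (contDiff_heatDeriv hc k).continuous.comp (by fun_prop)

lemma integral_heatDeriv_succ (hc : 0 < c) (hφ : IsTest φ) (k : ℕ) (s y : ℝ) :
    ∫ t, heatDeriv c (k + 1) (s - t) * φ (t, y) = ∫ t, heatDeriv c k (s - t) * d1 φ (t, y) := by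
  have h := integral_mul_deriv_eq_deriv_mul_of_integrable (u := fun t => heatDeriv c k (s - t)) (v := fun t => φ (t, y))
    (u' := fun t => -heatDeriv c (k + 1) (s - t)) (v' := fun t => d1 φ (t, y))
    (fun t _ => (hasDerivAt_heatDeriv hc k (s - t)).comp_const_sub s t) (fun t _ => smooth_hasDerivAt_d1 hφ.1 t y)
    (hφ.d1.integrable_mul_slice (continuous_heatDeriv_sub hc k s) y)
    (by simpa [Pi.mul_def] using (hφ.integrable_mul_slice (continuous_heatDeriv_sub hc (k + 1) s) y))
    (hφ.integrable_mul_slice (continuous_heatDeriv_sub hc k s) y)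
  rw [h, ← integral_neg]
  congr 1; funext t; ring

/-- Averages of the tensor identity over the tangential translations. -/
lemma WeakL2.integral_heat (hα : 0 < α) (hf : WeakL2 f)
    (hi : ∀ φ, IsTestInHalfPlane φ → ∫ x in halfPlane, f x * (φ x - α * lap φ x) = 0)
    (hii : ∀ h k, IsDecaying h → IsDecaying k → d1 h = d2 k → (d2 h = fun x => -d1 k x) → ∫ x in halfPlane, f x * h x = 0)
    (hc : 0 < c) (hφ : IsTest φ) :
    ∫ x in halfPlane, f x * ∫ t, heatDeriv c 0 (x.1 - t) * (d1^[4] fun z => φ z - α * lap φ z) (t, x.2) = 0 := by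
  let G : ℝ × ℝ → ℝ → ℝ := fun x t => heatDeriv c 4 (x.1 - t) * (φ (t, x.2) - α * d2 (d2 φ) (t, x.2))
      - α * heatDeriv c 6 (x.1 - t) * φ (t, x.2)
  have h0 : ∀ t, ∫ x in halfPlane, f x * G x t = 0 := fun t => by
    have := hf.integral_helmholtz_tensor hα hi hii hc t (m := fun y => φ (t, y)) (hφ.1.comp (contDiff_const.prodMk contDiff_id))
      (by
        obtain ⟨R, hR, h⟩ := hφ.exists_radius
        refine HasCompactSupport.intro (isCompact_Icc (a := -R) (b := R)) fun y hy => h _ ?_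
        by_contra hn
        have := (norm_snd_le ((t, y) : ℝ × ℝ)).trans (norm_le_rad _)
        exact hy (abs_le.1 ((norm_eq_abs y ▸ this).trans (not_le.1 hn).le)))
    exact this
  have hGc : Continuous (uncurry G) := by
    have c1 := hφ.continuous
    have c2 := hφ.d2.d2.continuous
    have c3 := (contDiff_heatDeriv hc 4).continuous
    have c4 := (contDiff_heatDeriv hc 6).continuous
    simp only [G, Function.uncurry_def]
    fun_prop
  obtain ⟨K, hK, hGb⟩ : ∃ K, 0 ≤ K ∧ ∀ x t, |G x t| ≤ K * envelope x * (1 + t ^ 2)⁻¹ := by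
    have bd : ∀ j (ψ : ℝ × ℝ → ℝ), IsTest ψ → ∃ K, 0 ≤ K ∧ ∀ (x : ℝ × ℝ) (t : ℝ),
        |heatDeriv c (j + 3) (x.1 - t) * ψ (t, x.2)| ≤ K * envelope x * (1 + t ^ 2)⁻¹ := by
      intro j ψ hψ
      obtain ⟨C, hC, hb⟩ := exists_heatDeriv_le hc j
      obtain ⟨D, hD, hd⟩ := hψ.exists_envelope_bound
      refine ⟨C * 2 * D, by positivity, fun x t => ?_⟩
      have e1 := mul_le_mul_of_nonneg_left (one_add_sq_le x.1 t) hC.le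
      rw [abs_mul]
      calc _ ≤ C * (2 * (1 + t ^ 2) * (1 + x.1 ^ 2)⁻¹) * (D * ((1 + t ^ 2)⁻¹ * envelope (t, x.2))) :=
            mul_le_mul ((hb _).trans e1) (hd _) (abs_nonneg _) (by positivity)
        _ = _ := by
          rw [envelope, envelope]
          have : (1 + t ^ 2) * (1 + t ^ 2)⁻¹ = 1 := mul_inv_cancel₀ (by positivity)
          linear_combination (C * 2 * D * (1 + x.1 ^ 2)⁻¹ * (1 + t ^ 2)⁻¹ * (1 + x.2 ^ 2)⁻¹) * this
    obtain ⟨K1, hK1, k1⟩ := bd 1 _ (hφ.sub (hφ.d2.d2.const_mul α))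
    obtain ⟨K2, hK2, k2⟩ := bd 3 _ hφ
    refine ⟨K1 + |α| * K2, by positivity, fun x t => (abs_sub _ _).trans ?_⟩
    rw [mul_assoc α, abs_mul α]
    have := mul_le_mul_of_nonneg_left (k2 x t) (abs_nonneg α)
    have := k1 x t
    linarith
  have hswap := integral_integral_swap (μ := volume.restrict halfPlane) (ν := (volume : Measure ℝ))
    (f := fun x t => f x * G x t) (by
      have hI := (WeakL2On.integrable_mul (weakL2_iff.1 hf)
        ((integrable_envelope.const_mul K).mono_measure Measure.restrict_le_self) (abs_envelope_le hK)).abs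
      refine (hI.mul_prod integrable_inv_one_add_sq).mono'
        ((hf.1.comp_quasiMeasurePreserving Measure.quasiMeasurePreserving_fst).mul hGc.aestronglyMeasurable)
        (.of_forall fun z => ?_)
      rw [norm_eq_abs, Function.uncurry_def]
      beta_reduce
      rw [abs_mul, abs_mul, mul_assoc |f z.1|, abs_of_nonneg (mul_nonneg hK (envelope_pos _).le)]
      exact mul_le_mul_of_nonneg_left (hGb _ _) (abs_nonneg _))
  simp_rw [h0, integral_zero, integral_const_mul] at hswap
  rw [← hswap]
  congr 1; funext x; congr 1
  have hψ := hφ.helmholtz α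
  have i1 : Integrable fun t => heatDeriv c 4 (x.1 - t) * (φ (t, x.2) - α * d2 (d2 φ) (t, x.2)) :=
    (hφ.sub (hφ.d2.d2.const_mul α)).integrable_mul_slice (continuous_heatDeriv_sub hc 4 x.1) x.2
  have i2 : Integrable fun t => heatDeriv c 6 (x.1 - t) * φ (t, x.2) :=
    hφ.integrable_mul_slice (continuous_heatDeriv_sub hc 6 x.1) x.2
  have i3 : Integrable fun t => heatDeriv c 4 (x.1 - t) * d1 (d1 φ) (t, x.2) :=
    hφ.d1.d1.integrable_mul_slice (continuous_heatDeriv_sub hc 4 x.1) x.2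
  have e1 : ∫ t, G x t = ∫ t, heatDeriv c 4 (x.1 - t) * (φ (t, x.2) - α * lap φ (t, x.2)) := by
    have : ∀ t, G x t = heatDeriv c 4 (x.1 - t) * (φ (t, x.2) - α * d2 (d2 φ) (t, x.2))
      - α * (heatDeriv c 6 (x.1 - t) * φ (t, x.2)) := fun t => by simp only [G]; ring
    simp_rw [this]
    rw [integral_sub i1 (i2.const_mul α), integral_const_mul, integral_heatDeriv_succ hc hφ 5,
      integral_heatDeriv_succ hc hφ.d1 4, ← integral_const_mul, ← integral_sub i1 (i3.const_mul α)]
    congr 1; funext t; rw [lap]; ring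
  rw [e1, integral_heatDeriv_succ hc hψ 3, integral_heatDeriv_succ hc hψ.d1 2, integral_heatDeriv_succ hc hψ.d1.d1 1,
    integral_heatDeriv_succ hc hψ.d1.d1.d1 0]
  rfl

lemma heatDeriv_zero {ε : ℝ} (hε : 0 < ε) (s : ℝ) : ε * heatDeriv (ε ^ 2 / 4) 0 (ε * s) = √π * exp (-s ^ 2) := by
  have hb : 0 < ε ^ 2 / 4 := by positivity
  set b := ε ^ 2 / 4 with hbe
  let F : ℝ → ℂ := fun ξ => ((exp (-b * ξ ^ 2) : ℝ) : ℂ) * cexp (2 * π * ξ * (ε * s / (2 * π) : ℝ) * I)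
  have hF : Integrable F := by
    refine Integrable.mono' (integrable_exp_neg_mul_sq hb) (by fun_prop)
      (.of_forall fun ξ => ?_)
    rw [norm_mul, norm_wave, mul_one, norm_real, norm_of_nonneg (exp_pos _).le]
  have h1 := integral_gaussian_wave hb (ε * s / (2 * π))
  have h2 := integral_eq_integral_Ioi_add hF
  have h3 : ∀ ξ, F ξ + F (-ξ) = ((2 * (F ξ).re : ℝ) : ℂ) := fun ξ => by
    have : F (-ξ) = (starRingEnd ℂ) (F ξ) := by
      simp only [F]
      rw [map_mul, ← Complex.exp_conj, Complex.conj_ofReal]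
      simp [map_ofNat]
    rw [this, Complex.add_conj]
  have h4 : heatDeriv b 0 (ε * s) = (∫ ξ in Ioi (0 : ℝ), F ξ).re := by
    rw [heatDeriv, layer]
    congr 2; funext ξ
    simp only [F, pow_zero, mul_one]
    congr 2
    have := pi_pos.ne'
    push_cast
    field_simp
    ring
  have h5 : (∫ ξ in Ioi (0 : ℝ), F ξ).re = ∫ ξ in Ioi (0 : ℝ), (F ξ).re := (integral_re hF.integrableOn).symm
  simp_rw [h3] at h2
  rw [integral_complex_ofReal, integral_const_mul, ← h5, ← h4, h1] at h2
  have h6 := Complex.ofReal_injective h2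
  have h7 : √(π / b) = 2 * √π / ε := by
    rw [hbe, show π / (ε ^ 2 / 4) = π * (2 / ε) ^ 2 by field_simp; norm_num, sqrt_mul pi_pos.le,
      sqrt_sq (by positivity)]
    ring
  have h8 : π ^ 2 * (ε * s / (2 * π)) ^ 2 / b = s ^ 2 := by
    have := pi_pos.ne'
    rw [hbe]; field_simp; norm_num
  rw [h7, h8] at h6
  have := hε.ne'
  field_simp at h6
  linarith

lemma integral_heat_eq_gaussian {ε : ℝ} (hε : 0 < ε) (φ : ℝ × ℝ → ℝ) (x : ℝ × ℝ) :
    ∫ t, heatDeriv (ε ^ 2 / 4) 0 (x.1 - t) * φ (t, x.2) = √π * ∫ s, exp (-s ^ 2) * φ (x.1 - ε * s, x.2) := by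
  rw [← integral_sub_left_eq_self (fun t => heatDeriv (ε ^ 2 / 4) 0 (x.1 - t) * φ (t, x.2)) volume x.1]
  have h := Measure.integral_comp_mul_left (fun t => heatDeriv (ε ^ 2 / 4) 0 (x.1 - (x.1 - t)) * φ (x.1 - t, x.2)) ε
  rw [abs_of_pos (by positivity), smul_eq_mul, eq_inv_mul_iff_mul_eq₀ hε.ne'] at h
  rw [← h, ← integral_const_mul, ← integral_const_mul]
  congr 1; funext s
  rw [sub_sub_cancel, ← mul_assoc, heatDeriv_zero hε]; ring

lemma WeakL2.integral_eq_zero_of_heat (hf : WeakL2 f) (hφ : IsTest φ)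
    (h : ∀ c, 0 < c → ∫ x in halfPlane, f x * ∫ t, heatDeriv c 0 (x.1 - t) * φ (t, x.2) = 0) :
    ∫ x in halfPlane, f x * φ x = 0 := by
  have hcont := hφ.continuous
  obtain ⟨C, hC, hb⟩ := hφ.exists_envelope_bound
  have hgi : Integrable fun s : ℝ => exp (-s ^ 2) := by simpa using integrable_exp_neg_mul_sq one_pos
  have hgi2 : Integrable fun s : ℝ => (1 + s ^ 2) * exp (-s ^ 2) := by
    have := integrable_rpow_mul_exp_neg_mul_sq (b := 1) one_pos (s := 2) (by norm_num)
    refine (hgi.add this).congr (.of_forall fun s => ?_)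
    simp only [Pi.add_apply, Real.rpow_two]
    ring_nf
  let ε : ℕ → ℝ := fun n => ((n : ℝ) + 1)⁻¹
  have hε : ∀ n, 0 < ε n ∧ ε n ≤ 1 := fun n =>
    ⟨by simp only [ε]; positivity, inv_le_one_of_one_le₀ (by linarith [(Nat.cast_nonneg n : (0 : ℝ) ≤ n)])⟩
  have hε0 : Tendsto ε atTop (𝓝 0) := by
    simpa [ε, one_div] using tendsto_one_div_add_atTop_nhds_zero_nat (𝕜 := ℝ)
  let J : ℕ → ℝ × ℝ → ℝ := fun n x => ∫ s, exp (-s ^ 2) * φ (x.1 - ε n * s, x.2)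
  have hφC : ∀ x, |φ x| ≤ C * envelope x := fun x => (hb x).trans (by
    refine mul_le_mul_of_nonneg_left (mul_le_of_le_one_left (envelope_pos x).le ?_) hC
    exact inv_le_one_of_one_le₀ (by nlinarith [sq_nonneg x.1]))
  have hφC' : ∀ x, |φ x| ≤ C := fun x => (hφC x).trans (mul_le_of_le_one_right hC (envelope_le_one x))
  have hJc : ∀ n, Continuous (J n) := fun n => by
    refine continuous_of_dominated (bound := fun s => C * exp (-s ^ 2)) (fun x => Continuous.aestronglyMeasurable (by fun_prop))
      (fun x => .of_forall fun s => ?_) (hgi.const_mul C) (.of_forall fun s => by fun_prop)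
    rw [norm_mul, norm_of_nonneg (exp_pos _).le, mul_comm]
    exact mul_le_mul_of_nonneg_right (hφC' _) (exp_pos _).le
  set A := ∫ s : ℝ, (1 + s ^ 2) * exp (-s ^ 2) with hA
  have hA0 : 0 ≤ A := integral_nonneg fun s => by positivity
  have hJb : ∀ n, ∀ x ∈ halfPlane, |J n x| ≤ C * 2 * A * envelope x := fun n x _ => by
    have := norm_integral_le_of_norm_le (hgi2.const_mul (C * 2 * envelope x))
      (f := fun s => exp (-s ^ 2) * φ (x.1 - ε n * s, x.2)) (.of_forall fun s => ?_)
    · rw [integral_const_mul] at this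
      refine this.trans (le_of_eq (by ring))
    · rw [norm_mul, norm_of_nonneg (exp_pos _).le, mul_comm, ← mul_assoc]
      refine mul_le_mul_of_nonneg_right ((hφC _).trans ?_) (exp_pos _).le
      have h1 := one_add_sq_le x.1 (ε n * s)
      have h2 : (ε n * s) ^ 2 ≤ s ^ 2 := by
        rw [mul_pow]; exact mul_le_of_le_one_left (sq_nonneg s) (pow_le_one₀ (hε n).1.le (hε n).2)
      have h3 : 2 * (1 + (ε n * s) ^ 2) * (1 + x.1 ^ 2)⁻¹ ≤ 2 * (1 + s ^ 2) * (1 + x.1 ^ 2)⁻¹ := by gcongr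
      have h4 : (0 : ℝ) ≤ (1 + x.2 ^ 2)⁻¹ := by positivity
      have h5 := mul_le_mul_of_nonneg_left (mul_le_mul_of_nonneg_right (h1.trans h3) h4) hC
      refine h5.trans (le_of_eq ?_)
      rw [envelope]; ring
  have hJl : ∀ x ∈ halfPlane, Tendsto (fun n => J n x) atTop (𝓝 (√π * φ x)) := fun x _ => by
    have e : √π * φ x = ∫ s : ℝ, exp (-s ^ 2) * φ (x.1 - 0 * s, x.2) := by
      have := integral_gaussian 1
      simp only [neg_mul, one_mul, div_one] at this
      rw [← this, ← integral_mul_const]; simp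
    rw [e]
    refine tendsto_integral_of_dominated_convergence (fun s => C * exp (-s ^ 2))
      (fun n => Continuous.aestronglyMeasurable (by fun_prop)) (hgi.const_mul C) (fun n => .of_forall fun s => ?_)
      (.of_forall fun s => ?_)
    · rw [norm_mul, norm_of_nonneg (exp_pos _).le, mul_comm]
      exact mul_le_mul_of_nonneg_right (hφC' _) (exp_pos _).le
    · have hc : Continuous fun r : ℝ => exp (-s ^ 2) * φ (x.1 - r * s, x.2) := by fun_prop
      exact (hc.tendsto 0).comp hε0
  have l := hf.tendsto_integral_mul_of_tendsto (ψ := fun x => √π * φ x) hJc (integrable_envelope.const_mul (C * 2 * A))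
    (abs_envelope_le (by positivity)) hJb hJl
  have hz : ∀ n, ∫ x in halfPlane, f x * J n x = 0 := fun n => by
    have h1 := h (ε n ^ 2 / 4) (by have := (hε n).1; positivity)
    simp_rw [integral_heat_eq_gaussian (hε n).1] at h1
    have e : ∀ x, f x * (√π * J n x) = √π * (f x * J n x) := fun x => by ring
    simp only [J] at e ⊢
    simp_rw [e] at h1
    rw [integral_const_mul] at h1
    exact (mul_eq_zero.1 h1).resolve_left (sqrt_pos.2 pi_pos).ne'
  have l2 := tendsto_nhds_unique l (tendsto_const_nhds.congr fun n => (hz n).symm)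
  have e : ∀ x, f x * (√π * φ x) = √π * (f x * φ x) := fun x => by ring
  simp_rw [e] at l2
  rw [integral_const_mul] at l2
  exact (mul_eq_zero.1 l2).resolve_left (sqrt_pos.2 pi_pos).ne'

lemma WeakL2.indicator (hf : WeakL2 f) : WeakL2On volume (halfPlane.indicator f) := by
  obtain ⟨h, C, hC⟩ := hf
  refine ⟨(aestronglyMeasurable_indicator_iff measurableSet_halfPlane).2 h, C, fun r hr => ?_⟩
  refine le_trans ?_ (hC r hr)
  rw [Measure.restrict_apply₀' measurableSet_halfPlane.nullMeasurableSet]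
  refine measure_mono fun x hx => ?_
  by_cases hxH : x ∈ halfPlane
  · exact ⟨by simpa [hxH] using hx, hxH⟩
  · have : r < |halfPlane.indicator f x| := hx
    rw [indicator_of_notMem hxH, abs_zero] at this
    exact absurd this (not_lt.2 hr.le)

lemma integral_indicator_mul (f φ : ℝ × ℝ → ℝ) :
    ∫ x, halfPlane.indicator f x * φ x = ∫ x in halfPlane, f x * φ x := by
  rw [← integral_indicator measurableSet_halfPlane]
  congr 1; funext x
  by_cases hx : x ∈ halfPlane <;> simp [hx]

lemma ae_restrict_of_indicator (h : halfPlane.indicator f =ᵐ[volume] fun _ => 0) :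
    ∀ᵐ x ∂(volume.restrict halfPlane), f x = 0 := by
  refine (ae_restrict_iff' measurableSet_halfPlane).2 (h.mono fun x hx hm => ?_)
  rwa [indicator_of_mem hm] at hx

theorem WeakL2.eq_zero_of_helmholtz_of_harmonic (hα : 0 < α) (hf : WeakL2 f)
    (hi : ∀ φ, IsTestInHalfPlane φ → ∫ x in halfPlane, f x * (φ x - α * lap φ x) = 0)
    (hii : ∀ h k, IsDecaying h → IsDecaying k → d1 h = d2 k → (d2 h = fun x => -d1 k x) → ∫ x in halfPlane, f x * h x = 0) :
    ∀ᵐ x ∂(volume.restrict halfPlane), f x = 0 := by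
  refine ae_restrict_of_indicator (hf.indicator.eq_zero_of_helmholtz (c := 1 / α) (by positivity) 4 fun ρ hρ => ?_)
  rw [integral_indicator_mul]
  have hψ := hρ.helmholtz α
  have h0 := hf.integral_eq_zero_of_heat hψ.d1.d1.d1.d1 fun c hc => hf.integral_heat hα hi hii hc hρ
  rw [d1_helmholtz hρ.1, d1_helmholtz hρ.d1.1, d1_helmholtz hρ.d1.d1.1, d1_helmholtz hρ.d1.d1.d1.1] at h0
  have e : ∀ x, f x * (1 / α * (d1^[4] ρ) x - lap (d1^[4] ρ) x) = 1 / α * (f x * (d1 (d1 (d1 (d1 ρ))) x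
      - α * lap (d1 (d1 (d1 (d1 ρ)))) x)) := fun x => by
    simp only [Function.iterate_succ, Function.iterate_zero, Function.comp_apply, id]
    field_simp
  simp_rw [e]
  rw [integral_const_mul, h0, mul_zero]

end

section

/-! ### Uniqueness -/

variable {α : ℝ} {f f' : ℝ × ℝ → ℝ} {g g' : ℝ → ℝ} {u v w : ℝ × ℝ → ℝ × ℝ} {q : SignedMeasure halfPlane}

lemma HasGradAndTrace.add_const_mul (h : HasGradAndTrace f g) (h' : HasGradAndTrace f' g') (c : ℝ) :
    HasGradAndTrace (fun x => f x + c * f' x) (fun s => g s + c * g' s) := by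
  obtain ⟨hf, hg, v₁, v₂, h1, h2, hv⟩ := h
  obtain ⟨hf', hg', v₁', v₂', h1', h2', hv'⟩ := h'
  refine ⟨WeakL2On.add hf (WeakL2On.const_mul hf' c), hg.add (hg'.smul c), fun x => v₁ x + c * v₁' x,
    fun x => v₂ x + c * v₂' x, WeakL2On.add h1 (WeakL2On.const_mul h1' c), WeakL2On.add h2 (WeakL2On.const_mul h2' c),
    fun φ hφ => ?_⟩
  have key : ∀ {a b ψ : ℝ × ℝ → ℝ}, WeakL2 a → WeakL2 b → IsTest ψ → ∫ x in halfPlane, (a x + c * b x) * ψ x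
      = (∫ x in halfPlane, a x * ψ x) + c * ∫ x in halfPlane, b x * ψ x := fun ha hb hψ => by
    rw [← integral_const_mul, ← integral_add (ha.integrable_mul_test hψ) ((hb.integrable_mul_test hψ).const_mul c)]
    congr 1; funext x; ring
  have hb : ∀ {a : ℝ → ℝ}, LocallyIntegrable a → Integrable fun s => a s * φ (s, 0) := fun ha => by
    have hc := hφ.continuous
    have := ha.integrable_smul_right_of_hasCompactSupport (g := fun s => φ (s, 0)) (by fun_prop) (hφ.hasCompactSupport_slice 0)
    simpa using this
  obtain ⟨e1, e2⟩ := hv φ hφ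
  obtain ⟨e1', e2'⟩ := hv' φ hφ
  constructor
  · rw [key hf hf' hφ.d1, key h1 h1' hφ, e1, e1']; ring
  · have e3 : ∫ s, (g s + c * g' s) * φ (s, 0) = (∫ s, g s * φ (s, 0)) + c * ∫ s, g' s * φ (s, 0) := by
      rw [← integral_const_mul, ← integral_add (hb hg) ((hb hg').const_mul c)]
      congr 1; funext s; ring
    rw [key hf hf' hφ.d2, key h2 h2' hφ, e2, e2', e3]; ring

lemma HasGradAndTrace.grad_of_zero (h : HasGradAndTrace f 0) : WeakL2 f ∧ ∃ f₁ f₂, WeakL2 f₁ ∧ WeakL2 f₂ ∧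
    ∀ φ, IsTest φ → (∫ x in halfPlane, f x * d1 φ x) = -(∫ x in halfPlane, f₁ x * φ x) ∧
      (∫ x in halfPlane, f x * d2 φ x) = -(∫ x in halfPlane, f₂ x * φ x) := by
  obtain ⟨hf, -, v₁, v₂, h1, h2, hv⟩ := h
  exact ⟨hf, v₁, v₂, h1, h2, fun φ hφ => by simpa using hv φ hφ⟩

lemma WeakL2.integral_lap_eq_zero (hf : WeakL2 f)
    (h : ∀ φ, IsTest φ → (∫ x in halfPlane, f x * d1 (d1 φ) x) + ∫ x in halfPlane, f x * d2 (d2 φ) x = 0) :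
    ∀ᵐ x ∂(volume.restrict halfPlane), f x = 0 := by
  refine ae_restrict_of_indicator (hf.indicator.eq_zero_of_helmholtz le_rfl 0 fun ρ hρ => ?_)
  rw [integral_indicator_mul]
  have e : ∀ x, f x * (0 * (d1^[0] ρ) x - lap (d1^[0] ρ) x) = -(f x * d1 (d1 ρ) x + f x * d2 (d2 ρ) x) := fun x => by
    simp only [Function.iterate_zero, id, lap]; ring
  simp_rw [e]
  rw [integral_neg, integral_add (hf.integrable_mul_test hρ.d1.d1) (hf.integrable_mul_test hρ.d2.d2), h ρ hρ, neg_zero]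

/-- The homogeneous problem has only the trivial solution. -/
theorem ae_eq_zero_of_curl_eq_zero (hα : 0 < α) (h1 : HasGradAndTrace (fun x => (v x).1) 0)
    (h2 : HasGradAndTrace (fun x => (v x).2) 0) (hdiv : DivFree v)
    (hcurl : ∀ φ, IsTestInHalfPlane φ → ∫ x in halfPlane, ((v x).1 * d2 (fun z => φ z - α * lap φ z) x
      - (v x).2 * d1 (fun z => φ z - α * lap φ z) x) = 0) :
    ∀ᵐ x ∂(volume.restrict halfPlane), v x = 0 := by
  obtain ⟨w1, v11, v12, w11, w12, g1⟩ := h1.grad_of_zero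
  obtain ⟨w2, v21, v22, w21, w22, g2⟩ := h2.grad_of_zero
  have ht : ∀ {a ψ}, WeakL2 a → IsTest ψ → IntegrableOn (fun x => a x * ψ x) halfPlane := fun ha hψ =>
    ha.integrable_mul_test hψ
  have hd : ∀ᵐ x ∂(volume.restrict halfPlane), v11 x + v22 x = 0 := by
    have hs : WeakL2 fun x => v11 x + v22 x := WeakL2On.add w11 w22
    have := isOpen_halfPlane.ae_eq_zero_of_integral_contDiff_smul_eq_zero (μ := volume)
      (hs.indicator.locallyIntegrable.locallyIntegrableOn halfPlane) fun ψ c1 c2 c3 => by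
        have hψ : IsTest ψ := ⟨c1, c2⟩
        have e := hdiv ψ ⟨hψ, c3⟩
        rw [integral_add (ht w1 hψ.d1) (ht w2 hψ.d2), (g1 ψ hψ).1, (g2 ψ hψ).2] at e
        have e2 : ∀ x, ψ x • halfPlane.indicator (fun x => v11 x + v22 x) x
            = halfPlane.indicator (fun x => v11 x + v22 x) x * ψ x := fun x => by rw [smul_eq_mul, mul_comm]
        simp_rw [e2]
        rw [integral_indicator_mul]
        simp_rw [add_mul]
        rw [integral_add (ht w11 hψ) (ht w22 hψ)]
        linarith
    refine (ae_restrict_iff' measurableSet_halfPlane).2 (this.mono fun x hx hm => ?_)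
    have := hx hm
    rwa [indicator_of_mem hm] at this
  have sd : ∀ ψ : ℝ × ℝ → ℝ, ∫ x in halfPlane, v11 x * ψ x = -∫ x in halfPlane, v22 x * ψ x := fun ψ => by
    rw [← integral_neg]
    refine integral_congr_ae (hd.mono fun x hx => ?_)
    have : v11 x = -v22 x := by linarith
    simp only [this]; ring
  have hω : WeakL2 fun x => v21 x - v12 x := WeakL2On.sub w21 w12
  have hi : ∀ φ, IsTestInHalfPlane φ → ∫ x in halfPlane, (v21 x - v12 x) * (φ x - α * lap φ x) = 0 := fun φ hφ => by
    have hψ := hφ.1.helmholtz α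
    have e := hcurl φ hφ
    rw [integral_sub (ht w1 hψ.d2) (ht w2 hψ.d1), (g1 _ hψ).2, (g2 _ hψ).1] at e
    simp_rw [sub_mul]
    rw [integral_sub (ht w21 hψ) (ht w12 hψ)]
    linarith
  have hii : ∀ h k, IsDecaying h → IsDecaying k → d1 h = d2 k → (d2 h = fun x => -d1 k x) →
      ∫ x in halfPlane, (v21 x - v12 x) * h x = 0 := fun h k hh hk e1 e2 => by
    simp_rw [sub_mul]
    rw [integral_sub (hh.integrable_mul w21) (hh.integrable_mul w12)]
    have a1 := (hh.gaussGreen w1 w11 w12 g1).2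
    have a2 := (hh.gaussGreen w2 w21 w22 g2).1
    have b1 := (hk.gaussGreen w1 w11 w12 g1).1
    have b2 := (hk.gaussGreen w2 w21 w22 g2).2
    rw [e1, b2] at a2
    rw [e2] at a1
    simp only [mul_neg] at a1
    rw [integral_neg, b1, sd] at a1
    linarith
  have hω0 := hω.eq_zero_of_helmholtz_of_harmonic hα hi hii
  have sω : ∀ ψ : ℝ × ℝ → ℝ, ∫ x in halfPlane, v21 x * ψ x = ∫ x in halfPlane, v12 x * ψ x := fun ψ => by
    refine integral_congr_ae (hω0.mono fun x hx => ?_)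
    have : v21 x = v12 x := by linarith
    simp only [this]
  have z1 := w1.integral_lap_eq_zero fun φ hφ => by
    rw [(g1 _ hφ.d1).1, (g1 _ hφ.d2).2, sd, ← sω]
    have a := (g2 _ hφ.d1).2
    have b := (g2 _ hφ.d2).1
    rw [smooth_d1_d2 hφ.1] at b
    linarith
  have z2 := w2.integral_lap_eq_zero fun φ hφ => by
    rw [(g2 _ hφ.d1).1, (g2 _ hφ.d2).2, sω]
    have a := (g1 _ hφ.d1).2
    have b := (g1 _ hφ.d2).1
    rw [smooth_d1_d2 hφ.1, sd] at b
    linarith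
  filter_upwards [z1, z2] with x e1 e2 using Prod.ext e1 e2

/-- Combinations of divergence free fields, and their curl equations. -/
lemma divFree_add_const_mul {a b a' b' : ℝ → ℝ} (hu1 : HasGradAndTrace (fun x => (u x).1) a) (hu2 : HasGradAndTrace (fun x => (u x).2) b)
    (hw1 : HasGradAndTrace (fun x => (w x).1) a') (hw2 : HasGradAndTrace (fun x => (w x).2) b') (c : ℝ) :
    (DivFree u → DivFree w → DivFree fun x => ((u x).1 + c * (w x).1, (u x).2 + c * (w x).2)) ∧
    ∀ {φ ψ : ℝ × ℝ → ℝ}, IsTest φ → IsTest ψ →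
      ∫ x in halfPlane, (((u x).1 + c * (w x).1) * φ x - ((u x).2 + c * (w x).2) * ψ x)
      = (∫ x in halfPlane, ((u x).1 * φ x - (u x).2 * ψ x)) + c * ∫ x in halfPlane, ((w x).1 * φ x - (w x).2 * ψ x) := by
  have key : ∀ {φ ψ : ℝ × ℝ → ℝ}, IsTest φ → IsTest ψ →
      ∫ x in halfPlane, (((u x).1 + c * (w x).1) * φ x - ((u x).2 + c * (w x).2) * ψ x)
      = (∫ x in halfPlane, ((u x).1 * φ x - (u x).2 * ψ x)) + c * ∫ x in halfPlane, ((w x).1 * φ x - (w x).2 * ψ x) :=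
    fun {φ ψ} hφ hψ => by
      have i1 : Integrable (fun x => (u x).1 * φ x - (u x).2 * ψ x) (volume.restrict halfPlane) :=
        (hu1.integrable_mul_test hφ).sub (hu2.integrable_mul_test hψ)
      have i2 : Integrable (fun x => (w x).1 * φ x - (w x).2 * ψ x) (volume.restrict halfPlane) :=
        (hw1.integrable_mul_test hφ).sub (hw2.integrable_mul_test hψ)
      rw [← integral_const_mul, ← integral_add i1 (i2.const_mul c)]
      congr 1; funext x; ring
  refine ⟨fun du dw φ hφ => ?_, key⟩
  have h := key hφ.1.d1 (hφ.1.d2.const_mul (-1))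
  have e : ∀ a b p q : ℝ, a * p - b * (-1 * q) = a * p + b * q := fun a b p q => by ring
  simp_rw [e] at h
  rw [h, du φ hφ, dw φ hφ, mul_zero, add_zero]

/-- Two fields with equal traces, zero divergence and equal curls of the filtered momentum agree. -/
theorem ae_eq_of_curl_eq {a b : ℝ → ℝ} (hα : 0 < α) (hu1 : HasGradAndTrace (fun x => (u x).1) a)
    (hu2 : HasGradAndTrace (fun x => (u x).2) b) (hw1 : HasGradAndTrace (fun x => (w x).1) a)
    (hw2 : HasGradAndTrace (fun x => (w x).2) b) (du : DivFree u) (dw : DivFree w)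
    (h : ∀ φ, IsTestInHalfPlane φ →
      ∫ x in halfPlane, ((u x).1 * d2 (fun z => φ z - α * lap φ z) x - (u x).2 * d1 (fun z => φ z - α * lap φ z) x)
      = ∫ x in halfPlane, ((w x).1 * d2 (fun z => φ z - α * lap φ z) x - (w x).2 * d1 (fun z => φ z - α * lap φ z) x)) :
    ∀ᵐ x ∂(volume.restrict halfPlane), u x = w x := by
  obtain ⟨k1, k2⟩ := divFree_add_const_mul hu1 hu2 hw1 hw2 (-1)
  have hz := ae_eq_zero_of_curl_eq_zero hα (v := fun x => ((u x).1 + -1 * (w x).1, (u x).2 + -1 * (w x).2))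
    (hasGradAndTrace_congr_trace (hu1.add_const_mul hw1 (-1)) fun s => by simp)
    (hasGradAndTrace_congr_trace (hu2.add_const_mul hw2 (-1)) fun s => by simp) (k1 du dw) fun φ hφ => by
      have hψ := hφ.1.helmholtz α
      rw [k2 hψ.d2 hψ.d1, h φ hφ]; ring
  filter_upwards [hz] with x hx
  have e1 := congrArg Prod.fst hx
  have e2 := congrArg Prod.snd hx
  simp only [Prod.fst_zero, Prod.snd_zero] at e1 e2
  exact Prod.ext (by linarith) (by linarith)

theorem isFilteredVelocity_sum (hα : 0 < α) (q : SignedMeasure halfPlane) :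
    IsFilteredVelocity α q fun x => interiorPart α q x + boundaryPart α (boundaryDatum α q) x := by
  obtain ⟨i1, i2, i3, i4⟩ := interiorPart_properties q hα
  have hb := isStokesSolution_boundaryPart hα (memL1Hhalf_boundaryDatum hα q)
  obtain ⟨b1, b2, b3, -⟩ := id hb
  obtain ⟨k1, k2⟩ := divFree_add_const_mul i1 i2 b1 b2 1
  have e : (fun x => interiorPart α q x + boundaryPart α (boundaryDatum α q) x)
      = fun x => ((interiorPart α q x).1 + 1 * (boundaryPart α (boundaryDatum α q) x).1,
        (interiorPart α q x).2 + 1 * (boundaryPart α (boundaryDatum α q) x).2) := funext fun x => by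
    simp only [one_mul]; rfl
  rw [e]
  refine ⟨hasGradAndTrace_congr_trace (i1.add_const_mul b1 1) fun s => by simp,
    hasGradAndTrace_congr_trace (i2.add_const_mul b2 1) fun s => by simp, k1 i3 b3, fun φ hφ => ?_⟩
  have hψ := hφ.1.helmholtz α
  rw [k2 hψ.d2 hψ.d1, i4 φ hφ, hb.curl hφ, mul_zero, add_zero]

theorem isFilteredVelocity_iff (hα : 0 < α) :
    IsFilteredVelocity α q u ↔ ∀ᵐ x ∂(volume.restrict halfPlane),
      u x = interiorPart α q x + boundaryPart α (boundaryDatum α q) x := by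
  have h0 := isFilteredVelocity_sum hα q
  refine ⟨fun h => ?_, fun h => h0.congr (h.mono fun x hx => hx.symm)⟩
  obtain ⟨a1, a2, a3, a4⟩ := h
  obtain ⟨b1, b2, b3, b4⟩ := h0
  exact ae_eq_of_curl_eq hα a1 a2 b1 b2 a3 b3 fun φ hφ => (a4 φ hφ).trans (b4 φ hφ).symm

theorem isStokesSolution_iff (hα : 0 < α) (hg : MemL1Hhalf g) :
    IsStokesSolution α g w ↔ ∀ᵐ x ∂(volume.restrict halfPlane), w x = boundaryPart α g x := by
  have h0 := isStokesSolution_boundaryPart hα hg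
  refine ⟨fun h => ?_, fun h => h0.congr (h.mono fun x hx => hx.symm)⟩
  have hc := fun φ (hφ : IsTestInHalfPlane φ) => (h.curl hφ).trans (h0.curl hφ).symm
  obtain ⟨a1, a2, a3, -⟩ := h
  obtain ⟨b1, b2, b3, -⟩ := h0
  exact ae_eq_of_curl_eq hα a1 a2 b1 b2 a3 b3 hc

end

end AlphaEuler

end

theorem mainTheorem4 (α : ℝ) (hα : 0 < α) :
    (∀ q : SignedMeasure halfPlane,
      (∀ x : ℝ × ℝ,
        (oddExtension q).Integrable (fun y => (smoothedBiotSavart α (x - y)).1) ∧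
        (oddExtension q).Integrable (fun y => (smoothedBiotSavart α (x - y)).2)) ∧
      (∀ x₁ : ℝ, q.Integrable (fun y : halfPlane => d2 (kernelH α) (x₁ - y.1.1, y.1.2))) ∧
      MemL1Hhalf (boundaryDatum α q) ∧
      ∀ u : ℝ × ℝ → ℝ × ℝ, IsFilteredVelocity α q u ↔
        ∀ᵐ x ∂(volume.restrict halfPlane),
          u x = interiorPart α q x + boundaryPart α (boundaryDatum α q) x) ∧
    (∀ g : ℝ → ℝ, MemL1Hhalf g →
      (∀ x ∈ halfPlane,
        Integrable (fun y : ℝ => g y * d2 (helmholtzGreen α) (x.1 - y, x.2)) ∧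
        ConvHConverges (conv1 g (d2 (helmholtzGreen α))) eta1 x ∧
        ConvHConverges (conv1 g (d2 (helmholtzGreen α))) eta2 x) ∧
      ∀ w : ℝ × ℝ → ℝ × ℝ, IsStokesSolution α g w ↔
        ∀ᵐ x ∂(volume.restrict halfPlane), w x = boundaryPart α g x) := by
  refine ⟨fun q => ⟨fun x => interiorPart_integrable q hα x, fun x₁ => boundaryDatum_integrable q hα x₁,
    memL1Hhalf_boundaryDatum hα q, fun u => isFilteredVelocity_iff hα⟩, fun g hg => ⟨fun x hx => ⟨?_, ?_, ?_⟩,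
    fun w => isStokesSolution_iff hα hg⟩⟩
  · exact integrable_conv1_integrand hα hg.1 x.1 hx
  · exact (convH_eq_synth hα hg.1 isPoissonKernel_eta1 hx).1
  · exact (convH_eq_synth hα hg.1 isPoissonKernel_eta2 hx).1
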